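/- **Setting.** Let $U\subset\{(P,Q)\in\mathbb R^2: 0<P<Q\}$ be open, let $\mathcal A$ be the ring of formal power series in $\epsilon$ whose coefficients are polynomials over $C^\infty(U)$ in the jet variables $\partial_x^sP,\partial_x^sQ$ $(s\ge1)$, and put $\Lambda=e^{\epsilon\partial_x}$, $f^\pm=\Lambda^{\pm1}f$, $u=(P,Q)$. For the Hamiltonian operators $$\mathcal P_0=\epsilon^{-1}\begin{pmatrix}Q\Lambda^{-1}-\Lambda Q&(1-\Lambda)Q\\ Q(\Lambda^{-1}-1)&0\end{pmatrix},\qquad \mathcal P_1=\epsilon^{-1}\begin{pmatrix}0&P(\Lambda-1)Q\\ Q(1-\Lambda^{-1})P&Q(\Lambda-\Lambda^{-1})Q\end{pmatrix}$$ let $I_a=\frac12\int\theta_\alpha\mathcal P_a^{\alpha\beta}\theta_\beta$ $(a=0,1)$ with odd variables $\theta_1,\theta_2$. Let $L=(1-Q\Lambda^{-1})^{-1}(\Lambda-P)$ and $M=(\Lambda-P)^{-1}(1-Q\Lambda^{-1})$, expanded in negative, resp. positive, powers of $\Lambda$, let $\operatorname{Res}\sum_nY_n\Lambda^n=Y_0$,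 and let $\mathcal I=\{(1,k),(2,k):k\ge0\}\cup\{(0,k):k\in\mathbb Z\}$. *The extended Ablowitz–Ladik hierarchy.* Put $v=Q-P$, $\lambda=(y+Q)(y+v)/y$, $H_k=1+\frac12+\dots+\frac1k$, $\log^+\lambda=\log Q+\log(1+\frac yQ)+\log(1+\frac vy)$, $\log^-\lambda=\log v+\log(1+\frac yv)+\log(1+\frac Qy)$ (logarithms of the form $\log(1+z)$ expanded in powers of $z$), and $$\theta_{0,k}=\tfrac1{k!}\operatorname{Res}_{y=0}\lambda^k(\log^+\lambda-H_k)\tfrac{dy}{y+Q},\quad \theta_{1,k}=\tfrac1{k!}\operatorname{Res}_{y=0}\lambda^k(\log^+\lambda+\log^-\lambda-2H_k)\tfrac{dy}{y+Q}\quad(k\ge1),\quad\theta_{1,0}=\log Q .$$ Let $h_{\alpha,k}\in\mathcal A$, $(\alpha,k)\in\mathcal I$, be densities with $$h_{2,k}=\tfrac1{(k+1)!}\operatorname{Res}L^{k+1}\ (k\ge0),\quad h_{0,-k}=(-1)^k(k-1)!\operatorname{Res}M^k\ (k\ge1),\quad h_{0,0}=\tfrac{\epsilon\partial_x}{1-\Lambda^{-1}}(\log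 Q-\log P),$$ and such that, for $(\alpha,k)=(0,k)$ with $k\ge1$ and $(1,k)$ with $k\ge0$, $h_{\alpha,k}=\theta_{\alpha,k}+\sum_{j\ge1}\epsilon^jh^{[j]}_{\alpha,k}$ with $h^{[j]}_{\alpha,k}$ of differential degree $j$, and $H_{\alpha,k-1}=\int h_{\alpha,k}\,dx$ is a bihamiltonian conserved quantity: $[I_1,[I_0,H_{\alpha,k-1}]]=0$ for the Schouten–Nijenhuis bracket. With $H_{\beta,q}=\int h_{\beta,q+1}\,dx$, the extended Ablowitz–Ladik hierarchy consists of the flows $$\frac{\partial u^\alpha}{\partial t^{\beta,q}}=\mathcal P_0^{\alpha\gamma}\frac{\delta H_{\beta,q}}{\delta u^\gamma},\qquad(\beta,q)\in\mathcal I.$$ Suppose further that the densities are tau-symmetric, $\frac{\partial h_{\alpha,p}}{\partial t^{\beta,q}}=\frac{\partial h_{\beta,q}}{\partial t^{\alpha,p}}$ for all $(\alpha,p),(\beta,q)\in\mathcal I$, and that $\Omega_{\alpha,p;\beta,q}\in\mathcal A$ is a tau structure: $\frac1\epsilon(\Lambda-1)\Omega_{\alpha,p;\beta,q}=\frac{\partial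 h_{\alpha,p}}{\partial t^{\beta,q}}$. *The ring $\mathcal B$.* Adjoin to $\mathcal A$ odd (anticommuting) variables $\sigma_{\alpha,k}^s$ $(\alpha=1,2;\ k\in\mathbb Z;\ s\ge0)$ with $\partial_x\sigma_{\alpha,k}^s=\sigma_{\alpha,k}^{s+1}$, write $\sigma_{\alpha,k}=\sigma_{\alpha,k}^0$, $\sigma_{\alpha,k}^-=\Lambda^{-1}\sigma_{\alpha,k}$, $\theta_\alpha=\sigma_{\alpha,0}$, and let $\mathcal B$ be the quotient by the differential ideal generated by the recursion relations ($k\in\mathbb Z$) $$(\Lambda Q-Q\Lambda^{-1})\sigma_{1,k+1}+(\Lambda-1)Q\sigma_{2,k+1}-P(1-\Lambda)Q\sigma_{2,k}=0,\qquad \sigma_{1,k+1}+P\sigma_{1,k}+(\Lambda+1)Q\sigma_{2,k}=0$$ (the smallest $\epsilon$-adically closed two-sided ideal that contains these elements, is stable under $\partial_x$, and contains $f$ whenever it contains $\epsilon f$). An even (odd) flow on $\mathcal B$ is an even (odd) derivation of $\mathcal B$ that commutes with $\partial_x$, kills $\epsilon$, and acts on $C^\infty(U)$ by the chain rule. **Proposition.**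 The flows of the extended Ablowitz–Ladik hierarchy are given by $$\epsilon\frac{\partial P}{\partial t^{\alpha,k}}=\frac P{Q-P}\bigl((\Lambda-1)\Omega_{2,0;\alpha,k}-Q(1-\Lambda^{-1})h_{\alpha,k}\bigr),\qquad \epsilon\frac{\partial Q}{\partial t^{\alpha,k}}=\frac Q{Q-P}\bigl((\Lambda-1)\Omega_{2,0;\alpha,k}-P(1-\Lambda^{-1})h_{\alpha,k}\bigr)$$ for $(\alpha,k)\in\mathcal I$. Moreover there are unique even flows $\frac{\partial}{\partial t^{\alpha,k}}$ $((\alpha,k)\in\mathcal I)$ and odd flows $\frac\partial{\partial\tau_k}$ $(k\in\mathbb Z)$ on $\mathcal B$ that satisfy these equations and, for all $k\in\mathbb Z$ and $(\beta,q)\in\mathcal I$, $$\epsilon\frac{\partial P}{\partial\tau_k}=P(\Lambda-1)Q\sigma_{2,k-1},\qquad \epsilon\frac{\partial Q}{\partial\tau_k}=Q(\Lambda^{-1}-1)\sigma_{1,k},$$ $$\epsilon\frac{\partial\sigma_{1,k+m}}{\partial\tau_k}=\sum_{i=0}^{m-1}\sigma_{1,k+i}(1-\Lambda)Q\sigma_{2,k+m-1-i}\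 (m\ge1),\qquad \frac{\partial\sigma_{1,k}}{\partial\tau_k}=0,\qquad \frac{\partial\sigma_{1,k}}{\partial\tau_{k+m}}=-\frac{\partial\sigma_{1,k+m}}{\partial\tau_k}\ (m\ge1),$$ $$\epsilon\frac{\partial(Q\sigma_{2,k+m})}{\partial\tau_k}=-Q\sum_{i=0}^m\sigma_{1,k+m-i}^-\sigma_{1,k+i}\ (m\ge0),\qquad \frac{\partial(Q\sigma_{2,k})}{\partial\tau_{k+1}}=0,\qquad \epsilon\frac{\partial(Q\sigma_{2,k})}{\partial\tau_{k+m}}=Q\sum_{i=1}^{m-1}\sigma_{1,k+m-i}^-\sigma_{1,k+i}\ (m\ge2),$$ $$\frac{\partial\,Q(\sigma_{1,k}+\sigma_{2,k})}{\partial t^{\beta,q}}=\frac{\partial\Omega_{2,0;\beta,q}}{\partial\tau_k},\qquad \frac{\partial(P\sigma_{1,k}+Q\sigma_{2,k})}{\partial t^{\beta,q}}=\frac{\partial h_{\beta,q}}{\partial\tau_{k+1}}.$$ The even flows extend the flows of the extended Ablowitz–Ladik hierarchy on $\mathcal A$. The odd flows correspond to the local and nonlocal Hamiltonian structures: $\frac{\partial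 u^\alpha}{\partial\tau_k}=\mathcal P_0^{\alpha\beta}\sigma_{\beta,k}=\mathcal P_1^{\alpha\beta}\sigma_{\beta,k-1}$ for all $k\in\mathbb Z$, and $\frac{\partial\theta_\alpha}{\partial\tau_a}=\frac{\delta I_a}{\delta u^\alpha}$ for $a=0,1$. All these flows commute with each other (in the graded sense: the odd flows anticommute among themselves). -/

import Mathlib

open scoped TensorProduct ContDiff

noncomputable section

namespace AblowitzLadik

/-! ## The coefficient ring `C^∞(U)` -/

/-- A local chart: an open set of points `(P, Q)` with `0 < P < Q`, the real domain on which the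
flat coordinates `v¹ = Q - P`, `v² = log Q` and the functions `log v¹`, `log (e^{v²} - v¹) = log P`
are defined. -/
structure Chart where
  carrier : Set (ℝ × ℝ)
  isOpen : IsOpen carrier
  pos : ∀ x ∈ carrier, 0 < x.1 ∧ x.1 < x.2

/-- The functions on `U` that are restrictions of functions smooth on `U`. -/
def smoothAlg (U : Chart) : Subalgebra ℝ (U.carrier → ℝ) where
  carrier := {f | ∃ F : ℝ × ℝ → ℝ, ContDiffOn ℝ ∞ F U.carrier ∧ ∀ x : U.carrier, f x = F x}
  mul_mem' := by
    rintro f g ⟨F, hF, hf⟩ ⟨G, hG, hg⟩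
    exact ⟨fun x => F x * G x, hF.mul hG, fun x => by simp [hf x, hg x]⟩
  add_mem' := by
    rintro f g ⟨F, hF, hf⟩ ⟨G, hG, hg⟩
    exact ⟨fun x => F x + G x, hF.add hG, fun x => by simp [hf x, hg x]⟩
  algebraMap_mem' := by
    intro r
    exact ⟨fun _ => r, contDiffOn_const, fun x => by simp⟩

/-- The ring `C^∞(U)`. -/
def Smooth (U : Chart) : Type := smoothAlg U

instance (U : Chart) : CommRing (Smooth U) := inferInstanceAs (CommRing (smoothAlg U))

instance (U : Chart) : Algebra ℝ (Smooth U) := inferInstanceAs (Algebra ℝ (smoothAlg U))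

/-- A smooth function as a function. -/
def Smooth.fn {U : Chart} (f : Smooth U) : U.carrier → ℝ := Subtype.val f

/-- The element of `C^∞(U)` given by a function that is smooth on `U`. -/
def Smooth.of {U : Chart} (F : ℝ × ℝ → ℝ) (hF : ContDiffOn ℝ ∞ F U.carrier) : Smooth U :=
  (⟨fun x => F x, F, hF, fun _ => rfl⟩ : smoothAlg U)

lemma Smooth.fn_ext {U : Chart} {f g : Smooth U} (h : ∀ x, f.fn x = g.fn x) : f = g :=
  Subtype.ext (funext h)

/-- The extension of a smooth function on `U` by zero. -/
def extendZero {U : Chart} (f : Smooth U) : ℝ × ℝ → ℝ := Function.extend Subtype.val f.fn 0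

lemma extendZero_apply {U : Chart} (f : Smooth U) (x : U.carrier) :
    extendZero f x = f.fn x := Subtype.val_injective.extend_apply _ _ _

lemma contDiffOn_extendZero {U : Chart} (f : Smooth U) :
    ContDiffOn ℝ ∞ (extendZero f) U.carrier := by
  obtain ⟨F, hF, hf⟩ := Subtype.property f
  refine hF.congr fun x hx => ?_
  exact (extendZero_apply f ⟨x, hx⟩).trans (hf ⟨x, hx⟩)

lemma differentiableAt_extendZero {U : Chart} (f : Smooth U) (x : U.carrier) :
    DifferentiableAt ℝ (extendZero f) x :=
  ((contDiffOn_extendZero f).differentiableOn (by simp)).differentiableAt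
    (U.isOpen.mem_nhds x.2)

/-- The coordinate directions: `0` is the direction of `P`, `1` is the direction of `Q`. -/
def dir (i : Fin 2) : ℝ × ℝ := if i = 0 then (1, 0) else (0, 1)

/-- The partial derivatives `∂/∂P` (`i = 0`) and `∂/∂Q` (`i = 1`) on `C^∞(U)`. -/
def partialSmooth (U : Chart) (i : Fin 2) : Smooth U →ₗ[ℝ] Smooth U where
  toFun f := Smooth.of (fun x => fderiv ℝ (extendZero f) x (dir i))
    (((contDiffOn_extendZero f).fderiv_of_isOpen U.isOpen (by simp)).clm_apply contDiffOn_const)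
  map_add' f g := by
    refine Smooth.fn_ext fun x => ?_
    have h : extendZero (f + g) =ᶠ[nhds (x : ℝ × ℝ)] (extendZero f + extendZero g) := by
      filter_upwards [U.isOpen.mem_nhds x.2] with y hy
      rw [Pi.add_apply, extendZero_apply (f + g) ⟨y, hy⟩, extendZero_apply f ⟨y, hy⟩,
        extendZero_apply g ⟨y, hy⟩]
      rfl
    change fderiv ℝ (extendZero (f + g)) x (dir i) =
      fderiv ℝ (extendZero f) x (dir i) + fderiv ℝ (extendZero g) x (dir i)
    rw [h.fderiv_eq, fderiv_add (differentiableAt_extendZero f x)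
      (differentiableAt_extendZero g x)]
    rfl
  map_smul' c f := by
    refine Smooth.fn_ext fun x => ?_
    have h : extendZero (c • f) =ᶠ[nhds (x : ℝ × ℝ)] (c • extendZero f) := by
      filter_upwards [U.isOpen.mem_nhds x.2] with y hy
      rw [Pi.smul_apply, extendZero_apply (c • f) ⟨y, hy⟩, extendZero_apply f ⟨y, hy⟩]
      rfl
    change fderiv ℝ (extendZero (c • f)) x (dir i) = c • fderiv ℝ (extendZero f) x (dir i)
    rw [h.fderiv_eq, fderiv_const_smul (differentiableAt_extendZero f x)]
    rfl

/-- The coordinate function `P`. -/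
def fP (U : Chart) : Smooth U := Smooth.of (fun x => x.1) contDiffOn_fst

/-- The coordinate function `Q`. -/
def fQ (U : Chart) : Smooth U := Smooth.of (fun x => x.2) contDiffOn_snd

/-- The function `1 / P`. -/
def fPinv (U : Chart) : Smooth U := Smooth.of (fun x => (x.1)⁻¹)
  (contDiffOn_fst.inv fun x hx => (U.pos x hx).1.ne')

/-- The function `1 / (Q - P)`. -/
def fQPinv (U : Chart) : Smooth U := Smooth.of (fun x => (x.2 - x.1)⁻¹)
  ((contDiffOn_snd.sub contDiffOn_fst).inv fun x hx => (sub_pos.2 (U.pos x hx).2).ne')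

/-- The function `log Q - log P`. -/
def fLogQP (U : Chart) : Smooth U :=
  Smooth.of (fun x => Real.log x.2 - Real.log x.1)
    ((contDiffOn_snd.log fun x hx => ((U.pos x hx).1.trans (U.pos x hx).2).ne').sub
      (contDiffOn_fst.log fun x hx => (U.pos x hx).1.ne'))

/-! ## Differential polynomials -/

/-- Polynomials over `C^∞(U)` in the jet variables. The variable `(i, s)` is `∂_x^{s+1} u^i`, where
`u^0 = P` and `u^1 = Q`. -/
abbrev Jet (U : Chart) := MvPolynomial (Fin 2 × ℕ) (Smooth U)

/-- `𝒜`: formal power series in `ε` whose coefficients are differential polynomials. The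
variable `PowerSeries.X` is `ε`. -/
abbrev DiffPoly (U : Chart) := PowerSeries (Jet U)

/-- A linear map of `C^∞(U)` applied to the coefficients of a differential polynomial. -/
def coeffwise {U : Chart} (D : Smooth U →ₗ[ℝ] Smooth U) : Jet U →ₗ[ℝ] Jet U where
  toFun f := ∑ m ∈ f.support, MvPolynomial.monomial m (D (f.coeff m))
  map_add' f g := by
    classical
    ext m : 1
    rw [MvPolynomial.coeff_add]
    simp only [MvPolynomial.coeff_sum, MvPolynomial.coeff_monomial,
      Finset.sum_ite_eq', MvPolynomial.mem_support_iff]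
    simp only [MvPolynomial.coeff_add, ite_not]
    split_ifs <;> simp_all [← map_add]
  map_smul' c f := by
    classical
    ext m : 1
    simp only [MvPolynomial.coeff_sum, MvPolynomial.coeff_monomial, MvPolynomial.coeff_smul,
      Finset.sum_ite_eq', MvPolynomial.mem_support_iff, map_smul, RingHom.id_apply]
    split_ifs <;> simp_all

/-- `∂/∂u^{i,s}` on differential polynomials. -/
def jetPartial (U : Chart) (i : Fin 2) : ℕ → (Jet U →ₗ[ℝ] Jet U)
  | 0 => coeffwise (partialSmooth U i)
  | s + 1 => (MvPolynomial.pderiv (i, s)).toLinearMap.restrictScalars ℝ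

/-- The total derivative `∂_x = ∑ u^{i,s+1} ∂/∂u^{i,s}` on differential polynomials. -/
def jetDx (U : Chart) : Jet U →ₗ[ℝ] Jet U :=
  (∑ i : Fin 2, (LinearMap.mulLeft ℝ (MvPolynomial.X (i, 0))) ∘ₗ jetPartial U i 0) +
    (MvPolynomial.mkDerivation (Smooth U)
      (fun v : Fin 2 × ℕ => (MvPolynomial.X (v.1, v.2 + 1) : Jet U))).toLinearMap.restrictScalars ℝ

/-! ## Operators on power series in `ε` -/

section Series

variable {R : Type} [Ring R] [Algebra ℝ R]

/-- A linear map applied to every coefficient of a power series in `ε`. -/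
def epsMap (D : R →ₗ[ℝ] R) : PowerSeries R →+ PowerSeries R where
  toFun f := PowerSeries.mk fun n => D (PowerSeries.coeff n f)
  map_zero' := by ext n; simp
  map_add' f g := by ext n; simp

/-- The bilinear extension to power series in `ε` of an operation on coefficients. -/
def epsConv (B : R → R → R) (f g : PowerSeries R) : PowerSeries R :=
  PowerSeries.mk fun n =>
    ∑ p ∈ Finset.HasAntidiagonal.antidiagonal n, B (PowerSeries.coeff p.1 f) (PowerSeries.coeff p.2 g)

/-- The power `Λ^m = e^{m ε ∂_x}` of the shift operator, for the derivation `d = ∂_x`. -/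
def shift (d : R →ₗ[ℝ] R) (m : ℤ) (f : PowerSeries R) : PowerSeries R :=
  PowerSeries.mk fun n => ∑ p ∈ Finset.HasAntidiagonal.antidiagonal n,
    ((m : ℝ) ^ p.1 / (p.1.factorial : ℝ)) • (d ^ p.1) (PowerSeries.coeff p.2 f)

/-- Division by `ε` (used only for series without constant term). -/
def divEps (f : PowerSeries R) : PowerSeries R :=
  PowerSeries.mk fun n => PowerSeries.coeff (n + 1) f

/-- The variational derivative `∑ (-∂_x)^s ∂/∂u^{i,s}`, for `d = ∂_x` and `pd s = ∂/∂u^{i,s}`. -/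
def varDeriv (d : R →ₗ[ℝ] R) (pd : ℕ → (R →ₗ[ℝ] R)) (f : R) : R :=
  ∑ᶠ s : ℕ, (-1 : ℝ) ^ s • (d ^ s) (pd s f)

/-- The same, for a power series in `ε`. -/
def epsVarDeriv (d : R →ₗ[ℝ] R) (pd : ℕ → (R →ₗ[ℝ] R)) (f : PowerSeries R) : PowerSeries R :=
  PowerSeries.mk fun n => varDeriv d pd (PowerSeries.coeff n f)

/-- The operator `ε 𝒫₀`, with
`ε 𝒫₀ = ((Q Λ⁻¹ - Λ Q, (1 - Λ) Q), (Q (Λ⁻¹ - 1), 0))`. -/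
def epsP0 (d : R →ₗ[ℝ] R) (_P Q : PowerSeries R) (ξ : Fin 2 → PowerSeries R) :
    Fin 2 → PowerSeries R :=
  ![(Q * shift d (-1) (ξ 0) - shift d 1 (Q * ξ 0)) + (Q * ξ 1 - shift d 1 (Q * ξ 1)),
    Q * (shift d (-1) (ξ 0) - ξ 0)]

/-- The operator `ε 𝒫₁`, with
`ε 𝒫₁ = ((0, P (Λ - 1) Q), (Q (1 - Λ⁻¹) P, Q (Λ - Λ⁻¹) Q))`. -/
def epsP1 (d : R →ₗ[ℝ] R) (P Q : PowerSeries R) (ξ : Fin 2 → PowerSeries R) :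
    Fin 2 → PowerSeries R :=
  ![P * (shift d 1 (Q * ξ 1) - Q * ξ 1),
    Q * (P * ξ 0 - shift d (-1) (P * ξ 0)) +
      Q * (shift d 1 (Q * ξ 1) - shift d (-1) (Q * ξ 1))]

end Series

/-- A smooth function as an element of `𝒜`. -/
def ofSmooth {U : Chart} (f : Smooth U) : DiffPoly U := PowerSeries.C (MvPolynomial.C f)

/-- `Λ^m` on `𝒜`. -/
def jetShift (U : Chart) (m : ℤ) : DiffPoly U → DiffPoly U := shift (jetDx U) m

/-- The variational derivatives `(δH/δP, δH/δQ)` of the local functional `H = ∫ h dx`. -/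
def jetVar {U : Chart} (h : DiffPoly U) : Fin 2 → DiffPoly U :=
  fun i => epsVarDeriv (jetDx U) (jetPartial U i) h

/-- The operator `ε 𝒫₀` on `𝒜`. -/
def jetP0 {U : Chart} (ξ : Fin 2 → DiffPoly U) : Fin 2 → DiffPoly U :=
  epsP0 (jetDx U) (ofSmooth (fP U)) (ofSmooth (fQ U)) ξ

/-- The operator `ε 𝒫₁` on `𝒜`. -/
def jetP1 {U : Chart} (ξ : Fin 2 → DiffPoly U) : Fin 2 → DiffPoly U :=
  epsP1 (jetDx U) (ofSmooth (fP U)) (ofSmooth (fQ U)) ξ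

/-- The Hamiltonian vector field `X^α = 𝒫₀^{αβ} δH/δu^β` of `H = ∫ h dx`. -/
def hamField {U : Chart} (h : DiffPoly U) : Fin 2 → DiffPoly U :=
  fun α => divEps (jetP0 (jetVar h) α)

/-- The derivative of `f` along the evolutionary vector field `∂u^α/∂t = X^α`,
that is `∑ (∂_x^s X^α) ∂f/∂u^{α,s}`. -/
def evolve {U : Chart} (X : Fin 2 → DiffPoly U) (f : DiffPoly U) : DiffPoly U :=
  ∑ α : Fin 2, epsConv (fun a b => ∑ᶠ s : ℕ, (jetDx U ^ s) a * jetPartial U α s b) (X α) f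

/-- The adjoint `X_*^†` of the linearization `X_*` of `X`, that is
`(X_*^† ξ)_β = ∑_{α,s} (-∂_x)^s (∂X^α/∂u^{β,s} ξ_α)`. -/
def adjLin {U : Chart} (X ξ : Fin 2 → DiffPoly U) : Fin 2 → DiffPoly U := fun β =>
  ∑ α : Fin 2, epsConv
    (fun a b => ∑ᶠ s : ℕ, (-1 : ℝ) ^ s • (jetDx U ^ s) (jetPartial U β s a * b)) (X α) (ξ α)

/-- The vector field `X` is an infinitesimal symmetry of the Hamiltonian structure `𝒫₁`, that is,
its Lie derivative `D_X(𝒫₁) - X_* ∘ 𝒫₁ - 𝒫₁ ∘ X_*^†` vanishes; equivalently, the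
Schouten-Nijenhuis bracket of `X` with `𝒫₁` is zero. -/
def PreservesP1 {U : Chart} (X : Fin 2 → DiffPoly U) : Prop :=
  ∀ (ξ : Fin 2 → DiffPoly U) (α : Fin 2),
    evolve X (jetP1 ξ α) - jetP1 (fun β => evolve X (ξ β)) α =
      evolve (jetP1 ξ) (X α) + jetP1 (adjLin X ξ) α

/-! ## The Lax operators -/

/-- Composition of (pseudo-)difference operators `∑_n X_n Λ^n`. -/
def opComp {U : Chart} (X Y : ℤ → DiffPoly U) : ℤ → DiffPoly U :=
  fun n => ∑ᶠ i : ℤ, X i * jetShift U i (Y (n - i))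

/-- Powers of a difference operator. -/
def opPow {U : Chart} (X : ℤ → DiffPoly U) : ℕ → (ℤ → DiffPoly U)
  | 0 => fun n => if n = 0 then 1 else 0
  | k + 1 => opComp X (opPow X k)

/-- `Λ - P`. -/
def opLambdaP (U : Chart) : ℤ → DiffPoly U :=
  fun n => if n = 1 then 1 else if n = 0 then -ofSmooth (fP U) else 0

/-- `1 - Q Λ⁻¹`. -/
def opOneQ (U : Chart) : ℤ → DiffPoly U :=
  fun n => if n = 0 then 1 else if n = -1 then -ofSmooth (fQ U) else 0

/-- `(1 - Q Λ⁻¹)⁻¹ = ∑_{n ≥ 0} (Q Λ⁻¹)^n`, expanded in negative powers of `Λ`. -/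
def opOneQInv (U : Chart) : ℤ → DiffPoly U :=
  fun n => if n ≤ 0 then
    ∏ j ∈ Finset.range n.natAbs, jetShift U (-(j : ℤ)) (ofSmooth (fQ U)) else 0

/-- `(Λ - P)⁻¹ = -∑_{n ≥ 0} (P⁻¹ Λ)^n P⁻¹`, expanded in positive powers of `Λ`. -/
def opLambdaPInv (U : Chart) : ℤ → DiffPoly U :=
  fun n => if 0 ≤ n then
    -∏ j ∈ Finset.range (n.natAbs + 1), jetShift U (j : ℤ) (ofSmooth (fPinv U)) else 0

/-- The Lax operator `L = (1 - Q Λ⁻¹)⁻¹ (Λ - P)`. -/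
def opL (U : Chart) : ℤ → DiffPoly U := opComp (opOneQInv U) (opLambdaP U)

/-- The Lax operator `M = (Λ - P)⁻¹ (1 - Q Λ⁻¹)`. -/
def opM (U : Chart) : ℤ → DiffPoly U := opComp (opLambdaPInv U) (opOneQ U)

/-! ## Hamiltonian densities of the Principal Hierarchy

With `λ = (y + Q)(y + v)/y`, `v = v¹ = Q - P`, `Q = e^{v²}`, the functions `θ_{0,k}` and `θ_{1,k}`
(`k ≥ 1`) are the residues at `y = 0` of
`λ^k (log⁺ λ - H_k) dy/(k! (y + Q))` and `λ^k (log⁺ λ + log⁻ λ - 2 H_k) dy/(k! (y + Q))`, where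
`log⁺ λ = log Q + log (1 + y/Q) + log (1 + v/y)` and
`log⁻ λ = log v + log (1 + y/v) + log (1 + Q/y)`, expanded in `y/Q, v/y` and in `y/v, Q/y`. -/

/-- The coefficient of `y^{k-1+j}` in `(y + Q)^{k-1} (y + v)^k`, which is the residue of
`y^{-j} λ^k dy/(y + Q)`. -/
def resCoeff (k : ℕ) (v Q : ℝ) (j : ℤ) : ℝ :=
  if 0 ≤ (k : ℤ) - 1 + j then
    ((Polynomial.X + Polynomial.C Q) ^ (k - 1) * (Polynomial.X + Polynomial.C v) ^ k :
      Polynomial ℝ).coeff ((k : ℤ) - 1 + j).toNat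
  else 0

/-- The harmonic number `H_k`. -/
def harm (k : ℕ) : ℝ := ∑ j ∈ Finset.Icc 1 k, 1 / (j : ℝ)

/-- `θ_{0,k}` for `k ≥ 1`, as a function of `(P, Q)`. -/
def theta0 (k : ℕ) (x : ℝ × ℝ) : ℝ :=
  let Q := x.2
  let v := x.2 - x.1
  (1 / (k.factorial : ℝ)) * ((Real.log Q - harm k) * resCoeff k v Q 0 +
    ∑ j ∈ Finset.Icc 1 k, ((-1 : ℝ) ^ (j + 1) / j) *
      (resCoeff k v Q (-(j : ℤ)) / Q ^ j + v ^ j * resCoeff k v Q j))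

/-- `θ_{1,k}`, as a function of `(P, Q)`; `θ_{1,0} = v² = log Q`. -/
def theta1 (k : ℕ) (x : ℝ × ℝ) : ℝ :=
  let Q := x.2
  let v := x.2 - x.1
  if k = 0 then Real.log Q else
  (1 / (k.factorial : ℝ)) * ((Real.log Q + Real.log v - 2 * harm k) * resCoeff k v Q 0 +
    ∑ j ∈ Finset.Icc 1 k, ((-1 : ℝ) ^ (j + 1) / j) *
      ((1 / Q ^ j + 1 / v ^ j) * resCoeff k v Q (-(j : ℤ)) +
        (v ^ j + Q ^ j) * resCoeff k v Q j))

/-! ## The extended Ablowitz-Ladik hierarchy -/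

/-- The index set `ℐ = {(1, k), (2, k) | k ≥ 0} ∪ {(0, k) | k ∈ ℤ}`. -/
inductive Idx : Type
  | zero (k : ℤ) : Idx
  | one (k : ℕ) : Idx
  | two (k : ℕ) : Idx

/-- `(α, k) ↦ (α, k + 1)`. -/
def Idx.next : Idx → Idx
  | .zero k => .zero (k + 1)
  | .one k => .one (k + 1)
  | .two k => .two (k + 1)

/-- The flow `∂u/∂t^{β,q} = 𝒫₀ δH_{β,q}/δu` with `H_{β,q} = ∫ h_{β,q+1} dx`. -/
def flow {U : Chart} (h : Idx → DiffPoly U) (i : Idx) : Fin 2 → DiffPoly U :=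
  hamField (h i.next)

/-- `f = f_0 + ε f_1 + ε² f_2 + ⋯`, where `f_0` is the function `θ` on `U` and `f_k` is a
differential polynomial of differential degree `k`. -/
def HasLeading {U : Chart} (f : DiffPoly U) (θ : ℝ × ℝ → ℝ) : Prop :=
  (∃ c : Smooth U, PowerSeries.coeff 0 f = MvPolynomial.C c ∧ ∀ x : U.carrier, c.fn x = θ x) ∧
  ∀ k : ℕ, MvPolynomial.IsWeightedHomogeneous (fun v : Fin 2 × ℕ => v.2 + 1)
    (PowerSeries.coeff k f) k

/-- `H = ∫ h dx` is a bihamiltonian conserved quantity: `[I₁, [I₀, H]] = 0`. -/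
def IsBihamiltonian {U : Chart} (h : DiffPoly U) : Prop := PreservesP1 (hamField h)

/-- The density `h_{0,0} = (ε ∂_x / (1 - Λ⁻¹)) (log Q - log P)`, where
`z / (1 - e^{-z}) = ∑ B_n z^n / n!` with `B_1 = 1/2`. -/
def density00 (U : Chart) : DiffPoly U :=
  PowerSeries.mk fun n => ((bernoulli' n : ℝ) / (n.factorial : ℝ)) •
    (jetDx U ^ n) (MvPolynomial.C (fLogQP U))

/-- `h` is a system of tau-symmetric densities of the Hamiltonians
`H_{α,p} = ∫ h_{α,p+1} dx` of the extended Ablowitz-Ladik hierarchy, and `Ω` is a tau structure for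
it. The flows `(2, p)`, `p ≥ 0`, and `(0, -p)`, `p ≥ 1`, are those of the Ablowitz-Ladik hierarchy;
the others are given by bihamiltonian conserved quantities that deform `∫ θ_{1,p} dx` and
`∫ θ_{0,p} dx`. -/
structure IsTauStructure {U : Chart} (h : Idx → DiffPoly U) (Ω : Idx → Idx → DiffPoly U) :
    Prop where
  two : ∀ p : ℕ, h (.two p) = (1 / ((p + 1).factorial : ℝ)) • opPow (opL U) (p + 1) 0
  zero_zero : h (.zero 0) = density00 U
  zero_neg : ∀ q : ℕ, 1 ≤ q →
    h (.zero (-(q : ℤ))) = ((-1 : ℝ) ^ q * ((q - 1).factorial : ℝ)) • opPow (opM U) q 0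
  zero_lead : ∀ k : ℕ, 1 ≤ k → HasLeading (h (.zero k)) (theta0 k)
  one_lead : ∀ k : ℕ, HasLeading (h (.one k)) (theta1 k)
  zero_biham : ∀ k : ℕ, 1 ≤ k → IsBihamiltonian (h (.zero k))
  one_biham : ∀ k : ℕ, IsBihamiltonian (h (.one k))
  tau_symm : ∀ i j : Idx, evolve (flow h j) (h i) = evolve (flow h i) (h j)
  omega : ∀ i j : Idx,
    jetShift U 1 (Ω i j) - Ω i j = PowerSeries.X * evolve (flow h j) (h i)

/-! ## The odd variables and the ring `ℬ` -/

/-- The index set of the odd variables: `(α, k, s)` is `σ_{α+1,k}^s = ∂_x^s σ_{α+1,k}`. -/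
abbrev OddIdx := Fin 2 × ℤ × ℕ

/-- The Grassmann algebra generated by the odd variables. -/
abbrev Grass := ExteriorAlgebra ℝ (OddIdx →₀ ℝ)

/-- The shift `σ_{α,k}^s ↦ σ_{α,k}^{s+1}` of the generators. -/
def oddShift : (OddIdx →₀ ℝ) →ₗ[ℝ] (OddIdx →₀ ℝ) :=
  Finsupp.lmapDomain ℝ ℝ fun v : OddIdx => (v.1, v.2.1, v.2.2 + 1)

lemma grass_dual_sq (v : OddIdx →₀ ℝ) :
    ((TrivSqZeroExt.inlHom Grass Grass).toAddMonoidHom (ExteriorAlgebra.ι ℝ v) +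
      TrivSqZeroExt.inr (ExteriorAlgebra.ι ℝ (oddShift v)) : TrivSqZeroExt Grass Grass) *
    ((TrivSqZeroExt.inlHom Grass Grass).toAddMonoidHom (ExteriorAlgebra.ι ℝ v) +
      TrivSqZeroExt.inr (ExteriorAlgebra.ι ℝ (oddShift v))) = 0 := by
  have h := ExteriorAlgebra.ι_sq_zero (R := ℝ) v
  have h2 := ExteriorAlgebra.ι_add_mul_swap (R := ℝ) v (oddShift v)
  ext
  · simp [h]
  · simp [h2]

/-- `g ↦ g + δ ∂_x g` (`δ² = 0`), as the algebra homomorphism given on generators. -/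
def grassDual : Grass →ₐ[ℝ] TrivSqZeroExt Grass Grass :=
  ExteriorAlgebra.lift ℝ
    ⟨(TrivSqZeroExt.inlAlgHom ℝ Grass Grass).toLinearMap ∘ₗ ExteriorAlgebra.ι ℝ +
      (TrivSqZeroExt.inrHom Grass Grass).restrictScalars ℝ ∘ₗ ExteriorAlgebra.ι ℝ ∘ₗ oddShift,
      fun v => grass_dual_sq v⟩

/-- The derivation `∂_x = ∑ σ_{α,k}^{s+1} ∂/∂σ_{α,k}^s` of the Grassmann algebra. -/
def grassDx : Grass →ₗ[ℝ] Grass :=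
  (TrivSqZeroExt.sndHom Grass Grass).restrictScalars ℝ ∘ₗ grassDual.toLinearMap

/-- Differential polynomials in `P`, `Q` and the odd variables. -/
abbrev Super (U : Chart) := Jet U ⊗[ℝ] Grass

/-- Formal power series in `ε` with coefficients in `Super U`. -/
abbrev SuperPoly (U : Chart) := PowerSeries (Super U)

/-- The derivation `∂_x` of `Super U`. -/
def superDx (U : Chart) : Super U →ₗ[ℝ] Super U :=
  LinearMap.rTensor Grass (jetDx U) + LinearMap.lTensor (Jet U) grassDx

/-- `∂/∂u^{i,s}` on `Super U`. -/
def superPartial (U : Chart) (i : Fin 2) (s : ℕ) : Super U →ₗ[ℝ] Super U :=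
  LinearMap.rTensor Grass (jetPartial U i s)

/-- The parity automorphism of `SuperPoly U`: it changes the sign of every odd variable. -/
def parity (U : Chart) : SuperPoly U →+* SuperPoly U :=
  PowerSeries.map (Algebra.TensorProduct.map (AlgHom.id ℝ (Jet U))
    (CliffordAlgebra.involute : Grass →ₐ[ℝ] Grass)).toRingHom

/-- The inclusion of `𝒜`. -/
def incl (U : Chart) : DiffPoly U →+* SuperPoly U :=
  PowerSeries.map (Algebra.TensorProduct.includeLeft : Jet U →ₐ[ℝ] Super U).toRingHom

/-- `Λ^m` on `SuperPoly U`. -/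
def superShift (U : Chart) (m : ℤ) : SuperPoly U → SuperPoly U := shift (superDx U) m

/-- The even variable `P`. -/
def sP (U : Chart) : SuperPoly U := incl U (ofSmooth (fP U))

/-- The even variable `Q`. -/
def sQ (U : Chart) : SuperPoly U := incl U (ofSmooth (fQ U))

/-- The odd variable `σ_{α+1,k}`. -/
def sig (U : Chart) (α : Fin 2) (k : ℤ) : SuperPoly U :=
  PowerSeries.C ((1 : Jet U) ⊗ₜ[ℝ] ExteriorAlgebra.ι ℝ (Finsupp.single (α, k, 0) (1 : ℝ)))

/-- The odd variable `σ_{1,k}`. -/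
abbrev s1 (U : Chart) (k : ℤ) : SuperPoly U := sig U 0 k

/-- The odd variable `σ_{2,k}`. -/
abbrev s2 (U : Chart) (k : ℤ) : SuperPoly U := sig U 1 k

/-- The first recursion relation,
`(Λ Q - Q Λ⁻¹) σ_{1,k+1} + (Λ - 1) Q σ_{2,k+1} - P (1 - Λ) Q σ_{2,k}`. -/
def rel1 (U : Chart) (k : ℤ) : SuperPoly U :=
  (superShift U 1 (sQ U * s1 U (k + 1)) - sQ U * superShift U (-1) (s1 U (k + 1))) +
    (superShift U 1 (sQ U * s2 U (k + 1)) - sQ U * s2 U (k + 1)) -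
    sP U * (sQ U * s2 U k - superShift U 1 (sQ U * s2 U k))

/-- The second recursion relation, `σ_{1,k+1} + P σ_{1,k} + (Λ + 1) Q σ_{2,k}`. -/
def rel2 (U : Chart) (k : ℤ) : SuperPoly U :=
  s1 U (k + 1) + sP U * s1 U k + (superShift U 1 (sQ U * s2 U k) + sQ U * s2 U k)

/-- The two-sided ideals of `SuperPoly U` that contain the recursion relations, are stable under
`∂_x`, are closed in the `ε`-adic topology, and satisfy `ε f ∈ I → f ∈ I`. (Stability under the
infinite series `Λ` requires the closure. The relations stem from
`𝒫₀ σ_{k+1} = 𝒫₁ σ_k`, where `𝒫₀, 𝒫₁` carry the factor `1/ε`, so relations divisible by `ε` are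
to be divided by it.) -/
structure IsRelIdeal {U : Chart} (I : Ideal (SuperPoly U)) : Prop where
  mul_right : ∀ f g : SuperPoly U, f ∈ I → f * g ∈ I
  rel1_mem : ∀ k : ℤ, rel1 U k ∈ I
  rel2_mem : ∀ k : ℤ, rel2 U k ∈ I
  dx_mem : ∀ f ∈ I, epsMap (superDx U) f ∈ I
  closed : ∀ f : SuperPoly U,
    (∀ n : ℕ, ∃ g ∈ I, ∃ r : SuperPoly U, f = g + PowerSeries.X ^ n * r) → f ∈ I
  saturated : ∀ f : SuperPoly U, PowerSeries.X * f ∈ I → f ∈ I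

/-- The differential ideal `J` generated by the recursion relations: the smallest ideal as in
`IsRelIdeal`. -/
def relIdeal (U : Chart) : Ideal (SuperPoly U) := sInf {I | IsRelIdeal I}

lemma mem_relIdeal {U : Chart} {f : SuperPoly U} :
    f ∈ relIdeal U ↔ ∀ I : Ideal (SuperPoly U), IsRelIdeal I → f ∈ I := by
  simp [relIdeal, Submodule.mem_sInf]

lemma isRelIdeal_relIdeal (U : Chart) : IsRelIdeal (relIdeal U) where
  mul_right f g hf := mem_relIdeal.2 fun I hI => hI.mul_right f g (mem_relIdeal.1 hf I hI)
  rel1_mem k := mem_relIdeal.2 fun _ hI => hI.rel1_mem k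
  rel2_mem k := mem_relIdeal.2 fun _ hI => hI.rel2_mem k
  dx_mem f hf := mem_relIdeal.2 fun I hI => hI.dx_mem f (mem_relIdeal.1 hf I hI)
  closed f hf := mem_relIdeal.2 fun I hI => hI.closed f fun n => by
    obtain ⟨g, hg, r, hr⟩ := hf n
    exact ⟨g, mem_relIdeal.1 hg I hI, r, hr⟩
  saturated f hf := mem_relIdeal.2 fun I hI => hI.saturated f (mem_relIdeal.1 hf I hI)

instance (U : Chart) : (relIdeal U).IsTwoSided :=
  ⟨fun b ha => (isRelIdeal_relIdeal U).mul_right _ b ha⟩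

/-- The quotient ring `ℬ`. -/
abbrev BRing (U : Chart) : Type := SuperPoly U ⧸ relIdeal U

/-- The projection onto `ℬ`. -/
def toB (U : Chart) : SuperPoly U →+* BRing U := Ideal.Quotient.mk (relIdeal U)

/-- The derivation `∂_x` of `ℬ`. -/
def dxB (U : Chart) : BRing U →+ BRing U :=
  QuotientAddGroup.map (relIdeal U).toAddSubgroup (relIdeal U).toAddSubgroup
    (epsMap (superDx U)) fun f hf => (isRelIdeal_relIdeal U).dx_mem f hf

/-- A smooth function as an element of `ℬ`. -/
def smoothB {U : Chart} (f : Smooth U) : BRing U := toB U (incl U (ofSmooth f))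

/-- The element `ε` of `ℬ`. -/
def epsB (U : Chart) : BRing U := toB U PowerSeries.X

/-- `ε 𝒫₀` applied to `(σ_{1,k}, σ_{2,k})`. -/
def superP0 (U : Chart) (k : ℤ) : Fin 2 → SuperPoly U :=
  epsP0 (superDx U) (sP U) (sQ U) fun α => sig U α k

/-- `ε 𝒫₁` applied to `(σ_{1,k}, σ_{2,k})`. -/
def superP1 (U : Chart) (k : ℤ) : Fin 2 → SuperPoly U :=
  epsP1 (superDx U) (sP U) (sQ U) fun α => sig U α k

/-- `ε` times the density of the local functional `I₀ = ½ ∫ θ_α 𝒫₀^{αβ} θ_β`, where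
`θ_α = σ_{α,0}`. -/
def densityI0 (U : Chart) : SuperPoly U :=
  (1 / 2 : ℝ) • ∑ α : Fin 2, sig U α 0 * superP0 U 0 α

/-- `ε` times the density of the local functional `I₁ = ½ ∫ θ_α 𝒫₁^{αβ} θ_β`. -/
def densityI1 (U : Chart) : SuperPoly U :=
  (1 / 2 : ℝ) • ∑ α : Fin 2, sig U α 0 * superP1 U 0 α

/-- The variational derivative `δ/δu^i` on `SuperPoly U`. -/
def superVar (U : Chart) (i : Fin 2) (f : SuperPoly U) : SuperPoly U :=
  epsVarDeriv (superDx U) (superPartial U i) f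

/-! ## Flows on `ℬ` -/

/-- An even flow on `ℬ`: a derivation that commutes with `∂_x`, kills `ε`, and acts on functions
of `P, Q` by the chain rule. -/
structure IsEvenFlow {U : Chart} (D : BRing U →+ BRing U) : Prop where
  leibniz : ∀ x y : BRing U, D (x * y) = D x * y + x * D y
  eps : D (epsB U) = 0
  dx : ∀ x : BRing U, D (dxB U x) = dxB U (D x)
  chain : ∀ f : Smooth U, D (smoothB f) =
    smoothB (partialSmooth U 0 f) * D (smoothB (fP U)) +
      smoothB (partialSmooth U 1 f) * D (smoothB (fQ U))

/-- An odd flow on `ℬ`: the same, with the graded Leibniz rule. -/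
structure IsOddFlow {U : Chart} (D : BRing U →+ BRing U) : Prop where
  leibniz : ∀ f g : SuperPoly U, D (toB U (f * g)) =
    D (toB U f) * toB U g + toB U (parity U f) * D (toB U g)
  eps : D (epsB U) = 0
  dx : ∀ x : BRing U, D (dxB U x) = dxB U (D x)
  chain : ∀ f : Smooth U, D (smoothB f) =
    smoothB (partialSmooth U 0 f) * D (smoothB (fP U)) +
      smoothB (partialSmooth U 1 f) * D (smoothB (fQ U))

/-- The right-hand side of the equation for `ε ∂P/∂t^{α,k}`:
`P/(Q - P) ((Λ - 1) Ω_{2,0;α,k} - Q (1 - Λ⁻¹) h_{α,k})`. -/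
def rhsP {U : Chart} (h : Idx → DiffPoly U) (Ω : Idx → Idx → DiffPoly U) (i : Idx) : DiffPoly U :=
  ofSmooth (fP U * fQPinv U) *
    ((jetShift U 1 (Ω (.two 0) i) - Ω (.two 0) i) -
      ofSmooth (fQ U) * (h i - jetShift U (-1) (h i)))

/-- The right-hand side of the equation for `ε ∂Q/∂t^{α,k}`:
`Q/(Q - P) ((Λ - 1) Ω_{2,0;α,k} - P (1 - Λ⁻¹) h_{α,k})`. -/
def rhsQ {U : Chart} (h : Idx → DiffPoly U) (Ω : Idx → Idx → DiffPoly U) (i : Idx) : DiffPoly U :=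
  ofSmooth (fQ U * fQPinv U) *
    ((jetShift U 1 (Ω (.two 0) i) - Ω (.two 0) i) -
      ofSmooth (fP U) * (h i - jetShift U (-1) (h i)))

/-- The system of equations that defines the super extension: `Dt i = ∂/∂t^i` and
`Dτ k = ∂/∂τ_k` are flows on `ℬ` that satisfy the equations below. -/
structure IsSuperExtension {U : Chart} (h : Idx → DiffPoly U) (Ω : Idx → Idx → DiffPoly U)
    (Dt : Idx → (BRing U →+ BRing U)) (Dτ : ℤ → (BRing U →+ BRing U)) : Prop where
  even : ∀ i, IsEvenFlow (Dt i)
  odd : ∀ k, IsOddFlow (Dτ k)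
  t_P : ∀ i, epsB U * Dt i (smoothB (fP U)) = toB U (incl U (rhsP h Ω i))
  t_Q : ∀ i, epsB U * Dt i (smoothB (fQ U)) = toB U (incl U (rhsQ h Ω i))
  tau_P : ∀ k : ℤ, epsB U * Dτ k (smoothB (fP U)) =
    toB U (sP U * (superShift U 1 (sQ U * s2 U (k - 1)) - sQ U * s2 U (k - 1)))
  tau_Q : ∀ k : ℤ, epsB U * Dτ k (smoothB (fQ U)) =
    toB U (sQ U * (superShift U (-1) (s1 U k) - s1 U k))
  tau_s1_pos : ∀ (k : ℤ) (m : ℕ), 1 ≤ m → epsB U * Dτ k (toB U (s1 U (k + m))) =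
    toB U (∑ i ∈ Finset.range m, s1 U (k + i) *
      (sQ U * s2 U (k + m - 1 - i) - superShift U 1 (sQ U * s2 U (k + m - 1 - i))))
  tau_s1_zero : ∀ k : ℤ, Dτ k (toB U (s1 U k)) = 0
  tau_s1_neg : ∀ (k : ℤ) (m : ℕ), 1 ≤ m →
    Dτ (k + m) (toB U (s1 U k)) = -Dτ k (toB U (s1 U (k + m)))
  tau_s2_nonneg : ∀ (k : ℤ) (m : ℕ), epsB U * Dτ k (toB U (sQ U * s2 U (k + m))) =
    toB U (-(sQ U * ∑ i ∈ Finset.range (m + 1),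
      superShift U (-1) (s1 U (k + m - i)) * s1 U (k + i)))
  tau_s2_one : ∀ k : ℤ, Dτ (k + 1) (toB U (sQ U * s2 U k)) = 0
  tau_s2_neg : ∀ (k : ℤ) (m : ℕ), 2 ≤ m → epsB U * Dτ (k + m) (toB U (sQ U * s2 U k)) =
    toB U (sQ U * ∑ i ∈ Finset.Icc 1 (m - 1),
      superShift U (-1) (s1 U (k + m - i)) * s1 U (k + i))
  t_sigma_Q : ∀ (i : Idx) (k : ℤ), Dt i (toB U (sQ U * (s1 U k + s2 U k))) =
    Dτ k (toB U (incl U (Ω (.two 0) i)))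
  t_sigma_P : ∀ (i : Idx) (k : ℤ), Dt i (toB U (sP U * s1 U k + sQ U * s2 U k)) =
    Dτ (k + 1) (toB U (incl U (h i)))

end AblowitzLadik

end

open scoped TensorProduct ContDiff

noncomputable section

namespace AblowitzLadik

variable {U : Chart}

/-! ## Power series in `ε` and functions of `ε ∂_x` -/

/-! The formulas for the flows come from two densities that are explicit. Since h_{2,0} = Q - P, the
tau structure says ε∂(Q - P)/∂t^i = (Λ - 1)Ω_{2,0;i}. Since h_{0,0} is the Todd operator ε∂_x/(1 -
Λ⁻¹) applied to log Q - log P, tau symmetry gives ∂h_{0,0}/∂t^i = ∂h_i/∂t^{0,0}. Once the flow (0,0)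
is known to be ∂_x, this says ε∂(log Q - log P)/∂t^i = (1 - Λ⁻¹)h_i, and the two linear equations
are solved for ∂P/∂t^i and ∂Q/∂t^i. That (0,0) is the translation (`IsTauStructure.flow_zero_zero`)
follows without knowing h_{0,1}: by tau symmetry the difference of the two fields annihilates the
explicit densities h_{2,0} and h_{0,-1}, and the invertibility of Q - P and of Λ + 1 forces it to
vanish.

Modulo the relation ideal J one has 𝒫₁σ_k = 𝒫₀σ_{k+1}. Before the quotient is taken, P, Q and the
σ's are free, so a graded derivation with any values of the right parity on them exists
(`exists_isTDer`). It descends to ℬ as soon as it maps the two relations into J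
(`IsSDer.map_relIdeal`).

For an even flow with Hamiltonian field X = 𝒫₀δh the values on σ_l are the derivatives, along u ↦
𝒫₀σ_l, of δh/δP and of Q(δh/δP + δh/δQ); X depends on h only through these two combinations. Hence
D(𝒫₀σ_l) is the derivative of X along 𝒫₀σ_l (`evenDer_superP0`). Such a D acts on the covectors σ by
-X_*^†, so the corresponding statement for 𝒫₁ (`evenDer_superP1`) is the vanishing of the Lie
derivative of 𝒫₁ along X. For the Ablowitz-Ladik flows this vanishing comes from the Lenard
recursion, proved by the trace calculus for L and M (`LaxStep.jetP0_eq`); for the other flows it is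
the bihamiltonian hypothesis. Consequently D maps a relation to a multiple of the difference between
the derivative of some f along 𝒫₁σ_l and its derivative along 𝒫₀σ_{l+1}, which lies in J. The
equations containing Ω and h arise by inverting Λ - 1 and 1 - Λ⁻¹ on elements linear in the σ's,
where these operators are injective (`Lin.eq_zero_of_shift`).

All the case distinctions for the odd flows are those of a single oriented sum: ε∂σ_{1,l}/∂τ_k and
ε∂(Qσ_{2,l})/∂τ_k are convolutions over an oriented interval between k and l or l + 1. Summation by
parts in the indices shows that the relations are preserved (`odd_rel1`, `odd_rel2`).

Commutators of flows are again flows, so they need be tested on generators only. For the odd flows,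
∂σ_{1,l}/∂τ_k is antisymmetric in k, l, so the cyclic sums of the values of the anticommutators
vanish, also after the index is raised or lowered by the recursion; a combinatorial lemma
(`eq_zero_of_cyclic`) then gives zero. For mixed pairs the commutators on σ_{1,l} are antisymmetric
in k, l and, by the recursion, depend on k + l only. For even pairs the statement reduces to the
gradients, which commute because the Hamiltonians are in involution and the Hessian is self-adjoint.
Uniqueness holds because ε is not a zero divisor in ℬ, Q and Q - P are invertible, and ℬ is
ε-adically separated. -/

lemma series_eq_add {R : Type} [Ring R] (f : PowerSeries R) :
    f = PowerSeries.C (PowerSeries.coeff 0 f) + PowerSeries.X * divEps f := by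
  ext n
  cases n with
  | zero => simp
  | succ n => simp [PowerSeries.coeff_succ_X_mul, divEps]

/-- An additive, `ε`-linear map that sends the constants into a closed subgroup takes its values in
this subgroup. -/
lemma eps_mem {R M : Type} [Ring R] [AddCommGroup M] (F : PowerSeries R →+ M) (e : M →+ M)
    (hF : ∀ f, F (PowerSeries.X * f) = e (F f)) (S : AddSubgroup M) (hS : ∀ x ∈ S, e x ∈ S)
    (closed : ∀ m, (∀ n : ℕ, ∃ g ∈ S, ∃ r, m = g + e^[n] r) → m ∈ S)
    (hC : ∀ r, F (PowerSeries.C r) ∈ S) (f : PowerSeries R) : F f ∈ S := by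
  have key : ∀ (n : ℕ) (f : PowerSeries R), ∃ g ∈ S, ∃ r, F f = g + e^[n] r := by
    intro n
    induction n with
    | zero => exact fun f => ⟨0, S.zero_mem, F f, by simp⟩
    | succ n ih =>
      intro f
      obtain ⟨g, hg, r, hr⟩ := ih (divEps f)
      refine ⟨F (PowerSeries.C (PowerSeries.coeff 0 f)) + e g, S.add_mem (hC _) (hS _ hg), r, ?_⟩
      conv_lhs => rw [series_eq_add f]
      rw [map_add, hF, hr, map_add, Function.iterate_succ_apply', add_assoc]
  exact closed _ fun n => key n f

section Series

variable {R S : Type} [Ring R] [Ring S]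

lemma series_eq_zero {f : PowerSeries R} (h : ∀ n : ℕ, ∃ g, f = PowerSeries.X ^ n * g) : f = 0 := by
  ext n
  obtain ⟨g, hg⟩ := h (n + 1)
  rw [hg, PowerSeries.coeff_X_pow_mul']
  simp

lemma iterate_X_mul (n : ℕ) (r : PowerSeries R) :
    (AddMonoidHom.mulLeft (PowerSeries.X : PowerSeries R))^[n] r = PowerSeries.X ^ n * r := by
  induction n with
  | zero => simp
  | succ n ih => rw [Function.iterate_succ_apply', ih, AddMonoidHom.coe_mulLeft, pow_succ', mul_assoc]

/-- Additive, `ε`-linear maps between power series agree if they agree on the constants. -/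
lemma eps_ext (F G : PowerSeries R →+ PowerSeries S)
    (hF : ∀ f, F (PowerSeries.X * f) = PowerSeries.X * F f)
    (hG : ∀ f, G (PowerSeries.X * f) = PowerSeries.X * G f)
    (h : ∀ r, F (PowerSeries.C r) = G (PowerSeries.C r)) (f : PowerSeries R) : F f = G f := by
  have := eps_mem (F - G) (AddMonoidHom.mulLeft PowerSeries.X)
    (fun f => by simp [hF, hG, mul_sub]) ⊥ (by simp)
    (fun m hm => by
      refine AddSubgroup.mem_bot.2 (series_eq_zero fun n => ?_)
      obtain ⟨g, hg, r, hr⟩ := hm n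
      exact ⟨r, by rw [hr, AddSubgroup.mem_bot.1 hg, zero_add, iterate_X_mul]⟩)
    (fun r => by simp [h]) f
  simpa [sub_eq_zero] using this

lemma X_mul_cancel {f g : PowerSeries R} (h : PowerSeries.X * f = PowerSeries.X * g) : f = g := by
  ext n
  simpa [PowerSeries.coeff_succ_X_mul] using congrArg (PowerSeries.coeff (n + 1)) h

lemma X_mul_divEps {f : PowerSeries R} (h : PowerSeries.coeff 0 f = 0) :
    PowerSeries.X * divEps f = f := by
  conv_rhs => rw [series_eq_add f, h]
  simp

lemma X_mul_comm' (f : PowerSeries R) : f * PowerSeries.X = PowerSeries.X * f :=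
  (PowerSeries.commute_X f).eq

lemma mul_X_left_comm (f g : PowerSeries R) :
    f * (PowerSeries.X * g) = PowerSeries.X * (f * g) := by
  rw [← mul_assoc, X_mul_comm', mul_assoc]

variable [Algebra ℝ R] [Algebra ℝ S]

/-- The operator `φ(ε d)` for a power series `φ`. -/
def epsOp (d : R →ₗ[ℝ] R) (φ : PowerSeries ℝ) : PowerSeries R →+ PowerSeries R where
  toFun f := PowerSeries.mk fun n => ∑ p ∈ Finset.HasAntidiagonal.antidiagonal n,
    PowerSeries.coeff p.1 φ • (d ^ p.1) (PowerSeries.coeff p.2 f)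
  map_zero' := by ext n; simp
  map_add' f g := by ext n; simp [Finset.sum_add_distrib]

lemma coeff_epsOp (d : R →ₗ[ℝ] R) (φ : PowerSeries ℝ) (f : PowerSeries R) (n : ℕ) :
    PowerSeries.coeff n (epsOp d φ f) = ∑ p ∈ Finset.HasAntidiagonal.antidiagonal n,
      PowerSeries.coeff p.1 φ • (d ^ p.1) (PowerSeries.coeff p.2 f) := by
  simp [epsOp]

lemma epsOp_C (d : R →ₗ[ℝ] R) (φ : PowerSeries ℝ) (r : R) :
    epsOp d φ (PowerSeries.C r) = PowerSeries.mk fun n => PowerSeries.coeff n φ • (d ^ n) r := by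
  ext n
  rw [coeff_epsOp, Finset.sum_eq_single (n, 0)]
  · simp
  · rintro ⟨i, j⟩ hij hne
    have : j ≠ 0 := fun h => hne (by simp_all)
    simp [PowerSeries.coeff_C, this]
  · simp

lemma epsOp_X_mul (d : R →ₗ[ℝ] R) (φ : PowerSeries ℝ) (f : PowerSeries R) :
    epsOp d φ (PowerSeries.X * f) = PowerSeries.X * epsOp d φ f := by
  ext n
  cases n with
  | zero => simp [coeff_epsOp]
  | succ n =>
    rw [PowerSeries.coeff_succ_X_mul, coeff_epsOp, coeff_epsOp,
      Finset.Nat.sum_antidiagonal_succ']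
    simp [PowerSeries.coeff_succ_X_mul]

lemma epsMap_C (d : R →ₗ[ℝ] R) (r : R) : epsMap d (PowerSeries.C r) = PowerSeries.C (d r) := by
  ext n
  by_cases h : n = 0 <;> simp [epsMap, PowerSeries.coeff_C, h]

lemma epsMap_X_mul (d : R →ₗ[ℝ] R) (f : PowerSeries R) :
    epsMap d (PowerSeries.X * f) = PowerSeries.X * epsMap d f := by
  ext n
  cases n <;> simp [epsMap, PowerSeries.coeff_succ_X_mul]

lemma coeff_epsMap (d : R →ₗ[ℝ] R) (f : PowerSeries R) (n : ℕ) :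
    PowerSeries.coeff n (epsMap d f) = d (PowerSeries.coeff n f) := by
  simp [epsMap]

/-- The functional calculus φ ↦ φ(εd) is multiplicative, so an invertible power series gives an
invertible operator. This is how 1 + Λ, (Λ - 1)/(ε∂_x) and the Todd operator are inverted. -/
lemma epsOp_mul (d : R →ₗ[ℝ] R) (φ ψ : PowerSeries ℝ) (f : PowerSeries R) :
    epsOp d (φ * ψ) f = epsOp d φ (epsOp d ψ f) := by
  refine eps_ext (epsOp d (φ * ψ)) ((epsOp d φ).comp (epsOp d ψ)) (epsOp_X_mul d _)
    (fun f => by simp [epsOp_X_mul]) (fun r => ?_) f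
  ext n
  rw [AddMonoidHom.comp_apply, epsOp_C, epsOp_C, coeff_epsOp, PowerSeries.coeff_mk,
    PowerSeries.coeff_mul, Finset.sum_smul]
  refine Finset.sum_congr rfl fun p hp => ?_
  rw [PowerSeries.coeff_mk, map_smul, smul_smul, ← Finset.HasAntidiagonal.mem_antidiagonal.1 hp, pow_add]
  rfl

lemma epsOp_one (d : R →ₗ[ℝ] R) (f : PowerSeries R) : epsOp d 1 f = f := by
  refine eps_ext (epsOp d 1) (AddMonoidHom.id _) (epsOp_X_mul d _) (fun f => by simp)
    (fun r => ?_) f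
  ext n
  by_cases h : n = 0 <;> simp [epsOp_C, PowerSeries.coeff_one, PowerSeries.coeff_C, h]

lemma epsOp_add (d : R →ₗ[ℝ] R) (φ ψ : PowerSeries ℝ) (f : PowerSeries R) :
    epsOp d (φ + ψ) f = epsOp d φ f + epsOp d ψ f := by
  ext n; simp [coeff_epsOp, add_smul, Finset.sum_add_distrib]

lemma epsOp_neg (d : R →ₗ[ℝ] R) (φ : PowerSeries ℝ) (f : PowerSeries R) :
    epsOp d (-φ) f = -epsOp d φ f := by
  ext n; simp [coeff_epsOp, Finset.sum_neg_distrib]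

lemma epsOp_sub (d : R →ₗ[ℝ] R) (φ ψ : PowerSeries ℝ) (f : PowerSeries R) :
    epsOp d (φ - ψ) f = epsOp d φ f - epsOp d ψ f := by
  rw [sub_eq_add_neg, epsOp_add, epsOp_neg, sub_eq_add_neg]

lemma epsOp_X (d : R →ₗ[ℝ] R) (f : PowerSeries R) :
    epsOp d PowerSeries.X f = PowerSeries.X * epsMap d f := by
  refine eps_ext (epsOp d PowerSeries.X)
    ((AddMonoidHom.mulLeft PowerSeries.X).comp (epsMap d)) (epsOp_X_mul d _)
    (fun f => by simp [epsMap_X_mul]) (fun r => ?_) f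
  rw [AddMonoidHom.comp_apply, epsMap_C, epsOp_C, AddMonoidHom.coe_mulLeft]
  ext n
  rcases n with _ | _ | n
  · simp [PowerSeries.coeff_zero_X]
  · simp
  · simp [PowerSeries.coeff_X]

/-- A linear map that intertwines `d` and `d'` intertwines `φ(ε d)` and `φ(ε d')`. -/
lemma epsOp_intertwine {d : R →ₗ[ℝ] R} {d' : S →ₗ[ℝ] S} {T : PowerSeries R →+ PowerSeries S}
    (hX : ∀ f, T (PowerSeries.X * f) = PowerSeries.X * T f)
    (hd : ∀ f, T (epsMap d f) = epsMap d' (T f)) (φ : PowerSeries ℝ)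
    (hs : ∀ (c : ℝ) f, T (c • f) = c • T f) (f : PowerSeries R) :
    T (epsOp d φ f) = epsOp d' φ (T f) := by
  -- Writing φ(t) = φ(0) + tφ₁(t) reduces the claim for φ to the claim for φ₁ at the price of a
  -- factor ε. The difference of the two sides is therefore divisible by every power of ε.
  have key : ∀ (n : ℕ) (φ : PowerSeries ℝ) (f : PowerSeries R), ∃ g,
      T (epsOp d φ f) - epsOp d' φ (T f) = PowerSeries.X ^ n * g := by
    intro n
    induction n with
    | zero => exact fun φ f => ⟨_, (by rw [pow_zero, one_mul])⟩
    | succ n ih =>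
      intro φ f
      obtain ⟨g, hg⟩ := ih (divEps φ) (epsMap d f)
      refine ⟨g, ?_⟩
      have hC : ∀ {Q : Type} [Ring Q] [Algebra ℝ Q] (e : Q →ₗ[ℝ] Q) (c : ℝ) (f : PowerSeries Q),
          epsOp e (PowerSeries.C c) f = c • f := by
        intro Q _ _ e c f
        have h1 : (PowerSeries.C c : PowerSeries ℝ) = PowerSeries.C c * 1 := by simp
        ext m
        rw [coeff_epsOp, Finset.sum_eq_single (0, m)]
        · simp
        · rintro ⟨i, j⟩ hij hne
          have : i ≠ 0 := fun h => hne (by simp_all)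
          simp [PowerSeries.coeff_C, this]
        · simp
      have e1 : ∀ {Q : Type} [Ring Q] [Algebra ℝ Q] (e : Q →ₗ[ℝ] Q) (f : PowerSeries Q),
          epsOp e φ f = PowerSeries.coeff 0 φ • f +
            PowerSeries.X * epsOp e (divEps φ) (epsMap e f) := by
        intro Q _ _ e f
        conv_lhs => rw [series_eq_add φ]
        rw [epsOp_add, hC, mul_comm, epsOp_mul, epsOp_X, epsOp_X_mul]
      rw [e1, e1, map_add, hs, hX, ← hd, pow_succ', mul_assoc, ← hg]
      rw [mul_sub]
      abel
  rw [← sub_eq_zero]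
  exact series_eq_zero fun n => key n φ f

/-- The series `e^{m t}`. -/
def expSeries (m : ℤ) : PowerSeries ℝ := PowerSeries.rescale (m : ℝ) (PowerSeries.exp ℝ)

lemma shift_eq (d : R →ₗ[ℝ] R) (m : ℤ) (f : PowerSeries R) :
    shift d m f = epsOp d (expSeries m) f := by
  ext n
  simp [shift, coeff_epsOp, expSeries, PowerSeries.coeff_rescale, PowerSeries.coeff_exp,
    div_eq_mul_inv]

lemma expSeries_add (m n : ℤ) : expSeries (m + n) = expSeries m * expSeries n := by
  simp [expSeries, PowerSeries.exp_mul_exp_eq_exp_add]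

lemma expSeries_zero : expSeries 0 = 1 := by
  simp [expSeries]

lemma coeff_zero_expSeries (m : ℤ) : PowerSeries.constantCoeff (expSeries m) = 1 := by
  rw [← PowerSeries.coeff_zero_eq_constantCoeff_apply]
  simp [expSeries, PowerSeries.coeff_rescale]

lemma shift_zero_right (d : R →ₗ[ℝ] R) (m : ℤ) : shift d m 0 = 0 := by
  rw [shift_eq, map_zero]

lemma shift_add (d : R →ₗ[ℝ] R) (m : ℤ) (f g : PowerSeries R) :
    shift d m (f + g) = shift d m f + shift d m g := by
  simp only [shift_eq, map_add]

lemma shift_neg (d : R →ₗ[ℝ] R) (m : ℤ) (f : PowerSeries R) :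
    shift d m (-f) = -shift d m f := by
  simp only [shift_eq, map_neg]

lemma shift_sub (d : R →ₗ[ℝ] R) (m : ℤ) (f g : PowerSeries R) :
    shift d m (f - g) = shift d m f - shift d m g := by
  simp only [shift_eq, map_sub]

lemma shift_shift (d : R →ₗ[ℝ] R) (m n : ℤ) (f : PowerSeries R) :
    shift d m (shift d n f) = shift d (m + n) f := by
  simp only [shift_eq, expSeries_add, epsOp_mul]

lemma shift_zero (d : R →ₗ[ℝ] R) (f : PowerSeries R) : shift d 0 f = f := by
  rw [shift_eq, expSeries_zero, epsOp_one]

lemma shift_X_mul (d : R →ₗ[ℝ] R) (m : ℤ) (f : PowerSeries R) :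
    shift d m (PowerSeries.X * f) = PowerSeries.X * shift d m f := by
  simp only [shift_eq, epsOp_X_mul]

lemma coeff_zero_shift (d : R →ₗ[ℝ] R) (m : ℤ) (f : PowerSeries R) :
    PowerSeries.coeff 0 (shift d m f) = PowerSeries.coeff 0 f := by
  simp [shift]

/-- On R ⊗ R the operators d ⊗ 1 and 1 ⊗ d commute, so the binomial theorem applies to their sum,
and multiplication intertwines this sum with d. -/
lemma pow_apply_mul {d : R →ₗ[ℝ] R} (hd : ∀ a b, d (a * b) = d a * b + a * d b) (n : ℕ) (a b : R) :
    (d ^ n) (a * b) = ∑ p ∈ Finset.HasAntidiagonal.antidiagonal n,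
      n.choose p.1 • ((d ^ p.1) a * (d ^ p.2) b) := by
  let D1 : Module.End ℝ (R ⊗[ℝ] R) := LinearMap.rTensor R d
  let D2 : Module.End ℝ (R ⊗[ℝ] R) := LinearMap.lTensor R d
  have hc : Commute D1 D2 := by
    ext x y
    simp [D1, D2]
  have h1 : ∀ z, d (LinearMap.mul' ℝ R z) = LinearMap.mul' ℝ R ((D1 + D2) z) := by
    intro z
    induction z with
    | zero => simp
    | tmul x y => simp [D1, D2, hd]
    | add x y hx hy => rw [map_add, map_add, hx, hy, map_add, map_add]
  have h2 : ∀ (n : ℕ) z, (d ^ n) (LinearMap.mul' ℝ R z) =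
      LinearMap.mul' ℝ R (((D1 + D2) ^ n) z) := by
    intro n
    induction n with
    | zero => simp
    | succ n ih =>
      intro z
      rw [pow_succ, Module.End.mul_apply, h1, ih, pow_succ, Module.End.mul_apply]
  have h3 := h2 n (a ⊗ₜ b)
  rw [LinearMap.mul'_apply] at h3
  rw [h3, hc.add_pow']
  simp only [LinearMap.sum_apply, map_sum, LinearMap.smul_apply, map_nsmul]
  refine Finset.sum_congr rfl fun p _ => ?_
  congr 1
  rw [Module.End.mul_apply]
  simp only [D1, D2, LinearMap.lTensor_pow, LinearMap.rTensor_pow, LinearMap.lTensor_tmul,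
    LinearMap.rTensor_tmul, LinearMap.mul'_apply]

lemma epsMap_mul {d : R →ₗ[ℝ] R} (hd : ∀ a b, d (a * b) = d a * b + a * d b)
    (f g : PowerSeries R) : epsMap d (f * g) = epsMap d f * g + f * epsMap d g := by
  ext n
  simp [coeff_epsMap, PowerSeries.coeff_mul, hd, Finset.sum_add_distrib]

/-- The exponential of a derivation is multiplicative. By `eps_ext` in each factor this is checked
on constants, where it is the Leibniz formula divided by n!. -/
lemma shift_mul {d : R →ₗ[ℝ] R} (hd : ∀ a b, d (a * b) = d a * b + a * d b) (m : ℤ)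
    (f g : PowerSeries R) : shift d m (f * g) = shift d m f * shift d m g := by
  simp only [shift_eq]
  refine eps_ext ((epsOp d (expSeries m)).comp (AddMonoidHom.mulRight g))
    ((AddMonoidHom.mulRight (epsOp d (expSeries m) g)).comp (epsOp d (expSeries m)))
    (fun f => by simp [mul_assoc, epsOp_X_mul]) (fun f => by simp [mul_assoc, epsOp_X_mul])
    (fun a => ?_) f
  simp only [AddMonoidHom.comp_apply, AddMonoidHom.coe_mulRight]
  refine eps_ext ((epsOp d (expSeries m)).comp (AddMonoidHom.mulLeft (PowerSeries.C a)))
    ((AddMonoidHom.mulLeft (epsOp d (expSeries m) (PowerSeries.C a))).comp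
      (epsOp d (expSeries m)))
    (fun f => by simp [mul_X_left_comm, epsOp_X_mul])
    (fun f => by simp [mul_X_left_comm, epsOp_X_mul])
    (fun b => ?_) g
  simp only [AddMonoidHom.comp_apply, AddMonoidHom.coe_mulLeft, ← map_mul, epsOp_C]
  ext n
  rw [PowerSeries.coeff_mul, PowerSeries.coeff_mk, pow_apply_mul hd, Finset.smul_sum]
  refine Finset.sum_congr rfl fun p hp => ?_
  rw [PowerSeries.coeff_mk, PowerSeries.coeff_mk, smul_mul_smul_comm, ← Nat.cast_smul_eq_nsmul ℝ,
    smul_smul]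
  congr 1
  obtain ⟨i, j⟩ := p
  obtain rfl := Finset.HasAntidiagonal.mem_antidiagonal.1 hp
  simp only [expSeries, PowerSeries.coeff_rescale, PowerSeries.coeff_exp]
  have hch : ((i + j).choose i : ℝ) * i.factorial * j.factorial = (i + j).factorial := by
    have := Nat.choose_mul_factorial_mul_factorial (Nat.le_add_right i j)
    rw [Nat.add_sub_cancel_left] at this
    exact_mod_cast this
  simp only [map_div₀, map_one, map_natCast]
  rw [← hch]
  have : ((i + j).choose i : ℝ) ≠ 0 :=
    Nat.cast_ne_zero.2 (Nat.choose_pos (Nat.le_add_right i j)).ne'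
  field_simp
  ring

lemma shift_one {d : R →ₗ[ℝ] R} (hd : ∀ a b, d (a * b) = d a * b + a * d b) (m : ℤ) :
    shift d m 1 = 1 := by
  have h1 : d 1 = 0 := by simpa using hd 1 1
  rw [shift_eq, ← (PowerSeries.C : R →+* PowerSeries R).map_one, epsOp_C]
  ext n
  cases n with
  | zero =>
    have := coeff_zero_expSeries m
    rw [← PowerSeries.coeff_zero_eq_constantCoeff_apply] at this
    simp [this]
  | succ n => simp [pow_succ, h1]

/-- `(e^t - 1) / t`. -/
def expQuot : PowerSeries ℝ := divEps (expSeries 1 - 1)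

lemma X_mul_expQuot : PowerSeries.X * expQuot = expSeries 1 - 1 := by
  refine X_mul_divEps ?_
  rw [map_sub, PowerSeries.coeff_zero_eq_constantCoeff_apply, coeff_zero_expSeries]
  simp

lemma constantCoeff_expQuot : PowerSeries.constantCoeff expQuot = 1 := by
  rw [← PowerSeries.coeff_zero_eq_constantCoeff_apply]
  simp [expQuot, divEps, expSeries, PowerSeries.coeff_exp, PowerSeries.coeff_one]

lemma shift_one_sub_eq (d : R →ₗ[ℝ] R) (f : PowerSeries R) :
    shift d 1 f - f = PowerSeries.X * epsOp d expQuot (epsMap d f) := by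
  rw [← epsOp_X_mul, ← epsOp_X, ← epsOp_mul, mul_comm, X_mul_expQuot, epsOp_sub, epsOp_one, shift_eq]

/-- The kernel of `Λ - 1` is the kernel of `∂_x`. -/
lemma epsMap_eq_zero_of_shift {d : R →ₗ[ℝ] R} {f : PowerSeries R} (h : shift d 1 f = f) :
    epsMap d f = 0 := by
  have h1 : epsOp d expQuot (epsMap d f) = 0 :=
    X_mul_cancel (by rw [← shift_one_sub_eq, h]; simp)
  have h2 : expQuot⁻¹ * expQuot = 1 :=
    PowerSeries.inv_mul_cancel _ (by rw [constantCoeff_expQuot]; exact one_ne_zero)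
  have h3 := congrArg (epsOp d expQuot⁻¹) h1
  rwa [← epsOp_mul, h2, epsOp_one, map_zero] at h3

/-- `Λ + 1` is invertible. -/
lemma exists_inv_shift_add (d : R →ₗ[ℝ] R) :
    ∃ φ : PowerSeries ℝ, ∀ f : PowerSeries R, epsOp d φ (shift d 1 f + f) = f := by
  refine ⟨(expSeries 1 + 1)⁻¹, fun f => ?_⟩
  have h2 : (expSeries 1 + 1)⁻¹ * (expSeries 1 + 1) = 1 := PowerSeries.inv_mul_cancel _ (by
    rw [map_add, coeff_zero_expSeries, map_one]; norm_num)
  have h3 : shift d 1 f + f = epsOp d (expSeries 1 + 1) f := by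
    rw [epsOp_add, epsOp_one, shift_eq]
  rw [h3, ← epsOp_mul, h2, epsOp_one]

end Series

/-- A `d`-stable, closed subgroup that is stable under `ε` and scalars is stable under
`φ(ε d)`. -/
lemma epsOp_mem {R : Type} [Ring R] [Algebra ℝ R] {d : R →ₗ[ℝ] R}
    {S : AddSubgroup (PowerSeries R)} (hX : ∀ f ∈ S, PowerSeries.X * f ∈ S)
    (hs : ∀ (c : ℝ), ∀ f ∈ S, c • f ∈ S) (hd : ∀ f ∈ S, epsMap d f ∈ S)
    (closed : ∀ f, (∀ n : ℕ, ∃ g ∈ S, ∃ r, f = g + PowerSeries.X ^ n * r) → f ∈ S)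
    (φ : PowerSeries ℝ) {f : PowerSeries R} (hf : f ∈ S) : epsOp d φ f ∈ S := by
  refine closed _ fun n => ?_
  induction n generalizing φ f with
  | zero => exact ⟨0, S.zero_mem, _, by rw [pow_zero, one_mul, zero_add]⟩
  | succ n ih =>
    obtain ⟨g, hg, r, hr⟩ := ih (divEps φ) (hd f hf)
    refine ⟨PowerSeries.coeff 0 φ • f + PowerSeries.X * g,
      S.add_mem (hs _ _ hf) (hX _ hg), r, ?_⟩
    have hC : epsOp d (PowerSeries.C (PowerSeries.coeff 0 φ)) f = PowerSeries.coeff 0 φ • f := by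
      ext m
      rw [coeff_epsOp, Finset.sum_eq_single (0, m)]
      · simp
      · rintro ⟨i, j⟩ hij hne
        have : i ≠ 0 := fun h => hne (by simp_all)
        simp [PowerSeries.coeff_C, this]
      · simp
    conv_lhs => rw [series_eq_add φ]
    rw [epsOp_add, hC, mul_comm, epsOp_mul, epsOp_X, epsOp_X_mul, hr, pow_succ', mul_assoc,
      mul_add]
    abel

/-! ## Partial derivatives of smooth functions and of differential polynomials -/


/-- Since U is open, any formula that represents f on U agrees with the extension by zero near each
point, so it may be used to compute the derivative. -/
lemma partialSmooth_fn (i : Fin 2) (f : Smooth U) (F : ℝ × ℝ → ℝ) (h : ∀ x, f.fn x = F x)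
    (x : U.carrier) : (partialSmooth U i f).fn x = fderiv ℝ F x (dir i) := by
  have h1 : extendZero f =ᶠ[nhds (x : ℝ × ℝ)] F := by
    filter_upwards [U.isOpen.mem_nhds x.2] with y hy
    rw [extendZero_apply f ⟨y, hy⟩, h]
  change fderiv ℝ (extendZero f) x (dir i) = _
  rw [h1.fderiv_eq]

lemma partialSmooth_mul (i : Fin 2) (f g : Smooth U) :
    partialSmooth U i (f * g) = partialSmooth U i f * g + f * partialSmooth U i g := by
  refine Smooth.fn_ext fun x => ?_
  rw [partialSmooth_fn i (f * g) (extendZero f * extendZero g) (fun y => by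
    rw [Pi.mul_apply, extendZero_apply, extendZero_apply]; rfl)]
  rw [fderiv_mul (differentiableAt_extendZero f x) (differentiableAt_extendZero g x)]
  change _ = fderiv ℝ (extendZero f) x (dir i) * g.fn x + f.fn x * fderiv ℝ (extendZero g) x (dir i)
  simp only [add_apply, smul_apply, smul_eq_mul,
    extendZero_apply]
  ring

lemma partialSmooth_comm (i j : Fin 2) (f : Smooth U) :
    partialSmooth U i (partialSmooth U j f) = partialSmooth U j (partialSmooth U i f) := by
  refine Smooth.fn_ext fun x => ?_
  rw [partialSmooth_fn i (partialSmooth U j f) (fun y => fderiv ℝ (extendZero f) y (dir j))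
    (fun y => rfl), partialSmooth_fn j (partialSmooth U i f)
    (fun y => fderiv ℝ (extendZero f) y (dir i)) (fun y => rfl)]
  have hc : ContDiffAt ℝ ∞ (extendZero f) x :=
    (contDiffOn_extendZero f).contDiffAt (U.isOpen.mem_nhds x.2)
  have hd : DifferentiableAt ℝ (fderiv ℝ (extendZero f)) x :=
    (hc.fderiv_right (m := ∞) (by simp)).differentiableAt (by simp)
  have hs := hc.isSymmSndFDerivAt (by
    rw [minSmoothness_of_isRCLikeNormedField]
    exact WithTop.coe_le_coe.2 (le_top : (2 : ℕ∞) ≤ ⊤))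
  rw [fderiv_clm_apply hd (differentiableAt_const _), fderiv_clm_apply hd (differentiableAt_const _)]
  simpa using hs (dir i) (dir j)

lemma partialSmooth_one (i : Fin 2) : partialSmooth U i 1 = 0 := by
  simpa using partialSmooth_mul i (1 : Smooth U) 1

lemma partialSmooth_fP (i : Fin 2) : partialSmooth U i (fP U) = if i = 0 then 1 else 0 := by
  refine Smooth.fn_ext fun x => ?_
  rw [partialSmooth_fn i (fP U) Prod.fst (fun y => rfl), fderiv_fst]
  fin_cases i <;> simp [dir] <;> rfl

lemma partialSmooth_fQ (i : Fin 2) : partialSmooth U i (fQ U) = if i = 1 then 1 else 0 := by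
  refine Smooth.fn_ext fun x => ?_
  rw [partialSmooth_fn i (fQ U) Prod.snd (fun y => rfl), fderiv_snd]
  fin_cases i <;> simp [dir] <;> rfl

/-- The function `1 / Q`. -/
def fQinv (U : Chart) : Smooth U := Smooth.of (fun x => (x.2)⁻¹)
  (contDiffOn_snd.inv fun x hx => ((U.pos x hx).1.trans (U.pos x hx).2).ne')

lemma fP_mul_fPinv : fP U * fPinv U = 1 :=
  Smooth.fn_ext fun x => mul_inv_cancel₀ (U.pos x x.2).1.ne'

lemma fQ_mul_fQinv : fQ U * fQinv U = 1 :=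
  Smooth.fn_ext fun x => mul_inv_cancel₀ ((U.pos x x.2).1.trans (U.pos x x.2).2).ne'

lemma fQP_mul_fQPinv : (fQ U - fP U) * fQPinv U = 1 :=
  Smooth.fn_ext fun x => mul_inv_cancel₀ (sub_pos.2 (U.pos x x.2).2).ne'

lemma partialSmooth_fLogQP (i : Fin 2) :
    partialSmooth U i (fLogQP U) = if i = 0 then -fPinv U else fQinv U := by
  refine Smooth.fn_ext fun x => ?_
  have hP := (U.pos x x.2).1
  have hQ := hP.trans (U.pos x x.2).2
  rw [partialSmooth_fn i (fLogQP U) (fun y => Real.log y.2 - Real.log y.1) (fun y => rfl)]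
  have h : HasFDerivAt (fun y : ℝ × ℝ => Real.log y.2 - Real.log y.1)
      ((x.1.2)⁻¹ • ContinuousLinearMap.snd ℝ ℝ ℝ - (x.1.1)⁻¹ • ContinuousLinearMap.fst ℝ ℝ ℝ) x.1 :=
    (hasFDerivAt_snd.log hQ.ne').sub (hasFDerivAt_fst.log hP.ne')
  rw [h.fderiv]
  fin_cases i <;> simp [dir] <;> rfl

lemma coeff_coeffwise (D : Smooth U →ₗ[ℝ] Smooth U) (f : Jet U) (m : Fin 2 × ℕ →₀ ℕ) :
    (coeffwise D f).coeff m = D (f.coeff m) := by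
  classical
  simp only [coeffwise, LinearMap.coe_mk, AddHom.coe_mk, MvPolynomial.coeff_sum,
    MvPolynomial.coeff_monomial, Finset.sum_ite_eq', MvPolynomial.mem_support_iff]
  split_ifs with h
  · rfl
  · rw [not_not.1 h, map_zero]

lemma coeffwise_mul (D : Smooth U →ₗ[ℝ] Smooth U) (hD : ∀ f g, D (f * g) = D f * g + f * D g)
    (f g : Jet U) : coeffwise D (f * g) = coeffwise D f * g + f * coeffwise D g := by
  classical
  ext m : 1
  simp only [coeff_coeffwise, MvPolynomial.coeff_add, MvPolynomial.coeff_mul, map_sum, hD,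
    Finset.sum_add_distrib]

lemma coeffwise_C (D : Smooth U →ₗ[ℝ] Smooth U) (f : Smooth U) :
    coeffwise D (MvPolynomial.C f) = MvPolynomial.C (D f) := by
  classical
  ext m : 1
  simp only [coeff_coeffwise, MvPolynomial.coeff_C]
  split_ifs <;> simp

lemma coeffwise_X (D : Smooth U →ₗ[ℝ] Smooth U) (hD : D 1 = 0) (v : Fin 2 × ℕ) :
    coeffwise D (MvPolynomial.X v) = 0 := by
  classical
  ext m : 1
  simp only [coeff_coeffwise, MvPolynomial.coeff_X, MvPolynomial.coeff_zero]
  split_ifs <;> simp [hD]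

lemma jetPartial_mul (i : Fin 2) (s : ℕ) (f g : Jet U) :
    jetPartial U i s (f * g) = jetPartial U i s f * g + f * jetPartial U i s g := by
  cases s with
  | zero => exact coeffwise_mul _ (partialSmooth_mul i) f g
  | succ s =>
    simp only [jetPartial, LinearMap.restrictScalars_apply, Derivation.coeFn_coe,
      Derivation.leibniz, smul_eq_mul]
    ring

lemma jetPartial_zero_C (i : Fin 2) (f : Smooth U) :
    jetPartial U i 0 (MvPolynomial.C f) = MvPolynomial.C (partialSmooth U i f) :=
  coeffwise_C _ f

lemma jetPartial_succ_C (i : Fin 2) (s : ℕ) (f : Smooth U) :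
    jetPartial U i (s + 1) (MvPolynomial.C f) = 0 := by
  simp [jetPartial]

lemma jetPartial_zero_X (i : Fin 2) (v : Fin 2 × ℕ) :
    jetPartial U i 0 (MvPolynomial.X v) = 0 :=
  coeffwise_X _ (partialSmooth_one i) v

lemma jetPartial_succ_X (i : Fin 2) (s : ℕ) (v : Fin 2 × ℕ) :
    jetPartial U i (s + 1) (MvPolynomial.X v) = if v = (i, s) then 1 else 0 := by
  classical
  simp only [jetPartial, LinearMap.restrictScalars_apply, Derivation.coeFn_coe,
    MvPolynomial.pderiv_X, Pi.single_apply]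

lemma jetDx_mul (f g : Jet U) : jetDx U (f * g) = jetDx U f * g + f * jetDx U g := by
  simp only [jetDx, LinearMap.add_apply, LinearMap.comp_apply,
    LinearMap.mulLeft_apply, jetPartial_mul, LinearMap.restrictScalars_apply, Derivation.coeFn_coe,
    Derivation.leibniz, smul_eq_mul, Fin.sum_univ_two]
  ring

lemma jetDx_C (f : Smooth U) : jetDx U (MvPolynomial.C f) =
    ∑ i : Fin 2, MvPolynomial.X (i, 0) * MvPolynomial.C (partialSmooth U i f) := by
  simp [jetDx, jetPartial_zero_C]

lemma jetDx_X (v : Fin 2 × ℕ) :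
    jetDx U (MvPolynomial.X v) = MvPolynomial.X (v.1, v.2 + 1) := by
  simp [jetDx, jetPartial_zero_X]

/-- A derivation of the ring of differential polynomials that kills the generators is zero. -/
lemma jet_eq_zero (D : Jet U →ₗ[ℝ] Jet U) (hD : ∀ f g, D (f * g) = D f * g + f * D g)
    (hC : ∀ f, D (MvPolynomial.C f) = 0) (hX : ∀ v, D (MvPolynomial.X v) = 0) (f : Jet U) :
    D f = 0 := by
  induction f using MvPolynomial.induction_on with
  | C a => exact hC a
  | add p q hp hq => rw [map_add, hp, hq, add_zero]
  | mul_X p v hp => rw [hD, hp, hX, zero_mul, mul_zero, add_zero]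

/-- A commutator of derivations is a derivation, so `jet_eq_zero` reduces the identity to the
generators. The commutation rules with `jetDx` below are obtained in the same way. -/
lemma jetPartial_comm (i j : Fin 2) (s t : ℕ) (f : Jet U) :
    jetPartial U i s (jetPartial U j t f) = jetPartial U j t (jetPartial U i s f) := by
  have := jet_eq_zero (jetPartial U i s ∘ₗ jetPartial U j t -
    jetPartial U j t ∘ₗ jetPartial U i s : Jet U →ₗ[ℝ] Jet U)
    (fun f g => by
      simp only [LinearMap.sub_apply, LinearMap.comp_apply,
        jetPartial_mul, map_add]
      ring)
    (fun f => by
      rcases s with _ | s <;> rcases t with _ | t <;>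
        simp [jetPartial_zero_C, jetPartial_succ_C, partialSmooth_comm i j])
    (fun v => by
      have h1 : ∀ (i : Fin 2) (s : ℕ), jetPartial U i s 1 = 0 := fun i s => by
        simpa using jetPartial_mul (U := U) i s 1 1
      rcases s with _ | s <;> rcases t with _ | t <;>
        simp only [LinearMap.sub_apply, LinearMap.comp_apply,
          jetPartial_zero_X, jetPartial_succ_X] <;> (try split_ifs) <;>
        simp only [h1, map_zero, sub_zero]) f
  simpa [sub_eq_zero] using this

lemma jetPartial_zero_dx (i : Fin 2) (f : Jet U) :
    jetPartial U i 0 (jetDx U f) = jetDx U (jetPartial U i 0 f) := by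
  have := jet_eq_zero (jetPartial U i 0 ∘ₗ jetDx U -
    jetDx U ∘ₗ jetPartial U i 0 : Jet U →ₗ[ℝ] Jet U)
    (fun f g => by
      simp only [LinearMap.sub_apply, LinearMap.comp_apply,
        jetPartial_mul, jetDx_mul, map_add]
      ring)
    (fun f => by
      simp [jetPartial_zero_C, jetDx_C, jetPartial_mul, jetPartial_zero_X, partialSmooth_comm i])
    (fun v => by simp [jetDx_X, jetPartial_zero_X]) f
  simpa [sub_eq_zero] using this

lemma jetPartial_succ_dx (i : Fin 2) (s : ℕ) (f : Jet U) :
    jetPartial U i (s + 1) (jetDx U f) =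
      jetDx U (jetPartial U i (s + 1) f) + jetPartial U i s f := by
  have := jet_eq_zero (jetPartial U i (s + 1) ∘ₗ jetDx U -
    jetDx U ∘ₗ jetPartial U i (s + 1) - jetPartial U i s : Jet U →ₗ[ℝ] Jet U)
    (fun f g => by
      simp only [LinearMap.sub_apply, LinearMap.comp_apply,
        jetPartial_mul, jetDx_mul, map_add]
      ring)
    (fun f => by
      rcases s with _ | s
      · simp only [LinearMap.sub_apply, LinearMap.comp_apply,
          jetDx_C, map_sum, jetPartial_mul, jetPartial_succ_X, jetPartial_succ_C, map_zero,
          jetPartial_zero_C, Prod.mk.injEq, and_true, Finset.sum_add_distrib, ite_mul, one_mul,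
          zero_mul, Finset.sum_ite_eq', Finset.mem_univ, if_true, mul_zero, Finset.sum_const_zero]
        simp
      · simp only [LinearMap.sub_apply, LinearMap.comp_apply,
          jetDx_C, map_sum, jetPartial_mul, jetPartial_succ_X, jetPartial_succ_C, map_zero]
        simp)
    (fun v => by
      have h1 : jetDx U (1 : Jet U) = 0 := by simpa using jetDx_mul (U := U) 1 1
      rcases s with _ | s
      · simp only [LinearMap.sub_apply, LinearMap.comp_apply,
          jetDx_X, jetPartial_succ_X, jetPartial_zero_X]
        split_ifs <;> simp_all
      · simp only [LinearMap.sub_apply, LinearMap.comp_apply,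
          jetDx_X, jetPartial_succ_X, Prod.ext_iff, add_left_inj]
        split_ifs <;> simp_all) f
  simpa [sub_eq_zero, sub_sub] using this

lemma jetDx_one : jetDx U (1 : Jet U) = 0 := by simpa using jetDx_mul (U := U) 1 1

/-- A differential polynomial depends on finitely many jet variables. -/
lemma exists_jetPartial_eq_zero (f : Jet U) :
    ∃ N : ℕ, ∀ s, N ≤ s → ∀ i, jetPartial U i s f = 0 := by
  induction f using MvPolynomial.induction_on with
  | C a =>
    refine ⟨1, fun s hs i => ?_⟩
    obtain ⟨s, rfl⟩ := Nat.exists_eq_add_of_le' hs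
    exact jetPartial_succ_C i s a
  | add p q hp hq =>
    obtain ⟨N, hN⟩ := hp
    obtain ⟨M, hM⟩ := hq
    refine ⟨max N M, fun s hs i => ?_⟩
    rw [map_add, hN s (le_trans (le_max_left _ _) hs), hM s (le_trans (le_max_right _ _) hs), add_zero]
  | mul_X p v hp =>
    obtain ⟨N, hN⟩ := hp
    refine ⟨max N (v.2 + 2), fun s hs i => ?_⟩
    have h2 : v.2 + 2 ≤ s := le_trans (le_max_right _ _) hs
    obtain ⟨s, rfl⟩ := Nat.exists_eq_add_of_le' (show 1 ≤ s by omega)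
    rw [jetPartial_mul, hN _ (le_trans (le_max_left _ _) hs), jetPartial_succ_X, if_neg]
    · simp
    · rintro rfl
      simp at h2

/-! ## Bilinear operations on power series in `ε` -/

/-- Additive and `ε`-linear maps. -/
structure IsEps {R S : Type} [Ring R] [Ring S] (F : PowerSeries R → PowerSeries S) : Prop where
  add : ∀ f g, F (f + g) = F f + F g
  X_mul : ∀ f, F (PowerSeries.X * f) = PowerSeries.X * F f

/-- Unbundled form of `eps_ext`: with `F` and `G` given as lambda terms, the arguments of a
multilinear identity are replaced by constants one at a time. -/
lemma IsEps.ext {R S : Type} [Ring R] [Ring S] {F G : PowerSeries R → PowerSeries S}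
    (hF : IsEps F) (hG : IsEps G) (h : ∀ r, F (PowerSeries.C r) = G (PowerSeries.C r))
    (f : PowerSeries R) : F f = G f :=
  eps_ext (AddMonoidHom.mk' F hF.add) (AddMonoidHom.mk' G hG.add) hF.X_mul hG.X_mul h f

section Conv

variable {R S T : Type} [Ring R] [Ring S] [Ring T]

/-- The bilinear extension to power series in `ε` of an operation on coefficients. -/
def conv (B : R →+ S →+ T) : PowerSeries R →+ PowerSeries S →+ PowerSeries T :=
  AddMonoidHom.mk' (fun f => AddMonoidHom.mk' (fun g => PowerSeries.mk fun n =>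
    ∑ p ∈ Finset.HasAntidiagonal.antidiagonal n,
      B (PowerSeries.coeff p.1 f) (PowerSeries.coeff p.2 g))
    (fun g g' => by ext n; simp [Finset.sum_add_distrib]))
    (fun f f' => by ext g n; simp [Finset.sum_add_distrib])

lemma coeff_conv (B : R →+ S →+ T) (f : PowerSeries R) (g : PowerSeries S) (n : ℕ) :
    PowerSeries.coeff n (conv B f g) = ∑ p ∈ Finset.HasAntidiagonal.antidiagonal n,
      B (PowerSeries.coeff p.1 f) (PowerSeries.coeff p.2 g) := by
  simp [conv]

lemma conv_X_left (B : R →+ S →+ T) (f : PowerSeries R) (g : PowerSeries S) :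
    conv B (PowerSeries.X * f) g = PowerSeries.X * conv B f g := by
  ext n
  cases n with
  | zero => simp [coeff_conv]
  | succ n =>
    rw [PowerSeries.coeff_succ_X_mul, coeff_conv, coeff_conv, Finset.Nat.sum_antidiagonal_succ]
    simp [PowerSeries.coeff_succ_X_mul]

lemma conv_X_right (B : R →+ S →+ T) (f : PowerSeries R) (g : PowerSeries S) :
    conv B f (PowerSeries.X * g) = PowerSeries.X * conv B f g := by
  ext n
  cases n with
  | zero => simp [coeff_conv]
  | succ n =>
    rw [PowerSeries.coeff_succ_X_mul, coeff_conv, coeff_conv, Finset.Nat.sum_antidiagonal_succ']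
    simp [PowerSeries.coeff_succ_X_mul]

lemma conv_C_C (B : R →+ S →+ T) (a : R) (b : S) :
    conv B (PowerSeries.C a) (PowerSeries.C b) = PowerSeries.C (B a b) := by
  ext n
  rw [coeff_conv]
  cases n with
  | zero => simp
  | succ n =>
    rw [PowerSeries.coeff_C, if_neg (by simp)]
    refine Finset.sum_eq_zero fun p hp => ?_
    have := Finset.HasAntidiagonal.mem_antidiagonal.1 hp
    rw [PowerSeries.coeff_C, PowerSeries.coeff_C]
    by_cases h : p.1 = 0
    · rw [if_neg (show p.2 ≠ 0 by omega), map_zero]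
    · rw [if_neg h, map_zero, AddMonoidHom.zero_apply]

end Conv

/-! ## Evolutionary derivations and adjoint linearizations of differential polynomials -/


/-- The bound depends on f only and not on the index or the summand, so several such sums can be cut
off at a common K. -/
lemma finsum_jetPartial {M : Type} [Ring M] (f : Jet U) : ∃ N : ℕ, ∀ K, N ≤ K → ∀ (i : Fin 2) (F : ℕ → Jet U →+ M),
    ∑ᶠ s, F s (jetPartial U i s f) = ∑ s ∈ Finset.range K, F s (jetPartial U i s f) := by
  obtain ⟨N, hN⟩ := exists_jetPartial_eq_zero f
  refine ⟨N, fun K hK i F => finsum_eq_sum_of_support_subset _ fun s hs => ?_⟩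
  by_contra h
  refine hs ?_
  change F s _ = 0
  rw [hN s (by simp at h; omega) i, map_zero]

section Adjoint

variable {M : Type} [Ring M] [Algebra ℝ M] [Algebra (Jet U) M]

/-- `x, f ↦ ∑ (∂_x^s x) ∂f/∂u^{i,s}`. -/
def evHom (U : Chart) (i : Fin 2) : Jet U →+ Jet U →+ Jet U :=
  AddMonoidHom.mk' (fun x => AddMonoidHom.mk'
    (fun f => ∑ᶠ s : ℕ, (jetDx U ^ s) x * jetPartial U i s f) (fun f g => by
      obtain ⟨N, hN⟩ := finsum_jetPartial (M := Jet U) f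
      obtain ⟨N', hN'⟩ := finsum_jetPartial (M := Jet U) g
      obtain ⟨N'', hN''⟩ := finsum_jetPartial (M := Jet U) (f + g)
      have e := hN (max N (max N' N'')) (by simp) i fun s => AddMonoidHom.mulLeft ((jetDx U ^ s) x)
      have e' := hN' (max N (max N' N'')) (by simp) i fun s => AddMonoidHom.mulLeft ((jetDx U ^ s) x)
      have e'' := hN'' (max N (max N' N'')) (by simp) i
        fun s => AddMonoidHom.mulLeft ((jetDx U ^ s) x)
      simp only [AddMonoidHom.coe_mulLeft] at e e' e''
      rw [e, e', e'', ← Finset.sum_add_distrib]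
      exact Finset.sum_congr rfl fun s _ => by rw [map_add, mul_add]))
    (fun x y => by
      refine AddMonoidHom.ext fun f => ?_
      obtain ⟨N, hN⟩ := finsum_jetPartial (M := Jet U) f
      have e := fun x => hN N le_rfl i fun s => AddMonoidHom.mulLeft ((jetDx U ^ s) x)
      simp only [AddMonoidHom.coe_mulLeft] at e
      simp only [AddMonoidHom.mk'_apply, AddMonoidHom.add_apply, e, ← Finset.sum_add_distrib]
      exact Finset.sum_congr rfl fun s _ => by rw [map_add, add_mul])

lemma evHom_eq_sum (f : Jet U) : ∃ N : ℕ, ∀ K, N ≤ K → ∀ (i : Fin 2) (x : Jet U),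
    evHom U i x f = ∑ s ∈ Finset.range K, (jetDx U ^ s) x * jetPartial U i s f := by
  obtain ⟨N, hN⟩ := finsum_jetPartial (M := Jet U) f
  exact ⟨N, fun K hK i x => hN K hK i fun s => AddMonoidHom.mulLeft ((jetDx U ^ s) x)⟩

lemma evHom_mul (i : Fin 2) (x f g : Jet U) :
    evHom U i x (f * g) = evHom U i x f * g + f * evHom U i x g := by
  obtain ⟨N, hN⟩ := evHom_eq_sum f
  obtain ⟨N', hN'⟩ := evHom_eq_sum g
  obtain ⟨N'', hN''⟩ := evHom_eq_sum (f * g)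
  rw [hN (max N (max N' N'')) (by simp), hN' (max N (max N' N'')) (by simp),
    hN'' (max N (max N' N'')) (by simp), Finset.sum_mul, Finset.mul_sum, ← Finset.sum_add_distrib]
  exact Finset.sum_congr rfl fun s _ => by rw [jetPartial_mul]; ring

lemma evHom_C (i : Fin 2) (x : Jet U) (f : Smooth U) :
    evHom U i x (MvPolynomial.C f) = x * MvPolynomial.C (partialSmooth U i f) := by
  obtain ⟨N, hN⟩ := evHom_eq_sum (MvPolynomial.C f : Jet U)
  rw [hN (N + 1) (by simp), Finset.sum_range_succ', Finset.sum_eq_zero, zero_add,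
    jetPartial_zero_C, pow_zero, Module.End.one_apply]
  intro s _
  rw [jetPartial_succ_C, mul_zero]

/-- The commutator of ∂/∂u^{i,s+1} with ∂_x is ∂/∂u^{i,s}. The terms so produced are, after a shift
of s, those in which ∂_x falls on ∂_x^s x. -/
lemma evHom_dx (i : Fin 2) (x f : Jet U) :
    evHom U i x (jetDx U f) = jetDx U (evHom U i x f) := by
  obtain ⟨N, hN⟩ := evHom_eq_sum f
  obtain ⟨N', hN'⟩ := evHom_eq_sum (jetDx U f)
  obtain ⟨K, hK⟩ := exists_jetPartial_eq_zero f
  -- The cutoff is one more than a multiple bound: the top term of one sum vanishes by `hK`, and the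
  -- bottom term of the other is the case s = 0, which has no commutator.
  have h1 := hN (max K (max N N') + 1) (by have := le_max_left N N'; have := le_max_right K (max N N'); omega) i x
  rw [hN' (max K (max N N') + 1) (by have := le_max_right N N'; have := le_max_right K (max N N'); omega), h1, map_sum]
  simp only [jetDx_mul]
  rw [Finset.sum_add_distrib, Finset.sum_range_succ', Finset.sum_range_succ (fun s =>
    jetDx U ((jetDx U ^ s) x) * jetPartial U i s f), hK _ (le_max_left _ _), mul_zero, add_zero,
    Finset.sum_range_succ' (fun s => (jetDx U ^ s) x * jetDx U (jetPartial U i s f)),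
    jetPartial_zero_dx, ← add_assoc, ← Finset.sum_add_distrib]
  congr 1
  refine Finset.sum_congr rfl fun s _ => ?_
  rw [jetPartial_succ_dx, pow_succ' _ s, Module.End.mul_apply]
  ring

/-- A derivation of the `∂_x`-module `M` over the derivation `∂_x` of differential polynomials. -/
def IsDxModule (d : M →ₗ[ℝ] M) : Prop :=
  ∀ (f : Jet U) (w : M), d (f • w) = jetDx U f • w + f • d w

/-- `f, w ↦ ∑ (-d)^s (∂f/∂u^{i,s} w)`. -/
def adHom (i : Fin 2) (d : M →ₗ[ℝ] M) : Jet U →+ M →+ M :=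
  AddMonoidHom.mk' (fun f => AddMonoidHom.mk'
    (fun w => ∑ᶠ s : ℕ, (-1 : ℝ) ^ s • (d ^ s) (jetPartial U i s f • w)) (fun w w' => by
      obtain ⟨N, hN⟩ := finsum_jetPartial (M := M) f
      have e := fun w => hN N le_rfl i fun s => (((-1 : ℝ) ^ s • (d ^ s)) : M →ₗ[ℝ] M).toAddMonoidHom.comp
        ((smulAddHom (Jet U) M).flip w)
      simp only [AddMonoidHom.comp_apply, AddMonoidHom.flip_apply, smulAddHom_apply,
        LinearMap.toAddMonoidHom_coe, LinearMap.smul_apply] at e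
      rw [e, e, e, ← Finset.sum_add_distrib]
      exact Finset.sum_congr rfl fun s _ => by rw [smul_add, map_add, smul_add]))
    (fun f g => by
      refine AddMonoidHom.ext fun w => ?_
      obtain ⟨N, hN⟩ := finsum_jetPartial (M := M) f
      obtain ⟨N', hN'⟩ := finsum_jetPartial (M := M) g
      obtain ⟨N'', hN''⟩ := finsum_jetPartial (M := M) (f + g)
      let F := fun s => (((-1 : ℝ) ^ s • (d ^ s)) : M →ₗ[ℝ] M).toAddMonoidHom.comp
        ((smulAddHom (Jet U) M).flip w)
      have e := hN (max N (max N' N'')) (by simp) i F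
      have e' := hN' (max N (max N' N'')) (by simp) i F
      have e'' := hN'' (max N (max N' N'')) (by simp) i F
      simp only [F, AddMonoidHom.comp_apply, AddMonoidHom.flip_apply, smulAddHom_apply,
        LinearMap.toAddMonoidHom_coe, LinearMap.smul_apply] at e e' e''
      simp only [AddMonoidHom.mk'_apply, AddMonoidHom.add_apply]
      rw [e, e', e'', ← Finset.sum_add_distrib]
      exact Finset.sum_congr rfl fun s _ => by rw [map_add, add_smul, map_add, smul_add])

lemma adHom_eq_sum (f : Jet U) : ∃ N : ℕ, ∀ K, N ≤ K → ∀ (i : Fin 2) (d : M →ₗ[ℝ] M) (w : M),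
    adHom i d f w =
      ∑ s ∈ Finset.range K, (-1 : ℝ) ^ s • (d ^ s) (jetPartial U i s f • w) := by
  obtain ⟨N, hN⟩ := finsum_jetPartial (M := M) f
  refine ⟨N, fun K hK i d w => ?_⟩
  exact hN K hK i fun s => (((-1 : ℝ) ^ s • (d ^ s)) : M →ₗ[ℝ] M).toAddMonoidHom.comp
    ((smulAddHom (Jet U) M).flip w)

lemma adHom_mul (i : Fin 2) (d : M →ₗ[ℝ] M) (f g : Jet U) (w : M) :
    adHom i d (f * g) w = adHom i d f (g • w) + adHom i d g (f • w) := by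
  obtain ⟨N, hN⟩ := adHom_eq_sum (M := M) f
  obtain ⟨N', hN'⟩ := adHom_eq_sum (M := M) g
  obtain ⟨N'', hN''⟩ := adHom_eq_sum (M := M) (f * g)
  rw [hN (max N (max N' N'')) (by simp), hN' (max N (max N' N'')) (by simp),
    hN'' (max N (max N' N'')) (by simp), ← Finset.sum_add_distrib]
  refine Finset.sum_congr rfl fun s _ => ?_
  rw [jetPartial_mul, ← smul_add, ← map_add, smul_smul, smul_smul, ← add_smul]
  congr 3
  ring

lemma adHom_C (i : Fin 2) (d : M →ₗ[ℝ] M) (f : Smooth U) (w : M) :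
    adHom i d (MvPolynomial.C f) w = (MvPolynomial.C (partialSmooth U i f) : Jet U) • w := by
  obtain ⟨N, hN⟩ := adHom_eq_sum (M := M) (MvPolynomial.C f : Jet U)
  rw [hN (N + 1) (by simp), Finset.sum_range_succ', Finset.sum_eq_zero, zero_add,
    jetPartial_zero_C, pow_zero, pow_zero, one_smul, Module.End.one_apply]
  intro s _
  rw [jetPartial_succ_C, zero_smul, map_zero, smul_zero]

/-- The adjoint of ∂_x ∘ f_* is f_*^† ∘ (-d); in coordinates this is a summation by parts over s. -/
lemma adHom_dx (i : Fin 2) {d : M →ₗ[ℝ] M} (hd : IsDxModule (U := U) d) (f : Jet U) (w : M) :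
    adHom i d (jetDx U f) w = -adHom i d f (d w) := by
  obtain ⟨N, hN⟩ := adHom_eq_sum (M := M) f
  obtain ⟨N', hN'⟩ := adHom_eq_sum (M := M) (jetDx U f)
  obtain ⟨K, hK⟩ := exists_jetPartial_eq_zero f
  rw [hN' (max K (max N N') + 1) (by have := le_max_right N N'; have := le_max_right K (max N N'); omega), hN (max K (max N N') + 1) (by have := le_max_left N N'; have := le_max_right K (max N N'); omega)]
  have e : ∀ s, (-1 : ℝ) ^ s • (d ^ s) (jetPartial U i s f • d w) =
      (-1 : ℝ) ^ s • (d ^ (s + 1)) (jetPartial U i s f • w) -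
        (-1 : ℝ) ^ s • (d ^ s) (jetDx U (jetPartial U i s f) • w) := by
    intro s
    rw [pow_succ, Module.End.mul_apply, hd, map_add, smul_add, add_sub_cancel_left]
  simp only [e]
  rw [Finset.sum_sub_distrib, neg_sub, Finset.sum_range_succ',
    Finset.sum_range_succ (fun s => (-1 : ℝ) ^ s • (d ^ (s + 1)) (jetPartial U i s f • w)),
    hK _ (le_max_left _ _), zero_smul, map_zero, smul_zero, add_zero,
    Finset.sum_range_succ' (fun s => (-1 : ℝ) ^ s • (d ^ s) (jetDx U (jetPartial U i s f) • w)),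
    jetPartial_zero_dx, add_sub_right_comm, ← Finset.sum_sub_distrib]
  congr 1
  refine Finset.sum_congr rfl fun s _ => ?_
  rw [jetPartial_succ_dx, add_smul, map_add, smul_add, pow_succ (-1 : ℝ) s]
  simp [sub_eq_add_neg]

lemma adHom_dx_pow (i : Fin 2) {d : M →ₗ[ℝ] M} (hd : IsDxModule (U := U) d) (n : ℕ) (f : Jet U)
    (w : M) : adHom i d ((jetDx U ^ n) f) w = (-1 : ℝ) ^ n • adHom i d f ((d ^ n) w) := by
  induction n generalizing w with
  | zero => simp
  | succ n ih =>
    rw [pow_succ', Module.End.mul_apply, adHom_dx i hd, ih, pow_succ (d) n, Module.End.mul_apply,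
      pow_succ (-1 : ℝ) n]
    simp

end Adjoint

lemma isDxModule_jetDx : IsDxModule (U := U) (jetDx U) := fun f w => jetDx_mul f w

lemma evHom_smul (i : Fin 2) (c : ℝ) (x f : Jet U) :
    evHom U i x (c • f) = c • evHom U i x f := by
  obtain ⟨K, hK⟩ := evHom_eq_sum f
  obtain ⟨K', hK'⟩ := evHom_eq_sum (c • f)
  rw [hK (max K K') (by simp), hK' (max K K') (by simp), Finset.smul_sum]
  exact Finset.sum_congr rfl fun s _ => by rw [LinearMap.map_smul, mul_smul_comm]

lemma adHom_smul_left (i : Fin 2) (c : ℝ) (f w : Jet U) :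
    adHom i (jetDx U) (c • f) w = c • adHom i (jetDx U) f w := by
  obtain ⟨K, hK⟩ := adHom_eq_sum (M := Jet U) f
  obtain ⟨K', hK'⟩ := adHom_eq_sum (M := Jet U) (c • f)
  rw [hK (max K K') (by simp), hK' (max K K') (by simp), Finset.smul_sum]
  refine Finset.sum_congr rfl fun s _ => ?_
  rw [LinearMap.map_smul, smul_assoc, LinearMap.map_smul, smul_comm]

lemma adHom_smul_right (i : Fin 2) (c : ℝ) (f w : Jet U) :
    adHom i (jetDx U) f (c • w) = c • adHom i (jetDx U) f w := by
  obtain ⟨K, hK⟩ := adHom_eq_sum (M := Jet U) f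
  rw [hK K le_rfl, hK K le_rfl, Finset.smul_sum]
  refine Finset.sum_congr rfl fun s _ => ?_
  rw [smul_eq_mul, mul_smul_comm, LinearMap.map_smul, smul_comm, smul_eq_mul]

/-- The Hessian of a local functional is self-adjoint. -/
lemma evHom_varDeriv (i j : Fin 2) (y h : Jet U) :
    evHom U j y (adHom i (jetDx U) h 1) = adHom i (jetDx U) (adHom j (jetDx U) h 1) y := by
  obtain ⟨N, hN⟩ := adHom_eq_sum (M := Jet U) h
  obtain ⟨N', hN'⟩ := exists_jetPartial_eq_zero h
  rw [hN N le_rfl i, hN N le_rfl j, map_sum, map_sum, AddMonoidHom.finsetSum_apply]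
  have hev : ∀ (s : ℕ) (x f : Jet U), evHom U j x ((jetDx U ^ s) f) =
      (jetDx U ^ s) (evHom U j x f) := by
    intro s x
    induction s with
    | zero => simp
    | succ s ih => intro f; rw [pow_succ, Module.End.mul_apply, ih, evHom_dx, Module.End.mul_apply]
  have e1 : ∀ s, ∃ K, ∀ L, K ≤ L → evHom U j y (jetPartial U i s h) =
      ∑ t ∈ Finset.range L, (jetDx U ^ t) y * jetPartial U j t (jetPartial U i s h) := fun s => by
    obtain ⟨K, hK⟩ := evHom_eq_sum (jetPartial U i s h)
    exact ⟨K, fun L hL => hK L hL j y⟩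
  have e2 : ∀ t, ∃ K, ∀ L, K ≤ L → adHom i (jetDx U) (jetPartial U j t h) ((jetDx U ^ t) y) =
      ∑ s ∈ Finset.range L, (-1 : ℝ) ^ s •
        (jetDx U ^ s) (jetPartial U i s (jetPartial U j t h) • ((jetDx U ^ t) y)) := fun t => by
    obtain ⟨K, hK⟩ := adHom_eq_sum (M := Jet U) (jetPartial U j t h)
    exact ⟨K, fun L hL => hK L hL i _ _⟩
  choose K1 hK1 using e1
  choose K2 hK2 using e2
  -- Both sides are brought to the double sum of (-∂_x)^s(∂²h/∂u^{i,s}∂u^{j,t} · ∂_x^t y), whose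
  -- mixed partials may be taken in either order.
  have l : ∀ s, (-1 : ℝ) ^ s • (jetDx U ^ s) (evHom U j y (jetPartial U i s h)) =
      ∑ t ∈ Finset.range N', (-1 : ℝ) ^ s • (jetDx U ^ s)
        ((jetDx U ^ t) y * jetPartial U j t (jetPartial U i s h)) := by
    intro s
    rw [hK1 s (max (K1 s) N') (le_max_left _ _), map_sum, Finset.smul_sum]
    refine (Finset.sum_subset (Finset.range_mono (le_max_right _ _)) fun t _ ht => ?_).symm
    rw [jetPartial_comm, hN' t (by simpa using ht), map_zero, mul_zero, map_zero, smul_zero]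
  have r : ∀ t, adHom i (jetDx U) (jetPartial U j t h) ((jetDx U ^ t) y) =
      ∑ s ∈ Finset.range N', (-1 : ℝ) ^ s •
        (jetDx U ^ s) (jetPartial U i s (jetPartial U j t h) • ((jetDx U ^ t) y)) := by
    intro t
    rw [hK2 t (max (K2 t) N') (le_max_left _ _)]
    refine (Finset.sum_subset (Finset.range_mono (le_max_right _ _)) fun s _ hs => ?_).symm
    rw [jetPartial_comm, hN' s (by simpa using hs), map_zero, zero_smul, map_zero, smul_zero]
  have L1 : ∑ s ∈ Finset.range N, evHom U j y ((-1 : ℝ) ^ s • (jetDx U ^ s)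
      (jetPartial U i s h • 1)) = ∑ s ∈ Finset.range (max N N'), (-1 : ℝ) ^ s • (jetDx U ^ s)
        (evHom U j y (jetPartial U i s h)) := by
    have e := hN (max N N') (le_max_left _ _) i (jetDx U) 1
    rw [hN N le_rfl i] at e
    rw [← map_sum, e, map_sum]
    refine Finset.sum_congr rfl fun s _ => ?_
    rw [evHom_smul, hev, smul_eq_mul, mul_one]
  -- The sign (-1)^t of the variational derivative cancels the sign from moving ∂_x^t onto y.
  have R1 : ∑ t ∈ Finset.range N, adHom i (jetDx U) ((-1 : ℝ) ^ t • (jetDx U ^ t)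
      (jetPartial U j t h • 1)) y = ∑ t ∈ Finset.range (max N N'),
        adHom i (jetDx U) (jetPartial U j t h) ((jetDx U ^ t) y) := by
    have e := hN (max N N') (le_max_left _ _) j (jetDx U) 1
    rw [hN N le_rfl j] at e
    rw [← AddMonoidHom.finsetSum_apply, ← map_sum, e, map_sum, AddMonoidHom.finsetSum_apply]
    refine Finset.sum_congr rfl fun t _ => ?_
    rw [adHom_smul_left, adHom_dx_pow i isDxModule_jetDx, smul_smul, ← mul_pow, smul_eq_mul, mul_one]
    simp
  rw [L1, R1]
  have cut : ∀ F : ℕ → Jet U, (∀ s, N' ≤ s → F s = 0) →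
      ∑ s ∈ Finset.range (max N N'), F s = ∑ s ∈ Finset.range N', F s := fun F hF =>
    (Finset.sum_subset (Finset.range_mono (le_max_right _ _)) fun s _ hs =>
      hF s (by simpa using hs)).symm
  rw [cut _ (fun s hs => by rw [hN' s hs, map_zero, map_zero, smul_zero]),
    cut _ (fun s hs => by rw [hN' s hs, map_zero, AddMonoidHom.zero_apply])]
  simp only [l, r]
  rw [Finset.sum_comm]
  refine Finset.sum_congr rfl fun t _ => Finset.sum_congr rfl fun s _ => ?_
  rw [jetPartial_comm, smul_eq_mul, mul_comm]

/-- Integration by parts. -/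
lemma varDeriv_evHom (i j : Fin 2) (y h : Jet U) :
    adHom i (jetDx U) (evHom U j y h) 1 = adHom i (jetDx U) (y * adHom j (jetDx U) h 1) 1 := by
  obtain ⟨N, hN⟩ := adHom_eq_sum (M := Jet U) h
  obtain ⟨N', hN'⟩ := evHom_eq_sum h
  rw [hN (max N N') (by simp), hN' (max N N') (by simp), Finset.mul_sum, map_sum, map_sum,
    AddMonoidHom.finsetSum_apply, AddMonoidHom.finsetSum_apply]
  refine Finset.sum_congr rfl fun s _ => ?_
  have e : ∀ f : Jet U, adHom i (jetDx U) ((jetDx U ^ s) f) y =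
      (-1 : ℝ) ^ s • adHom i (jetDx U) f ((jetDx U ^ s) y) := fun f =>
    adHom_dx_pow i isDxModule_jetDx s f y
  rw [adHom_mul, adHom_mul, adHom_dx_pow i isDxModule_jetDx]
  simp only [smul_eq_mul, mul_one]
  rw [adHom_smul_right, adHom_smul_left, e, smul_smul, ← mul_pow]
  simp

/-! ## Derivations of `𝒜` -/

/-- Derivations of `𝒜` with values in a module that commute with `∂_x` and obey the chain rule. -/
structure IsADer {M : Type} [Ring M] (j : DiffPoly U →+* M) (d : M →+ M) (D : DiffPoly U →+ M) :
    Prop where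
  mul : ∀ f g, D (f * g) = j f * D g + j g * D f
  X_mul : ∀ f, D (PowerSeries.X * f) = j PowerSeries.X * D f
  dx : ∀ f, D (epsMap (jetDx U) f) = d (D f)
  smooth : ∀ f : Smooth U, D (ofSmooth f) =
    j (ofSmooth (partialSmooth U 0 f)) * D (ofSmooth (fP U)) +
      j (ofSmooth (partialSmooth U 1 f)) * D (ofSmooth (fQ U))

/-- The chain rule gives the values on smooth functions, ∂_x those on the jet variables, the Leibniz
rule those on polynomials, and closedness those on power series. -/
lemma IsADer.mem {M : Type} [Ring M] {j : DiffPoly U →+* M} {d : M →+ M} {D : DiffPoly U →+ M}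
    (hD : IsADer j d D) (S : AddSubgroup M) (hmul : ∀ a, ∀ m ∈ S, j a * m ∈ S)
    (hdx : ∀ m ∈ S, d m ∈ S)
    (closed : ∀ m, (∀ n : ℕ, ∃ g ∈ S, ∃ r, m = g + j PowerSeries.X ^ n * r) → m ∈ S)
    (hP : D (ofSmooth (fP U)) ∈ S) (hQ : D (ofSmooth (fQ U)) ∈ S) (f : DiffPoly U) : D f ∈ S := by
  have hit : ∀ (n : ℕ) r, (AddMonoidHom.mulLeft (j PowerSeries.X))^[n] r = j PowerSeries.X ^ n * r := by
    intro n r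
    induction n with
    | zero => simp
    | succ n ih => rw [Function.iterate_succ_apply', ih, AddMonoidHom.coe_mulLeft, pow_succ', mul_assoc]
  refine eps_mem D (AddMonoidHom.mulLeft (j PowerSeries.X)) hD.X_mul S (fun x hx => hmul _ x hx)
    (fun m hm => closed m fun n => ?_) (fun b => ?_) f
  · obtain ⟨g, hg, r, hr⟩ := hm n
    exact ⟨g, hg, r, by rw [hr, hit]⟩
  · have hX : ∀ (s : ℕ) (i : Fin 2), D (PowerSeries.C (MvPolynomial.X (i, s))) ∈ S := by
      intro s
      induction s with
      | zero =>
        intro i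
        have e : PowerSeries.C (MvPolynomial.X (i, 0) : Jet U) =
            epsMap (jetDx U) (ofSmooth (if i = 0 then fP U else fQ U)) := by
          rw [ofSmooth, epsMap_C, jetDx_C]
          fin_cases i <;> simp [partialSmooth_fP, partialSmooth_fQ]
        rw [e, hD.dx]
        refine hdx _ ?_
        split_ifs
        exacts [hP, hQ]
      | succ s ih =>
        intro i
        have e : PowerSeries.C (MvPolynomial.X (i, s + 1) : Jet U) =
            epsMap (jetDx U) (PowerSeries.C (MvPolynomial.X (i, s))) := by
          rw [epsMap_C, jetDx_X]
        rw [e, hD.dx]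
        exact hdx _ (ih i)
    induction b using MvPolynomial.induction_on with
    | C a =>
      have := hD.smooth a
      rw [ofSmooth] at this
      rw [this]
      exact S.add_mem (hmul _ _ hP) (hmul _ _ hQ)
    | add p q hp hq =>
      rw [map_add, map_add]
      exact S.add_mem hp hq
    | mul_X p v hp =>
      rw [map_mul, hD.mul]
      exact S.add_mem (hmul _ _ (hX v.2 v.1)) (hmul _ _ hp)

lemma IsADer.sub {M : Type} [Ring M] {j : DiffPoly U →+* M} {d : M →+ M} {D D' : DiffPoly U →+ M}
    (hD : IsADer j d D) (hD' : IsADer j d D') : IsADer j d (D - D') where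
  mul f g := by simp only [AddMonoidHom.sub_apply, hD.mul, hD'.mul, mul_sub]; abel
  X_mul f := by simp only [AddMonoidHom.sub_apply, hD.X_mul, hD'.X_mul, mul_sub]
  dx f := by simp only [AddMonoidHom.sub_apply, hD.dx, hD'.dx, map_sub]
  smooth f := by
    simp only [AddMonoidHom.sub_apply, hD.smooth f, hD'.smooth f, mul_sub]; abel

/-- Derivations of `𝒜` with values in power series agree if they agree on `P` and `Q`. -/
lemma IsADer.ext {T : Type} [Ring T] {j : DiffPoly U →+* PowerSeries T}
    {d : PowerSeries T →+ PowerSeries T} {D D' : DiffPoly U →+ PowerSeries T}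
    (hj : j PowerSeries.X = PowerSeries.X)
    (hD : IsADer j d D) (hD' : IsADer j d D') (hP : D (ofSmooth (fP U)) = D' (ofSmooth (fP U)))
    (hQ : D (ofSmooth (fQ U)) = D' (ofSmooth (fQ U))) (f : DiffPoly U) : D f = D' f := by
  have := (hD.sub hD').mem ⊥ (fun a m hm => by simp_all) (fun m hm => by simp_all) (fun m hm => by
    refine AddSubgroup.mem_bot.2 (series_eq_zero fun n => ?_)
    obtain ⟨g, hg, r, hr⟩ := hm n
    exact ⟨r, by rw [hr, AddSubgroup.mem_bot.1 hg, zero_add, hj]⟩) (by simp [hP]) (by simp [hQ]) f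
  simpa [sub_eq_zero] using this

/-! ## Evolutionary vector fields -/

lemma evolve_eq (X : Fin 2 → DiffPoly U) (f : DiffPoly U) :
    evolve X f = conv (evHom U 0) (X 0) f + conv (evHom U 1) (X 1) f := by
  rw [evolve, Fin.sum_univ_two]
  congr 1

/-- The evolutionary derivation as an additive map. -/
def evolveHom (X : Fin 2 → DiffPoly U) : DiffPoly U →+ DiffPoly U :=
  conv (evHom U 0) (X 0) + conv (evHom U 1) (X 1)

lemma evolveHom_apply (X : Fin 2 → DiffPoly U) (f : DiffPoly U) : evolveHom X f = evolve X f := by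
  rw [evolve_eq]; rfl

lemma evolve_add (X : Fin 2 → DiffPoly U) (f g : DiffPoly U) :
    evolve X (f + g) = evolve X f + evolve X g := by
  simp only [← evolveHom_apply, map_add]

lemma evolve_sub (X : Fin 2 → DiffPoly U) (f g : DiffPoly U) :
    evolve X (f - g) = evolve X f - evolve X g := by
  simp only [← evolveHom_apply, map_sub]

lemma evolve_X_mul (X : Fin 2 → DiffPoly U) (f : DiffPoly U) :
    evolve X (PowerSeries.X * f) = PowerSeries.X * evolve X f := by
  simp only [evolve_eq, conv_X_right, mul_add]

lemma evolve_left_sub (X Y : Fin 2 → DiffPoly U) (f : DiffPoly U) :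
    evolve (fun α => X α - Y α) f = evolve X f - evolve Y f := by
  simp only [evolve_eq, map_sub, AddMonoidHom.sub_apply]
  ring

lemma evolve_left_X_mul (X : Fin 2 → DiffPoly U) (f : DiffPoly U) :
    evolve (fun α => PowerSeries.X * X α) f = PowerSeries.X * evolve X f := by
  simp only [evolve_eq, conv_X_left, mul_add]

lemma conv_evHom_mul (i : Fin 2) (x f g : DiffPoly U) : conv (evHom U i) x (f * g) =
    conv (evHom U i) x f * g + f * conv (evHom U i) x g := by
  refine IsEps.ext (F := fun x => conv (evHom U i) x (f * g))
    (G := fun x => conv (evHom U i) x f * g + f * conv (evHom U i) x g)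
    ⟨fun _ _ => by simp only [map_add, AddMonoidHom.add_apply],
      fun _ => by simp only [conv_X_left]⟩
    ⟨fun _ _ => by simp only [map_add, AddMonoidHom.add_apply]; ring,
      fun _ => by simp only [conv_X_left]; ring⟩ (fun x => ?_) x
  refine IsEps.ext (F := fun f => conv (evHom U i) (PowerSeries.C x) (f * g))
    (G := fun f => conv (evHom U i) (PowerSeries.C x) f * g + f * conv (evHom U i) (PowerSeries.C x) g)
    ⟨fun _ _ => by simp only [map_add, add_mul],
      fun _ => by simp only [mul_assoc, conv_X_right]⟩
    ⟨fun _ _ => by simp only [map_add]; ring,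
      fun _ => by simp only [conv_X_right]; ring⟩ (fun f => ?_) f
  refine IsEps.ext (F := fun g => conv (evHom U i) (PowerSeries.C x) (PowerSeries.C f * g))
    (G := fun g => conv (evHom U i) (PowerSeries.C x) (PowerSeries.C f) * g +
      PowerSeries.C f * conv (evHom U i) (PowerSeries.C x) g)
    ⟨fun _ _ => by simp only [map_add, mul_add],
      fun _ => by simp only [mul_left_comm _ PowerSeries.X, conv_X_right]⟩
    ⟨fun _ _ => by simp only [map_add]; ring,
      fun _ => by simp only [conv_X_right]; ring⟩ (fun g => ?_) g
  simp only [← map_mul, conv_C_C, evHom_mul, map_add]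

lemma conv_evHom_dx (i : Fin 2) (x f : DiffPoly U) :
    conv (evHom U i) x (epsMap (jetDx U) f) = epsMap (jetDx U) (conv (evHom U i) x f) := by
  refine IsEps.ext (F := fun x => conv (evHom U i) x (epsMap (jetDx U) f))
    (G := fun x => epsMap (jetDx U) (conv (evHom U i) x f))
    ⟨fun _ _ => by simp only [map_add, AddMonoidHom.add_apply],
      fun _ => by simp only [conv_X_left]⟩
    ⟨fun _ _ => by simp only [map_add, AddMonoidHom.add_apply],
      fun _ => by simp only [conv_X_left, epsMap_X_mul]⟩ (fun x => ?_) x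
  refine IsEps.ext (F := fun f => conv (evHom U i) (PowerSeries.C x) (epsMap (jetDx U) f))
    (G := fun f => epsMap (jetDx U) (conv (evHom U i) (PowerSeries.C x) f))
    ⟨fun _ _ => by simp only [map_add], fun _ => by simp only [epsMap_X_mul, conv_X_right]⟩
    ⟨fun _ _ => by simp only [map_add], fun _ => by simp only [epsMap_X_mul, conv_X_right]⟩
    (fun f => ?_) f
  simp only [conv_C_C, epsMap_C, evHom_dx]

lemma evolve_mul (X : Fin 2 → DiffPoly U) (f g : DiffPoly U) :
    evolve X (f * g) = evolve X f * g + f * evolve X g := by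
  simp only [evolve_eq, conv_evHom_mul]
  ring

lemma evolve_dx (X : Fin 2 → DiffPoly U) (f : DiffPoly U) :
    evolve X (epsMap (jetDx U) f) = epsMap (jetDx U) (evolve X f) := by
  simp only [evolve_eq, conv_evHom_dx, map_add]

lemma evolve_ofSmooth (X : Fin 2 → DiffPoly U) (f : Smooth U) : evolve X (ofSmooth f) =
    ofSmooth (partialSmooth U 0 f) * X 0 + ofSmooth (partialSmooth U 1 f) * X 1 := by
  have : ∀ i, conv (evHom U i) (X i) (ofSmooth f) = ofSmooth (partialSmooth U i f) * X i := by
    intro i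
    refine IsEps.ext (F := fun x => conv (evHom U i) x (ofSmooth f))
      (G := fun x => ofSmooth (partialSmooth U i f) * x)
      ⟨fun _ _ => by simp only [map_add, AddMonoidHom.add_apply], fun _ => by simp only [conv_X_left]⟩
      ⟨fun _ _ => by ring, fun _ => by ring⟩ (fun x => ?_) _
    simp only [ofSmooth, conv_C_C, evHom_C, ← map_mul, mul_comm x]
  rw [evolve_eq, this, this]

lemma ofSmooth_one : ofSmooth (1 : Smooth U) = 1 := by simp [ofSmooth]

lemma ofSmooth_zero : ofSmooth (0 : Smooth U) = 0 := by simp [ofSmooth]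

lemma ofSmooth_mul (f g : Smooth U) : ofSmooth (f * g) = ofSmooth f * ofSmooth g := by
  simp [ofSmooth]

lemma ofSmooth_sub (f g : Smooth U) : ofSmooth (f - g) = ofSmooth f - ofSmooth g := by
  simp [ofSmooth]

lemma ofSmooth_neg (f : Smooth U) : ofSmooth (-f) = -ofSmooth f := by
  simp [ofSmooth]

lemma evolve_P (X : Fin 2 → DiffPoly U) : evolve X (ofSmooth (fP U)) = X 0 := by
  rw [evolve_ofSmooth, partialSmooth_fP, partialSmooth_fP]
  simp [ofSmooth_one, ofSmooth_zero]

lemma evolve_Q (X : Fin 2 → DiffPoly U) : evolve X (ofSmooth (fQ U)) = X 1 := by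
  rw [evolve_ofSmooth, partialSmooth_fQ, partialSmooth_fQ]
  simp [ofSmooth_one, ofSmooth_zero]

lemma isADer_evolveHom (X : Fin 2 → DiffPoly U) :
    IsADer (RingHom.id _) (epsMap (jetDx U)) (evolveHom X) where
  mul f g := by simp only [evolveHom_apply, evolve_mul, RingHom.id_apply]; ring
  X_mul f := by simp only [evolveHom_apply, evolve_X_mul, RingHom.id_apply]
  dx f := by simp only [evolveHom_apply, evolve_dx]
  smooth f := by
    simp only [evolveHom_apply, RingHom.id_apply]
    rw [evolve_P, evolve_Q, evolve_ofSmooth]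

lemma evolve_smul (X : Fin 2 → DiffPoly U) (c : ℝ) (f : DiffPoly U) :
    evolve X (c • f) = c • evolve X f := by
  simp only [evolve_eq]
  rw [smul_add]
  congr 1 <;>
  · ext1 n
    simp only [coeff_conv, PowerSeries.coeff_smul, evHom_smul, Finset.smul_sum]

lemma evolve_epsOp (X : Fin 2 → DiffPoly U) (φ : PowerSeries ℝ) (f : DiffPoly U) :
    evolve X (epsOp (jetDx U) φ f) = epsOp (jetDx U) φ (evolve X f) := by
  simp only [← evolveHom_apply]
  exact epsOp_intertwine (fun f => by simp only [evolveHom_apply, evolve_X_mul])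
    (fun f => by simp only [evolveHom_apply, evolve_dx]) φ
    (fun c f => by simp only [evolveHom_apply, evolve_smul]) f

/-! ## The shift operator on `𝒜` -/

lemma jetShift_add (m : ℤ) (f g : DiffPoly U) :
    jetShift U m (f + g) = jetShift U m f + jetShift U m g := shift_add _ m f g

lemma jetShift_sub (m : ℤ) (f g : DiffPoly U) :
    jetShift U m (f - g) = jetShift U m f - jetShift U m g := shift_sub _ m f g

lemma jetShift_neg (m : ℤ) (f : DiffPoly U) : jetShift U m (-f) = -jetShift U m f :=
  shift_neg _ m f

lemma jetShift_mul (m : ℤ) (f g : DiffPoly U) :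
    jetShift U m (f * g) = jetShift U m f * jetShift U m g := shift_mul jetDx_mul m f g

lemma jetShift_one (m : ℤ) : jetShift U m 1 = 1 := shift_one jetDx_mul m

lemma jetShift_map_zero (m : ℤ) : jetShift U m 0 = 0 := shift_zero_right _ m

lemma jetShift_jetShift (m n : ℤ) (f : DiffPoly U) :
    jetShift U m (jetShift U n f) = jetShift U (m + n) f := shift_shift _ m n f

lemma jetShift_zero (f : DiffPoly U) : jetShift U 0 f = f := shift_zero _ f

lemma jetShift_neg_one_one (f : DiffPoly U) : jetShift U (-1) (jetShift U 1 f) = f := by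
  rw [jetShift_jetShift]; exact jetShift_zero f

lemma jetShift_one_neg_one (f : DiffPoly U) : jetShift U 1 (jetShift U (-1) f) = f := by
  rw [jetShift_jetShift]; exact jetShift_zero f

lemma jetShift_X_mul (m : ℤ) (f : DiffPoly U) :
    jetShift U m (PowerSeries.X * f) = PowerSeries.X * jetShift U m f := shift_X_mul _ m f

lemma evolve_jetShift (X : Fin 2 → DiffPoly U) (m : ℤ) (f : DiffPoly U) :
    evolve X (jetShift U m f) = jetShift U m (evolve X f) := by
  simp only [jetShift, shift_eq, evolve_epsOp]

/-- `Λ^m` as a ring homomorphism. -/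
def jetShiftHom (U : Chart) (m : ℤ) : DiffPoly U →+* DiffPoly U where
  toFun := jetShift U m
  map_one' := jetShift_one m
  map_mul' := jetShift_mul m
  map_zero' := jetShift_map_zero m
  map_add' := jetShift_add m

lemma jetShiftHom_apply (m : ℤ) (f : DiffPoly U) : jetShiftHom U m f = jetShift U m f := rfl

/-! ## Adjoints -/

/-- The inclusion of the differential polynomials into power series over an algebra. -/
def seriesMap (U : Chart) (M : Type) [Ring M] [Algebra (Jet U) M] : DiffPoly U →+* PowerSeries M :=
  PowerSeries.map (algebraMap (Jet U) M)

lemma seriesMap_C {M : Type} [Ring M] [Algebra (Jet U) M] (a : Jet U) : seriesMap U M (PowerSeries.C a) =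
    PowerSeries.C (algebraMap (Jet U) M a) := by simp [seriesMap]

lemma seriesMap_X {M : Type} [Ring M] [Algebra (Jet U) M] : seriesMap U M PowerSeries.X = PowerSeries.X := by simp [seriesMap]

lemma seriesMap_X_mul {M : Type} [Ring M] [Algebra (Jet U) M] (f : DiffPoly U) : seriesMap U M (PowerSeries.X * f) =
    PowerSeries.X * seriesMap U M f := by rw [map_mul, seriesMap_X]

section Adjoint

variable {M : Type} [Ring M] [Algebra ℝ M] [Algebra (Jet U) M]

/-- The bilinear extension of `f, w ↦ ∑ (-d)^s (∂f/∂u^{i,s} w)` to power series in `ε`. -/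
def adSeries (i : Fin 2) (d : M →ₗ[ℝ] M) : DiffPoly U →+ PowerSeries M →+ PowerSeries M :=
  conv (adHom i d)

lemma adSeries_mul (i : Fin 2) (d : M →ₗ[ℝ] M) (f g : DiffPoly U) (w : PowerSeries M) :
    adSeries i d (f * g) w = adSeries i d f (seriesMap U M g * w) +
      adSeries i d g (seriesMap U M f * w) := by
  simp only [adSeries]
  refine IsEps.ext (F := fun w => conv (adHom i d) (f * g) w)
    (G := fun w => conv (adHom i d) f (seriesMap U M g * w) +
      conv (adHom i d) g (seriesMap U M f * w))
    ⟨fun _ _ => by simp only [map_add], fun _ => by simp only [conv_X_right]⟩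
    ⟨fun _ _ => by simp only [map_add, mul_add]; abel,
      fun _ => by simp only [mul_X_left_comm, conv_X_right, mul_add]⟩ (fun w => ?_) w
  refine IsEps.ext (F := fun f => conv (adHom i d) (f * g) (PowerSeries.C w))
    (G := fun f => conv (adHom i d) f (seriesMap U M g * PowerSeries.C w) +
      conv (adHom i d) g (seriesMap U M f * PowerSeries.C w))
    ⟨fun _ _ => by simp only [map_add, add_mul, AddMonoidHom.add_apply],
      fun _ => by simp only [mul_assoc, conv_X_left]⟩
    ⟨fun _ _ => by simp only [map_add, add_mul, AddMonoidHom.add_apply]; abel,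
      fun _ => by simp only [seriesMap_X_mul, mul_assoc, conv_X_left, conv_X_right, mul_add]⟩ (fun f => ?_) f
  refine IsEps.ext (F := fun g => conv (adHom i d) (PowerSeries.C f * g) (PowerSeries.C w))
    (G := fun g => conv (adHom i d) (PowerSeries.C f) (seriesMap U M g * PowerSeries.C w) +
      conv (adHom i d) g (seriesMap U M (PowerSeries.C f) * PowerSeries.C w))
    ⟨fun _ _ => by simp only [map_add, mul_add, AddMonoidHom.add_apply],
      fun _ => by simp only [mul_X_left_comm, conv_X_left]⟩
    ⟨fun _ _ => by simp only [map_add, add_mul, AddMonoidHom.add_apply]; abel,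
      fun _ => by simp only [seriesMap_X_mul, mul_assoc, conv_X_left, conv_X_right, mul_add]⟩ (fun g => ?_) g
  simp only [seriesMap_C, ← map_mul, conv_C_C, adHom_mul, map_add, Algebra.smul_def]

lemma adSeries_X_left (i : Fin 2) (d : M →ₗ[ℝ] M) (f : DiffPoly U) (w : PowerSeries M) :
    adSeries i d (PowerSeries.X * f) w = PowerSeries.X * adSeries i d f w := conv_X_left _ f w

lemma adSeries_ofSmooth (i : Fin 2) (d : M →ₗ[ℝ] M) (f : Smooth U) (w : PowerSeries M) :
    adSeries i d (ofSmooth f) w = seriesMap U M (ofSmooth (partialSmooth U i f)) * w := by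
  simp only [adSeries]
  refine IsEps.ext (F := fun w => conv (adHom i d) (ofSmooth f) w)
    (G := fun w => seriesMap U M (ofSmooth (partialSmooth U i f)) * w)
    ⟨fun _ _ => by simp only [map_add], fun _ => by simp only [conv_X_right]⟩
    ⟨fun _ _ => by simp only [mul_add],
      fun _ => by simp only [mul_X_left_comm]⟩ (fun w => ?_) w
  simp only [ofSmooth, conv_C_C, adHom_C, seriesMap_C, ← map_mul, Algebra.smul_def]

lemma adHom_add_smul (i : Fin 2) (d : M →ₗ[ℝ] M) [IsScalarTower ℝ (Jet U) M]
    (c : ℝ) (f : Jet U) (w : M) :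
    adHom i d (c • f) w = c • adHom i d f w := by
  obtain ⟨K, hK⟩ := adHom_eq_sum (M := M) f
  obtain ⟨K', hK'⟩ := adHom_eq_sum (M := M) (c • f)
  rw [hK (max K K') (by simp), hK' (max K K') (by simp), Finset.smul_sum]
  refine Finset.sum_congr rfl fun s _ => ?_
  rw [LinearMap.map_smul, smul_assoc, LinearMap.map_smul, smul_comm]

lemma adHom_smul_right' (i : Fin 2) (d : M →ₗ[ℝ] M) [IsScalarTower ℝ (Jet U) M]
    (c : ℝ) (f : Jet U) (w : M) :
    adHom i d f (c • w) = c • adHom i d f w := by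
  obtain ⟨K, hK⟩ := adHom_eq_sum (M := M) f
  rw [hK K le_rfl, hK K le_rfl, Finset.smul_sum]
  refine Finset.sum_congr rfl fun s _ => ?_
  rw [smul_comm _ c w, LinearMap.map_smul, smul_comm]

/-- The adjoint of ∂_x is -d, so the adjoint of Λ^m = e^{mε∂_x} is the shift by -m. -/
lemma adSeries_shift [IsScalarTower ℝ (Jet U) M] (i : Fin 2) {d : M →ₗ[ℝ] M}
    (hd : IsDxModule (U := U) d) (m : ℤ)
    (f : DiffPoly U) (w : PowerSeries M) :
    adSeries i d (jetShift U m f) w = adSeries i d f (shift d (-m) w) := by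
  simp only [jetShift, shift_eq, adSeries]
  refine IsEps.ext (F := fun f => conv (adHom i d) (epsOp (jetDx U) (expSeries m) f) w)
    (G := fun f => conv (adHom i d) f (epsOp d (expSeries (-m)) w))
    ⟨fun _ _ => by simp only [map_add, AddMonoidHom.add_apply],
      fun _ => by simp only [epsOp_X_mul, conv_X_left]⟩
    ⟨fun _ _ => by simp only [map_add, AddMonoidHom.add_apply],
      fun _ => by simp only [conv_X_left]⟩ (fun f => ?_) f
  refine IsEps.ext (F := fun w => conv (adHom i d) (epsOp (jetDx U) (expSeries m) (PowerSeries.C f)) w)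
    (G := fun w => conv (adHom i d) (PowerSeries.C f) (epsOp d (expSeries (-m)) w))
    ⟨fun _ _ => by simp only [map_add], fun _ => by simp only [conv_X_right]⟩
    ⟨fun _ _ => by simp only [map_add],
      fun _ => by simp only [epsOp_X_mul, conv_X_right]⟩ (fun w => ?_) w
  rw [epsOp_C, epsOp_C]
  ext n
  rw [coeff_conv, coeff_conv, Finset.sum_eq_single (n, 0), Finset.sum_eq_single (0, n)]
  · simp only [PowerSeries.coeff_mk, PowerSeries.coeff_zero_C, adHom_add_smul, adHom_smul_right',
      adHom_dx_pow i hd, smul_smul]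
    congr 1
    simp only [expSeries, PowerSeries.coeff_rescale]
    rw [mul_right_comm, ← mul_pow]
    simp
  · rintro ⟨a, b⟩ h hne
    have : a ≠ 0 := fun h' => hne (by simp_all)
    simp [PowerSeries.coeff_C, this]
  · simp
  · rintro ⟨a, b⟩ h hne
    have : b ≠ 0 := fun h' => hne (by simp_all)
    simp [PowerSeries.coeff_C, this]
  · simp

end Adjoint

/-- The adjoint of the linearization of `f`, applied to `w`. -/
def adj (i : Fin 2) (f w : DiffPoly U) : DiffPoly U := adSeries i (jetDx U) f w

lemma seriesMap_self (f : DiffPoly U) : seriesMap U (Jet U) f = f := by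
  ext n
  simp [seriesMap]

lemma adj_mul (i : Fin 2) (f g w : DiffPoly U) :
    adj i (f * g) w = adj i f (g * w) + adj i g (f * w) := by
  simp only [adj, adSeries_mul, seriesMap_self]

lemma adj_add (i : Fin 2) (f g w : DiffPoly U) : adj i (f + g) w = adj i f w + adj i g w := by
  simp [adj]

lemma adj_sub (i : Fin 2) (f g w : DiffPoly U) : adj i (f - g) w = adj i f w - adj i g w := by
  simp [adj]

lemma adj_neg (i : Fin 2) (f w : DiffPoly U) : adj i (-f) w = -adj i f w := by
  simp [adj]

lemma adj_add_right (i : Fin 2) (f w z : DiffPoly U) : adj i f (w + z) = adj i f w + adj i f z := by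
  simp [adj]

lemma adj_sub_right (i : Fin 2) (f w z : DiffPoly U) : adj i f (w - z) = adj i f w - adj i f z := by
  simp [adj]

lemma adj_zero_right (i : Fin 2) (f : DiffPoly U) : adj i f 0 = 0 := by
  simp [adj]

lemma adj_zero (i : Fin 2) (w : DiffPoly U) : adj i 0 w = 0 := by
  simp [adj]

lemma adj_X_mul (i : Fin 2) (f w : DiffPoly U) :
    adj i (PowerSeries.X * f) w = PowerSeries.X * adj i f w := adSeries_X_left _ _ f w

lemma adj_jetShift (i : Fin 2) (m : ℤ) (f w : DiffPoly U) :
    adj i (jetShift U m f) w = adj i f (jetShift U (-m) w) :=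
  adSeries_shift i isDxModule_jetDx m f w

lemma adj_ofSmooth (i : Fin 2) (f : Smooth U) (w : DiffPoly U) :
    adj i (ofSmooth f) w = ofSmooth (partialSmooth U i f) * w := by
  rw [adj, adSeries_ofSmooth, seriesMap_self]

lemma adj_one (i : Fin 2) (w : DiffPoly U) : adj i 1 w = 0 := by
  have := adj_ofSmooth i (1 : Smooth U) w
  rwa [ofSmooth_one, partialSmooth_one, ofSmooth_zero, zero_mul] at this

lemma adj_P (i : Fin 2) (w : DiffPoly U) : adj i (ofSmooth (fP U)) w = if i = 0 then w else 0 := by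
  rw [adj_ofSmooth, partialSmooth_fP]
  split_ifs <;> simp [ofSmooth_one, ofSmooth_zero]

lemma adj_Q (i : Fin 2) (w : DiffPoly U) : adj i (ofSmooth (fQ U)) w = if i = 1 then w else 0 := by
  rw [adj_ofSmooth, partialSmooth_fQ]
  split_ifs <;> simp [ofSmooth_one, ofSmooth_zero]

/-- The variational derivative is the adjoint linearization applied to the constant 1. It is thereby
computed by the product and shift rules for `adj`. -/
lemma jetVar_eq (f : DiffPoly U) (i : Fin 2) : jetVar f i = adj i f 1 := by
  ext1 n
  rw [adj, adSeries, coeff_conv, Finset.sum_eq_single (n, 0)]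
  · rw [jetVar, epsVarDeriv, PowerSeries.coeff_mk, varDeriv]
    simp [adHom]
  · rintro ⟨a, b⟩ h hne
    have : b ≠ 0 := fun h' => hne (by simp_all)
    simp [PowerSeries.coeff_one, this]
  · simp

lemma adjLin_eq (X ξ : Fin 2 → DiffPoly U) (i : Fin 2) :
    adjLin X ξ i = adj i (X 0) (ξ 0) + adj i (X 1) (ξ 1) := by
  rw [adjLin, Fin.sum_univ_two]
  congr 1

lemma jetVar_jetShift (m : ℤ) (f : DiffPoly U) (i : Fin 2) :
    jetVar (jetShift U m f) i = jetVar f i := by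
  rw [jetVar_eq, jetVar_eq, adj_jetShift, jetShift_one]

/-- The Hessian of a local functional is self-adjoint. -/
lemma evolve_jetVar (Y : Fin 2 → DiffPoly U) (h : DiffPoly U) (i : Fin 2) :
    evolve Y (jetVar h i) = adj i (jetVar h 0) (Y 0) + adj i (jetVar h 1) (Y 1) := by
  have : ∀ (j : Fin 2) (y : DiffPoly U),
      conv (evHom U j) y (jetVar h i) = adj i (jetVar h j) y := by
    intro j y
    simp only [jetVar_eq, adj, adSeries]
    refine IsEps.ext (F := fun y => conv (evHom U j) y (conv (adHom i (jetDx U)) h 1))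
      (G := fun y => conv (adHom i (jetDx U)) (conv (adHom j (jetDx U)) h 1) y)
      ⟨fun _ _ => by simp only [map_add, AddMonoidHom.add_apply], fun _ => by simp only [conv_X_left]⟩
      ⟨fun _ _ => by simp only [map_add], fun _ => by simp only [conv_X_right]⟩ (fun y => ?_) y
    refine IsEps.ext
      (F := fun h => conv (evHom U j) (PowerSeries.C y) (conv (adHom i (jetDx U)) h 1))
      (G := fun h => conv (adHom i (jetDx U)) (conv (adHom j (jetDx U)) h 1) (PowerSeries.C y))
      ⟨fun _ _ => by simp only [map_add, AddMonoidHom.add_apply],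
        fun _ => by simp only [conv_X_left, conv_X_right]⟩
      ⟨fun _ _ => by simp only [map_add, AddMonoidHom.add_apply],
        fun _ => by simp only [conv_X_left]⟩ (fun h => ?_) h
    rw [← (PowerSeries.C : Jet U →+* DiffPoly U).map_one]
    simp only [conv_C_C, evHom_varDeriv]
  rw [evolve_eq, this, this]

/-- Integration by parts. -/
lemma jetVar_evolve (Y : Fin 2 → DiffPoly U) (h : DiffPoly U) (i : Fin 2) :
    jetVar (evolve Y h) i = jetVar (Y 0 * jetVar h 0 + Y 1 * jetVar h 1) i := by
  have : ∀ (j : Fin 2) (y : DiffPoly U),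
      adj i (conv (evHom U j) y h) 1 = adj i (y * jetVar h j) 1 := by
    intro j y
    simp only [jetVar_eq, adj, adSeries]
    refine IsEps.ext (F := fun y => conv (adHom i (jetDx U)) (conv (evHom U j) y h) 1)
      (G := fun y => conv (adHom i (jetDx U)) (y * conv (adHom j (jetDx U)) h 1) 1)
      ⟨fun _ _ => by simp only [map_add, AddMonoidHom.add_apply], fun _ => by simp only [conv_X_left]⟩
      ⟨fun _ _ => by simp only [map_add, add_mul, AddMonoidHom.add_apply],
        fun _ => by simp only [mul_assoc, conv_X_left]⟩ (fun y => ?_) y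
    refine IsEps.ext
      (F := fun h => conv (adHom i (jetDx U)) (conv (evHom U j) (PowerSeries.C y) h) 1)
      (G := fun h => conv (adHom i (jetDx U)) (PowerSeries.C y * conv (adHom j (jetDx U)) h 1) 1)
      ⟨fun _ _ => by simp only [map_add, AddMonoidHom.add_apply],
        fun _ => by simp only [conv_X_left, conv_X_right]⟩
      ⟨fun _ _ => by simp only [map_add, mul_add, AddMonoidHom.add_apply],
        fun _ => by simp only [conv_X_left, mul_X_left_comm]⟩ (fun h => ?_) h
    rw [← (PowerSeries.C : Jet U →+* DiffPoly U).map_one]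
    simp only [conv_C_C, varDeriv_evHom, ← map_mul]
  rw [evolve_eq, jetVar_eq, jetVar_eq, adj_add, adj_add, this, this]

/-! ## The Hamiltonian operators -/

lemma jetP0_zero (ξ : Fin 2 → DiffPoly U) : jetP0 ξ 0 =
    (ofSmooth (fQ U) * jetShift U (-1) (ξ 0) - jetShift U 1 (ofSmooth (fQ U) * ξ 0)) +
      (ofSmooth (fQ U) * ξ 1 - jetShift U 1 (ofSmooth (fQ U) * ξ 1)) := rfl

lemma jetP0_one (ξ : Fin 2 → DiffPoly U) : jetP0 ξ 1 =
    ofSmooth (fQ U) * (jetShift U (-1) (ξ 0) - ξ 0) := rfl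

lemma jetP1_zero (ξ : Fin 2 → DiffPoly U) : jetP1 ξ 0 =
    ofSmooth (fP U) * (jetShift U 1 (ofSmooth (fQ U) * ξ 1) - ofSmooth (fQ U) * ξ 1) := rfl

lemma jetP1_one (ξ : Fin 2 → DiffPoly U) : jetP1 ξ 1 =
    ofSmooth (fQ U) * (ofSmooth (fP U) * ξ 0 - jetShift U (-1) (ofSmooth (fP U) * ξ 0)) +
      ofSmooth (fQ U) * (jetShift U 1 (ofSmooth (fQ U) * ξ 1) -
        jetShift U (-1) (ofSmooth (fQ U) * ξ 1)) := rfl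

lemma coeff_zero_jetShift (m : ℤ) (f : DiffPoly U) :
    PowerSeries.constantCoeff (jetShift U m f) = PowerSeries.constantCoeff f := by
  simpa [jetShift] using coeff_zero_shift (jetDx U) m f

lemma X_mul_divEps_jetP0 (ξ : Fin 2 → DiffPoly U) (α : Fin 2) :
    PowerSeries.X * divEps (jetP0 ξ α) = jetP0 ξ α := by
  refine X_mul_divEps ?_
  fin_cases α
  · change PowerSeries.coeff 0 (jetP0 ξ 0) = 0
    rw [jetP0_zero]
    simp [coeff_zero_jetShift]
  · change PowerSeries.coeff 0 (jetP0 ξ 1) = 0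
    rw [jetP0_one]
    simp [coeff_zero_jetShift]

lemma X_mul_hamField (h : DiffPoly U) (α : Fin 2) :
    PowerSeries.X * hamField h α = jetP0 (jetVar h) α := X_mul_divEps_jetP0 _ α

lemma X_mul_evolve_hamField (h f : DiffPoly U) :
    PowerSeries.X * evolve (hamField h) f = evolve (jetP0 (jetVar h)) f := by
  rw [← evolve_left_X_mul]
  congr 1
  funext α
  exact X_mul_hamField h α

lemma adjLin_X_mul (V ξ : Fin 2 → DiffPoly U) (α : Fin 2) :
    adjLin (fun β => PowerSeries.X * V β) ξ α = PowerSeries.X * adjLin V ξ α := by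
  simp only [adjLin_eq, adj_X_mul, mul_add]

/-! ### Adjoint linearizations of Hamiltonian vector fields -/

section Adjoints

variable (h : DiffPoly U) (ξ : Fin 2 → DiffPoly U)

/-- The linearization of 𝒫₀δh is 𝒫₀ composed with the Hessian plus the variation of the coefficients
of 𝒫₀. Skew-adjointness of 𝒫₀ and self-adjointness of the Hessian turn the first part into minus the
derivative of δh along 𝒫₀ξ. The coefficients of 𝒫₀ depend on Q only, so the P component has no
correction and the Q component below has one. -/
lemma adjLin_jetP0_zero :
    adjLin (jetP0 (jetVar h)) ξ 0 = -evolve (jetP0 ξ) (jetVar h 0) := by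
  rw [evolve_jetVar, adjLin_eq]
  simp only [jetP0_zero, jetP0_one, adj_add, adj_sub, adj_mul, adj_jetShift, adj_Q, neg_neg,
    adj_add_right, adj_sub_right, mul_sub, jetShift_mul, jetShift_neg_one_one, Fin.isValue, zero_ne_one, if_false]
  ring_nf

lemma adjLin_jetP0_one :
    adjLin (jetP0 (jetVar h)) ξ 1 = -evolve (jetP0 ξ) (jetVar h 1) +
      (jetShift U (-1) (jetVar h 0) * ξ 0 - jetVar h 0 * jetShift U (-1) (ξ 0) +
        jetVar h 1 * ξ 0 - jetVar h 1 * jetShift U (-1) (ξ 0) +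
        (jetShift U (-1) (jetVar h 0) - jetVar h 0) * ξ 1) := by
  rw [evolve_jetVar, adjLin_eq]
  simp only [jetP0_zero, jetP0_one, adj_add, adj_sub, adj_mul, adj_jetShift, adj_Q, neg_neg,
    adj_add_right, adj_sub_right, mul_sub, jetShift_mul, jetShift_neg_one_one, if_true]
  ring_nf

/-- The same computation for 𝒫₁, whose coefficients involve both P and Q, so that both components
are corrected. -/
lemma adjLin_jetP1_zero :
    adjLin (jetP1 (jetVar h)) ξ 0 = -evolve (jetP1 ξ) (jetVar h 0) +
      (jetShift U 1 (ofSmooth (fQ U) * jetVar h 1) - ofSmooth (fQ U) * jetVar h 1) * ξ 0 -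
      jetVar h 0 * (jetShift U 1 (ofSmooth (fQ U) * ξ 1) - ofSmooth (fQ U) * ξ 1) := by
  rw [evolve_jetVar, adjLin_eq]
  simp only [jetP1_zero, jetP1_one, adj_add, adj_sub, adj_mul, adj_jetShift, adj_Q, adj_P, neg_neg,
    adj_add_right, adj_sub_right, mul_sub, jetShift_mul, jetShift_neg_one_one,
    jetShift_one_neg_one, Fin.isValue, zero_ne_one,
    if_false, if_true]
  ring_nf

lemma adjLin_jetP1_one :
    adjLin (jetP1 (jetVar h)) ξ 1 = -evolve (jetP1 ξ) (jetVar h 1) +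
      (ofSmooth (fP U) * jetVar h 0 - jetShift U (-1) (ofSmooth (fP U) * jetVar h 0) +
        jetShift U 1 (ofSmooth (fQ U) * jetVar h 1) -
        jetShift U (-1) (ofSmooth (fQ U) * jetVar h 1)) * ξ 1 -
      jetVar h 1 * (ofSmooth (fP U) * ξ 0 - jetShift U (-1) (ofSmooth (fP U) * ξ 0) +
        jetShift U 1 (ofSmooth (fQ U) * ξ 1) - jetShift U (-1) (ofSmooth (fQ U) * ξ 1)) := by
  rw [evolve_jetVar, adjLin_eq]
  simp only [jetP1_zero, jetP1_one, adj_add, adj_sub, adj_mul, adj_jetShift, adj_Q, adj_P, neg_neg,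
    adj_add_right, adj_sub_right, mul_sub, mul_add, jetShift_mul, jetShift_neg_one_one,
    jetShift_one_neg_one, Fin.isValue, one_ne_zero,
    if_false, if_true]
  ring_nf

end Adjoints

/-- A vector field that is Hamiltonian with respect to `𝒫₁` preserves `𝒫₁`. -/
lemma preservesP1_jetP1 (h : DiffPoly U) : PreservesP1 (jetP1 (jetVar h)) := by
  intro ξ α
  have hs : ∀ f : DiffPoly U, jetShift U (-1) (jetShift U 1 f) = f := jetShift_neg_one_one
  have hs' : ∀ f : DiffPoly U, jetShift U 1 (jetShift U (-1) f) = f := jetShift_one_neg_one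
  have a0 := adjLin_jetP1_zero h ξ
  have a1 := adjLin_jetP1_one h ξ
  fin_cases α
  · change evolve (jetP1 (jetVar h)) (jetP1 ξ 0) - jetP1 _ 0 =
      evolve (jetP1 ξ) (jetP1 (jetVar h) 0) + jetP1 (adjLin _ ξ) 0
    -- All terms with derivatives of ξ or of the gradient of h cancel by the adjoint formulas. What
    -- is left is an identity in shifts of P, Q, ξ and δh, which expresses the Jacobi identity for
    -- 𝒫₁.
    rw [jetP1_zero ξ, jetP1_zero, jetP1_zero (jetVar h), jetP1_zero (adjLin _ ξ), a1]
    simp only [evolve_mul, evolve_sub, evolve_jetShift, evolve_P, evolve_Q]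
    simp only [jetP1_zero, jetP1_one, jetShift_mul, jetShift_sub, jetShift_add, jetShift_neg,
      jetShift_jetShift]
    norm_num only
    simp only [jetShift_zero]
    ring
  · change evolve (jetP1 (jetVar h)) (jetP1 ξ 1) - jetP1 _ 1 =
      evolve (jetP1 ξ) (jetP1 (jetVar h) 1) + jetP1 (adjLin _ ξ) 1
    rw [jetP1_one ξ, jetP1_one, jetP1_one (jetVar h), jetP1_one (adjLin _ ξ), a1, a0]
    simp only [evolve_mul, evolve_sub, evolve_add, evolve_jetShift, evolve_P, evolve_Q]
    simp only [jetP1_zero, jetP1_one, jetShift_mul, jetShift_sub, jetShift_add, jetShift_neg,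
      jetShift_jetShift]
    norm_num only
    simp only [jetShift_zero]
    ring

lemma jetP1_X_mul (V : Fin 2 → DiffPoly U) (α : Fin 2) :
    jetP1 (fun β => PowerSeries.X * V β) α = PowerSeries.X * jetP1 V α := by
  fin_cases α
  · change jetP1 _ 0 = _ * jetP1 _ 0
    simp only [jetP1_zero, mul_left_comm _ PowerSeries.X, jetShift_X_mul]
    ring
  · change jetP1 _ 1 = _ * jetP1 _ 1
    simp only [jetP1_one, mul_left_comm _ PowerSeries.X, jetShift_X_mul]
    ring

lemma PreservesP1.of_X_mul {V : Fin 2 → DiffPoly U}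
    (h : PreservesP1 (fun β => PowerSeries.X * V β)) : PreservesP1 V := by
  intro ξ α
  refine X_mul_cancel ?_
  have := h ξ α
  simp only [evolve_left_X_mul, evolve_X_mul, jetP1_X_mul] at this
  rw [mul_sub, mul_add, this]
  congr 1
  rw [← jetP1_X_mul]
  congr 1
  funext β
  exact adjLin_X_mul V ξ β

/-! ## Hamiltonians in involution -/

section Involution

variable {h k : DiffPoly U}

/-- The functional ∫ X·δk, equal to the derivative of ∫ k along X, has vanishing variational
derivative. Written out, this reads D_X(δk) + X_*^†(δk) = 0. -/
lemma evolve_jetVar_of_involution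
    (hk : ∀ α, jetVar (evolve (hamField h) k) α = 0) (α : Fin 2) :
    evolve (jetP0 (jetVar h)) (jetVar k α) = -adjLin (jetP0 (jetVar h)) (jetVar k) α := by
  have e : jetVar (evolve (jetP0 (jetVar h)) k) α = 0 := by
    rw [← X_mul_evolve_hamField, jetVar_eq, adj_X_mul, ← jetVar_eq, hk, mul_zero]
  rw [jetVar_evolve, jetVar_eq, adj_add, adj_mul, adj_mul, mul_one, mul_one, mul_one, mul_one] at e
  rw [evolve_jetVar, adjLin_eq]
  linear_combination e

lemma evolve_jetVar_zero_comm
    (hk : ∀ α, jetVar (evolve (hamField h) k) α = 0) :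
    evolve (hamField h) (jetVar k 0) = evolve (hamField k) (jetVar h 0) := by
  refine X_mul_cancel ?_
  rw [X_mul_evolve_hamField, X_mul_evolve_hamField, evolve_jetVar_of_involution hk,
    adjLin_jetP0_zero, neg_neg]

/-- The derivative of δk/δQ alone carries the correction of `adjLin_jetP0_one`. Together with the
derivative of the factor Q it becomes exactly the derivative of Q on the other side. -/
lemma evolve_jetVar_sum_comm
    (hk : ∀ α, jetVar (evolve (hamField h) k) α = 0) :
    evolve (hamField h) (ofSmooth (fQ U) * (jetVar k 0 + jetVar k 1)) =
      evolve (hamField k) (ofSmooth (fQ U) * (jetVar h 0 + jetVar h 1)) := by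
  refine X_mul_cancel ?_
  rw [X_mul_evolve_hamField, X_mul_evolve_hamField, evolve_mul, evolve_mul, evolve_add, evolve_add,
    evolve_Q, evolve_Q, evolve_jetVar_of_involution hk, evolve_jetVar_of_involution hk,
    adjLin_jetP0_zero, adjLin_jetP0_one]
  simp only [jetP0_one]
  ring

/-- A Hamiltonian field X depends on h only through δh/δP and Q(δh/δP + δh/δQ): one has εX₁ = Q(Λ⁻¹
- 1)δh/δP and ε(X₀ - X₁) = (1 - Λ)Q(δh/δP + δh/δQ). Both combinations commute by the two preceding
lemmas. -/
lemma evolve_hamField_comm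
    (hk : ∀ α, jetVar (evolve (hamField h) k) α = 0) (α : Fin 2) :
    evolve (hamField h) (hamField k α) = evolve (hamField k) (hamField h α) := by
  have e0 := evolve_jetVar_zero_comm hk
  have e1 := evolve_jetVar_sum_comm hk
  have hX : ∀ (l : DiffPoly U) (α : Fin 2), PowerSeries.X * hamField l α = jetP0 (jetVar l) α :=
    X_mul_hamField
  have q1 : ∀ l m : DiffPoly U,
      PowerSeries.X * (PowerSeries.X * evolve (hamField l) (hamField m 1)) =
      PowerSeries.X * hamField l 1 *
        (jetShift U (-1) (jetVar m 0) - jetVar m 0) + PowerSeries.X * (ofSmooth (fQ U) *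
          (jetShift U (-1) (evolve (hamField l) (jetVar m 0)) -
            evolve (hamField l) (jetVar m 0))) := by
    intro l m
    rw [← evolve_X_mul, hX m, jetP0_one, evolve_mul, evolve_sub, evolve_jetShift, evolve_Q]
    ring
  have c1 : evolve (hamField h) (hamField k 1) = evolve (hamField k) (hamField h 1) := by
    refine X_mul_cancel (X_mul_cancel ?_)
    rw [q1, q1, e0, hX, hX, jetP0_one, jetP0_one]
    ring
  have d : ∀ l : DiffPoly U, PowerSeries.X * (hamField l 0 - hamField l 1) =
      ofSmooth (fQ U) * (jetVar l 0 + jetVar l 1) -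
        jetShift U 1 (ofSmooth (fQ U) * (jetVar l 0 + jetVar l 1)) := by
    intro l
    rw [mul_sub, hX, hX, jetP0_zero, jetP0_one, mul_add, jetShift_add]
    ring
  have c2 : evolve (hamField h) (hamField k 0 - hamField k 1) =
      evolve (hamField k) (hamField h 0 - hamField h 1) := by
    refine X_mul_cancel ?_
    rw [← evolve_X_mul, ← evolve_X_mul, d, d, evolve_sub, evolve_sub, evolve_jetShift,
      evolve_jetShift, e1]
  rw [evolve_sub, evolve_sub] at c2
  fin_cases α
  · change evolve _ (hamField k 0) = evolve _ (hamField h 0)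
    linear_combination c2 + c1
  · exact c1

end Involution

/-! ## Rings of difference operators -/

/-- The operator has order at most `N` in `Λ` (for `s = 1`) or in `Λ⁻¹` (for `s = -1`). -/
def OrderLE (s : ℤˣ) (N : ℕ) (X : ℤ → DiffPoly U) : Prop := ∀ i : ℤ, X i ≠ 0 → (s : ℤ) * i ≤ N

/-- The two one-sided bounds confine i to a finite window, for either sign of s. Hence products of
operators expanded in powers of Λ or of Λ⁻¹ have finite sums as coefficients. -/
lemma mem_window {s : ℤˣ} {A B : ℕ} {i n : ℤ} {K : ℕ} (h₁ : (s : ℤ) * i ≤ A)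
    (h₂ : (s : ℤ) * (n - i) ≤ B) (hK : A + B + n.natAbs ≤ K) :
    i ∈ Finset.Icc (-(K : ℤ)) K := by
  rw [Finset.mem_Icc]
  rcases Int.units_eq_one_or s with rfl | rfl
  · simp only [Units.val_one, one_mul] at h₁ h₂
    omega
  · simp only [Units.val_neg, Units.val_one] at h₁ h₂
    omega

lemma OrderLE.opComp_eq {s : ℤˣ} {A B : ℕ} {X Y : ℤ → DiffPoly U} (hX : OrderLE s A X)
    (hY : OrderLE s B Y) {n : ℤ} {K : ℕ} (hK : A + B + n.natAbs ≤ K) :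
    opComp X Y n = ∑ i ∈ Finset.Icc (-(K : ℤ)) K, X i * jetShift U i (Y (n - i)) := by
  refine finsum_eq_sum_of_support_subset _ fun i hi => ?_
  rw [Function.mem_support] at hi
  refine mem_window (hX i fun h => hi (by rw [h, zero_mul]))
    (hY (n - i) fun h => hi (by rw [h, jetShift_map_zero, mul_zero])) hK

lemma OrderLE.opComp {s : ℤˣ} {A B : ℕ} {X Y : ℤ → DiffPoly U} (hX : OrderLE s A X)
    (hY : OrderLE s B Y) : OrderLE s (A + B) (opComp X Y) := by
  intro n hn
  by_contra hlt
  refine hn (finsum_eq_zero_of_forall_eq_zero fun i => ?_)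
  by_contra h
  have h₁ := hX i fun h' => h (by rw [h', zero_mul])
  have h₂ := hY (n - i) fun h' => h (by rw [h', jetShift_map_zero, mul_zero])
  rw [mul_sub] at h₂
  push_cast at hlt
  omega

lemma jetShift_sum {ι : Type*} (m : ℤ) (S : Finset ι) (f : ι → DiffPoly U) :
    jetShift U m (∑ i ∈ S, f i) = ∑ i ∈ S, jetShift U m (f i) := map_sum (jetShiftHom U m) f S

/-- Reindexed so that the summation variable is the total power of Λ. The window is then the same
for all i with bounded s·i, and the sums over i and m can be exchanged. -/
lemma OrderLE.opComp_sub_eq {s : ℤˣ} {N A B : ℕ} {Y Z : ℤ → DiffPoly U} (hY : OrderLE s A Y)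
    (hZ : OrderLE s B Z) {n i : ℤ} (hi : (s : ℤ) * i ≤ N) {K : ℕ}
    (hK : N + A + B + n.natAbs ≤ K) :
    AblowitzLadik.opComp Y Z (n - i) =
      ∑ m ∈ Finset.Icc (-(K : ℤ)) K, Y (m - i) * jetShift U (m - i) (Z (n - m)) := by
  rw [AblowitzLadik.opComp, ← finsum_comp_equiv (Equiv.subRight i)]
  simp only [Equiv.subRight_apply, sub_sub_sub_cancel_right]
  refine finsum_eq_sum_of_support_subset _ fun m hm => ?_
  rw [Function.mem_support] at hm
  have h₁ := hY (m - i) fun h => hm (by rw [h, zero_mul])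
  have h₂ := hZ (n - m) fun h => hm (by rw [h, jetShift_map_zero, mul_zero])
  refine mem_window (s := s) (A := N + A) (B := B) ?_ h₂ hK
  rw [mul_sub] at h₁
  push_cast
  linarith

lemma opComp_assoc {s : ℤˣ} {A B C : ℕ} {X Y Z : ℤ → DiffPoly U} (hX : OrderLE s A X)
    (hY : OrderLE s B Y) (hZ : OrderLE s C Z) :
    opComp (opComp X Y) Z = opComp X (opComp Y Z) := by
  funext n
  set K : ℕ := A + B + C + n.natAbs with hK
  have hK' : ∀ m ∈ Finset.Icc (-(K : ℤ)) K, A + B + m.natAbs ≤ A + B + C + K := by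
    intro m hm
    rw [Finset.mem_Icc] at hm
    omega
  rw [(hX.opComp hY).opComp_eq hZ (K := K) le_rfl,
    hX.opComp_eq (hY.opComp hZ) (K := A + B + C + K) (by omega)]
  calc _ = ∑ m ∈ Finset.Icc (-(K : ℤ)) K, ∑ i ∈ Finset.Icc (-((A + B + C + K : ℕ) : ℤ))
        (A + B + C + K : ℕ), X i * jetShift U i (Y (m - i)) * jetShift U m (Z (n - m)) := by
        refine Finset.sum_congr rfl fun m hm => ?_
        rw [hX.opComp_eq hY (hK' m hm), Finset.sum_mul]
    _ = _ := by
        rw [Finset.sum_comm]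
        refine Finset.sum_congr rfl fun i _ => ?_
        -- The window for m is independent of i only where X i ≠ 0 bounds s·i.
        by_cases hi : X i = 0
        · simp [hi]
        · rw [hY.opComp_sub_eq hZ (hX i hi) (K := K) le_rfl, jetShift_sum, Finset.mul_sum]
          refine Finset.sum_congr rfl fun m _ => ?_
          rw [jetShift_mul, jetShift_jetShift, mul_assoc, add_sub_cancel]

/-- The identity operator. -/
def opOne (U : Chart) : ℤ → DiffPoly U := fun n => if n = 0 then 1 else 0

lemma opOne_opComp (X : ℤ → DiffPoly U) : opComp (opOne U) X = X := by
  funext n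
  rw [opComp, finsum_eq_single _ 0 fun i hi => by simp [opOne, hi]]
  simp [opOne, jetShift_zero]

lemma opComp_opOne (X : ℤ → DiffPoly U) : opComp X (opOne U) = X := by
  funext n
  rw [opComp, finsum_eq_single _ n fun i hi => by
    simp [opOne, sub_eq_zero, hi.symm, jetShift_map_zero]]
  simp [opOne, jetShift_one]

/-- Difference operators whose order in `Λ` (for `s = 1`) or in `Λ⁻¹` (for `s = -1`) is bounded. -/
def BddOp (U : Chart) (s : ℤˣ) : Type := {X : ℤ → DiffPoly U // ∃ N, OrderLE s N X}

instance (s : ℤˣ) : Monoid (BddOp U s) where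
  mul X Y := ⟨opComp X.1 Y.1, by
    obtain ⟨A, hA⟩ := X.2
    obtain ⟨B, hB⟩ := Y.2
    exact ⟨_, hA.opComp hB⟩⟩
  one := ⟨opOne U, 0, fun i hi => by
    by_cases h : i = 0
    · simp [h]
    · simp [opOne, h] at hi⟩
  mul_assoc X Y Z := by
    obtain ⟨A, hA⟩ := X.2
    obtain ⟨B, hB⟩ := Y.2
    obtain ⟨C, hC⟩ := Z.2
    exact Subtype.ext (opComp_assoc hA hB hC)
  one_mul X := Subtype.ext (opOne_opComp X.1)
  mul_one X := Subtype.ext (opComp_opOne X.1)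

lemma BddOp.coe_mul {s : ℤˣ} (X Y : BddOp U s) : (X * Y).1 = opComp X.1 Y.1 := rfl

lemma BddOp.coe_one {s : ℤˣ} : (1 : BddOp U s).1 = opOne U := rfl

lemma BddOp.coe_pow {s : ℤˣ} (X : BddOp U s) (k : ℕ) : (X ^ k).1 = opPow X.1 k := by
  induction k with
  | zero => rfl
  | succ k ih => rw [pow_succ', BddOp.coe_mul, ih, opPow]

/-! ## The trace pairing -/

lemma adj_sum {ι : Type*} (i : Fin 2) (S : Finset ι) (f : ι → DiffPoly U) (w : DiffPoly U) :
    adj i (∑ j ∈ S, f j) w = ∑ j ∈ S, adj i (f j) w := by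
  classical
  induction S using Finset.induction_on with
  | empty => simp [adj_zero]
  | insert a S ha ih => rw [Finset.sum_insert ha, Finset.sum_insert ha, adj_add, ih]

lemma adj_sum_right {ι : Type*} (i : Fin 2) (S : Finset ι) (f : DiffPoly U) (w : ι → DiffPoly U) :
    adj i f (∑ j ∈ S, w j) = ∑ j ∈ S, adj i f (w j) := by
  classical
  induction S using Finset.induction_on with
  | empty => simp [adj_zero_right]
  | insert a S ha ih => rw [Finset.sum_insert ha, Finset.sum_insert ha, adj_add_right, ih]

/-- The variational derivative of `Res (X W)` with `W` held fixed. -/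
def trAdj {s : ℤˣ} (α : Fin 2) (X W : BddOp U s) : DiffPoly U :=
  ∑ᶠ n : ℤ, adj α (X.1 n) (jetShift U n (W.1 (-n)))

lemma trAdj_eq {s : ℤˣ} (α : Fin 2) {X W : BddOp U s} {A B : ℕ} (hX : OrderLE s A X.1)
    (hW : OrderLE s B W.1) {K : ℕ} (hK : A + B ≤ K) :
    trAdj α X W = ∑ n ∈ Finset.Icc (-(K : ℤ)) K, adj α (X.1 n) (jetShift U n (W.1 (-n))) := by
  refine finsum_eq_sum_of_support_subset _ fun i hi => ?_
  rw [Function.mem_support] at hi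
  refine mem_window (n := 0) (hX i fun h => hi (by rw [h, adj_zero]))
    (hW (0 - i) fun h => hi ?_) (by simpa using hK)
  rw [zero_sub] at h
  rw [h, jetShift_map_zero, adj_zero_right]

lemma OrderLE.opComp_neg_eq {s : ℤˣ} {A B C : ℕ} {X W : ℤ → DiffPoly U} (hW : OrderLE s C W)
    (hX : OrderLE s A X) {j : ℤ} (hj : (s : ℤ) * j ≤ B) {K : ℕ} (hK : A + B + C ≤ K) :
    AblowitzLadik.opComp W X (-j) =
      ∑ n ∈ Finset.Icc (-(K : ℤ)) K, W (-n) * jetShift U (-n) (X (n - j)) := by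
  have h : AblowitzLadik.opComp W X (-j) =
      ∑ᶠ n : ℤ, W (-n) * jetShift U (-n) (X (n - j)) := by
    rw [AblowitzLadik.opComp, ← finsum_comp_equiv (Equiv.neg ℤ)]
    refine finsum_congr fun n => ?_
    rw [Equiv.neg_apply, show -j - -n = n - j by ring]
  rw [h]
  refine finsum_eq_sum_of_support_subset _ fun n hn => ?_
  rw [Function.mem_support] at hn
  have h₁ := hW (-n) fun h => hn (by rw [h, zero_mul])
  have h₂ := hX (n - j) fun h => hn (by rw [h, jetShift_map_zero, mul_zero])
  refine mem_window (s := s) (A := A + B) (B := C) (n := 0) ?_ (by simpa using h₁)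
    (by simpa using hK)
  rw [mul_sub] at h₂
  push_cast
  linarith

lemma trAdj_mul_right {s : ℤˣ} (α : Fin 2) {X Y W : BddOp U s} {A B C : ℕ}
    (hA : OrderLE s A X.1) (hB : OrderLE s B Y.1) (hC : OrderLE s C W.1) {K L : ℕ}
    (hK : A + B + C ≤ K) (hL : A + B + C ≤ L) :
    trAdj α X (Y * W) = ∑ n ∈ Finset.Icc (-(K : ℤ)) K, ∑ i ∈ Finset.Icc (-(L : ℤ)) L,
      adj α (X.1 i) (jetShift U i (Y.1 (n - i)) * jetShift U n (W.1 (-n))) := by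
  rw [trAdj_eq α hA (hB.opComp hC) (K := L) (by omega), Finset.sum_comm]
  refine Finset.sum_congr rfl fun i _ => ?_
  by_cases hi : X.1 i = 0
  · simp [hi, adj_zero]
  · have := hB.opComp_sub_eq hC (n := 0) (hA i hi) (K := K) (by simpa using hK)
    rw [BddOp.coe_mul, ← zero_sub, this, jetShift_sum, adj_sum_right]
    refine Finset.sum_congr rfl fun m _ => ?_
    rw [jetShift_mul, jetShift_jetShift, add_sub_cancel, zero_sub]

lemma trAdj_mul_right' {s : ℤˣ} (α : Fin 2) {X Y W : BddOp U s} {A B C : ℕ}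
    (hA : OrderLE s A X.1) (hB : OrderLE s B Y.1) (hC : OrderLE s C W.1) {K L : ℕ}
    (hK : A + B + C ≤ K) (hL : A + B + C ≤ L) :
    trAdj α Y (W * X) = ∑ n ∈ Finset.Icc (-(K : ℤ)) K, ∑ j ∈ Finset.Icc (-(L : ℤ)) L,
      adj α (Y.1 j) (jetShift U (j - n) (X.1 (n - j)) * jetShift U j (W.1 (-n))) := by
  rw [trAdj_eq α hB (hC.opComp hA) (K := L) (by omega), Finset.sum_comm]
  refine Finset.sum_congr rfl fun j _ => ?_
  by_cases hj : Y.1 j = 0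
  · simp [hj, adj_zero]
  · rw [BddOp.coe_mul, hC.opComp_neg_eq hA (hB j hj) hK, jetShift_sum, adj_sum_right]
    refine Finset.sum_congr rfl fun n _ => ?_
    rw [jetShift_mul, jetShift_jetShift, mul_comm, ← sub_eq_add_neg]

/-- The window is symmetric about 0 and the reflection i ↦ n - i is not, but both the support and
its reflection lie inside the window. -/
lemma sum_window_reflect {M : Type*} [AddCommMonoid M] {s : ℤˣ} {A B L : ℕ} {n : ℤ}
    (hL : A + B + n.natAbs ≤ L) (f : ℤ → M)
    (hf : ∀ i, f i ≠ 0 → (s : ℤ) * i ≤ A ∧ (s : ℤ) * (n - i) ≤ B) :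
    ∑ i ∈ Finset.Icc (-(L : ℤ)) L, f i = ∑ j ∈ Finset.Icc (-(L : ℤ)) L, f (n - j) := by
  rw [← finsum_eq_sum_of_support_subset f, ← finsum_eq_sum_of_support_subset fun j => f (n - j),
    ← finsum_comp_equiv (Equiv.subLeft n)]
  · rfl
  · intro j hj
    have := hf (n - j) hj
    refine mem_window (s := s) (A := B) (B := A) (n := n) ?_ this.1 (by omega)
    simpa using this.2
  · intro i hi
    exact mem_window (hf i hi).1 (hf i hi).2 hL

/-- The Leibniz rule for a variation of Res(XYW) combined with the cyclicity of the residue up to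
total differences. The differences do not matter because `adj_jetShift` moves a shift from the
varied factor to the other one. -/
lemma trAdj_mul {s : ℤˣ} (α : Fin 2) (X Y W : BddOp U s) :
    trAdj α (X * Y) W = trAdj α X (Y * W) + trAdj α Y (W * X) := by
  obtain ⟨A, hA⟩ := X.2
  obtain ⟨B, hB⟩ := Y.2
  obtain ⟨C, hC⟩ := W.2
  obtain ⟨K, hK⟩ : ∃ K, K = A + B + C := ⟨_, rfl⟩
  obtain ⟨L, hL⟩ : ∃ L, L = A + B + K := ⟨_, rfl⟩
  rw [trAdj_eq α (hA.opComp hB) hC (K := K) (by omega),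
    trAdj_mul_right α hA hB hC (K := K) (L := L) (by omega) (by omega),
    trAdj_mul_right' α hA hB hC (K := K) (L := L) (by omega) (by omega), ← Finset.sum_add_distrib]
  refine Finset.sum_congr rfl fun n hn => ?_
  have hn' : A + B + n.natAbs ≤ L := by
    rw [Finset.mem_Icc] at hn
    omega
  have e1 : adj α ((X * Y).1 n) (jetShift U n (W.1 (-n))) =
      ∑ i ∈ Finset.Icc (-(L : ℤ)) L, (adj α (X.1 i)
        (jetShift U i (Y.1 (n - i)) * jetShift U n (W.1 (-n))) +
        adj α (jetShift U i (Y.1 (n - i))) (X.1 i * jetShift U n (W.1 (-n)))) := by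
    rw [BddOp.coe_mul, hA.opComp_eq hB hn', adj_sum]
    exact Finset.sum_congr rfl fun i _ => adj_mul _ _ _ _
  have e2 : ∑ i ∈ Finset.Icc (-(L : ℤ)) L,
      adj α (jetShift U i (Y.1 (n - i))) (X.1 i * jetShift U n (W.1 (-n))) =
      ∑ j ∈ Finset.Icc (-(L : ℤ)) L,
        adj α (Y.1 j) (jetShift U (j - n) (X.1 (n - j)) * jetShift U j (W.1 (-n))) := by
    refine (sum_window_reflect (s := s) (A := A) (B := B) hn' _ fun i hi => ⟨hA i ?_, hB _ ?_⟩).trans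
      (Finset.sum_congr rfl fun j _ => ?_)
    · intro h
      exact hi (by rw [h, zero_mul, adj_zero_right])
    · intro h
      exact hi (by rw [h, jetShift_map_zero, adj_zero])
    · rw [adj_jetShift, sub_sub_cancel, jetShift_mul, jetShift_jetShift, neg_sub, sub_add_cancel]
  rw [e1, Finset.sum_add_distrib, e2]

lemma trAdj_one_right {s : ℤˣ} (α : Fin 2) (X : BddOp U s) :
    trAdj α X 1 = jetVar (X.1 0) α := by
  rw [trAdj, finsum_eq_single _ 0 fun n hn => by
    rw [BddOp.coe_one, opOne, if_neg (neg_ne_zero.2 hn), jetShift_map_zero, adj_zero_right]]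
  rw [BddOp.coe_one, opOne, neg_zero, if_pos rfl, jetShift_one, jetVar_eq]

lemma trAdj_one_left {s : ℤˣ} (α : Fin 2) (W : BddOp U s) : trAdj α 1 W = 0 := by
  refine finsum_eq_zero_of_forall_eq_zero fun n => ?_
  by_cases hn : n = 0
  · rw [BddOp.coe_one, opOne, if_pos hn, adj_one]
  · rw [BddOp.coe_one, opOne, if_neg hn, adj_zero]

/-- By cyclicity each of the k + 1 factors contributes the same variation. The extra power m in the
second slot is what lets the induction collect the factors. -/
lemma trAdj_pow {s : ℤˣ} (α : Fin 2) (X : BddOp U s) (k m : ℕ) :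
    trAdj α (X ^ (k + 1)) (X ^ m) = (k + 1) * trAdj α X (X ^ (k + m)) := by
  induction k generalizing m with
  | zero => simp
  | succ k ih =>
    rw [pow_succ' X (k + 1), trAdj_mul, ← pow_add, ← pow_succ, ih,
      show k + 1 + m = k + (m + 1) by ring]
    push_cast
    ring

lemma jetVar_pow {s : ℤˣ} (α : Fin 2) (X : BddOp U s) (k : ℕ) :
    jetVar ((X ^ (k + 1)).1 0) α = (k + 1) * trAdj α X (X ^ k) := by
  rw [← trAdj_one_right, ← pow_zero X, trAdj_pow, add_zero]

/-- The variation of `X = a⁻¹ b`. -/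
lemma trAdj_quot {s : ℤˣ} (α : Fin 2) {a a' b : BddOp U s} (h : a * a' = 1) (h' : a' * a = 1)
    (k : ℕ) : trAdj α (a' * b) ((a' * b) ^ k) =
      trAdj α b ((a' * b) ^ k * a') - trAdj α a ((a' * b) ^ (k + 1) * a') := by
  rw [trAdj_mul, eq_sub_iff_add_eq, add_right_comm, add_eq_right]
  -- The variation of a a' = 1 is zero. Paired with this particular operator, it replaces the
  -- variation of a' by minus that of a, which is the rule δ(a⁻¹) = -a⁻¹(δa)a⁻¹ under the trace.
  have e := trAdj_mul α a a' (a * ((a' * b) ^ (k + 1) * a'))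
  rw [h, trAdj_one_left, ← mul_assoc a' a, h', one_mul] at e
  rw [add_comm, e]
  congr 2
  rw [mul_assoc, mul_assoc, h', mul_one, pow_succ', ← mul_assoc, ← mul_assoc, h, one_mul]

/-! ## The factors of the Lax operators -/

lemma opLambdaP_opComp (X : ℤ → DiffPoly U) (n : ℤ) :
    opComp (opLambdaP U) X n = jetShift U 1 (X (n - 1)) - ofSmooth (fP U) * X n := by
  rw [opComp, finsum_eq_sum_of_support_subset (s := {0, 1})]
  · rw [Finset.sum_pair zero_ne_one]
    simp only [opLambdaP, zero_ne_one, if_false, if_true, sub_zero, jetShift_zero]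
    ring
  · intro i hi
    by_contra h
    simp only [Finset.coe_insert, Finset.coe_singleton, Set.mem_insert_iff,
      Set.mem_singleton_iff, not_or] at h
    simp [opLambdaP, h.1, h.2] at hi

lemma opComp_opLambdaP (X : ℤ → DiffPoly U) (n : ℤ) :
    opComp X (opLambdaP U) n = X (n - 1) - X n * jetShift U n (ofSmooth (fP U)) := by
  rw [opComp, finsum_eq_sum_of_support_subset (s := {n - 1, n})]
  · rw [Finset.sum_pair (by omega)]
    simp only [opLambdaP, sub_sub_cancel, sub_self, zero_ne_one, if_false, if_true, jetShift_one,
      jetShift_neg]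
    ring
  · intro i hi
    by_contra h
    simp only [Finset.coe_insert, Finset.coe_singleton, Set.mem_insert_iff,
      Set.mem_singleton_iff, not_or] at h
    have h1 : n - i ≠ 1 := by omega
    have h2 : n - i ≠ 0 := by omega
    simp [opLambdaP, h1, h2, jetShift_map_zero] at hi

lemma opOneQ_opComp (X : ℤ → DiffPoly U) (n : ℤ) :
    opComp (opOneQ U) X n = X n - ofSmooth (fQ U) * jetShift U (-1) (X (n + 1)) := by
  rw [opComp, finsum_eq_sum_of_support_subset (s := {0, -1})]
  · rw [Finset.sum_pair (by omega)]
    simp only [opOneQ, neg_eq_zero, one_ne_zero, if_false, if_true, sub_zero, jetShift_zero,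
      sub_neg_eq_add]
    ring
  · intro i hi
    by_contra h
    simp only [Finset.coe_insert, Finset.coe_singleton, Set.mem_insert_iff,
      Set.mem_singleton_iff, not_or] at h
    simp [opOneQ, h.1, h.2] at hi

lemma opComp_opOneQ (X : ℤ → DiffPoly U) (n : ℤ) :
    opComp X (opOneQ U) n = X n - X (n + 1) * jetShift U (n + 1) (ofSmooth (fQ U)) := by
  rw [opComp, finsum_eq_sum_of_support_subset (s := {n, n + 1})]
  · rw [Finset.sum_pair (by omega)]
    simp only [opOneQ, sub_self, sub_add_cancel_left, neg_eq_zero, one_ne_zero, if_false, if_true,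
      jetShift_one, jetShift_neg]
    ring
  · intro i hi
    by_contra h
    simp only [Finset.coe_insert, Finset.coe_singleton, Set.mem_insert_iff,
      Set.mem_singleton_iff, not_or] at h
    have h1 : n - i ≠ 0 := by omega
    have h2 : n - i ≠ -1 := by omega
    simp [opOneQ, h1, h2, jetShift_map_zero] at hi

lemma ofSmooth_P_mul_inv : ofSmooth (fP U) * ofSmooth (fPinv U) = 1 := by
  rw [← ofSmooth_mul, fP_mul_fPinv, ofSmooth_one]

lemma jetShift_P_mul_inv (m : ℤ) :
    jetShift U m (ofSmooth (fP U)) * jetShift U m (ofSmooth (fPinv U)) = 1 := by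
  rw [← jetShift_mul, ofSmooth_P_mul_inv, jetShift_one]

lemma opOneQInv_neg (n : ℕ) : opOneQInv U (-(n : ℤ)) =
    ∏ j ∈ Finset.range n, jetShift U (-(j : ℤ)) (ofSmooth (fQ U)) := by
  rw [opOneQInv, if_pos (by omega), Int.natAbs_neg, Int.natAbs_natCast]

lemma opOneQInv_pos {n : ℤ} (hn : 0 < n) : opOneQInv U n = 0 := by
  rw [opOneQInv, if_neg (by omega)]

lemma opLambdaPInv_nat (n : ℕ) : opLambdaPInv U (n : ℤ) =
    -∏ j ∈ Finset.range (n + 1), jetShift U (j : ℤ) (ofSmooth (fPinv U)) := by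
  rw [opLambdaPInv, if_pos (by omega), Int.natAbs_natCast]

lemma opLambdaPInv_neg {n : ℤ} (hn : n < 0) : opLambdaPInv U n = 0 := by
  rw [opLambdaPInv, if_neg (by omega)]

lemma opOneQ_opComp_inv : opComp (opOneQ U) (opOneQInv U) = opOne U := by
  funext n
  rw [opOneQ_opComp, opOne]
  rcases lt_trichotomy n 0 with hn | rfl | hn
  · obtain ⟨k, rfl⟩ : ∃ k : ℕ, n = -((k + 1 : ℕ) : ℤ) := ⟨(-n - 1).toNat, by omega⟩
    rw [if_neg (by omega), opOneQInv_neg,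
      show -((k + 1 : ℕ) : ℤ) + 1 = -(k : ℤ) by push_cast; ring, opOneQInv_neg,
      Finset.prod_range_succ', ← jetShiftHom_apply (-1), map_prod]
    simp only [jetShiftHom_apply, jetShift_jetShift, Nat.cast_zero, neg_zero, jetShift_zero]
    rw [mul_comm, sub_eq_zero]
    congr 1
    refine Finset.prod_congr rfl fun j _ => ?_
    congr 1
    push_cast
    ring
  · have := opOneQInv_neg (U := U) 0
    rw [opOneQInv_pos (n := 0 + 1) (by omega), if_pos rfl, jetShift_map_zero]
    simpa using this
  · rw [opOneQInv_pos hn, opOneQInv_pos (by omega), if_neg (by omega), jetShift_map_zero]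
    simp

lemma inv_opComp_opOneQ : opComp (opOneQInv U) (opOneQ U) = opOne U := by
  funext n
  rw [opComp_opOneQ, opOne]
  rcases lt_trichotomy n 0 with hn | rfl | hn
  · obtain ⟨k, rfl⟩ : ∃ k : ℕ, n = -((k + 1 : ℕ) : ℤ) := ⟨(-n - 1).toNat, by omega⟩
    rw [if_neg (by omega), opOneQInv_neg,
      show -((k + 1 : ℕ) : ℤ) + 1 = -(k : ℤ) by push_cast; ring, opOneQInv_neg,
      Finset.prod_range_succ, sub_self]
  · have := opOneQInv_neg (U := U) 0
    rw [opOneQInv_pos (n := 0 + 1) (by omega), if_pos rfl]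
    simpa using this
  · rw [opOneQInv_pos hn, opOneQInv_pos (by omega), if_neg (by omega)]
    simp

lemma opLambdaP_opComp_inv : opComp (opLambdaP U) (opLambdaPInv U) = opOne U := by
  funext n
  rw [opLambdaP_opComp, opOne]
  rcases lt_trichotomy n 0 with hn | rfl | hn
  · rw [opLambdaPInv_neg hn, opLambdaPInv_neg (by omega), if_neg (by omega), jetShift_map_zero]
    simp
  · have := opLambdaPInv_nat (U := U) 0
    rw [opLambdaPInv_neg (n := 0 - 1) (by omega), if_pos rfl, jetShift_map_zero]
    simp only [Nat.cast_zero, zero_add, Finset.range_one, Finset.prod_singleton,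
      jetShift_zero] at this
    rw [this]
    linear_combination ofSmooth_P_mul_inv (U := U)
  · obtain ⟨k, rfl⟩ : ∃ k : ℕ, n = ((k + 1 : ℕ) : ℤ) := ⟨(n - 1).toNat, by omega⟩
    rw [if_neg (by omega), opLambdaPInv_nat,
      show ((k + 1 : ℕ) : ℤ) - 1 = (k : ℤ) by push_cast; ring, opLambdaPInv_nat,
      Finset.prod_range_succ' _ (k + 1), jetShift_neg, ← jetShiftHom_apply 1, map_prod]
    simp only [jetShiftHom_apply, jetShift_jetShift, Nat.cast_zero, jetShift_zero]
    have : ∏ j ∈ Finset.range (k + 1), jetShift U (1 + (j : ℤ)) (ofSmooth (fPinv U)) =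
        ∏ j ∈ Finset.range (k + 1), jetShift U ((j + 1 : ℕ) : ℤ) (ofSmooth (fPinv U)) := by
      refine Finset.prod_congr rfl fun j _ => ?_
      congr 1
      push_cast
      ring
    rw [this]
    linear_combination (∏ j ∈ Finset.range (k + 1),
      jetShift U ((j + 1 : ℕ) : ℤ) (ofSmooth (fPinv U))) * ofSmooth_P_mul_inv (U := U)

lemma inv_opComp_opLambdaP : opComp (opLambdaPInv U) (opLambdaP U) = opOne U := by
  funext n
  rw [opComp_opLambdaP, opOne]
  rcases lt_trichotomy n 0 with hn | rfl | hn
  · rw [opLambdaPInv_neg hn, opLambdaPInv_neg (by omega), if_neg (by omega)]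
    simp
  · have := opLambdaPInv_nat (U := U) 0
    rw [opLambdaPInv_neg (n := 0 - 1) (by omega), if_pos rfl, jetShift_zero]
    simp only [Nat.cast_zero, zero_add, Finset.range_one, Finset.prod_singleton,
      jetShift_zero] at this
    rw [this]
    linear_combination ofSmooth_P_mul_inv (U := U)
  · obtain ⟨k, rfl⟩ : ∃ k : ℕ, n = ((k + 1 : ℕ) : ℤ) := ⟨(n - 1).toNat, by omega⟩
    rw [if_neg (by omega), opLambdaPInv_nat,
      show ((k + 1 : ℕ) : ℤ) - 1 = (k : ℤ) by push_cast; ring, opLambdaPInv_nat,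
      Finset.prod_range_succ _ (k + 1)]
    linear_combination (∏ j ∈ Finset.range (k + 1),
      jetShift U (j : ℤ) (ofSmooth (fPinv U))) * jetShift_P_mul_inv (U := U) ((k + 1 : ℕ) : ℤ)

/-- `Λ - P` as an operator of bounded order. -/
def bLambdaP (U : Chart) (s : ℤˣ) : BddOp U s := ⟨opLambdaP U, 1, fun i hi => by
  have : i = 1 ∨ i = 0 := by
    by_contra h
    rw [not_or] at h
    exact hi (by simp [opLambdaP, h.1, h.2])
  rcases Int.units_eq_one_or s with rfl | rfl <;> rcases this with rfl | rfl <;> simp⟩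

/-- `1 - Q Λ⁻¹` as an operator of bounded order. -/
def bOneQ (U : Chart) (s : ℤˣ) : BddOp U s := ⟨opOneQ U, 1, fun i hi => by
  have : i = 0 ∨ i = -1 := by
    by_contra h
    rw [not_or] at h
    exact hi (by simp [opOneQ, h.1, h.2])
  rcases Int.units_eq_one_or s with rfl | rfl <;> rcases this with rfl | rfl <;> simp⟩

/-- `(1 - Q Λ⁻¹)⁻¹` as an operator of bounded order. -/
def bOneQInv (U : Chart) : BddOp U 1 := ⟨opOneQInv U, 0, fun i hi => by
  by_contra h
  exact hi (opOneQInv_pos (by simpa using h))⟩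

/-- `(Λ - P)⁻¹` as an operator of bounded order. -/
def bLambdaPInv (U : Chart) : BddOp U (-1) := ⟨opLambdaPInv U, 0, fun i hi => by
  by_contra h
  exact hi (opLambdaPInv_neg (by simpa using h))⟩

lemma trAdj_bLambdaP {s : ℤˣ} (α : Fin 2) (W : BddOp U s) :
    trAdj α (bLambdaP U s) W = if α = 0 then -W.1 0 else 0 := by
  rw [trAdj, finsum_eq_single _ 0]
  · change adj α (opLambdaP U 0) _ = _
    simp only [opLambdaP, zero_ne_one, if_false, if_true, adj_neg, adj_P, neg_zero, jetShift_zero]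
    split_ifs <;> simp
  · intro n hn
    change adj α (opLambdaP U n) _ = _
    by_cases h : n = 1
    · simp only [opLambdaP, h, if_true, adj_one]
    · simp only [opLambdaP, h, hn, if_false, adj_zero]

lemma trAdj_bOneQ {s : ℤˣ} (α : Fin 2) (W : BddOp U s) :
    trAdj α (bOneQ U s) W = if α = 1 then -jetShift U (-1) (W.1 1) else 0 := by
  rw [trAdj, finsum_eq_single _ (-1)]
  · change adj α (opOneQ U (-1)) _ = _
    simp only [opOneQ, neg_eq_zero, one_ne_zero, if_false, if_true, adj_neg, adj_Q, neg_neg]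
    split_ifs <;> simp
  · intro n hn
    change adj α (opOneQ U n) _ = _
    by_cases h : n = 0
    · simp only [opOneQ, h, if_true, adj_one]
    · simp only [opOneQ, h, hn, if_false, adj_zero]

/-- `A_k = L^k (1 - Q Λ⁻¹)⁻¹`. -/
def opA (U : Chart) (k : ℕ) : ℤ → DiffPoly U :=
  ((bOneQInv U * bLambdaP U 1) ^ k * bOneQInv U).1

/-- `B_k = M^k (Λ - P)⁻¹`. -/
def opB (U : Chart) (k : ℕ) : ℤ → DiffPoly U :=
  ((bLambdaPInv U * bOneQ U (-1)) ^ k * bLambdaPInv U).1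

lemma bOneQ_mul_inv : bOneQ U 1 * bOneQInv U = 1 := Subtype.ext opOneQ_opComp_inv

lemma inv_mul_bOneQ : bOneQInv U * bOneQ U 1 = 1 := Subtype.ext inv_opComp_opOneQ

lemma bLambdaP_mul_inv : bLambdaP U (-1) * bLambdaPInv U = 1 := Subtype.ext opLambdaP_opComp_inv

lemma inv_mul_bLambdaP : bLambdaPInv U * bLambdaP U (-1) = 1 := Subtype.ext inv_opComp_opLambdaP

lemma quot_pow_mul_right {G : Type*} [Monoid G] {a a' b : G} (h : a' * a = 1) (k : ℕ) :
    (a' * b) ^ (k + 1) * a' * a = (a' * b) ^ k * a' * b := by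
  rw [mul_assoc, h, mul_one, pow_succ, mul_assoc]

lemma quot_pow_mul_left {G : Type*} [Monoid G] {a a' b : G} (h : a * a' = 1) (k : ℕ) :
    a * ((a' * b) ^ (k + 1) * a') = b * ((a' * b) ^ k * a') := by
  rw [pow_succ', ← mul_assoc, ← mul_assoc, ← mul_assoc, h, one_mul, mul_assoc]

lemma natCast_mul_eq_smul (n : ℕ) (f : DiffPoly U) : (n : DiffPoly U) * f = (n : ℝ) • f := by
  rw [← nsmul_eq_mul, Nat.cast_smul_eq_nsmul]

/-- In L = (1 - QΛ⁻¹)⁻¹(Λ - P) the variable P occurs only in the numerator and Q only in the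
denominator. So the P-gradient reads off the coefficient of Λ⁰ in A_k and the Q-gradient that of Λ¹
in A_{k+1}. -/
lemma jetVar_opL (k : ℕ) (α : Fin 2) : jetVar (opPow (opL U) (k + 1) 0) α =
    ((k + 1 : ℕ) : ℝ) • ![-opA U k 0, jetShift U (-1) (opA U (k + 1) 1)] α := by
  have h := jetVar_pow α (bOneQInv U * bLambdaP U 1) k
  rw [BddOp.coe_pow] at h
  refine h.trans ?_
  rw [trAdj_quot α bOneQ_mul_inv inv_mul_bOneQ, trAdj_bLambdaP, trAdj_bOneQ, ← Nat.cast_one,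
    ← Nat.cast_add, natCast_mul_eq_smul]
  congr 1
  fin_cases α <;> simp [opA]

/-- In M numerator and denominator are exchanged, whence the opposite sign and the opposite order of
the indices. -/
lemma jetVar_opM (k : ℕ) (α : Fin 2) : jetVar (opPow (opM U) (k + 1) 0) α =
    (-((k + 1 : ℕ) : ℝ)) • ![-opB U (k + 1) 0, jetShift U (-1) (opB U k 1)] α := by
  have h := jetVar_pow α (bLambdaPInv U * bOneQ U (-1)) k
  rw [BddOp.coe_pow] at h
  refine h.trans ?_
  rw [trAdj_quot α bLambdaP_mul_inv inv_mul_bLambdaP, trAdj_bLambdaP, trAdj_bOneQ, ← Nat.cast_one,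
    ← Nat.cast_add, natCast_mul_eq_smul, neg_smul, ← smul_neg]
  congr 1
  fin_cases α <;> simp [opB]

/-- Consecutive operators of the two families: `T' (1 - Q Λ⁻¹) = T (Λ - P)` and
`(1 - Q Λ⁻¹) T' = (Λ - P) T`. -/
structure LaxStep (T T' : ℤ → DiffPoly U) : Prop where
  right : ∀ n, T' n - T' (n + 1) * jetShift U (n + 1) (ofSmooth (fQ U)) =
    T (n - 1) - T n * jetShift U n (ofSmooth (fP U))
  left : ∀ n, T' n - ofSmooth (fQ U) * jetShift U (-1) (T' (n + 1)) =
    jetShift U 1 (T (n - 1)) - ofSmooth (fP U) * T n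

lemma laxStep_opA (k : ℕ) : LaxStep (opA U k) (opA U (k + 1)) where
  right n := by
    have h := congrArg (fun X : BddOp U 1 => X.1 n)
      (quot_pow_mul_right (b := bLambdaP U 1) (inv_mul_bOneQ (U := U)) k)
    exact (opComp_opOneQ _ n).symm.trans (h.trans (opComp_opLambdaP _ n))
  left n := by
    have h := congrArg (fun X : BddOp U 1 => X.1 n)
      (quot_pow_mul_left (b := bLambdaP U 1) (bOneQ_mul_inv (U := U)) k)
    exact (opOneQ_opComp _ n).symm.trans (h.trans (opLambdaP_opComp _ n))

lemma laxStep_opB (k : ℕ) : LaxStep (opB U (k + 1)) (opB U k) where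
  right n := by
    have h := congrArg (fun X : BddOp U (-1) => X.1 n)
      (quot_pow_mul_right (b := bOneQ U (-1)) (inv_mul_bLambdaP (U := U)) k)
    exact (opComp_opOneQ _ n).symm.trans (h.symm.trans (opComp_opLambdaP _ n))
  left n := by
    have h := congrArg (fun X : BddOp U (-1) => X.1 n)
      (quot_pow_mul_left (b := bOneQ U (-1)) (bLambdaP_mul_inv (U := U)) k)
    exact (opOneQ_opComp _ n).symm.trans (h.symm.trans (opLambdaP_opComp _ n))

/-! ## The Lenard recursion -/

lemma LaxStep.jetP1_one {T T' : ℤ → DiffPoly U} (h : LaxStep T T') :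
    jetP1 ![-T 0, jetShift U (-1) (T' 1)] 1 =
      ofSmooth (fQ U) * (T' 0 - jetShift U (-1) (T' 0)) := by
  have r := h.right 0
  have l := congrArg (jetShift U (-1)) (h.left 0)
  rw [AblowitzLadik.jetP1_one]
  simp only [Matrix.cons_val_zero, Matrix.cons_val_one, jetShift_mul, jetShift_sub, jetShift_neg,
    jetShift_one_neg_one, jetShift_neg_one_one, mul_neg, zero_add, zero_sub, jetShift_zero] at *
  linear_combination ofSmooth (fQ U) * (l - r)

lemma LaxStep.jetP1_zero (T T' : ℤ → DiffPoly U) :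
    jetP1 ![-T 0, jetShift U (-1) (T' 1)] 0 = ofSmooth (fP U) *
      (jetShift U 1 (ofSmooth (fQ U)) * T' 1 - ofSmooth (fQ U) * jetShift U (-1) (T' 1)) := by
  rw [AblowitzLadik.jetP1_zero]
  simp only [Matrix.cons_val_one, jetShift_mul, jetShift_one_neg_one, Matrix.cons_val_fin_one]

/-- The left and right step relations at Λ⁰ and Λ⁻¹ eliminate every coefficient other than the ones
occurring in the two gradients. -/
lemma LaxStep.jetP0_eq {T T' T'' : ℤ → DiffPoly U} (h : LaxStep T T') (h' : LaxStep T' T'') :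
    jetP0 ![-T' 0, jetShift U (-1) (T'' 1)] = jetP1 ![-T 0, jetShift U (-1) (T' 1)] := by
  funext α
  fin_cases α
  · change jetP0 _ 0 = jetP1 _ 0
    rw [LaxStep.jetP1_zero, jetP0_zero]
    have r := h.right 0
    have l := h.left 0
    have r' := h'.right 0
    have l' := h'.left 0
    have r1 := congrArg (jetShift U 1) (h.right (-1))
    have l1 := h.left (-1)
    simp only [Matrix.cons_val_zero, Matrix.cons_val_one, jetShift_mul, jetShift_sub, jetShift_neg,
      jetShift_one_neg_one, mul_neg, zero_add, zero_sub, neg_add_cancel, jetShift_zero] at *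
    linear_combination l1 - r1 + r' - l' - ofSmooth (fP U) * (l - r)
  · change jetP0 _ 1 = jetP1 _ 1
    rw [h.jetP1_one, jetP0_one]
    simp only [Matrix.cons_val_zero, jetShift_neg]
    ring

/-! ## Real scalars -/

lemma adj_smul (i : Fin 2) (c : ℝ) (f w : DiffPoly U) : adj i (c • f) w = c • adj i f w := by
  ext1 n
  simp only [adj, adSeries, coeff_conv, PowerSeries.coeff_smul, adHom_add_smul, Finset.smul_sum]

lemma jetVar_smul (c : ℝ) (f : DiffPoly U) (i : Fin 2) : jetVar (c • f) i = c • jetVar f i := by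
  simp only [jetVar_eq, adj_smul]

lemma jetShift_smul (m : ℤ) (c : ℝ) (f : DiffPoly U) :
    jetShift U m (c • f) = c • jetShift U m f := by
  ext1 n
  simp only [jetShift, shift, PowerSeries.coeff_mk, PowerSeries.coeff_smul, map_smul,
    Finset.smul_sum]
  exact Finset.sum_congr rfl fun _ _ => smul_comm _ _ _

lemma jetP0_smul (c : ℝ) (ξ : Fin 2 → DiffPoly U) (α : Fin 2) :
    jetP0 (fun β => c • ξ β) α = c • jetP0 ξ α := by
  fin_cases α
  · change jetP0 _ 0 = c • jetP0 _ 0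
    simp only [jetP0_zero, mul_smul_comm, jetShift_smul, smul_add, smul_sub]
  · change jetP0 _ 1 = c • jetP0 _ 1
    simp only [jetP0_one, mul_smul_comm, jetShift_smul, smul_sub, mul_sub]

lemma jetP1_smul (c : ℝ) (ξ : Fin 2 → DiffPoly U) (α : Fin 2) :
    jetP1 (fun β => c • ξ β) α = c • jetP1 ξ α := by
  fin_cases α
  · change jetP1 _ 0 = c • jetP1 _ 0
    simp only [jetP1_zero, mul_smul_comm, jetShift_smul, smul_sub, mul_sub]
  · change jetP1 _ 1 = c • jetP1 _ 1
    simp only [jetP1_one, mul_smul_comm, jetShift_smul, smul_add, smul_sub, mul_sub]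

/-! ## The densities of the Ablowitz-Ladik hierarchy -/

lemma opL_zero : opL U 0 = ofSmooth (fQ U) - ofSmooth (fP U) := by
  have h1 := opOneQInv_neg (U := U) 1
  have h0 := opOneQInv_neg (U := U) 0
  simp only [Nat.cast_one, Finset.range_one, Finset.prod_singleton, Nat.cast_zero, neg_zero,
    jetShift_zero, Finset.range_zero, Finset.prod_empty] at h1 h0
  rw [opL, opComp_opLambdaP, zero_sub, h1, h0, jetShift_zero, one_mul]

lemma opM_zero : opM U 0 = -ofSmooth (fPinv U) +
    ofSmooth (fPinv U) * jetShift U 1 (ofSmooth (fPinv U)) * jetShift U 1 (ofSmooth (fQ U)) := by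
  have h1 := opLambdaPInv_nat (U := U) 1
  have h0 := opLambdaPInv_nat (U := U) 0
  simp only [Nat.cast_one, Finset.range_one, Finset.prod_singleton, Nat.cast_zero, zero_add,
    jetShift_zero, Finset.prod_range_succ] at h1 h0
  rw [opM, opComp_opOneQ, zero_add, h1, h0]
  ring

lemma IsTauStructure.two_zero {h : Idx → DiffPoly U} {Ω : Idx → Idx → DiffPoly U}
    (H : IsTauStructure h Ω) : h (.two 0) = ofSmooth (fQ U) - ofSmooth (fP U) := by
  rw [H.two, zero_add, opPow, opPow, ← opL_zero]
  change (1 / ((1 : ℕ).factorial : ℝ)) • opComp (opL U) (opOne U) 0 = _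
  rw [opComp_opOne]
  simp

lemma IsTauStructure.zero_neg_one {h : Idx → DiffPoly U} {Ω : Idx → Idx → DiffPoly U}
    (H : IsTauStructure h Ω) : h (.zero (-1)) = ofSmooth (fPinv U) -
      ofSmooth (fPinv U) * jetShift U 1 (ofSmooth (fPinv U)) * jetShift U 1 (ofSmooth (fQ U)) := by
  have := H.zero_neg 1 le_rfl
  rw [opPow, opPow] at this
  rw [Nat.cast_one] at this
  rw [this]
  change _ • opComp (opM U) (opOne U) 0 = _
  rw [opComp_opOne, opM_zero]
  simp only [pow_one, Nat.sub_self, Nat.factorial_zero, Nat.cast_one, mul_one, neg_smul, one_smul]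
  ring

lemma epsOp_todd_eq : (PowerSeries.mk fun n => ((bernoulli' n : ℝ) / (n.factorial : ℝ)) :
    PowerSeries ℝ) * (1 - expSeries (-1)) = PowerSeries.X := by
  have h := bernoulli'PowerSeries_mul_exp_sub_one ℝ
  have e : (bernoulli'PowerSeries ℝ) =
      PowerSeries.mk fun n => ((bernoulli' n : ℝ) / (n.factorial : ℝ)) := by
    ext n
    simp [bernoulli'PowerSeries]
  have h2 : expSeries 1 * expSeries (-1) = 1 := by
    rw [← expSeries_add]
    exact expSeries_zero
  have h3 : expSeries 1 = PowerSeries.exp ℝ := by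
    simp [expSeries]
  rw [e, ← h3] at h
  linear_combination expSeries (-1) * h + (PowerSeries.X - PowerSeries.mk fun n => ((bernoulli' n : ℝ) / (n.factorial : ℝ))) * h2

/-- The generating series of the Bernoulli numbers, `z / (1 - e^{-z})`. -/
def toddSeries : PowerSeries ℝ := PowerSeries.mk fun n => (bernoulli' n : ℝ) / (n.factorial : ℝ)

lemma toddSeries_mul : toddSeries * (1 - expSeries (-1)) = PowerSeries.X := epsOp_todd_eq

lemma density00_eq : density00 U = epsOp (jetDx U) toddSeries (ofSmooth (fLogQP U)) := by
  rw [ofSmooth, epsOp_C]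
  simp only [toddSeries, PowerSeries.coeff_mk]
  rfl

lemma epsOp_todd_sub (f : DiffPoly U) :
    epsOp (jetDx U) toddSeries (f - jetShift U (-1) f) = PowerSeries.X * epsMap (jetDx U) f := by
  rw [← epsOp_X, ← toddSeries_mul, epsOp_mul, epsOp_sub, epsOp_one, jetShift, shift_eq]

lemma epsOp_todd_injective {f g : DiffPoly U}
    (h : epsOp (jetDx U) toddSeries f = epsOp (jetDx U) toddSeries g) : f = g := by
  have h2 : toddSeries⁻¹ * toddSeries = 1 := PowerSeries.inv_mul_cancel _ (by
    rw [← PowerSeries.coeff_zero_eq_constantCoeff_apply]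
    simp [toddSeries])
  rw [← epsOp_one (jetDx U) f, ← h2, epsOp_mul, h, ← epsOp_mul, h2, epsOp_one]

/-- All terms of the Todd series except the constant one are total derivatives and have no
variational derivative. -/
lemma jetVar_density00 (i : Fin 2) :
    jetVar (density00 U) i = ofSmooth (partialSmooth U i (fLogQP U)) := by
  ext1 n
  have e : PowerSeries.coeff n (jetVar (density00 U) i) =
      adHom i (jetDx U) (PowerSeries.coeff n (density00 U)) 1 := by
    simp [jetVar, epsVarDeriv, varDeriv, adHom]
  rw [e, density00, PowerSeries.coeff_mk, adHom_smul_left, adHom_dx_pow i isDxModule_jetDx,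
    ofSmooth]
  cases n with
  | zero => simp [adHom_C]
  | succ n =>
    have h1 : jetDx U 1 = 0 := jetDx_one
    rw [pow_succ (jetDx U), Module.End.mul_apply, h1]
    simp

/-! ## The flows preserve the second Hamiltonian structure -/

lemma PreservesP1.of_eq {V : Fin 2 → DiffPoly U} (k : DiffPoly U)
    (h : ∀ α, PowerSeries.X * V α = jetP1 (jetVar k) α) : PreservesP1 V := by
  refine PreservesP1.of_X_mul ?_
  rw [funext h]
  exact preservesP1_jetP1 k

/-- One step of the Lenard chain of L. The gradient of Res L^{k+1} carries the factor k + 1, so with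
the normalization 1/(p + 1) both gradients have the coefficient 1/(p + 1)!. -/
lemma IsTauStructure.flow_two {h : Idx → DiffPoly U} {Ω : Idx → Idx → DiffPoly U}
    (H : IsTauStructure h Ω) (p : ℕ) (α : Fin 2) : PowerSeries.X * flow h (.two p) α =
      jetP1 (jetVar ((1 / (p + 1 : ℝ)) • h (.two p))) α := by
  have e1 : jetVar (h (.two (p + 1))) = fun β => (1 / ((p + 1).factorial : ℝ)) •
      ![-opA U (p + 1) 0, jetShift U (-1) (opA U (p + 1 + 1) 1)] β := by
    funext β
    have := jetVar_opL (U := U) (p + 1) β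
    rw [H.two, jetVar_smul, this, smul_smul]
    congr 1
    rw [Nat.factorial_succ (p + 1)]
    have : ((p + 1).factorial : ℝ) ≠ 0 := by positivity
    push_cast
    field_simp
  have e2 : jetVar ((1 / (p + 1 : ℝ)) • h (.two p)) = fun β => (1 / ((p + 1).factorial : ℝ)) •
      ![-opA U p 0, jetShift U (-1) (opA U (p + 1) 1)] β := by
    funext β
    have := jetVar_opL (U := U) p β
    rw [jetVar_smul, H.two, jetVar_smul, this, smul_smul, smul_smul]
    congr 1
    have : ((p + 1).factorial : ℝ) ≠ 0 := by positivity
    push_cast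
    field_simp
  change PowerSeries.X * hamField (h (.two (p + 1))) α = _
  rw [X_mul_hamField, e1, e2, jetP0_smul, jetP1_smul,
    LaxStep.jetP0_eq (laxStep_opA p) (laxStep_opA (p + 1))]

/-- The chain of M runs in the other direction: the flow with Hamiltonian ∫ Res M^{k+1} with respect
to 𝒫₀ has a multiple of ∫ Res M^{k+2} as Hamiltonian with respect to 𝒫₁. The index -(k+2) appears
because the flow (0, q) is generated by h_{0,q+1}. -/
lemma IsTauStructure.flow_zero_neg {h : Idx → DiffPoly U} {Ω : Idx → Idx → DiffPoly U}
    (H : IsTauStructure h Ω) (k : ℕ) :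
    ∃ f, ∀ α, PowerSeries.X * flow h (.zero (-(k + 2 : ℕ))) α = jetP1 (jetVar f) α := by
  obtain ⟨c, hc⟩ : ∃ c : ℝ, h (.zero (-((k + 1 : ℕ) : ℤ))) = c • opPow (opM U) (k + 1) 0 :=
    ⟨_, H.zero_neg (k + 1) (by omega)⟩
  -- The factor compensates the exponents k + 1 and k + 2, which both gradients acquire by
  -- differentiation.
  refine ⟨(c * (k + 1) / (k + 2)) • opPow (opM U) (k + 1 + 1) 0, fun α => ?_⟩
  have e1 : jetVar (h (.zero (-((k + 1 : ℕ) : ℤ)))) = fun β => (-(c * (k + 1))) •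
      ![-opB U (k + 1) 0, jetShift U (-1) (opB U k 1)] β := by
    funext β
    have := jetVar_opM (U := U) k β
    rw [hc, jetVar_smul, this, smul_smul]
    congr 1
    push_cast
    ring
  have e2 : jetVar ((c * (k + 1) / (k + 2)) • opPow (opM U) (k + 1 + 1) 0) =
      fun β => (-(c * (k + 1))) •
      ![-opB U (k + 1 + 1) 0, jetShift U (-1) (opB U (k + 1) 1)] β := by
    funext β
    have := jetVar_opM (U := U) (k + 1) β
    rw [jetVar_smul, this, smul_smul]
    congr 1
    have : (k + 2 : ℝ) ≠ 0 := by positivity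
    push_cast
    field_simp
    ring
  change PowerSeries.X * hamField (h (.zero (-((k + 2 : ℕ) : ℤ) + 1))) α = _
  rw [show -((k + 2 : ℕ) : ℤ) + 1 = -((k + 1 : ℕ) : ℤ) by push_cast; ring,
    X_mul_hamField, e1, e2, jetP0_smul, jetP1_smul,
    LaxStep.jetP0_eq (laxStep_opB (k + 1)) (laxStep_opB k)]

lemma ofSmooth_Q_mul_inv : ofSmooth (fQ U) * ofSmooth (fQinv U) = 1 := by
  rw [← ofSmooth_mul, fQ_mul_fQinv, ofSmooth_one]

lemma IsTauStructure.flow_zero_neg_one_one {h : Idx → DiffPoly U} {Ω : Idx → Idx → DiffPoly U}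
    (H : IsTauStructure h Ω) : PowerSeries.X * flow h (.zero (-1)) 1 =
      ofSmooth (fQ U) * (ofSmooth (fPinv U) - jetShift U (-1) (ofSmooth (fPinv U))) := by
  change PowerSeries.X * hamField (h (.zero (-1 + 1))) 1 = _
  rw [neg_add_cancel, X_mul_hamField, jetP0_one, H.zero_zero, jetVar_density00,
    partialSmooth_fLogQP, if_pos rfl, ofSmooth_neg, jetShift_neg]
  ring

lemma IsTauStructure.flow_zero_neg_one_zero {h : Idx → DiffPoly U} {Ω : Idx → Idx → DiffPoly U}
    (H : IsTauStructure h Ω) : PowerSeries.X * flow h (.zero (-1)) 0 =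
      jetShift U 1 (ofSmooth (fQ U)) * jetShift U 1 (ofSmooth (fPinv U)) -
        ofSmooth (fQ U) * jetShift U (-1) (ofSmooth (fPinv U)) := by
  change PowerSeries.X * hamField (h (.zero (-1 + 1))) 0 = _
  rw [neg_add_cancel, X_mul_hamField, jetP0_zero, H.zero_zero, jetVar_density00, jetVar_density00,
    partialSmooth_fLogQP, partialSmooth_fLogQP, if_pos rfl, if_neg one_ne_zero, ofSmooth_neg,
    ofSmooth_Q_mul_inv, jetShift_neg, mul_neg, mul_neg, jetShift_neg, jetShift_one, jetShift_mul]
  ring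

/-- The start of the chain of M, where the 𝒫₀-Hamiltonian is ∫(log Q - log P) and not the residue of
a power. It is checked by computing both fields. -/
lemma IsTauStructure.flow_zero_neg_one {h : Idx → DiffPoly U} {Ω : Idx → Idx → DiffPoly U}
    (H : IsTauStructure h Ω) (α : Fin 2) :
    PowerSeries.X * flow h (.zero (-1)) α = jetP1 (jetVar (opPow (opM U) (0 + 1) 0)) α := by
  have e2 : jetVar (opPow (opM U) (0 + 1) 0) = fun β => (-1 : ℝ) •
      ![-opB U 1 0, jetShift U (-1) (opB U 0 1)] β := by
    funext β
    have := jetVar_opM (U := U) 0 β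
    rw [this]
    simp
  have hB : ∀ n, opB U 0 n = opLambdaPInv U n := by
    intro n
    rw [opB, pow_zero, one_mul]
    rfl
  have h1 := opLambdaPInv_nat (U := U) 1
  have h0 := opLambdaPInv_nat (U := U) 0
  simp only [Nat.cast_one, Finset.range_one, Finset.prod_singleton, Nat.cast_zero, zero_add,
    jetShift_zero, Finset.prod_range_succ] at h1 h0
  rw [e2, jetP1_smul]
  fin_cases α
  · change PowerSeries.X * flow h (.zero (-1)) 0 = _ • jetP1 _ 0
    rw [LaxStep.jetP1_zero, H.flow_zero_neg_one_zero, hB, h1, jetShift_neg, jetShift_mul,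
      jetShift_neg_one_one]
    rw [neg_smul, one_smul]
    linear_combination -(jetShift U 1 (ofSmooth (fQ U)) * jetShift U 1 (ofSmooth (fPinv U)) -
        ofSmooth (fQ U) * jetShift U (-1) (ofSmooth (fPinv U))) * ofSmooth_P_mul_inv (U := U)
  · change PowerSeries.X * flow h (.zero (-1)) 1 = _ • jetP1 _ 1
    rw [(laxStep_opB 0).jetP1_one, H.flow_zero_neg_one_one, hB, h0, jetShift_neg]
    rw [neg_smul, one_smul]
    ring

/-- The Ablowitz-Ladik flows are Hamiltonian with respect to 𝒫₁ by the Lenard chains. For the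
remaining flows the statement is the bihamiltonian hypothesis at the next index. -/
lemma IsTauStructure.preservesP1 {h : Idx → DiffPoly U} {Ω : Idx → Idx → DiffPoly U}
    (H : IsTauStructure h Ω) (i : Idx) : PreservesP1 (flow h i) := by
  rcases i with k | k | k
  · rcases lt_trichotomy k (-1) with hk | rfl | hk
    · obtain ⟨n, rfl⟩ : ∃ n : ℕ, k = -((n + 2 : ℕ) : ℤ) := ⟨(-k - 2).toNat, by omega⟩
      obtain ⟨f, hf⟩ := H.flow_zero_neg n
      exact PreservesP1.of_eq f hf
    · exact PreservesP1.of_eq _ H.flow_zero_neg_one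
    · obtain ⟨n, rfl⟩ : ∃ n : ℕ, k = n := ⟨k.toNat, by omega⟩
      exact H.zero_biham (n + 1) (by omega)
  · exact H.one_biham (k + 1)
  · exact PreservesP1.of_eq _ (H.flow_two k)

/-! ## Commutativity of the flows -/

/-- Existence of Ω makes ε∂h_j/∂t^i a difference (Λ - 1)Ω, which has no variational derivative: the
Hamiltonians are in involution. -/
lemma IsTauStructure.jetVar_evolve_eq_zero {h : Idx → DiffPoly U} {Ω : Idx → Idx → DiffPoly U}
    (H : IsTauStructure h Ω) (i j : Idx) (α : Fin 2) : jetVar (evolve (flow h i) (h j)) α = 0 := by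
  refine X_mul_cancel ?_
  rw [jetVar_eq, ← adj_X_mul, ← H.omega, adj_sub, ← jetVar_eq, ← jetVar_eq, jetVar_jetShift,
    sub_self, mul_zero]

/-! ## The translation flow -/

/-- The vector field `∂u/∂t = u_x`. -/
def translation (U : Chart) : Fin 2 → DiffPoly U :=
  ![epsMap (jetDx U) (ofSmooth (fP U)), epsMap (jetDx U) (ofSmooth (fQ U))]

lemma isADer_dx : IsADer (U := U) (RingHom.id _) (epsMap (jetDx U)) (epsMap (jetDx U)) where
  mul f g := by
    simp only [epsMap_mul jetDx_mul, RingHom.id_apply]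
    ring
  X_mul f := by simp only [epsMap_X_mul, RingHom.id_apply]
  dx f := rfl
  smooth f := by
    simp only [RingHom.id_apply, ofSmooth, epsMap_C, jetDx_C, Fin.sum_univ_two, partialSmooth_fP,
      partialSmooth_fQ, ← map_mul, ← map_add]
    congr 1
    simp
    ring

lemma evolve_translation (f : DiffPoly U) : evolve (translation U) f = epsMap (jetDx U) f := by
  rw [← evolveHom_apply]
  refine IsADer.ext (j := RingHom.id _) rfl (isADer_evolveHom _) isADer_dx ?_ ?_ f
  · rw [evolveHom_apply, evolve_P]; rfl
  · rw [evolveHom_apply, evolve_Q]; rfl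

lemma evolve_density00 (V : Fin 2 → DiffPoly U) : evolve V (density00 U) =
    epsOp (jetDx U) toddSeries
      (ofSmooth (fQinv U) * V 1 - ofSmooth (fPinv U) * V 0) := by
  rw [density00_eq, evolve_epsOp, evolve_ofSmooth, partialSmooth_fLogQP, partialSmooth_fLogQP,
    if_pos rfl, if_neg one_ne_zero, ofSmooth_neg,
    neg_mul, neg_add_eq_sub]

/-- The Todd operator composed with 1 - Λ⁻¹ is ε∂_x. So a time derivative of log Q - log P that is a
difference (1 - Λ⁻¹)f turns into ∂_x f. -/
lemma evolve_density00_of_eq (V : Fin 2 → DiffPoly U) (f : DiffPoly U)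
    (h : PowerSeries.X * (ofSmooth (fQinv U) * V 1 - ofSmooth (fPinv U) * V 0) =
      f - jetShift U (-1) f) : evolve V (density00 U) = epsMap (jetDx U) f := by
  refine X_mul_cancel ?_
  rw [evolve_density00, ← epsOp_X_mul, h, epsOp_todd_sub]

lemma evolve_fPinv (V : Fin 2 → DiffPoly U) :
    evolve V (ofSmooth (fPinv U)) = -(ofSmooth (fPinv U) * ofSmooth (fPinv U)) * V 0 := by
  have h := congrArg (evolve V) (ofSmooth_P_mul_inv (U := U))
  have h1 : evolve V (1 : DiffPoly U) = 0 := by simpa using evolve_mul V 1 1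
  rw [evolve_mul, evolve_P, h1] at h
  linear_combination ofSmooth (fPinv U) * h - evolve V (ofSmooth (fPinv U)) *
    ofSmooth_P_mul_inv (U := U)

lemma ofSmooth_QP_mul_inv : (ofSmooth (fQ U) - ofSmooth (fP U)) * ofSmooth (fQPinv U) = 1 := by
  rw [← ofSmooth_sub, ← ofSmooth_mul, fQP_mul_fQPinv, ofSmooth_one]

/-! ### Flows of the hierarchy expressed through `h` and `Ω` -/

section Tau

variable {h : Idx → DiffPoly U} {Ω : Idx → Idx → DiffPoly U}

lemma jetVar_P (α : Fin 2) : jetVar (ofSmooth (fP U)) α = if α = 0 then 1 else 0 := by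
  rw [jetVar_eq, adj_P]

lemma jetVar_Q (α : Fin 2) : jetVar (ofSmooth (fQ U)) α = if α = 1 then 1 else 0 := by
  rw [jetVar_eq, adj_Q]

lemma IsTauStructure.flow_two_zero (H : IsTauStructure h Ω) : PowerSeries.X *
    (ofSmooth (fQinv U) * flow h (.two 0) 1 - ofSmooth (fPinv U) * flow h (.two 0) 0) =
      (ofSmooth (fQ U) - ofSmooth (fP U)) -
        jetShift U (-1) (ofSmooth (fQ U) - ofSmooth (fP U)) := by
  have e : ∀ α, jetVar ((1 / ((0 : ℕ) + 1 : ℝ)) • h (.two 0)) α = ![-1, 1] α := by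
    intro α
    rw [jetVar_smul, H.two_zero, jetVar_eq, adj_sub, ← jetVar_eq, ← jetVar_eq, jetVar_P, jetVar_Q]
    fin_cases α <;> simp
  have h0 := H.flow_two 0 0
  have h1 := H.flow_two 0 1
  rw [jetP1_zero, e] at h0
  rw [jetP1_one, e, e] at h1
  simp only [Matrix.cons_val_zero, Matrix.cons_val_one, mul_one, mul_neg, jetShift_neg] at h0 h1
  rw [mul_sub, mul_left_comm, h1, mul_left_comm, h0, jetShift_sub]
  linear_combination (-ofSmooth (fP U) - -jetShift U (-1) (ofSmooth (fP U)) +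
    (jetShift U 1 (ofSmooth (fQ U)) - jetShift U (-1) (ofSmooth (fQ U)))) *
      ofSmooth_Q_mul_inv (U := U) -
    (jetShift U 1 (ofSmooth (fQ U)) - ofSmooth (fQ U)) * ofSmooth_P_mul_inv (U := U)

lemma IsTauStructure.flow_zero_neg_one_log (H : IsTauStructure h Ω) : PowerSeries.X *
    (ofSmooth (fQinv U) * flow h (.zero (-1)) 1 - ofSmooth (fPinv U) * flow h (.zero (-1)) 0) =
      h (.zero (-1)) - jetShift U (-1) (h (.zero (-1))) := by
  rw [mul_sub, mul_left_comm, H.flow_zero_neg_one_one,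
    mul_left_comm PowerSeries.X (ofSmooth (fPinv U)), H.flow_zero_neg_one_zero,
    H.zero_neg_one, jetShift_sub, jetShift_mul, jetShift_mul, jetShift_neg_one_one,
    jetShift_neg_one_one]
  linear_combination (ofSmooth (fPinv U) - jetShift U (-1) (ofSmooth (fPinv U))) *
    ofSmooth_Q_mul_inv (U := U)

lemma shift_add_eq_zero {f : DiffPoly U} (hf : jetShift U 1 f + f = 0) : f = 0 := by
  obtain ⟨φ, hφ⟩ := exists_inv_shift_add (jetDx U)
  have := hφ f
  change epsOp (jetDx U) φ (jetShift U 1 f + f) = f at this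
  rw [← this, hf, map_zero]

/-- The density h_{0,1} is not given explicitly. Tau symmetry replaces ∂h_{2,0}/∂t^{0,0} and
∂h_{0,-1}/∂t^{0,0} by derivatives of h_{0,0} along the explicit flows (2,0) and (0,-1), which turn
out to be the x-derivatives of the same densities. The difference Z from the translation therefore
kills h_{2,0} and h_{0,-1}. -/
lemma IsTauStructure.flow_zero_zero (H : IsTauStructure h Ω) :
    flow h (.zero 0) = translation U := by
  set Z : Fin 2 → DiffPoly U := fun α => flow h (.zero 0) α - translation U α with hZ
  have hev : ∀ f, evolve Z f = evolve (flow h (.zero 0)) f - epsMap (jetDx U) f := by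
    intro f
    rw [hZ, evolve_left_sub, evolve_translation]
  have t1 : evolve Z (h (.two 0)) = 0 := by
    rw [hev, ← H.tau_symm, H.zero_zero,
      evolve_density00_of_eq _ _ H.flow_two_zero, H.two_zero, sub_self]
  have t2 : evolve Z (h (.zero (-1))) = 0 := by
    rw [hev, ← H.tau_symm (.zero 0) (.zero (-1)), H.zero_zero,
      evolve_density00_of_eq _ _ H.flow_zero_neg_one_log, sub_self]
  rw [H.two_zero, evolve_sub, evolve_P, evolve_Q] at t1
  rw [H.zero_neg_one, evolve_sub, evolve_mul, evolve_mul, evolve_jetShift, evolve_jetShift,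
    evolve_fPinv, evolve_Q, sub_eq_zero.1 t1, jetShift_mul, jetShift_neg, jetShift_mul] at t2
  have hu := jetShift_P_mul_inv (U := U) 1
  have hu' := congrArg (jetShift U 1) (ofSmooth_QP_mul_inv (U := U))
  rw [jetShift_mul, jetShift_sub, jetShift_one] at hu'
  -- As Z kills Q - P, its components coincide, and Z h_{0,-1} = 0 factors as (p w + s Z₀)·s(1 - p
  -- q) = 0, where p, q, w are the shifts of 1/P, Q, Z₀ and s = 1/P. The factor 1 - p q is the shift
  -- of (P - Q)/P, hence invertible.
  have hw : jetShift U 1 (ofSmooth (fPinv U) * Z 0) + ofSmooth (fPinv U) * Z 0 = 0 := by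
    rw [jetShift_mul]
    generalize jetShift U 1 (ofSmooth (fPinv U)) = p at *
    generalize jetShift U 1 (ofSmooth (fQ U)) = q at *
    generalize jetShift U 1 (Z 0) = w at *
    generalize jetShift U 1 (ofSmooth (fP U)) = p' at *
    generalize jetShift U 1 (ofSmooth (fQPinv U)) = r at *
    have hP := ofSmooth_P_mul_inv (U := U)
    generalize ofSmooth (fPinv U) = s at *
    generalize ofSmooth (fP U) = s' at *
    have e : (p * w + s * Z 0) * (s * (1 - p * q)) = 0 := by
      linear_combination -t2
    have e2 : (1 - p * q) * (p' * r) = -1 := by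
      linear_combination -hu' - q * r * hu
    calc p * w + s * Z 0 = -((p * w + s * Z 0) * (s * (1 - p * q))) * (s' * (p' * r)) := by
          linear_combination (-(p * w + s * Z 0)) * hP -
            (-(p * w + s * Z 0) * (s' * s)) * e2
      _ = 0 := by rw [e]; ring
  -- Now (Λ + 1)(Z₀/P) = 0, and Λ + 1 is injective.
  have h0 : Z 0 = 0 := by
    have := shift_add_eq_zero hw
    calc Z 0 = ofSmooth (fP U) * (ofSmooth (fPinv U) * Z 0) := by
          rw [← mul_assoc, ofSmooth_P_mul_inv, one_mul]
      _ = 0 := by rw [this, mul_zero]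
  funext α
  rw [← sub_eq_zero]
  change Z α = 0
  fin_cases α
  · exact h0
  · change Z 1 = 0
    rw [sub_eq_zero.1 t1, h0]

/-- `ε ∂(log Q - log P)/∂t^i = (1 - Λ⁻¹) h_i`. -/
lemma IsTauStructure.flow_log (H : IsTauStructure h Ω) (i : Idx) : PowerSeries.X *
    (ofSmooth (fQinv U) * flow h i 1 - ofSmooth (fPinv U) * flow h i 0) =
      h i - jetShift U (-1) (h i) := by
  -- After the Todd operator is applied, both sides become ε times a derivative: ∂h_{0,0}/∂t^i on
  -- the left, and ∂_x h_i = ∂h_i/∂t^{0,0} on the right.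
  refine epsOp_todd_injective ?_
  rw [epsOp_X_mul, ← evolve_density00, epsOp_todd_sub, ← H.zero_zero, H.tau_symm,
    H.flow_zero_zero, evolve_translation]

/-- `ε ∂(Q - P)/∂t^i = (Λ - 1) Ω_{2,0;i}`. -/
lemma IsTauStructure.flow_sub (H : IsTauStructure h Ω) (i : Idx) :
    PowerSeries.X * (flow h i 1 - flow h i 0) =
      jetShift U 1 (Ω (.two 0) i) - Ω (.two 0) i := by
  rw [H.omega, H.two_zero, evolve_sub, evolve_P, evolve_Q]

/-- `flow_sub` and `flow_log` form a linear system for the two components of the flow with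
determinant (Q - P)/(PQ). -/
lemma IsTauStructure.flow_P (H : IsTauStructure h Ω) (i : Idx) :
    PowerSeries.X * flow h i 0 = rhsP h Ω i := by
  rw [rhsP, ← H.flow_sub, ← H.flow_log, ofSmooth_mul]
  linear_combination (-PowerSeries.X * flow h i 0) * ofSmooth_QP_mul_inv (U := U) +
    PowerSeries.X * ofSmooth (fP U) * ofSmooth (fQPinv U) * flow h i 1 *
      ofSmooth_Q_mul_inv (U := U) - PowerSeries.X * ofSmooth (fQ U) * ofSmooth (fQPinv U) *
      flow h i 0 * ofSmooth_P_mul_inv (U := U)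

lemma IsTauStructure.flow_Q (H : IsTauStructure h Ω) (i : Idx) :
    PowerSeries.X * flow h i 1 = rhsQ h Ω i := by
  rw [rhsQ, ← H.flow_sub, ← H.flow_log, ofSmooth_mul]
  linear_combination (-PowerSeries.X * flow h i 1) * ofSmooth_QP_mul_inv (U := U) +
    PowerSeries.X * ofSmooth (fP U) * ofSmooth (fQPinv U) * flow h i 1 *
      ofSmooth_Q_mul_inv (U := U) - PowerSeries.X * ofSmooth (fQ U) * ofSmooth (fQPinv U) *
      flow h i 0 * ofSmooth_P_mul_inv (U := U)

lemma IsTauStructure.evolve_flow_comm (H : IsTauStructure h Ω) (i j : Idx) (α : Fin 2) :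
    evolve (flow h i) (flow h j α) = evolve (flow h j) (flow h i α) :=
  evolve_hamField_comm (fun β => H.jetVar_evolve_eq_zero i j.next β) α

lemma IsTauStructure.evolve_grad_comm (H : IsTauStructure h Ω) (i j : Idx) :
    evolve (flow h i) (jetVar (h j.next) 0) = evolve (flow h j) (jetVar (h i.next) 0) :=
  evolve_jetVar_zero_comm (fun β => H.jetVar_evolve_eq_zero i j.next β)

lemma IsTauStructure.evolve_grad_sum_comm (H : IsTauStructure h Ω) (i j : Idx) :
    evolve (flow h i) (ofSmooth (fQ U) * (jetVar (h j.next) 0 + jetVar (h j.next) 1)) =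
      evolve (flow h j) (ofSmooth (fQ U) * (jetVar (h i.next) 0 + jetVar (h i.next) 1)) :=
  evolve_jetVar_sum_comm (fun β => H.jetVar_evolve_eq_zero i j.next β)

end Tau

/-! The additive group structures of super differential polynomials are taken from the ring
structures. -/

/-- The additive group of the ring `Super U`. -/
abbrev superAddCommGroup : AddCommGroup (Super U) := Ring.toAddCommGroup

attribute [local instance] superAddCommGroup

/-- The additive group of the ring `SuperPoly U`. -/
abbrev superPolyAddCommGroup : AddCommGroup (SuperPoly U) := Ring.toAddCommGroup

/-- The negation of the ring `SuperPoly U`. -/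
abbrev superPolyDistribNeg : HasDistribNeg (SuperPoly U) :=
  NonUnitalNonAssocRing.toHasDistribNeg

attribute [local instance] superPolyAddCommGroup superPolyDistribNeg

/-- The negation of the ring `SuperPoly U`. -/
abbrev superPolyNeg : Neg (SuperPoly U) := superPolyDistribNeg.toInvolutiveNeg.toNeg

/-- The subtraction of the ring `SuperPoly U`. -/
abbrev superPolySub : Sub (SuperPoly U) := Ring.toSub

attribute [local instance] superPolyNeg superPolySub

/-! ## The differential algebra of super differential polynomials -/

lemma grassDual_ι (v : OddIdx →₀ ℝ) : grassDual (ExteriorAlgebra.ι ℝ v) =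
    TrivSqZeroExt.inl (ExteriorAlgebra.ι ℝ v) +
      TrivSqZeroExt.inr (ExteriorAlgebra.ι ℝ (oddShift v)) :=
  ExteriorAlgebra.lift_ι_apply ℝ _ _ v

lemma fst_grassDual (g : Grass) : (grassDual g).fst = g := by
  have h : (TrivSqZeroExt.fstHom ℝ Grass Grass).comp grassDual = AlgHom.id ℝ Grass := by
    refine ExteriorAlgebra.hom_ext (LinearMap.ext fun v => ?_)
    change (grassDual (ExteriorAlgebra.ι ℝ v)).fst = ExteriorAlgebra.ι ℝ v
    simp [grassDual_ι]
  exact congrArg (fun F : Grass →ₐ[ℝ] Grass => F g) h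

/-- The map g ↦ g + δ∂_x g is an algebra homomorphism whose first component is the identity; the
Leibniz rule is its δ-component. -/
lemma grassDx_mul (a b : Grass) : grassDx (a * b) = grassDx a * b + a * grassDx b := by
  change (grassDual (a * b)).snd = (grassDual a).snd * b + a * (grassDual b).snd
  rw [map_mul, TrivSqZeroExt.snd_mul, fst_grassDual, fst_grassDual, smul_eq_mul,
    MulOpposite.smul_eq_mul_unop, MulOpposite.unop_op, add_comm]

lemma grassDx_ι (v : OddIdx →₀ ℝ) :
    grassDx (ExteriorAlgebra.ι ℝ v) = ExteriorAlgebra.ι ℝ (oddShift v) := by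
  change (grassDual (ExteriorAlgebra.ι ℝ v)).snd = _
  simp [grassDual_ι]

lemma grassDx_algebraMap (c : ℝ) : grassDx (algebraMap ℝ Grass c) = 0 := by
  have h1 : grassDx 1 = 0 := by simpa using grassDx_mul 1 1
  rw [Algebra.algebraMap_eq_smul_one, map_smul, h1, smul_zero]

lemma superDx_tmul (f : Jet U) (g : Grass) :
    superDx U (f ⊗ₜ g) = jetDx U f ⊗ₜ g + f ⊗ₜ grassDx g := by
  simp [superDx]

lemma superDx_mul (a b : Super U) : superDx U (a * b) = superDx U a * b + a * superDx U b := by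
  induction a using TensorProduct.induction_on with
  | zero => simp
  | add x y hx hy => simp only [add_mul, map_add, hx, hy]; abel
  | tmul f g =>
    induction b using TensorProduct.induction_on with
    | zero => simp
    | add x y hx hy => simp only [mul_add, map_add, hx, hy]; abel
    | tmul f' g' =>
      simp only [Algebra.TensorProduct.tmul_mul_tmul, superDx_tmul, jetDx_mul, grassDx_mul,
        add_mul, mul_add, TensorProduct.add_tmul, TensorProduct.tmul_add]
      abel

lemma smul_super (f : Jet U) (w : Super U) : f • w = (f ⊗ₜ[ℝ] (1 : Grass)) * w := by
  induction w using TensorProduct.induction_on with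
  | zero => simp
  | add x y hx hy => rw [smul_add, mul_add, hx, hy]
  | tmul f' g' => rw [TensorProduct.smul_tmul', Algebra.TensorProduct.tmul_mul_tmul, one_mul,
      smul_eq_mul]

lemma isDxModule_superDx : IsDxModule (U := U) (superDx U) := by
  intro f w
  rw [smul_super, superDx_mul, superDx_tmul, ← map_one (algebraMap ℝ Grass), grassDx_algebraMap,
    TensorProduct.tmul_zero, add_zero, map_one, smul_super, smul_super]

lemma seriesMap_super (f : DiffPoly U) : seriesMap U (Super U) f = incl U f := rfl

/-- The inclusion of the Grassmann algebra. -/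
def inclG (U : Chart) : Grass →ₐ[ℝ] Super U := Algebra.TensorProduct.includeRight

lemma inclG_apply (g : Grass) : inclG U g = (1 : Jet U) ⊗ₜ[ℝ] g := rfl

lemma superDx_inclG (g : Grass) : superDx U (inclG U g) = inclG U (grassDx g) := by
  rw [inclG_apply, superDx_tmul, jetDx_one, TensorProduct.zero_tmul, zero_add, inclG_apply]

lemma incl_C (f : Jet U) : incl U (PowerSeries.C f) = PowerSeries.C (f ⊗ₜ[ℝ] (1 : Grass)) :=
  PowerSeries.map_C _ _

lemma incl_X : incl U PowerSeries.X = PowerSeries.X := PowerSeries.map_X _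

lemma incl_X_mul (f : DiffPoly U) : incl U (PowerSeries.X * f) = PowerSeries.X * incl U f := by
  rw [map_mul, incl_X]

lemma incl_dx (f : DiffPoly U) :
    incl U (epsMap (jetDx U) f) = epsMap (superDx U) (incl U f) := by
  refine IsEps.ext (F := fun f => incl U (epsMap (jetDx U) f))
    (G := fun f => epsMap (superDx U) (incl U f))
    ⟨fun _ _ => by simp only [map_add], fun _ => by simp only [epsMap_X_mul, incl_X_mul]⟩
    ⟨fun _ _ => by simp only [map_add], fun _ => by simp only [epsMap_X_mul, incl_X_mul]⟩
    (fun f => ?_) f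
  simp only [epsMap_C, incl_C, superDx_tmul, ← map_one (algebraMap ℝ Grass), grassDx_algebraMap,
    TensorProduct.tmul_zero, add_zero]

lemma incl_smul (c : ℝ) (f : DiffPoly U) : incl U (c • f) = c • incl U f := by
  ext1 n
  simp only [incl, PowerSeries.coeff_map, PowerSeries.coeff_smul]
  exact map_smul (Algebra.TensorProduct.includeLeft : Jet U →ₐ[ℝ] Super U) c _

lemma incl_epsOp (φ : PowerSeries ℝ) (f : DiffPoly U) :
    incl U (epsOp (jetDx U) φ f) = epsOp (superDx U) φ (incl U f) :=
  epsOp_intertwine (T := (incl U : DiffPoly U →+ SuperPoly U)) (fun f => incl_X_mul f)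
    (fun f => incl_dx f) φ (fun c f => incl_smul c f) f

lemma incl_jetShift (m : ℤ) (f : DiffPoly U) :
    incl U (jetShift U m f) = superShift U m (incl U f) := by
  rw [jetShift, superShift, shift_eq, shift_eq, incl_epsOp]

lemma incl_comm (f : DiffPoly U) (z : SuperPoly U) : incl U f * z = z * incl U f := by
  refine IsEps.ext (F := fun f => incl U f * z) (G := fun f => z * incl U f)
    ⟨fun _ _ => by simp only [map_add, add_mul],
      fun _ => by simp only [incl_X_mul, mul_assoc]⟩
    ⟨fun _ _ => by simp only [map_add, mul_add],
      fun _ => by simp only [incl_X_mul, mul_X_left_comm]⟩ (fun f => ?_) f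
  refine IsEps.ext (F := fun z => incl U (PowerSeries.C f) * z)
    (G := fun z => z * incl U (PowerSeries.C f))
    ⟨fun _ _ => by simp only [mul_add], fun _ => by simp only [mul_X_left_comm]⟩
    ⟨fun _ _ => by simp only [add_mul], fun _ => by simp only [mul_assoc]⟩ (fun z => ?_) z
  simp only [incl_C, ← map_mul]
  congr 1
  induction z using TensorProduct.induction_on with
  | zero => simp
  | add x y hx hy => simp only [mul_add, add_mul, hx, hy]
  | tmul f' g' => simp [Algebra.TensorProduct.tmul_mul_tmul, mul_comm]

lemma superShift_add (m : ℤ) (f g : SuperPoly U) :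
    superShift U m (f + g) = superShift U m f + superShift U m g := shift_add _ m f g

lemma superShift_sub (m : ℤ) (f g : SuperPoly U) :
    superShift U m (f - g) = superShift U m f - superShift U m g := shift_sub _ m f g

lemma superShift_neg (m : ℤ) (f : SuperPoly U) : superShift U m (-f) = -superShift U m f :=
  shift_neg _ m f

lemma superShift_mul (m : ℤ) (f g : SuperPoly U) :
    superShift U m (f * g) = superShift U m f * superShift U m g := shift_mul superDx_mul m f g

lemma superShift_one (m : ℤ) : superShift U m 1 = 1 := shift_one superDx_mul m

lemma superShift_map_zero (m : ℤ) : superShift U m 0 = 0 := shift_zero_right _ m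

lemma superShift_superShift (m n : ℤ) (f : SuperPoly U) :
    superShift U m (superShift U n f) = superShift U (m + n) f := shift_shift _ m n f

lemma superShift_zero (f : SuperPoly U) : superShift U 0 f = f := shift_zero _ f

lemma superShift_neg_one_one (f : SuperPoly U) : superShift U (-1) (superShift U 1 f) = f := by
  rw [superShift_superShift]; exact superShift_zero f

lemma superShift_one_neg_one (f : SuperPoly U) : superShift U 1 (superShift U (-1) f) = f := by
  rw [superShift_superShift]; exact superShift_zero f

lemma superShift_X_mul (m : ℤ) (f : SuperPoly U) :
    superShift U m (PowerSeries.X * f) = PowerSeries.X * superShift U m f := shift_X_mul _ m f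

lemma coeff_zero_superShift (m : ℤ) (f : SuperPoly U) :
    PowerSeries.coeff 0 (superShift U m f) = PowerSeries.coeff 0 f :=
  coeff_zero_shift (superDx U) m f

/-! ## Derivations of `𝒜` with values in super differential polynomials -/

section Linearization

variable {M : Type} [Ring M] [Algebra ℝ M] [Algebra (Jet U) M]

/-- `f, w ↦ ∑ ∂f/∂u^{i,s} d^s w`. -/
def linHom (i : Fin 2) (d : M →ₗ[ℝ] M) : Jet U →+ M →+ M :=
  AddMonoidHom.mk' (fun f => AddMonoidHom.mk'
    (fun w => ∑ᶠ s : ℕ, jetPartial U i s f • (d ^ s) w) (fun w w' => by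
      obtain ⟨N, hN⟩ := finsum_jetPartial (M := M) f
      have e := fun w => hN N le_rfl i fun s => (smulAddHom (Jet U) M).flip ((d ^ s) w)
      simp only [AddMonoidHom.flip_apply, smulAddHom_apply] at e
      rw [e, e, e, ← Finset.sum_add_distrib]
      exact Finset.sum_congr rfl fun s _ => by rw [map_add, smul_add]))
    (fun f g => by
      refine AddMonoidHom.ext fun w => ?_
      obtain ⟨N, hN⟩ := finsum_jetPartial (M := M) f
      obtain ⟨N', hN'⟩ := finsum_jetPartial (M := M) g
      obtain ⟨N'', hN''⟩ := finsum_jetPartial (M := M) (f + g)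
      let F := fun s => (smulAddHom (Jet U) M).flip ((d ^ s) w)
      have e := hN (max N (max N' N'')) (by simp) i F
      have e' := hN' (max N (max N' N'')) (by simp) i F
      have e'' := hN'' (max N (max N' N'')) (by simp) i F
      simp only [F, AddMonoidHom.flip_apply, smulAddHom_apply] at e e' e''
      simp only [AddMonoidHom.mk'_apply, AddMonoidHom.add_apply]
      rw [e, e', e'', ← Finset.sum_add_distrib]
      exact Finset.sum_congr rfl fun s _ => by rw [map_add, add_smul])

lemma linHom_eq_sum (f : Jet U) : ∃ N : ℕ, ∀ K, N ≤ K → ∀ (i : Fin 2) (d : M →ₗ[ℝ] M) (w : M),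
    linHom i d f w = ∑ s ∈ Finset.range K, jetPartial U i s f • (d ^ s) w := by
  obtain ⟨N, hN⟩ := finsum_jetPartial (M := M) f
  exact ⟨N, fun K hK i d w => hN K hK i fun s => (smulAddHom (Jet U) M).flip ((d ^ s) w)⟩

lemma linHom_mul (i : Fin 2) (d : M →ₗ[ℝ] M) (f g : Jet U) (w : M) :
    linHom i d (f * g) w = f • linHom i d g w + g • linHom i d f w := by
  obtain ⟨N, hN⟩ := linHom_eq_sum (M := M) f
  obtain ⟨N', hN'⟩ := linHom_eq_sum (M := M) g
  obtain ⟨N'', hN''⟩ := linHom_eq_sum (M := M) (f * g)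
  rw [hN (max N (max N' N'')) (by simp), hN' (max N (max N' N'')) (by simp),
    hN'' (max N (max N' N'')) (by simp), Finset.smul_sum, Finset.smul_sum,
    ← Finset.sum_add_distrib]
  exact Finset.sum_congr rfl fun s _ => by
    rw [jetPartial_mul, add_smul, smul_smul, smul_smul, mul_comm g, add_comm]

lemma linHom_C (i : Fin 2) (d : M →ₗ[ℝ] M) (f : Smooth U) (w : M) :
    linHom i d (MvPolynomial.C f) w = (MvPolynomial.C (partialSmooth U i f) : Jet U) • w := by
  obtain ⟨N, hN⟩ := linHom_eq_sum (M := M) (MvPolynomial.C f : Jet U)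
  rw [hN (N + 1) (by simp), Finset.sum_range_succ', Finset.sum_eq_zero, zero_add,
    jetPartial_zero_C, pow_zero, Module.End.one_apply]
  intro s _
  rw [jetPartial_succ_C, zero_smul]

lemma linHom_dx (i : Fin 2) {d : M →ₗ[ℝ] M} (hd : IsDxModule (U := U) d) (f : Jet U) (w : M) :
    linHom i d (jetDx U f) w = d (linHom i d f w) := by
  obtain ⟨N, hN⟩ := linHom_eq_sum (M := M) f
  obtain ⟨N', hN'⟩ := linHom_eq_sum (M := M) (jetDx U f)
  obtain ⟨K, hK⟩ := exists_jetPartial_eq_zero f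
  have h1 := hN (max K (max N N') + 1)
    (by have := le_max_left N N'; have := le_max_right K (max N N'); omega) i d w
  rw [hN' (max K (max N N') + 1)
    (by have := le_max_right N N'; have := le_max_right K (max N N'); omega), h1, map_sum]
  simp only [hd _ _]
  rw [Finset.sum_add_distrib, Finset.sum_range_succ', Finset.sum_range_succ (fun s =>
    jetPartial U i s f • d ((d ^ s) w)), hK _ (le_max_left _ _), zero_smul, add_zero,
    Finset.sum_range_succ' (fun s => jetDx U (jetPartial U i s f) • (d ^ s) w),
    jetPartial_zero_dx, add_right_comm, ← Finset.sum_add_distrib]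
  congr 1
  refine Finset.sum_congr rfl fun s _ => ?_
  rw [jetPartial_succ_dx, pow_succ' _ s, Module.End.mul_apply, add_smul]

lemma linHom_smul_left [IsScalarTower ℝ (Jet U) M] (i : Fin 2) (d : M →ₗ[ℝ] M) (c : ℝ)
    (f : Jet U) (w : M) : linHom i d (c • f) w = c • linHom i d f w := by
  obtain ⟨K, hK⟩ := linHom_eq_sum (M := M) f
  obtain ⟨K', hK'⟩ := linHom_eq_sum (M := M) (c • f)
  rw [hK (max K K') (by simp), hK' (max K K') (by simp), Finset.smul_sum]
  exact Finset.sum_congr rfl fun s _ => by rw [LinearMap.map_smul, smul_assoc]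

end Linearization

/-- The derivation of `𝒜` along the vector field `x` with super components. -/
def aDer (x : Fin 2 → SuperPoly U) : DiffPoly U →+ SuperPoly U :=
  (conv (linHom 0 (superDx U))).flip (x 0) + (conv (linHom 1 (superDx U))).flip (x 1)

lemma aDer_apply (x : Fin 2 → SuperPoly U) (f : DiffPoly U) : aDer x f =
    conv (linHom 0 (superDx U)) f (x 0) + conv (linHom 1 (superDx U)) f (x 1) := rfl

lemma conv_linHom_mul (i : Fin 2) (f g : DiffPoly U) (w : SuperPoly U) :
    conv (linHom i (superDx U)) (f * g) w = incl U f * conv (linHom i (superDx U)) g w +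
      incl U g * conv (linHom i (superDx U)) f w := by
  refine IsEps.ext (F := fun w => conv (linHom i (superDx U)) (f * g) w)
    (G := fun w => incl U f * conv (linHom i (superDx U)) g w +
      incl U g * conv (linHom i (superDx U)) f w)
    ⟨fun _ _ => by simp only [map_add], fun _ => by simp only [conv_X_right]⟩
    ⟨fun _ _ => by simp only [map_add, mul_add]; abel,
      fun _ => by simp only [mul_X_left_comm, conv_X_right, mul_add]⟩ (fun w => ?_) w
  refine IsEps.ext (F := fun f => conv (linHom i (superDx U)) (f * g) (PowerSeries.C w))
    (G := fun f => incl U f * conv (linHom i (superDx U)) g (PowerSeries.C w) +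
      incl U g * conv (linHom i (superDx U)) f (PowerSeries.C w))
    ⟨fun _ _ => by simp only [map_add, add_mul, AddMonoidHom.add_apply],
      fun _ => by simp only [mul_assoc, conv_X_left]⟩
    ⟨fun _ _ => by simp only [map_add, add_mul, mul_add, AddMonoidHom.add_apply]; abel,
      fun _ => by simp only [incl_X_mul, mul_assoc, conv_X_left, mul_X_left_comm, mul_add]⟩
    (fun f => ?_) f
  refine IsEps.ext
    (F := fun g => conv (linHom i (superDx U)) (PowerSeries.C f * g) (PowerSeries.C w))
    (G := fun g => incl U (PowerSeries.C f) * conv (linHom i (superDx U)) g (PowerSeries.C w) +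
      incl U g * conv (linHom i (superDx U)) (PowerSeries.C f) (PowerSeries.C w))
    ⟨fun _ _ => by simp only [map_add, mul_add, AddMonoidHom.add_apply],
      fun _ => by simp only [mul_X_left_comm, conv_X_left]⟩
    ⟨fun _ _ => by simp only [map_add, add_mul, mul_add, AddMonoidHom.add_apply]; abel,
      fun _ => by simp only [incl_X_mul, mul_assoc, conv_X_left, mul_X_left_comm, mul_add]⟩
    (fun g => ?_) g
  simp only [incl_C, ← map_mul, conv_C_C, linHom_mul, map_add, smul_super]

lemma conv_linHom_dx (i : Fin 2) (f : DiffPoly U) (w : SuperPoly U) :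
    conv (linHom i (superDx U)) (epsMap (jetDx U) f) w =
      epsMap (superDx U) (conv (linHom i (superDx U)) f w) := by
  refine IsEps.ext (F := fun w => conv (linHom i (superDx U)) (epsMap (jetDx U) f) w)
    (G := fun w => epsMap (superDx U) (conv (linHom i (superDx U)) f w))
    ⟨fun _ _ => by simp only [map_add], fun _ => by simp only [conv_X_right]⟩
    ⟨fun _ _ => by simp only [map_add], fun _ => by simp only [conv_X_right, epsMap_X_mul]⟩
    (fun w => ?_) w
  refine IsEps.ext
    (F := fun f => conv (linHom i (superDx U)) (epsMap (jetDx U) f) (PowerSeries.C w))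
    (G := fun f => epsMap (superDx U) (conv (linHom i (superDx U)) f (PowerSeries.C w)))
    ⟨fun _ _ => by simp only [map_add, AddMonoidHom.add_apply],
      fun _ => by simp only [epsMap_X_mul, conv_X_left]⟩
    ⟨fun _ _ => by simp only [map_add, AddMonoidHom.add_apply],
      fun _ => by simp only [epsMap_X_mul, conv_X_left]⟩ (fun f => ?_) f
  simp only [conv_C_C, epsMap_C, linHom_dx i isDxModule_superDx]

lemma conv_linHom_ofSmooth (i : Fin 2) (f : Smooth U) (w : SuperPoly U) :
    conv (linHom i (superDx U)) (ofSmooth f) w = incl U (ofSmooth (partialSmooth U i f)) * w := by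
  refine IsEps.ext (F := fun w => conv (linHom i (superDx U)) (ofSmooth f) w)
    (G := fun w => incl U (ofSmooth (partialSmooth U i f)) * w)
    ⟨fun _ _ => by simp only [map_add], fun _ => by simp only [conv_X_right]⟩
    ⟨fun _ _ => by simp only [mul_add], fun _ => by simp only [mul_X_left_comm]⟩
    (fun w => ?_) w
  simp only [ofSmooth, conv_C_C, linHom_C, incl_C, smul_super, map_mul]

lemma aDer_P (x : Fin 2 → SuperPoly U) : aDer x (ofSmooth (fP U)) = x 0 := by
  rw [aDer_apply, conv_linHom_ofSmooth, conv_linHom_ofSmooth, partialSmooth_fP, partialSmooth_fP]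
  simp [ofSmooth_one, ofSmooth_zero]

lemma aDer_Q (x : Fin 2 → SuperPoly U) : aDer x (ofSmooth (fQ U)) = x 1 := by
  rw [aDer_apply, conv_linHom_ofSmooth, conv_linHom_ofSmooth, partialSmooth_fQ, partialSmooth_fQ]
  simp [ofSmooth_one, ofSmooth_zero]

lemma isADer_aDer (x : Fin 2 → SuperPoly U) :
    IsADer (incl U) (epsMap (superDx U)) (aDer x) where
  mul f g := by simp only [aDer_apply, conv_linHom_mul, mul_add]; abel
  X_mul f := by simp only [aDer_apply, conv_X_left, incl_X, mul_add]
  dx f := by simp only [aDer_apply, conv_linHom_dx, map_add]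
  smooth f := by
    rw [aDer_P, aDer_Q, aDer_apply, conv_linHom_ofSmooth, conv_linHom_ofSmooth]

lemma aDer_X_mul (x : Fin 2 → SuperPoly U) (f : DiffPoly U) :
    aDer (fun α => PowerSeries.X * x α) f = PowerSeries.X * aDer x f := by
  simp only [aDer_apply, conv_X_right, mul_add]

lemma aDer_smul (x : Fin 2 → SuperPoly U) (c : ℝ) (f : DiffPoly U) :
    aDer x (c • f) = c • aDer x f := by
  simp only [aDer_apply, smul_add]
  congr 1 <;>
  · ext1 n
    simp only [coeff_conv, PowerSeries.coeff_smul, linHom_smul_left, Finset.smul_sum]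

/-! ## Parity -/

/-- Grassmann numbers as super differential polynomials. -/
def cG (U : Chart) : Grass →+* SuperPoly U := PowerSeries.C.comp (inclG U).toRingHom

lemma cG_apply (g : Grass) : cG U g = PowerSeries.C (inclG U g) := rfl

lemma cG_smul (c : ℝ) (g : Grass) : cG U (c • g) = c • cG U g := by
  rw [cG_apply, cG_apply, map_smul]
  ext1 n
  simp only [PowerSeries.coeff_C, PowerSeries.coeff_smul]
  split_ifs <;> simp

lemma cG_dx (g : Grass) : cG U (grassDx g) = epsMap (superDx U) (cG U g) := by
  rw [cG_apply, cG_apply, epsMap_C, superDx_inclG]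

lemma C_tmul (f : Jet U) (g : Grass) : (PowerSeries.C (f ⊗ₜ[ℝ] g) : SuperPoly U) =
    incl U (PowerSeries.C f) * cG U g := by
  rw [incl_C, cG_apply, ← map_mul, inclG_apply, Algebra.TensorProduct.tmul_mul_tmul, mul_one,
    one_mul]

lemma sig_eq (α : Fin 2) (k : ℤ) :
    sig U α k = cG U (ExteriorAlgebra.ι ℝ (Finsupp.single (α, k, 0) 1)) := rfl

lemma parity_X : parity U PowerSeries.X = PowerSeries.X := PowerSeries.map_X _

lemma parity_X_mul (f : SuperPoly U) :
    parity U (PowerSeries.X * f) = PowerSeries.X * parity U f := by rw [map_mul, parity_X]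

lemma parity_incl (f : DiffPoly U) : parity U (incl U f) = incl U f := by
  ext1 n
  simp only [parity, incl, PowerSeries.coeff_map]
  change Algebra.TensorProduct.map _ _ (_ ⊗ₜ[ℝ] (1 : Grass)) = _ ⊗ₜ[ℝ] (1 : Grass)
  rw [Algebra.TensorProduct.map_tmul, map_one]
  rfl

lemma parity_cG (g : Grass) : parity U (cG U g) =
    cG U ((CliffordAlgebra.involute : Grass →ₐ[ℝ] Grass) g) := by
  rw [cG_apply, parity, PowerSeries.map_C]
  rfl

lemma involute_ι (v : OddIdx →₀ ℝ) :
    (CliffordAlgebra.involute : Grass →ₐ[ℝ] Grass) (ExteriorAlgebra.ι ℝ v) =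
      (-1 : ℤ) • ExteriorAlgebra.ι ℝ v := by
  rw [neg_one_smul]
  exact CliffordAlgebra.involute_ι v

lemma parity_sig (α : Fin 2) (k : ℤ) : parity U (sig U α k) = -sig U α k := by
  rw [sig_eq, parity_cG, involute_ι, neg_one_smul, map_neg]

/-- Stated for a general sign so that it serves both the identity (e = 1) and the parity
automorphism (e = -1). -/
lemma grassDx_twist {τ : Grass →ₐ[ℝ] Grass} {e : ℤ}
    (hτ : ∀ v, τ (ExteriorAlgebra.ι ℝ v) = e • ExteriorAlgebra.ι ℝ v) (g : Grass) :
    τ (grassDx g) = grassDx (τ g) := by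
  induction g using ExteriorAlgebra.induction with
  | algebraMap r => rw [grassDx_algebraMap, AlgHom.commutes, grassDx_algebraMap, map_zero]
  | ι v => rw [grassDx_ι, hτ, hτ, map_zsmul, grassDx_ι]
  | mul a b ha hb => simp only [grassDx_mul, map_add, map_mul, ha, hb]
  | add a b ha hb => simp only [map_add, ha, hb]

lemma parity_dx (f : SuperPoly U) :
    parity U (epsMap (superDx U) f) = epsMap (superDx U) (parity U f) := by
  refine IsEps.ext (F := fun f => parity U (epsMap (superDx U) f))
    (G := fun f => epsMap (superDx U) (parity U f))
    ⟨fun _ _ => by simp only [map_add], fun _ => by simp only [epsMap_X_mul, parity_X_mul]⟩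
    ⟨fun _ _ => by simp only [map_add], fun _ => by simp only [epsMap_X_mul, parity_X_mul]⟩
    (fun f => ?_) f
  induction f using TensorProduct.induction_on with
  | zero => simp
  | add x y hx hy => simp only [map_add, hx, hy]
  | tmul f g =>
    simp only [C_tmul, epsMap_mul superDx_mul, map_add, map_mul, ← incl_dx, ← cG_dx, parity_incl,
      parity_cG, grassDx_twist involute_ι]

lemma parity_smul (c : ℝ) (f : SuperPoly U) : parity U (c • f) = c • parity U f := by
  ext1 n
  simp only [parity, PowerSeries.coeff_map, PowerSeries.coeff_smul]
  exact map_smul (Algebra.TensorProduct.map (AlgHom.id ℝ (Jet U))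
    (CliffordAlgebra.involute : Grass →ₐ[ℝ] Grass)) c _

/-- Elements of parity `e = ±1`: they are eigenvectors of the parity automorphism and
(anti)commute with the odd variables. -/
structure HasPar (e : ℤ) (x : SuperPoly U) : Prop where
  parity : parity U x = e • x
  comm : ∀ v, x * cG U (ExteriorAlgebra.ι ℝ v) = e • (cG U (ExteriorAlgebra.ι ℝ v) * x)

namespace HasPar

variable {e e' : ℤ} {x y : SuperPoly U}

lemma zero : HasPar e (0 : SuperPoly U) := ⟨by simp, fun v => by simp⟩

lemma add (hx : HasPar e x) (hy : HasPar e y) : HasPar e (x + y) where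
  parity := by rw [map_add, hx.parity, hy.parity, smul_add]
  comm v := by rw [add_mul, hx.comm, hy.comm, mul_add, smul_add]

lemma neg (hx : HasPar e x) : HasPar e (-x) where
  parity := by rw [map_neg, hx.parity, smul_neg]
  comm v := by rw [neg_mul, hx.comm, mul_neg, smul_neg]

lemma sub (hx : HasPar e x) (hy : HasPar e y) : HasPar e (x - y) := by
  rw [sub_eq_add_neg]
  exact hx.add hy.neg

lemma mul (hx : HasPar e x) (hy : HasPar e' y) : HasPar (e * e') (x * y) where
  parity := by rw [map_mul, hx.parity, hy.parity, smul_mul_smul_comm]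
  comm v := by
    rw [mul_assoc, hy.comm, mul_smul_comm, ← mul_assoc, hx.comm, smul_mul_assoc, smul_smul,
      mul_assoc, mul_comm e']

lemma smul (c : ℝ) (hx : HasPar e x) : HasPar e (c • x) where
  parity := by rw [parity_smul, hx.parity, smul_comm]
  comm v := by rw [smul_mul_assoc, hx.comm, mul_smul_comm, smul_comm]

lemma incl (f : DiffPoly U) : HasPar 1 (incl U f) where
  parity := by rw [parity_incl, one_smul]
  comm v := by rw [one_smul, incl_comm]

lemma ι (v : OddIdx →₀ ℝ) : HasPar (-1) (cG U (ExteriorAlgebra.ι ℝ v)) where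
  parity := by rw [parity_cG, involute_ι, map_zsmul]
  comm w := by
    rw [← RingHom.map_mul, ← RingHom.map_mul, neg_one_smul, ← RingHom.map_neg]
    congr 1
    exact eq_neg_of_add_eq_zero_left (ExteriorAlgebra.ι_add_mul_swap v w)

lemma sig (α : Fin 2) (k : ℤ) : HasPar (-1) (sig U α k) := ι _

lemma incl_mul (f : DiffPoly U) (hx : HasPar e x) : HasPar e (AblowitzLadik.incl U f * x) := by
  simpa using (incl f).mul hx

lemma dx (hx : HasPar e x) : HasPar e (epsMap (superDx U) x) where
  parity := by rw [parity_dx, hx.parity, map_zsmul]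
  comm v := by
    have h := congrArg (epsMap (superDx U)) (hx.comm v)
    rw [map_zsmul, epsMap_mul superDx_mul, epsMap_mul superDx_mul, ← cG_dx, grassDx_ι, hx.comm,
      smul_add, add_comm] at h
    exact add_left_cancel h

lemma of_X_mul (hx : HasPar e (PowerSeries.X * x)) : HasPar e x where
  parity := X_mul_cancel (by rw [← parity_X_mul, hx.parity, mul_smul_comm])
  comm v := X_mul_cancel (by
    rw [← mul_assoc, hx.comm, mul_smul_comm, mul_X_left_comm])

lemma closed (h : ∀ n : ℕ, ∃ g, HasPar e g ∧ ∃ r, x = g + PowerSeries.X ^ n * r) : HasPar e x where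
  parity := by
    rw [← sub_eq_zero]
    refine series_eq_zero fun n => ?_
    obtain ⟨g, hg, r, hr⟩ := h n
    refine ⟨AblowitzLadik.parity U r - e • r, ?_⟩
    rw [hr, map_add, hg.parity, map_mul, map_pow, parity_X, smul_add, mul_sub, mul_smul_comm]
    abel
  comm v := by
    rw [← sub_eq_zero]
    refine series_eq_zero fun n => ?_
    obtain ⟨g, hg, r, hr⟩ := h n
    refine ⟨r * cG U (ExteriorAlgebra.ι ℝ v) - e • (cG U (ExteriorAlgebra.ι ℝ v) * r), ?_⟩
    have hX : cG U (ExteriorAlgebra.ι ℝ v) * (PowerSeries.X ^ n * r) =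
        PowerSeries.X ^ n * (cG U (ExteriorAlgebra.ι ℝ v) * r) := by
      rw [← mul_assoc, (PowerSeries.commute_X_pow _ n).eq, mul_assoc]
    rw [hr, add_mul, hg.comm, mul_add, hX, smul_add, mul_sub, mul_smul_comm, mul_assoc]
    abel

/-- The subgroup of elements of parity `e`. -/
def subgroup (U : Chart) (e : ℤ) : AddSubgroup (SuperPoly U) where
  carrier := {x | HasPar e x}
  zero_mem' := zero
  add_mem' := add
  neg_mem' := neg

lemma aDer {x : Fin 2 → SuperPoly U} (hx : ∀ α, HasPar e (x α)) (f : DiffPoly U) :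
    HasPar e (aDer x f) :=
  (isADer_aDer x).mem (subgroup U e) (fun a _ h => incl_mul a h) (fun _ h => dx h)
    (fun _ h => closed fun n => by
      obtain ⟨g, hg, r, hr⟩ := h n
      exact ⟨g, hg, r, by rw [hr, incl_X]⟩) (by rw [aDer_P]; exact hx 0)
    (by rw [aDer_Q]; exact hx 1) f

/-- Moving an element of parity e past g costs the twist τ. This is the interchange needed for the
graded Leibniz rule on products. -/
lemma twist {τ : Grass →ₐ[ℝ] Grass}
    (hτ : ∀ v, τ (ExteriorAlgebra.ι ℝ v) = e • ExteriorAlgebra.ι ℝ v) (hx : HasPar e x)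
    (g : Grass) : cG U (τ g) * x = x * cG U g := by
  induction g using ExteriorAlgebra.induction generalizing x with
  | algebraMap r =>
    rw [AlgHom.commutes, Algebra.algebraMap_eq_smul_one, cG_smul, map_one, smul_mul_assoc,
      mul_smul_comm, one_mul, mul_one]
  | ι v => rw [hτ, map_zsmul, hx.comm, smul_mul_assoc]
  | mul a b ha hb => rw [map_mul, map_mul, mul_assoc, hb hx, ← mul_assoc, ha hx, map_mul, mul_assoc]
  | add a b ha hb => rw [map_add, map_add, map_add, add_mul, mul_add, ha hx, hb hx]

end HasPar

/-! ## Twisted derivations -/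

/-- Twisted derivations of the super differential polynomials along `π`, that commute with `∂_x`
and obey the chain rule. -/
structure IsTDer {M : Type} [Ring M] (τ : SuperPoly U →+* SuperPoly U) (π : SuperPoly U →+* M)
    (d : M →+ M) (D : SuperPoly U →+ M) : Prop where
  mul : ∀ f g, D (f * g) = D f * π g + π (τ f) * D g
  X_mul : ∀ f, D (PowerSeries.X * f) = π PowerSeries.X * D f
  dx : ∀ f, D (epsMap (superDx U) f) = d (D f)
  smooth : ∀ f : Smooth U, D (incl U (ofSmooth f)) =
    π (incl U (ofSmooth (partialSmooth U 0 f))) * D (sP U) +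
      π (incl U (ofSmooth (partialSmooth U 1 f))) * D (sQ U)

section TDer

variable {M : Type} [Ring M] {τ : SuperPoly U →+* SuperPoly U} {π : SuperPoly U →+* M}
  {d : M →+ M} {D D' : SuperPoly U →+ M}

lemma IsTDer.sub (hD : IsTDer τ π d D) (hD' : IsTDer τ π d D') : IsTDer τ π d (D - D') where
  mul f g := by simp only [AddMonoidHom.sub_apply, hD.mul, hD'.mul, mul_sub, sub_mul]; abel
  X_mul f := by simp only [AddMonoidHom.sub_apply, hD.X_mul, hD'.X_mul, mul_sub]
  dx f := by simp only [AddMonoidHom.sub_apply, hD.dx, hD'.dx, map_sub]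
  smooth f := by
    simp only [AddMonoidHom.sub_apply, hD.smooth f, hD'.smooth f, mul_sub]; abel

lemma IsTDer.comp_incl (hD : IsTDer τ π d D) (hτ : ∀ f, τ (incl U f) = incl U f)
    (hπ : ∀ f m, π (incl U f) * m = m * π (incl U f)) :
    IsADer (π.comp (incl U)) d (D.comp (incl U : DiffPoly U →+ SuperPoly U)) where
  mul f g := by
    change D (incl U (f * g)) = π (incl U f) * D (incl U g) + π (incl U g) * D (incl U f)
    rw [map_mul, hD.mul, hτ, hπ g, add_comm]
  X_mul f := by
    change D (incl U (PowerSeries.X * f)) = π (incl U PowerSeries.X) * D (incl U f)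
    rw [incl_X_mul, hD.X_mul, incl_X]
  dx f := by
    change D (incl U (epsMap (jetDx U) f)) = d (D (incl U f))
    rw [incl_dx, hD.dx]
  smooth f := hD.smooth f

/-- Twisted derivations have values in a closed differential subbimodule that contains the values
on generators. -/
lemma IsTDer.mem (hD : IsTDer τ π d D) (hτ : ∀ f, τ (incl U f) = incl U f)
    (hπ : ∀ f m, π (incl U f) * m = m * π (incl U f)) (S : AddSubgroup M)
    (hl : ∀ a, ∀ m ∈ S, π a * m ∈ S) (hr : ∀ a, ∀ m ∈ S, m * π a ∈ S)
    (hdx : ∀ m ∈ S, d m ∈ S)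
    (closed : ∀ m, (∀ n : ℕ, ∃ g ∈ S, ∃ r, m = g + π PowerSeries.X ^ n * r) → m ∈ S)
    (hP : D (sP U) ∈ S) (hQ : D (sQ U) ∈ S) (hs : ∀ α k, D (sig U α k) ∈ S) (f : SuperPoly U) :
    D f ∈ S := by
  have hit : ∀ (n : ℕ) r,
      (AddMonoidHom.mulLeft (π PowerSeries.X))^[n] r = π PowerSeries.X ^ n * r := by
    intro n r
    induction n with
    | zero => simp
    | succ n ih => rw [Function.iterate_succ_apply', ih, AddMonoidHom.coe_mulLeft, pow_succ', mul_assoc]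
  have hA : ∀ f, D (incl U f) ∈ S := fun f =>
    (hD.comp_incl hτ hπ).mem S (fun a m hm => hl _ m hm) hdx
      (fun m hm => closed m (by simpa only [RingHom.comp_apply, incl_X] using hm)) hP hQ f
  have hv : ∀ (s : ℕ) (α : Fin 2) (k : ℤ),
      D (cG U (ExteriorAlgebra.ι ℝ (Finsupp.single (α, k, s) 1))) ∈ S := by
    intro s α k
    induction s with
    | zero => exact hs α k
    | succ s ih =>
      have e : oddShift (Finsupp.single (α, k, s) 1) = Finsupp.single (α, k, s + 1) 1 := by
        simp [oddShift]
      rw [← e, ← grassDx_ι, cG_dx, hD.dx]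
      exact hdx _ ih
  have hreal : ∀ (c : ℝ) g, D (cG U g) ∈ S → D (cG U (c • g)) ∈ S := by
    intro c g hg
    have e : cG U (c • g) = incl U (PowerSeries.C (algebraMap ℝ (Jet U) c)) * cG U g := by
      rw [← C_tmul, cG_apply, inclG_apply, TensorProduct.tmul_smul, TensorProduct.smul_tmul',
        ← Algebra.algebraMap_eq_smul_one]
    rw [e, hD.mul]
    exact S.add_mem (hr _ _ (hA _)) (hl _ _ hg)
  have hG : ∀ g, D (cG U g) ∈ S := by
    intro g
    induction g using ExteriorAlgebra.induction with
    | algebraMap r =>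
      rw [Algebra.algebraMap_eq_smul_one]
      refine hreal r 1 ?_
      have := hA 1
      rwa [map_one, ← map_one (cG U)] at this
    | ι v =>
      induction v using Finsupp.induction_linear with
      | zero => simp
      | add v w hv hw =>
        rw [map_add, map_add, map_add]
        exact S.add_mem hv hw
      | single v c =>
        rw [← mul_one c, ← smul_eq_mul, ← Finsupp.smul_single, map_smul]
        exact hreal c _ (hv _ _ _)
    | mul a b ha hb =>
      rw [map_mul, hD.mul]
      exact S.add_mem (hr _ _ ha) (hl _ _ hb)
    | add a b ha hb =>
      rw [map_add, map_add]
      exact S.add_mem ha hb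
  refine eps_mem D (AddMonoidHom.mulLeft (π PowerSeries.X)) hD.X_mul S (fun x hx => hl _ x hx)
    (fun m hm => closed m fun n => ?_) (fun b => ?_) f
  · obtain ⟨g, hg, r, hr⟩ := hm n
    exact ⟨g, hg, r, by rw [hr, hit]⟩
  · induction b using TensorProduct.induction_on with
    | zero => simp
    | add x y hx hy =>
      rw [map_add, map_add]
      exact S.add_mem hx hy
    | tmul f g =>
      rw [C_tmul, hD.mul]
      exact S.add_mem (hr _ _ (hA _)) (hl _ _ (hG g))

end TDer

/-! ## Existence of twisted derivations -/

/-- The extension of a map from coefficients to power series. -/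
def epsExt {R S : Type} [Ring R] [Ring S] (D : R →+ PowerSeries S) :
    PowerSeries R →+ PowerSeries S where
  toFun f := PowerSeries.mk fun n => ∑ p ∈ Finset.HasAntidiagonal.antidiagonal n,
    PowerSeries.coeff p.2 (D (PowerSeries.coeff p.1 f))
  map_zero' := by ext n; simp
  map_add' f g := by ext n; simp [Finset.sum_add_distrib]

lemma coeff_epsExt {R S : Type} [Ring R] [Ring S] (D : R →+ PowerSeries S) (f : PowerSeries R)
    (n : ℕ) : PowerSeries.coeff n (epsExt D f) =
      ∑ p ∈ Finset.HasAntidiagonal.antidiagonal n,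
        PowerSeries.coeff p.2 (D (PowerSeries.coeff p.1 f)) := by
  simp [epsExt]

lemma epsExt_C {R S : Type} [Ring R] [Ring S] (D : R →+ PowerSeries S) (r : R) :
    epsExt D (PowerSeries.C r) = D r := by
  ext n
  rw [coeff_epsExt, Finset.sum_eq_single (0, n)]
  · simp
  · rintro ⟨a, b⟩ h hne
    have ha : a ≠ 0 := by
      rintro rfl
      simp at h
      exact hne (by rw [h])
    simp [PowerSeries.coeff_C, ha]
  · simp

lemma epsExt_X_mul {R S : Type} [Ring R] [Ring S] (D : R →+ PowerSeries S) (f : PowerSeries R) :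
    epsExt D (PowerSeries.X * f) = PowerSeries.X * epsExt D f := by
  ext n
  cases n with
  | zero => simp [coeff_epsExt]
  | succ n =>
    rw [PowerSeries.coeff_succ_X_mul, coeff_epsExt, coeff_epsExt,
      Finset.Nat.antidiagonal_succ, Finset.sum_cons, Finset.sum_map]
    simp [PowerSeries.coeff_succ_X_mul]

section TDerExistence

/-- The values `∂_x^s y_{α,k}` of a derivation on the generators of the Grassmann algebra. -/
def genVal (y : Fin 2 → ℤ → SuperPoly U) : (OddIdx →₀ ℝ) →ₗ[ℝ] SuperPoly U :=
  Finsupp.linearCombination ℝ fun v : OddIdx => (epsMap (superDx U))^[v.2.2] (y v.1 v.2.1)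

lemma genVal_single (y : Fin 2 → ℤ → SuperPoly U) (v : OddIdx) :
    genVal y (Finsupp.single v 1) = (epsMap (superDx U))^[v.2.2] (y v.1 v.2.1) := by
  simp [genVal]

lemma epsMap_smul {R : Type} [Ring R] [Algebra ℝ R] (d : R →ₗ[ℝ] R) (c : ℝ) (f : PowerSeries R) :
    epsMap d (c • f) = c • epsMap d f := by
  ext1 n
  rw [coeff_epsMap, PowerSeries.coeff_smul, map_smul, PowerSeries.coeff_smul, coeff_epsMap]

lemma genVal_oddShift (y : Fin 2 → ℤ → SuperPoly U) (v : OddIdx →₀ ℝ) :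
    genVal y (oddShift v) = epsMap (superDx U) (genVal y v) := by
  induction v using Finsupp.induction_linear with
  | zero => simp
  | add v w hv hw => simp only [map_add, hv, hw]
  | single v c =>
    rw [← mul_one c, ← smul_eq_mul, ← Finsupp.smul_single, map_smul, map_smul, map_smul,
      epsMap_smul, genVal_single, ← Function.iterate_succ_apply' (epsMap (superDx U))]
    congr 1
    have e : oddShift (Finsupp.single v 1) = Finsupp.single (v.1, v.2.1, v.2.2 + 1) 1 := by
      simp [oddShift]
    rw [e, genVal_single]

lemma hasPar_genVal {e : ℤ} {y : Fin 2 → ℤ → SuperPoly U} (hy : ∀ α k, HasPar e (y α k))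
    (v : OddIdx →₀ ℝ) : HasPar e (genVal y v) := by
  induction v using Finsupp.induction_linear with
  | zero => rw [map_zero]; exact HasPar.zero
  | add v w hv hw => rw [map_add]; exact hv.add hw
  | single v c =>
    rw [← mul_one c, ← smul_eq_mul, ← Finsupp.smul_single, map_smul, genVal_single]
    refine HasPar.smul c ?_
    induction v.2.2 with
    | zero => exact hy _ _
    | succ n ih => rw [Function.iterate_succ_apply']; exact ih.dx

/-- The representation of a generator by `2 × 2` matrices. -/
def genMat (τ : Grass →ₐ[ℝ] Grass) (y : Fin 2 → ℤ → SuperPoly U) :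
    (OddIdx →₀ ℝ) →ₗ[ℝ] Matrix (Fin 2) (Fin 2) (SuperPoly U) where
  toFun v := !![cG U (τ (ExteriorAlgebra.ι ℝ v)), genVal y v; 0, cG U (ExteriorAlgebra.ι ℝ v)]
  map_add' v w := by
    ext i j
    fin_cases i <;> fin_cases j <;> simp
  map_smul' c v := by
    ext1 i j
    fin_cases i <;> fin_cases j <;> simp [cG_smul]

variable {e : ℤ} {τ : Grass →ₐ[ℝ] Grass}

/-- A value of parity -e on a generator makes the corner entry τ(v)y(v) + y(v)v vanish. So the
triangular matrices square to zero and the universal property of the exterior algebra applies to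
them. -/
lemma genMat_sq (hτ : ∀ v, τ (ExteriorAlgebra.ι ℝ v) = e • ExteriorAlgebra.ι ℝ v)
    {y : Fin 2 → ℤ → SuperPoly U} (hy : ∀ α k, HasPar (-e) (y α k)) (v : OddIdx →₀ ℝ) :
    genMat τ y v * genMat τ y v = 0 := by
  have h0 : cG U (ExteriorAlgebra.ι ℝ v) * cG U (ExteriorAlgebra.ι ℝ v) = 0 := by
    rw [← map_mul, ExteriorAlgebra.ι_sq_zero, map_zero]
  have h1 : cG U (τ (ExteriorAlgebra.ι ℝ v)) * cG U (τ (ExteriorAlgebra.ι ℝ v)) = 0 := by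
    rw [← map_mul, ← map_mul, ExteriorAlgebra.ι_sq_zero, map_zero, map_zero]
  have h2 : cG U (τ (ExteriorAlgebra.ι ℝ v)) * genVal y v +
      genVal y v * cG U (ExteriorAlgebra.ι ℝ v) = 0 := by
    rw [hτ, map_zsmul, (hasPar_genVal hy v).comm, smul_mul_assoc, neg_smul, add_neg_cancel]
  change !![_, _; _, _] * !![_, _; _, _] = _
  rw [Matrix.mul_fin_two, h0, h1, h2]
  ext1 i j
  fin_cases i <;> fin_cases j <;> simp

variable (hτ : ∀ v, τ (ExteriorAlgebra.ι ℝ v) = e • ExteriorAlgebra.ι ℝ v)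
  {y : Fin 2 → ℤ → SuperPoly U} (hy : ∀ α k, HasPar (-e) (y α k))

/-- The representation of the Grassmann algebra by triangular matrices, whose corner is a twisted
derivation. -/
def grassMat : Grass →ₐ[ℝ] Matrix (Fin 2) (Fin 2) (SuperPoly U) :=
  ExteriorAlgebra.lift ℝ ⟨genMat τ y, genMat_sq hτ hy⟩

lemma grassMat_ι (v : OddIdx →₀ ℝ) : grassMat hτ hy (ExteriorAlgebra.ι ℝ v) = genMat τ y v :=
  ExteriorAlgebra.lift_ι_apply ℝ _ _ v

lemma grassMat_diag (g : Grass) : grassMat hτ hy g 0 0 = cG U (τ g) ∧ grassMat hτ hy g 1 0 = 0 ∧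
    grassMat hτ hy g 1 1 = cG U g := by
  induction g using ExteriorAlgebra.induction with
  | algebraMap r =>
    rw [AlgHom.commutes, AlgHom.commutes, Algebra.algebraMap_eq_smul_one,
      Algebra.algebraMap_eq_smul_one, cG_smul, map_one]
    simp
  | ι v => rw [grassMat_ι]; exact ⟨rfl, rfl, rfl⟩
  | mul a b ha hb =>
    rw [map_mul, Matrix.mul_apply, Matrix.mul_apply, Matrix.mul_apply]
    simp only [Fin.sum_univ_two, ha, hb, map_mul]
    simp
  | add a b ha hb =>
    rw [map_add]
    simp only [Matrix.add_apply, ha, hb, map_add]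
    simp

/-- The twisted derivation of the Grassmann algebra with given values on generators. -/
def grassDer : Grass →ₗ[ℝ] SuperPoly U where
  toFun g := grassMat hτ hy g 0 1
  map_add' a b := by rw [map_add, Matrix.add_apply]
  map_smul' c a := by rw [map_smul, Matrix.smul_apply]; rfl

lemma grassDer_apply (g : Grass) : grassDer hτ hy g = grassMat hτ hy g 0 1 := rfl

lemma grassDer_ι (v : OddIdx →₀ ℝ) : grassDer hτ hy (ExteriorAlgebra.ι ℝ v) = genVal y v := by
  rw [grassDer_apply, grassMat_ι]
  rfl

lemma grassDer_mul (a b : Grass) : grassDer hτ hy (a * b) =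
    grassDer hτ hy a * cG U b + cG U (τ a) * grassDer hτ hy b := by
  simp only [grassDer_apply]
  rw [map_mul, Matrix.mul_apply, Fin.sum_univ_two, (grassMat_diag hτ hy a).1,
    (grassMat_diag hτ hy b).2.2, add_comm]

lemma grassDer_algebraMap (c : ℝ) : grassDer hτ hy (algebraMap ℝ Grass c) = 0 := by
  rw [grassDer_apply, AlgHom.commutes, Matrix.algebraMap_matrix_apply]
  rfl

lemma grassDer_dx (g : Grass) :
    grassDer hτ hy (grassDx g) = epsMap (superDx U) (grassDer hτ hy g) := by
  induction g using ExteriorAlgebra.induction with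
  | algebraMap r => rw [grassDx_algebraMap, grassDer_algebraMap, map_zero, map_zero]
  | ι v => rw [grassDx_ι, grassDer_ι, grassDer_ι, genVal_oddShift]
  | mul a b ha hb =>
    simp only [grassDx_mul, map_add, grassDer_mul, ha, hb, epsMap_mul superDx_mul, ← cG_dx,
      grassDx_twist hτ]
    abel
  | add a b ha hb => simp only [map_add, ha, hb]

/-- The twisted derivation on coefficients. -/
def superDer (x : Fin 2 → SuperPoly U) : Super U →ₗ[ℝ] SuperPoly U :=
  TensorProduct.lift (LinearMap.mk₂ ℝ (fun f g => aDer x (PowerSeries.C f) * cG U g +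
      incl U (PowerSeries.C f) * grassDer hτ hy g)
    (fun f f' g => by simp only [map_add, add_mul]; abel)
    (fun c f g => by
      have h : (PowerSeries.C (c • f) : DiffPoly U) = c • PowerSeries.C f := by
        ext1 n
        simp only [PowerSeries.coeff_C, PowerSeries.coeff_smul]
        split_ifs <;> simp
      rw [h, aDer_smul, incl_smul, smul_mul_assoc, smul_mul_assoc, smul_add])
    (fun f g g' => by simp only [map_add, mul_add]; abel)
    (fun c f g => by rw [cG_smul, map_smul, mul_smul_comm, mul_smul_comm, smul_add]))

lemma superDer_tmul (x : Fin 2 → SuperPoly U) (f : Jet U) (g : Grass) :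
    superDer hτ hy x (f ⊗ₜ g) = aDer x (PowerSeries.C f) * cG U g +
      incl U (PowerSeries.C f) * grassDer hτ hy g := rfl

lemma superDer_dx (x : Fin 2 → SuperPoly U) (a : Super U) :
    superDer hτ hy x (superDx U a) = epsMap (superDx U) (superDer hτ hy x a) := by
  induction a using TensorProduct.induction_on with
  | zero => simp
  | add a b ha hb => simp only [map_add, ha, hb]
  | tmul f g =>
    simp only [superDx_tmul, map_add, superDer_tmul, epsMap_mul superDx_mul, ← cG_dx,
      grassDer_dx, ← epsMap_C, (isADer_aDer x).dx, incl_dx]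
    abel

/-- Coefficients from 𝒜 are central, so the only delicate interchange is that of the Grassmann
factor g with the derivative of f', of parity e. It produces exactly the twist of the first factor.
-/
lemma superDer_mul {x : Fin 2 → SuperPoly U} (hx : ∀ α, HasPar e (x α))
    {ρ : SuperPoly U →+* SuperPoly U} (hρ : ∀ f, ρ (incl U f) = incl U f)
    (hρ' : ∀ g, ρ (cG U g) = cG U (τ g)) (a b : Super U) :
    superDer hτ hy x (a * b) = superDer hτ hy x a * PowerSeries.C b +
      ρ (PowerSeries.C a) * superDer hτ hy x b := by
  induction a using TensorProduct.induction_on with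
  | zero => simp
  | add a a' ha ha' => simp only [add_mul, map_add, ha, ha']; abel
  | tmul f g =>
    induction b using TensorProduct.induction_on with
    | zero => simp
    | add b b' hb hb' => simp only [mul_add, map_add, hb, hb']; abel
    | tmul f' g' =>
      have h1 : aDer x (PowerSeries.C (f * f')) = incl U (PowerSeries.C f) * aDer x
          (PowerSeries.C f') + incl U (PowerSeries.C f') * aDer x (PowerSeries.C f) := by
        rw [map_mul, (isADer_aDer x).mul]
      have h2 := HasPar.twist hτ (HasPar.aDer hx (PowerSeries.C f')) g
      rw [Algebra.TensorProduct.tmul_mul_tmul, superDer_tmul, superDer_tmul, superDer_tmul,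
        C_tmul, C_tmul, map_mul ρ, hρ, hρ', h1, map_mul (cG U), grassDer_mul, map_mul, map_mul]
      have c1 : incl U (PowerSeries.C f') * aDer x (PowerSeries.C f) * (cG U g * cG U g') =
          aDer x (PowerSeries.C f) * cG U g * (incl U (PowerSeries.C f') * cG U g') := by
        rw [incl_comm, mul_assoc, mul_assoc, ← mul_assoc (cG U g), ← incl_comm _ (cG U g), mul_assoc]
      have c2 : incl U (PowerSeries.C f) * aDer x (PowerSeries.C f') * (cG U g * cG U g') =
          incl U (PowerSeries.C f) * cG U (τ g) * (aDer x (PowerSeries.C f') * cG U g') := by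
        rw [mul_assoc, mul_assoc, ← mul_assoc _ (cG U g), ← h2, mul_assoc]
      have c3 : incl U (PowerSeries.C f) * incl U (PowerSeries.C f') *
          (grassDer hτ hy g * cG U g') =
          incl U (PowerSeries.C f) * grassDer hτ hy g * (incl U (PowerSeries.C f') * cG U g') := by
        rw [mul_assoc, mul_assoc, ← mul_assoc (incl U (PowerSeries.C f')), incl_comm _ (grassDer hτ hy g),
          mul_assoc]
      have c4 : incl U (PowerSeries.C f) * incl U (PowerSeries.C f') *
          (cG U (τ g) * grassDer hτ hy g') =
          incl U (PowerSeries.C f) * cG U (τ g) * (incl U (PowerSeries.C f') * grassDer hτ hy g') := by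
        rw [mul_assoc, mul_assoc, ← mul_assoc (incl U (PowerSeries.C f')), incl_comm _ (cG U (τ g)), mul_assoc]
      rw [add_mul, mul_add, add_mul, mul_add, c1, c2, c3, c4]
      abel

end TDerExistence

/-- Twisted derivations with given values on the generators exist. -/
lemma exists_isTDer {e : ℤ} {τ : Grass →ₐ[ℝ] Grass}
    (hτ : ∀ v, τ (ExteriorAlgebra.ι ℝ v) = e • ExteriorAlgebra.ι ℝ v)
    {ρ : SuperPoly U →+* SuperPoly U} (hρ : ∀ f, ρ (incl U f) = incl U f)
    (hρ' : ∀ g, ρ (cG U g) = cG U (τ g)) {x : Fin 2 → SuperPoly U} (hx : ∀ α, HasPar e (x α))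
    {y : Fin 2 → ℤ → SuperPoly U} (hy : ∀ α k, HasPar (-e) (y α k)) :
    ∃ D : SuperPoly U →+ SuperPoly U, IsTDer ρ (RingHom.id _) (epsMap (superDx U)) D ∧
      D (sP U) = x 0 ∧ D (sQ U) = x 1 ∧ ∀ α k, D (sig U α k) = y α k := by
  let D0 : Super U →+ SuperPoly U := (superDer hτ hy x).toAddMonoidHom
  have hi : ∀ f : Jet U, superDer hτ hy x (f ⊗ₜ (1 : Grass)) = aDer x (PowerSeries.C f) := by
    intro f
    have h1 : grassDer hτ hy 1 = 0 := by
      simpa using grassDer_algebraMap hτ hy 1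
    rw [superDer_tmul, h1, map_one, mul_one, mul_zero, add_zero]
  have hs : ∀ f : Smooth U, epsExt D0 (incl U (ofSmooth f)) = aDer x (ofSmooth f) := by
    intro f
    rw [ofSmooth, incl_C, epsExt_C]
    exact hi _
  have hP : epsExt D0 (sP U) = x 0 := by rw [sP, hs, aDer_P]
  have hQ : epsExt D0 (sQ U) = x 1 := by rw [sQ, hs, aDer_Q]
  have hρX : ∀ f, ρ (PowerSeries.X * f) = PowerSeries.X * ρ f := fun f => by
    rw [map_mul, ← incl_X, hρ]
  refine ⟨epsExt D0, ⟨fun f g => ?_, epsExt_X_mul D0, fun f => ?_, fun f => ?_⟩, hP, hQ, ?_⟩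
  · refine IsEps.ext (F := fun f => epsExt D0 (f * g))
      (G := fun f => epsExt D0 f * g + ρ f * epsExt D0 g)
      ⟨fun _ _ => by simp only [add_mul, map_add],
        fun _ => by simp only [mul_assoc, epsExt_X_mul]⟩
      ⟨fun _ _ => by simp only [add_mul, map_add]; abel,
        fun _ => by simp only [epsExt_X_mul, hρX, mul_assoc, mul_add]⟩ (fun f => ?_) f
    refine IsEps.ext (F := fun g => epsExt D0 (PowerSeries.C f * g))
      (G := fun g => epsExt D0 (PowerSeries.C f) * g + ρ (PowerSeries.C f) * epsExt D0 g)
      ⟨fun _ _ => by simp only [mul_add, map_add],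
        fun _ => by simp only [mul_X_left_comm, epsExt_X_mul]⟩
      ⟨fun _ _ => by simp only [mul_add, map_add]; abel,
        fun _ => by simp only [epsExt_X_mul, mul_X_left_comm, mul_add]⟩ (fun g => ?_) g
    simp only [← map_mul, epsExt_C]
    exact superDer_mul hτ hy hx hρ hρ' f g
  · refine IsEps.ext (F := fun f => epsExt D0 (epsMap (superDx U) f))
      (G := fun f => epsMap (superDx U) (epsExt D0 f))
      ⟨fun _ _ => by simp only [map_add], fun _ => by simp only [epsMap_X_mul, epsExt_X_mul]⟩
      ⟨fun _ _ => by simp only [map_add], fun _ => by simp only [epsMap_X_mul, epsExt_X_mul]⟩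
      (fun f => ?_) f
    simp only [epsMap_C, epsExt_C]
    exact superDer_dx hτ hy x f
  · rw [hP, hQ, hs, (isADer_aDer x).smooth, aDer_P, aDer_Q]
    rfl
  · intro α k
    rw [sig, epsExt_C]
    refine (superDer_tmul hτ hy x _ _).trans ?_
    rw [grassDer_ι, genVal_single, map_one PowerSeries.C, map_one (incl U)]
    have h1 : aDer x 1 = 0 := by
      have := (isADer_aDer x).mul 1 1
      simpa using this
    rw [h1, zero_mul, zero_add, one_mul]
    rfl

/-! ## Derivations and shifts -/

lemma series_smul_eq {R : Type} [Ring R] [Algebra ℝ R] (c : ℝ) (f : PowerSeries R) :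
    c • f = PowerSeries.C (algebraMap ℝ R c) * f := by
  ext1 n
  rw [PowerSeries.coeff_smul, PowerSeries.coeff_C_mul, Algebra.smul_def]

lemma smul_eq_incl_mul (c : ℝ) (f : SuperPoly U) :
    c • f = incl U (ofSmooth (algebraMap ℝ (Smooth U) c)) * f := by
  rw [series_smul_eq, ofSmooth, incl_C]
  rfl

lemma partialSmooth_algebraMap (i : Fin 2) (c : ℝ) :
    partialSmooth U i (algebraMap ℝ (Smooth U) c) = 0 := by
  rw [Algebra.algebraMap_eq_smul_one, map_smul, partialSmooth_one, smul_zero]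

lemma IsTDer.smul {M : Type} [Ring M] {τ : SuperPoly U →+* SuperPoly U} {π : SuperPoly U →+* M}
    {d : M →+ M} {D : SuperPoly U →+ M} (hD : IsTDer τ π d D)
    (hτ : ∀ f, τ (incl U f) = incl U f) (c : ℝ) (f : SuperPoly U) :
    D (c • f) = π (incl U (ofSmooth (algebraMap ℝ (Smooth U) c))) * D f := by
  rw [smul_eq_incl_mul, hD.mul, hD.smooth, partialSmooth_algebraMap, partialSmooth_algebraMap, hτ,
    ofSmooth_zero, map_zero, map_zero, zero_mul, zero_mul, zero_add, zero_mul, zero_add]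

/-- Twisted derivations of `SuperPoly U`. -/
abbrev IsSDer (τ : SuperPoly U →+* SuperPoly U) (D : SuperPoly U →+ SuperPoly U) : Prop :=
  IsTDer τ (RingHom.id _) (epsMap (superDx U)) D

section SDer

variable {τ : SuperPoly U →+* SuperPoly U} {D : SuperPoly U →+ SuperPoly U}

lemma IsSDer.epsOp (hD : IsSDer τ D) (hτ : ∀ f, τ (incl U f) = incl U f) (φ : PowerSeries ℝ)
    (f : SuperPoly U) : D (epsOp (superDx U) φ f) = epsOp (superDx U) φ (D f) :=
  epsOp_intertwine (fun f => hD.X_mul f) (fun f => hD.dx f) φ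
    (fun c f => by rw [hD.smul hτ, smul_eq_incl_mul]; rfl) f

lemma IsSDer.shift (hD : IsSDer τ D) (hτ : ∀ f, τ (incl U f) = incl U f) (m : ℤ)
    (f : SuperPoly U) : D (superShift U m f) = superShift U m (D f) := by
  simp only [superShift, shift_eq, hD.epsOp hτ]

lemma IsSDer.incl (hD : IsSDer τ D) (hτ : ∀ f, τ (incl U f) = incl U f) (f : DiffPoly U) :
    D (AblowitzLadik.incl U f) = aDer ![D (sP U), D (sQ U)] f := by
  refine IsADer.ext (D := D.comp (AblowitzLadik.incl U : DiffPoly U →+ SuperPoly U)) incl_X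
    (hD.comp_incl hτ fun f m => incl_comm f m) (isADer_aDer _) ?_ ?_ f
  · rw [aDer_P]; rfl
  · rw [aDer_Q]; rfl

end SDer

/-- Even derivations with given values on the generators exist. -/
lemma exists_even {x : Fin 2 → SuperPoly U} (hx : ∀ α, HasPar 1 (x α))
    {y : Fin 2 → ℤ → SuperPoly U} (hy : ∀ α k, HasPar (-1) (y α k)) :
    ∃ D : SuperPoly U →+ SuperPoly U, IsSDer (RingHom.id _) D ∧
      D (sP U) = x 0 ∧ D (sQ U) = x 1 ∧ ∀ α k, D (sig U α k) = y α k :=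
  exists_isTDer (e := 1) (τ := AlgHom.id ℝ Grass) (fun v => by rw [one_smul]; rfl)
    (fun _ => rfl) (fun _ => rfl) hx hy

/-- Odd derivations with given values on the generators exist. -/
lemma exists_odd {x : Fin 2 → SuperPoly U} (hx : ∀ α, HasPar (-1) (x α))
    {y : Fin 2 → ℤ → SuperPoly U} (hy : ∀ α k, HasPar 1 (y α k)) :
    ∃ D : SuperPoly U →+ SuperPoly U, IsSDer (parity U) D ∧
      D (sP U) = x 0 ∧ D (sQ U) = x 1 ∧ ∀ α k, D (sig U α k) = y α k :=
  exists_isTDer (e := -1) involute_ι parity_incl parity_cG hx hy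

/-! ## The relation ideal -/

lemma relIdeal_smul (c : ℝ) {f : SuperPoly U} (hf : f ∈ relIdeal U) : c • f ∈ relIdeal U := by
  rw [smul_eq_incl_mul]
  exact (relIdeal U).mul_mem_left _ hf

lemma relIdeal_epsOp (φ : PowerSeries ℝ) {f : SuperPoly U} (hf : f ∈ relIdeal U) :
    epsOp (superDx U) φ f ∈ relIdeal U :=
  epsOp_mem (S := (relIdeal U).toAddSubgroup) (fun _ h => (relIdeal U).mul_mem_left _ h)
    (fun c _ h => relIdeal_smul c h) (isRelIdeal_relIdeal U).dx_mem
    (isRelIdeal_relIdeal U).closed φ hf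

lemma relIdeal_shift (m : ℤ) {f : SuperPoly U} (hf : f ∈ relIdeal U) :
    superShift U m f ∈ relIdeal U := by
  rw [superShift, shift_eq]
  exact relIdeal_epsOp _ hf

/-- Twisted derivations that map the relations to the relation ideal preserve it. -/
lemma IsSDer.map_relIdeal {τ : SuperPoly U →+* SuperPoly U} {D : SuperPoly U →+ SuperPoly U}
    (hD : IsSDer τ D) (hJ : ∀ f ∈ relIdeal U, τ f ∈ relIdeal U)
    (h1 : ∀ k, D (rel1 U k) ∈ relIdeal U) (h2 : ∀ k, D (rel2 U k) ∈ relIdeal U)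
    {f : SuperPoly U} (hf : f ∈ relIdeal U) : D f ∈ relIdeal U := by
  have hr := isRelIdeal_relIdeal U
  have hX : ∀ (n : ℕ) (r : SuperPoly U), D (PowerSeries.X ^ n * r) = PowerSeries.X ^ n * D r := by
    intro n r
    induction n with
    | zero => simp
    | succ n ih => rw [pow_succ', mul_assoc, hD.X_mul, ih, mul_assoc]; rfl
  -- The elements f of J with D f in J again form an ideal as in `IsRelIdeal`, so by minimality they
  -- exhaust J. Closedness and saturation carry over because D is ε-linear.
  let I : Ideal (SuperPoly U) :=
    { carrier := {f | f ∈ relIdeal U ∧ D f ∈ relIdeal U}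
      zero_mem' := ⟨zero_mem _, by rw [map_zero]; exact zero_mem _⟩
      add_mem' := fun ha hb => ⟨add_mem ha.1 hb.1, by rw [map_add]; exact add_mem ha.2 hb.2⟩
      smul_mem' := fun a f hf => ⟨(relIdeal U).mul_mem_left a hf.1, by
        rw [smul_eq_mul, hD.mul]
        exact add_mem ((relIdeal U).mul_mem_left _ hf.1) ((relIdeal U).mul_mem_left _ hf.2)⟩ }
  refine (mem_relIdeal.1 hf I ⟨fun f g hf => ⟨hr.mul_right f g hf.1, ?_⟩,
    fun k => ⟨hr.rel1_mem k, h1 k⟩, fun k => ⟨hr.rel2_mem k, h2 k⟩,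
    fun f hf => ⟨hr.dx_mem f hf.1, ?_⟩, fun f hf => ⟨hr.closed f fun n => ?_,
      hr.closed _ fun n => ?_⟩, fun f hf => ⟨hr.saturated f hf.1, hr.saturated _ ?_⟩⟩).2
  · rw [hD.mul]
    exact add_mem (hr.mul_right _ _ hf.2) (hr.mul_right _ _ (hJ _ hf.1))
  · rw [hD.dx]
    exact hr.dx_mem _ hf.2
  · obtain ⟨g, hg, r, hr⟩ := hf n
    exact ⟨g, hg.1, r, hr⟩
  · obtain ⟨g, hg, r, hr⟩ := hf n
    exact ⟨D g, hg.2, D r, by rw [hr, map_add, hX]⟩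
  · have := hf.2
    rwa [hD.X_mul] at this

lemma parity_shift (m : ℤ) (f : SuperPoly U) :
    parity U (superShift U m f) = superShift U m (parity U f) := by
  simp only [superShift, shift_eq]
  exact epsOp_intertwine (T := (parity U : SuperPoly U →+ SuperPoly U)) parity_X_mul parity_dx _
    parity_smul f

lemma parity_parity (f : SuperPoly U) : parity U (parity U f) = f := by
  refine IsEps.ext (F := fun f => parity U (parity U f)) (G := fun f => f)
    ⟨fun _ _ => by simp only [map_add], fun _ => by simp only [parity_X_mul]⟩
    ⟨fun _ _ => rfl, fun _ => rfl⟩ (fun f => ?_) f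
  induction f using TensorProduct.induction_on with
  | zero => simp
  | add x y hx hy => simp only [map_add, hx, hy]
  | tmul f g =>
    simp only [C_tmul, map_mul, parity_incl, parity_cG]
    congr 2
    exact CliffordAlgebra.involute_involute g

lemma parity_sP : parity U (sP U) = sP U := parity_incl _

lemma parity_sQ : parity U (sQ U) = sQ U := parity_incl _

lemma rel1_eq (k : ℤ) : rel1 U k =
    (superShift U 1 (sQ U * s1 U (k + 1)) - sQ U * superShift U (-1) (s1 U (k + 1))) +
      (superShift U 1 (sQ U * s2 U (k + 1)) - sQ U * s2 U (k + 1)) -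
      sP U * (sQ U * s2 U k - superShift U 1 (sQ U * s2 U k)) := rfl

lemma rel2_eq (k : ℤ) : rel2 U k =
    s1 U (k + 1) + sP U * s1 U k + (superShift U 1 (sQ U * s2 U k) + sQ U * s2 U k) := rfl

lemma parity_sQ_mul_sig (α : Fin 2) (k : ℤ) :
    parity U (sQ U * sig U α k) = -(sQ U * sig U α k) := by
  rw [map_mul, parity_sQ, parity_sig, mul_neg]

lemma map_rel1_neg {R : Type} [Ring R] (π : R →+* R) {a b c d e f p : R} (ha : π a = -a)
    (hb : π b = -b) (hc : π c = -c) (hd : π d = -d) (he : π e = -e) (hf : π f = -f) (hp : π p = p) :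
    π ((a - b) + (c - d) - p * (e - f)) = -((a - b) + (c - d) - p * (e - f)) := by
  simp only [map_sub, map_add, map_mul, ha, hb, hc, hd, he, hf, hp]
  noncomm_ring

lemma parity_rel1 (k : ℤ) : parity U (rel1 U k) = -rel1 U k := by
  have h : ∀ m α k, parity U (superShift U m (sQ U * sig U α k)) =
      -superShift U m (sQ U * sig U α k) := fun m α k => by
    rw [parity_shift, parity_sQ_mul_sig, superShift_neg]
  have h' : parity U (sQ U * superShift U (-1) (s1 U (k + 1))) =
      -(sQ U * superShift U (-1) (s1 U (k + 1))) := by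
    rw [map_mul, parity_sQ, parity_shift, parity_sig, superShift_neg, mul_neg]
  rw [rel1_eq]
  exact map_rel1_neg (parity U) (h _ _ _) h' (h _ _ _) (parity_sQ_mul_sig _ _)
    (parity_sQ_mul_sig _ _) (h _ _ _) parity_sP

lemma parity_rel2 (k : ℤ) : parity U (rel2 U k) = -rel2 U k := by
  rw [rel2_eq, map_add, map_add, map_add, parity_shift, parity_sQ_mul_sig, superShift_neg,
    map_mul, parity_sP, parity_sig, parity_sig, mul_neg]
  abel

/-- The relations are odd, so the preimage of J under parity is an ideal as in `IsRelIdeal` and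
contains J. -/
lemma parity_mem_relIdeal {f : SuperPoly U} (hf : f ∈ relIdeal U) : parity U f ∈ relIdeal U := by
  have hr := isRelIdeal_relIdeal U
  refine mem_relIdeal.1 hf ((relIdeal U).comap (parity U)) ⟨fun f g hf => ?_, fun k => ?_,
    fun k => ?_, fun f hf => ?_, fun f hf => hr.closed _ fun n => ?_,
    fun f hf => hr.saturated _ ?_⟩
  · rw [Ideal.mem_comap, map_mul]
    exact hr.mul_right _ _ hf
  · rw [Ideal.mem_comap, parity_rel1]
    exact neg_mem (hr.rel1_mem k)
  · rw [Ideal.mem_comap, parity_rel2]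
    exact neg_mem (hr.rel2_mem k)
  · rw [Ideal.mem_comap, parity_dx]
    exact hr.dx_mem _ hf
  · obtain ⟨g, hg, r, hr⟩ := hf n
    exact ⟨parity U g, hg, parity U r, by rw [hr, map_add, map_mul, map_pow, parity_X]⟩
  · rwa [Ideal.mem_comap, map_mul, parity_X] at hf

/-! ## The ring `ℬ` -/

lemma toB_surjective (x : BRing U) : ∃ f, toB U f = x := Ideal.Quotient.mk_surjective x

lemma toB_eq_zero {f : SuperPoly U} : toB U f = 0 ↔ f ∈ relIdeal U := Ideal.Quotient.eq_zero_iff_mem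

lemma toB_eq {f g : SuperPoly U} : toB U f = toB U g ↔ f - g ∈ relIdeal U := by
  rw [← sub_eq_zero, ← map_sub, toB_eq_zero]

lemma dxB_toB (f : SuperPoly U) : dxB U (toB U f) = toB U (epsMap (superDx U) f) := rfl

lemma epsB_mul_toB (f : SuperPoly U) : epsB U * toB U f = toB U (PowerSeries.X * f) :=
  (map_mul (toB U) _ _).symm

/-- Saturation of J means that ε is not a zero divisor in ℬ. Flows are therefore determined by ε
times their values. -/
lemma epsB_cancel {x y : BRing U} (h : epsB U * x = epsB U * y) : x = y := by
  obtain ⟨f, rfl⟩ := toB_surjective x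
  obtain ⟨g, rfl⟩ := toB_surjective y
  rw [epsB_mul_toB, epsB_mul_toB, toB_eq, ← mul_sub] at h
  exact toB_eq.2 ((isRelIdeal_relIdeal U).saturated _ h)

/-- Closedness of J means that ℬ is separated in the ε-adic topology, so that a flow is determined
by its values on the generators. -/
lemma eq_zero_of_epsB_pow {x : BRing U} (h : ∀ n : ℕ, ∃ r, x = epsB U ^ n * r) : x = 0 := by
  obtain ⟨f, rfl⟩ := toB_surjective x
  refine toB_eq_zero.2 ((isRelIdeal_relIdeal U).closed _ fun n => ?_)
  obtain ⟨r, hr⟩ := h n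
  obtain ⟨r, rfl⟩ := toB_surjective r
  rw [epsB, ← map_pow, ← map_mul, toB_eq] at hr
  exact ⟨_, hr, r, by rw [sub_add_cancel]⟩

lemma inclB_comm (f : DiffPoly U) (x : BRing U) :
    toB U (incl U f) * x = x * toB U (incl U f) := by
  obtain ⟨g, rfl⟩ := toB_surjective x
  rw [← map_mul, incl_comm, map_mul]

lemma epsB_comm (x : BRing U) : epsB U * x = x * epsB U := by
  rw [epsB, ← incl_X, inclB_comm]

/-- The shift on `ℬ`. -/
def shiftB (U : Chart) (m : ℤ) : BRing U →+* BRing U :=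
  Ideal.Quotient.lift (relIdeal U) ((toB U).comp
    { toFun := superShift U m
      map_one' := superShift_one m
      map_mul' := superShift_mul m
      map_zero' := superShift_map_zero m
      map_add' := superShift_add m }) fun _ hf => toB_eq_zero.2 (relIdeal_shift m hf)

lemma shiftB_toB (m : ℤ) (f : SuperPoly U) : shiftB U m (toB U f) = toB U (superShift U m f) := rfl

/-- The parity automorphism of `ℬ`. -/
def parityB (U : Chart) : BRing U →+* BRing U :=
  Ideal.Quotient.lift (relIdeal U) ((toB U).comp (parity U))
    fun _ hf => toB_eq_zero.2 (parity_mem_relIdeal hf)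

lemma parityB_toB (f : SuperPoly U) : parityB U (toB U f) = toB U (parity U f) := rfl

lemma parityB_parityB (x : BRing U) : parityB U (parityB U x) = x := by
  obtain ⟨f, rfl⟩ := toB_surjective x
  rw [parityB_toB, parityB_toB, parity_parity]

/-- `1 + Λ` is injective on `ℬ`. -/
lemma eq_zero_of_shiftB_add {x : BRing U} (h : shiftB U 1 x + x = 0) : x = 0 := by
  obtain ⟨f, rfl⟩ := toB_surjective x
  obtain ⟨φ, hφ⟩ := exists_inv_shift_add (superDx U)
  rw [shiftB_toB, ← map_add, toB_eq_zero] at h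
  rw [toB_eq_zero, ← hφ f]
  exact relIdeal_epsOp φ h

/-- `2` is invertible in `ℬ`. -/
lemma eq_zero_of_add_self {x : BRing U} (h : x + x = 0) : x = 0 := by
  obtain ⟨f, rfl⟩ := toB_surjective x
  rw [← map_add, toB_eq_zero] at h
  have := relIdeal_smul (1 / 2 : ℝ) h
  rw [toB_eq_zero]
  convert this using 1
  rw [← two_smul ℝ f, smul_smul]
  norm_num

/-- The descent to `ℬ` of a derivation that preserves the relation ideal. -/
def descend (D : SuperPoly U →+ SuperPoly U) (hD : ∀ f ∈ relIdeal U, D f ∈ relIdeal U) :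
    BRing U →+ BRing U :=
  QuotientAddGroup.map (relIdeal U).toAddSubgroup (relIdeal U).toAddSubgroup D hD

lemma descend_toB (D : SuperPoly U →+ SuperPoly U) (hD : ∀ f ∈ relIdeal U, D f ∈ relIdeal U)
    (f : SuperPoly U) : descend D hD (toB U f) = toB U (D f) := rfl

/-! ## Flows on `ℬ` -/

/-- A map on `ℬ` as a map on `SuperPoly U`. -/
def lift (D : BRing U →+ BRing U) : SuperPoly U →+ BRing U := D.comp (toB U : SuperPoly U →+ BRing U)

lemma lift_apply (D : BRing U →+ BRing U) (f : SuperPoly U) : lift D f = D (toB U f) := rfl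

/-- A twisted derivation with values in `ℬ` that vanishes on the generators vanishes. -/
lemma IsTDer.eq_zero {τ : SuperPoly U →+* SuperPoly U} {π : SuperPoly U →+* BRing U}
    {D : SuperPoly U →+ BRing U} (hD : IsTDer τ π (dxB U) D) (hτ : ∀ f, τ (incl U f) = incl U f)
    (hπ : ∀ f, π (incl U f) = toB U (incl U f)) (hP : D (sP U) = 0) (hQ : D (sQ U) = 0)
    (hs : ∀ α k, D (sig U α k) = 0) (f : SuperPoly U) : D f = 0 := by
  have hX : π PowerSeries.X = epsB U := by rw [← incl_X, hπ, incl_X]; rfl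
  refine hD.mem hτ (fun f m => by rw [hπ, inclB_comm]) ⊥ (fun a m hm => ?_) (fun a m hm => ?_)
    (fun m hm => ?_) (fun m hm => ?_) hP hQ hs f
  · rw [AddSubgroup.mem_bot] at hm ⊢
    rw [hm, mul_zero]
  · rw [AddSubgroup.mem_bot] at hm ⊢
    rw [hm, zero_mul]
  · rw [AddSubgroup.mem_bot] at hm ⊢
    rw [hm, map_zero]
  · rw [AddSubgroup.mem_bot]
    refine eq_zero_of_epsB_pow fun n => ?_
    obtain ⟨g, hg, r, hr⟩ := hm n
    exact ⟨r, by rw [hr, AddSubgroup.mem_bot.1 hg, zero_add, hX]⟩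

section Flows

variable {D D' : BRing U →+ BRing U}

lemma IsEvenFlow.isTDer (hD : IsEvenFlow D) :
    IsTDer (RingHom.id _) (toB U) (dxB U) (lift D) where
  mul f g := by
    rw [lift_apply, map_mul, hD.leibniz]
    rfl
  X_mul f := by
    rw [lift_apply, map_mul, hD.leibniz]
    change D (epsB U) * _ + _ = _
    rw [hD.eps, zero_mul, zero_add]
    rfl
  dx f := hD.dx (toB U f)
  smooth f := hD.chain f

lemma IsOddFlow.isTDer (hD : IsOddFlow D) : IsTDer (parity U) (toB U) (dxB U) (lift D) where
  mul f g := hD.leibniz f g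
  X_mul f := by
    refine (hD.leibniz _ _).trans ?_
    change D (epsB U) * _ + _ = _
    rw [hD.eps, zero_mul, zero_add, parity_X]
    rfl
  dx f := hD.dx (toB U f)
  smooth f := hD.chain f

lemma IsSDer.isEvenFlow {D : SuperPoly U →+ SuperPoly U} (hD : IsSDer (RingHom.id _) D)
    (hJ : ∀ f ∈ relIdeal U, D f ∈ relIdeal U) : IsEvenFlow (descend D hJ) where
  leibniz x y := by
    obtain ⟨f, rfl⟩ := toB_surjective x
    obtain ⟨g, rfl⟩ := toB_surjective y
    rw [← map_mul, descend_toB, hD.mul, map_add, map_mul, map_mul]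
    rfl
  eps := by
    have h := hD.X_mul 1
    have h1 : D 1 = 0 := by simpa using hD.mul 1 1
    rw [h1, mul_zero, mul_one] at h
    rw [epsB, descend_toB, h, map_zero]
  dx x := by
    obtain ⟨f, rfl⟩ := toB_surjective x
    rw [dxB_toB, descend_toB, hD.dx]
    rfl
  chain f := by
    simp only [smoothB, descend_toB, hD.smooth f, map_add, map_mul]
    rfl

lemma IsSDer.isOddFlow {D : SuperPoly U →+ SuperPoly U} (hD : IsSDer (parity U) D)
    (hJ : ∀ f ∈ relIdeal U, D f ∈ relIdeal U) : IsOddFlow (descend D hJ) where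
  leibniz f g := by
    rw [descend_toB, hD.mul, map_add, map_mul, map_mul]
    rfl
  eps := by
    have h := hD.X_mul 1
    have h1 : D 1 = 0 := by simpa using hD.mul 1 1
    rw [h1, mul_zero, mul_one] at h
    rw [epsB, descend_toB, h, map_zero]
  dx x := by
    obtain ⟨f, rfl⟩ := toB_surjective x
    rw [dxB_toB, descend_toB, hD.dx]
    rfl
  chain f := by
    simp only [smoothB, descend_toB, hD.smooth f, map_add, map_mul]
    rfl

lemma IsOddFlow.leibniz_parityB (hD : IsOddFlow D) (x y : BRing U) :
    D (x * y) = D x * y + parityB U x * D y := by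
  obtain ⟨f, rfl⟩ := toB_surjective x
  obtain ⟨g, rfl⟩ := toB_surjective y
  rw [← map_mul, hD.leibniz, parityB_toB]

lemma IsEvenFlow.ext (hD : IsEvenFlow D) (hD' : IsEvenFlow D')
    (hP : D (toB U (sP U)) = D' (toB U (sP U))) (hQ : D (toB U (sQ U)) = D' (toB U (sQ U)))
    (hs : ∀ α k, D (toB U (sig U α k)) = D' (toB U (sig U α k))) : D = D' := by
  refine AddMonoidHom.ext fun x => ?_
  obtain ⟨f, rfl⟩ := toB_surjective x
  rw [← sub_eq_zero]
  exact (hD.isTDer.sub hD'.isTDer).eq_zero (fun _ => rfl) (fun _ => rfl) (sub_eq_zero.2 hP)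
    (sub_eq_zero.2 hQ) (fun α k => sub_eq_zero.2 (hs α k)) f

lemma IsOddFlow.ext (hD : IsOddFlow D) (hD' : IsOddFlow D')
    (hP : D (toB U (sP U)) = D' (toB U (sP U))) (hQ : D (toB U (sQ U)) = D' (toB U (sQ U)))
    (hs : ∀ α k, D (toB U (sig U α k)) = D' (toB U (sig U α k))) : D = D' := by
  refine AddMonoidHom.ext fun x => ?_
  obtain ⟨f, rfl⟩ := toB_surjective x
  rw [← sub_eq_zero]
  exact (hD.isTDer.sub hD'.isTDer).eq_zero parity_incl (fun _ => rfl) (sub_eq_zero.2 hP)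
    (sub_eq_zero.2 hQ) (fun α k => sub_eq_zero.2 (hs α k)) f

lemma isEvenFlow_zero : IsEvenFlow (0 : BRing U →+ BRing U) :=
  ⟨fun _ _ => by simp, rfl, fun _ => by simp, fun _ => by simp⟩

lemma isOddFlow_zero : IsOddFlow (0 : BRing U →+ BRing U) :=
  ⟨fun _ _ => by simp, rfl, fun _ => by simp, fun _ => by simp⟩

lemma IsEvenFlow.epsB_mul (hD : IsEvenFlow D) (x : BRing U) : D (epsB U * x) = epsB U * D x := by
  rw [hD.leibniz, hD.eps, zero_mul, zero_add]

lemma parityB_epsB : parityB U (epsB U) = epsB U := by rw [epsB, parityB_toB, parity_X]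

lemma IsOddFlow.epsB_mul (hD : IsOddFlow D) (x : BRing U) : D (epsB U * x) = epsB U * D x := by
  rw [hD.leibniz_parityB, hD.eps, zero_mul, zero_add, parityB_epsB]

lemma parityB_incl (f : DiffPoly U) : parityB U (toB U (incl U f)) = toB U (incl U f) := by
  rw [parityB_toB, parity_incl]

lemma parityB_smoothB (f : Smooth U) : parityB U (smoothB f) = smoothB f := parityB_incl _

lemma parityB_dxB (x : BRing U) : parityB U (dxB U x) = dxB U (parityB U x) := by
  obtain ⟨f, rfl⟩ := toB_surjective x
  rw [dxB_toB, parityB_toB, parity_dx]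
  rfl

/-- Even flows that respect the parity of the generators commute with the parity. -/
lemma IsEvenFlow.parityB_comm (hD : IsEvenFlow D)
    (hP : parityB U (D (toB U (sP U))) = D (toB U (sP U)))
    (hQ : parityB U (D (toB U (sQ U))) = D (toB U (sQ U)))
    (hs : ∀ α k, parityB U (D (toB U (sig U α k))) = -D (toB U (sig U α k))) (x : BRing U) :
    D (parityB U x) = parityB U (D x) := by
  obtain ⟨f, rfl⟩ := toB_surjective x
  rw [← sub_eq_zero]
  -- The commutator of D with parity is a derivation along the composite of parity with the
  -- projection, so it vanishes once it vanishes on the generators.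
  have h : IsTDer (RingHom.id _) ((toB U).comp (parity U)) (dxB U)
      (lift (D.comp (parityB U : BRing U →+ BRing U) - (parityB U : BRing U →+ BRing U).comp D)) := by
    have e : ∀ x, (D.comp (parityB U : BRing U →+ BRing U) -
      (parityB U : BRing U →+ BRing U).comp D) x = D (parityB U x) - parityB U (D x) := fun _ => rfl
    refine ⟨fun f g => ?_, fun f => ?_, fun f => ?_, fun f => ?_⟩
    · simp only [lift_apply, e, map_mul, hD.leibniz, map_add, RingHom.comp_apply, RingHom.id_apply,
        parityB_toB, sub_mul, mul_sub]
      abel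
    · simp only [lift_apply, e, RingHom.comp_apply, parity_X]
      change _ = epsB U * _
      simp only [← epsB_mul_toB, hD.epsB_mul, map_mul (parityB U), parityB_epsB, mul_sub]
    · change D (parityB U (dxB U (toB U f))) - parityB U (D (dxB U (toB U f))) = dxB U (_ - _)
      rw [parityB_dxB, hD.dx, hD.dx, parityB_dxB, map_sub]
      rfl
    · change D (parityB U (smoothB f)) - parityB U (D (smoothB f)) =
        toB U (parity U (incl U _)) * (D (parityB U (smoothB _)) - parityB U (D (smoothB _))) +
        toB U (parity U (incl U _)) * (D (parityB U (smoothB _)) - parityB U (D (smoothB _)))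
      simp only [parityB_smoothB, hD.chain f, map_add, map_mul, parity_incl, mul_sub]
      change _ = smoothB (partialSmooth U 0 f) * _ - smoothB (partialSmooth U 0 f) * _ +
        (smoothB (partialSmooth U 1 f) * _ - smoothB (partialSmooth U 1 f) * _)
      abel
  refine h.eq_zero (fun _ => rfl) parityB_incl ?_ ?_ (fun α k => ?_) f
  · change D (parityB U (toB U (incl U _))) - parityB U (D (toB U (sP U))) = 0
    rw [hP, parityB_incl]
    exact sub_self _
  · change D (parityB U (toB U (incl U _))) - parityB U (D (toB U (sQ U))) = 0
    rw [hQ, parityB_incl]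
    exact sub_self _
  · change D (parityB U (toB U (sig U α k))) - parityB U (D (toB U (sig U α k))) = 0
    rw [hs, parityB_toB, parity_sig, map_neg, map_neg, sub_self]

/-- Odd flows that reverse the parity of the generators anticommute with the parity. -/
lemma IsOddFlow.parityB_comm (hD : IsOddFlow D)
    (hP : parityB U (D (toB U (sP U))) = -D (toB U (sP U)))
    (hQ : parityB U (D (toB U (sQ U))) = -D (toB U (sQ U)))
    (hs : ∀ α k, parityB U (D (toB U (sig U α k))) = D (toB U (sig U α k))) (x : BRing U) :
    D (parityB U x) = -parityB U (D x) := by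
  obtain ⟨f, rfl⟩ := toB_surjective x
  rw [← add_eq_zero_iff_eq_neg]
  have h : IsTDer (parity U) ((toB U).comp (parity U)) (dxB U)
      (lift (D.comp (parityB U : BRing U →+ BRing U) + (parityB U : BRing U →+ BRing U).comp D)) := by
    have e : ∀ x, (D.comp (parityB U : BRing U →+ BRing U) +
      (parityB U : BRing U →+ BRing U).comp D) x = D (parityB U x) + parityB U (D x) := fun _ => rfl
    refine ⟨fun f g => ?_, fun f => ?_, fun f => ?_, fun f => ?_⟩
    · simp only [lift_apply, e, map_mul, hD.leibniz_parityB, map_add, RingHom.comp_apply,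
        ← parityB_toB, add_mul, mul_add]
      abel
    · simp only [lift_apply, e, RingHom.comp_apply, parity_X]
      change _ = epsB U * _
      simp only [← epsB_mul_toB, hD.epsB_mul, map_mul (parityB U), parityB_epsB, mul_add]
    · change D (parityB U (dxB U (toB U f))) + parityB U (D (dxB U (toB U f))) = dxB U (_ + _)
      rw [parityB_dxB, hD.dx, hD.dx, parityB_dxB, map_add]
      rfl
    · change D (parityB U (smoothB f)) + parityB U (D (smoothB f)) =
        toB U (parity U (incl U _)) * (D (parityB U (smoothB _)) + parityB U (D (smoothB _))) +
        toB U (parity U (incl U _)) * (D (parityB U (smoothB _)) + parityB U (D (smoothB _)))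
      simp only [parityB_smoothB, hD.chain f, map_add, map_mul, parity_incl, mul_add]
      change _ = smoothB (partialSmooth U 0 f) * _ + smoothB (partialSmooth U 0 f) * _ +
        (smoothB (partialSmooth U 1 f) * _ + smoothB (partialSmooth U 1 f) * _)
      abel
  refine h.eq_zero parity_incl parityB_incl ?_ ?_ (fun α k => ?_) f
  · change D (parityB U (toB U (incl U _))) + parityB U (D (toB U (sP U))) = 0
    rw [hP, parityB_incl]
    exact add_neg_cancel _
  · change D (parityB U (toB U (incl U _))) + parityB U (D (toB U (sQ U))) = 0
    rw [hQ, parityB_incl]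
    exact add_neg_cancel _
  · change D (parityB U (toB U (sig U α k))) + parityB U (D (toB U (sig U α k))) = 0
    rw [hs, parityB_toB, parity_sig, map_neg, map_neg, neg_add_cancel]

/-- In the (anti)commutator of two chain rules the second derivatives of f multiply graded symmetric
products of the velocities and cancel. The value e = -1 serves commutators and e = 1
anticommutators. -/
lemma chain_comm_aux {B : Type} [Ring B] (e : ℤ) (a00 a01 a11 a0 a1 p q p' q' pp' qq' pp qq : B)
    (h : p * p' = -(e • (p' * p)) ∧ p * q' = -(e • (q' * p)) ∧ q * p' = -(e • (p' * q)) ∧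
      q * q' = -(e • (q' * q))) :
    (a00 * p + a01 * q) * p' + a0 * pp' + ((a01 * p + a11 * q) * q' + a1 * qq') +
      e • ((a00 * p' + a01 * q') * p + a0 * pp + ((a01 * p' + a11 * q') * q + a1 * qq)) =
    a0 * (pp' + e • pp) + a1 * (qq' + e • qq) := by
  obtain ⟨h2, h3, h4, h5⟩ := h
  simp only [add_mul, mul_assoc, h2, h3, h4, h5, mul_neg, smul_add, mul_add, mul_smul_comm]
  abel

/-! ### Graded commutators of flows are flows -/

section Commutators

/-- The generators `P`, `Q`. -/
def genB (U : Chart) : Fin 2 → BRing U := ![smoothB (fP U), smoothB (fQ U)]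

/-- The commutator of even flows. -/
lemma IsEvenFlow.comm (hD : IsEvenFlow D) (hD' : IsEvenFlow D')
    (hc : ∀ i j, D (genB U i) * D' (genB U j) = D' (genB U j) * D (genB U i)) :
    IsEvenFlow (D.comp D' - D'.comp D) := by
  have e : ∀ x, (D.comp D' - D'.comp D) x = D (D' x) - D' (D x) := fun _ => rfl
  refine ⟨fun x y => ?_, ?_, fun x => ?_, fun f => ?_⟩
  · simp only [e, hD.leibniz, hD'.leibniz, map_add]
    noncomm_ring
  · simp only [e, hD.eps, hD'.eps, map_zero, sub_zero]
  · simp only [e, hD.dx, hD'.dx, map_sub]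
  · simp only [e, hD.chain f, hD'.chain f, map_add, hD.leibniz, hD'.leibniz, hD.chain (partialSmooth U _ f),
      hD'.chain (partialSmooth U _ f), partialSmooth_comm 1 0]
    have h := chain_comm_aux (-1) (smoothB (partialSmooth U 0 (partialSmooth U 0 f)))
      (smoothB (partialSmooth U 0 (partialSmooth U 1 f)))
      (smoothB (partialSmooth U 1 (partialSmooth U 1 f)))
      (smoothB (partialSmooth U 0 f)) (smoothB (partialSmooth U 1 f))
      (D (smoothB (fP U))) (D (smoothB (fQ U))) (D' (smoothB (fP U))) (D' (smoothB (fQ U)))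
      (D (D' (smoothB (fP U)))) (D (D' (smoothB (fQ U))))
      (D' (D (smoothB (fP U)))) (D' (D (smoothB (fQ U)))) (by simpa [genB] using ⟨hc 0 0, hc 0 1, hc 1 0, hc 1 1⟩)
    simpa only [neg_one_smul, ← sub_eq_add_neg] using h

/-- The commutator of an even and an odd flow. -/
lemma IsEvenFlow.comm_odd (hD : IsEvenFlow D) (hD' : IsOddFlow D')
    (hp : ∀ x, D (parityB U x) = parityB U (D x))
    (hc : ∀ i j, D (genB U i) * D' (genB U j) = D' (genB U j) * D (genB U i)) :
    IsOddFlow (D.comp D' - D'.comp D) := by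
  have e : ∀ x, (D.comp D' - D'.comp D) x = D (D' x) - D' (D x) := fun _ => rfl
  refine ⟨fun f g => ?_, ?_, fun x => ?_, fun f => ?_⟩
  · simp only [e, map_mul, hD.leibniz, hD'.leibniz_parityB, map_add, hp, ← parityB_toB]
    noncomm_ring
  · simp only [e, hD.eps, hD'.eps, map_zero, sub_zero]
  · simp only [e, hD.dx, hD'.dx, map_sub]
  · simp only [e, hD.chain f, hD'.chain f, map_add, hD.leibniz, hD'.leibniz_parityB, hD.chain (partialSmooth U _ f),
      hD'.chain (partialSmooth U _ f), partialSmooth_comm 1 0, parityB_smoothB]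
    have h := chain_comm_aux (-1) (smoothB (partialSmooth U 0 (partialSmooth U 0 f)))
      (smoothB (partialSmooth U 0 (partialSmooth U 1 f)))
      (smoothB (partialSmooth U 1 (partialSmooth U 1 f)))
      (smoothB (partialSmooth U 0 f)) (smoothB (partialSmooth U 1 f))
      (D (smoothB (fP U))) (D (smoothB (fQ U))) (D' (smoothB (fP U))) (D' (smoothB (fQ U)))
      (D (D' (smoothB (fP U)))) (D (D' (smoothB (fQ U))))
      (D' (D (smoothB (fP U)))) (D' (D (smoothB (fQ U)))) (by simpa [genB] using ⟨hc 0 0, hc 0 1, hc 1 0, hc 1 1⟩)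
    simpa only [neg_one_smul, ← sub_eq_add_neg] using h

/-- The anticommutator of odd flows. -/
lemma IsOddFlow.anticomm (hD : IsOddFlow D) (hD' : IsOddFlow D')
    (hp : ∀ x, D (parityB U x) = -parityB U (D x))
    (hp' : ∀ x, D' (parityB U x) = -parityB U (D' x))
    (hc : ∀ i j, D (genB U i) * D' (genB U j) = -(D' (genB U j) * D (genB U i))) :
    IsEvenFlow (D.comp D' + D'.comp D) := by
  have e : ∀ x, (D.comp D' + D'.comp D) x = D (D' x) + D' (D x) := fun _ => rfl
  refine ⟨fun x y => ?_, ?_, fun x => ?_, fun f => ?_⟩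
  · simp only [e, hD.leibniz_parityB, hD'.leibniz_parityB, map_add, hp, hp', parityB_parityB]
    noncomm_ring
  · simp only [e, hD.eps, hD'.eps, map_zero, add_zero]
  · simp only [e, hD.dx, hD'.dx, map_add]
  · simp only [e, hD.chain f, hD'.chain f, map_add, hD.leibniz_parityB, hD'.leibniz_parityB, hD.chain (partialSmooth U _ f),
      hD'.chain (partialSmooth U _ f), partialSmooth_comm 1 0, parityB_smoothB]
    have h := chain_comm_aux 1 (smoothB (partialSmooth U 0 (partialSmooth U 0 f)))
      (smoothB (partialSmooth U 0 (partialSmooth U 1 f)))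
      (smoothB (partialSmooth U 1 (partialSmooth U 1 f)))
      (smoothB (partialSmooth U 0 f)) (smoothB (partialSmooth U 1 f))
      (D (smoothB (fP U))) (D (smoothB (fQ U))) (D' (smoothB (fP U))) (D' (smoothB (fQ U)))
      (D (D' (smoothB (fP U)))) (D (D' (smoothB (fQ U))))
      (D' (D (smoothB (fP U)))) (D' (D (smoothB (fQ U)))) (by simpa [genB] using ⟨hc 0 0, hc 0 1, hc 1 0, hc 1 1⟩)
    simpa only [one_smul] using h

end Commutators

end Flows

/-! ## Oriented sums -/

section OrientedSum

variable {M N : Type} [AddCommGroup M] [AddCommGroup N]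

/-- A discrete primitive. -/
def prim (f : ℤ → M) : ℤ → M
  | Int.ofNat n => ∑ i ∈ Finset.range n, f i
  | Int.negSucc n => -∑ i ∈ Finset.range (n + 1), f (-1 - i)

lemma prim_add_one (f : ℤ → M) (n : ℤ) : prim f (n + 1) = prim f n + f n := by
  rcases n with n | n
  · change ∑ i ∈ Finset.range (n + 1), f i = _
    rw [Finset.sum_range_succ]
    rfl
  · rcases n with _ | n
    · change ∑ i ∈ Finset.range 0, f i = -∑ i ∈ Finset.range 1, f (-1 - i) + f (-1)
      simp
    · change prim f (Int.negSucc n) = -∑ i ∈ Finset.range (n + 2), f (-1 - i) + _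
      rw [Finset.sum_range_succ]
      have e : (Int.negSucc (n + 1)) = -1 - ((n + 1 : ℕ) : ℤ) := by
        rw [Int.negSucc_eq]; push_cast; ring
      rw [e]
      change -∑ i ∈ Finset.range (n + 1), f (-1 - i) = _
      abel

/-- The oriented sum of `f j` over `k ≤ j < l`. -/
def osum (f : ℤ → M) (k l : ℤ) : M := prim f l - prim f k

lemma osum_self (f : ℤ → M) (k : ℤ) : osum f k k = 0 := sub_self _

lemma osum_swap (f : ℤ → M) (k l : ℤ) : osum f k l = -osum f l k := (neg_sub _ _).symm

lemma osum_succ (f : ℤ → M) (k l : ℤ) : osum f k (l + 1) = osum f k l + f l := by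
  rw [osum, prim_add_one, osum]
  abel

lemma osum_left (f : ℤ → M) (k l : ℤ) : osum f k l = f k + osum f (k + 1) l := by
  simp only [osum, prim_add_one]
  abel

/-- The oriented sum is the unique solution of its difference equation with initial value 0.
Identities between such sums are thereby proved without distinguishing k ≤ l from k > l. -/
lemma osum_unique {f : ℤ → M} {k : ℤ} {g : ℤ → M} (h0 : g k = 0)
    (h : ∀ l, g (l + 1) = g l + f l) (l : ℤ) : g l = osum f k l := by
  induction l using Int.inductionOn' (b := k) with
  | zero => rw [h0, osum_self]
  | succ l _ ih => rw [h, ih, osum_succ]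
  | pred l _ ih =>
    have h1 := h (l - 1)
    have h2 := osum_succ f k (l - 1)
    rw [sub_add_cancel] at h1 h2
    rw [ih, h2] at h1
    exact (add_right_cancel h1).symm

lemma osum_nat (f : ℤ → M) (k : ℤ) (m : ℕ) :
    osum f k (k + m) = ∑ i ∈ Finset.range m, f (k + i) := by
  induction m with
  | zero => simp [osum_self]
  | succ m ih =>
    rw [Finset.sum_range_succ, ← ih, ← osum_succ, Nat.cast_succ, add_assoc]

lemma osum_map (φ : M →+ N) (f : ℤ → M) (k l : ℤ) :
    φ (osum f k l) = osum (fun j => φ (f j)) k l :=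
  osum_unique (g := fun l => φ (osum f k l)) (by simp only [osum_self, map_zero])
    (fun l => by simp only [osum_succ, map_add]) l

lemma osum_add (f g : ℤ → M) (k l : ℤ) :
    osum (fun j => f j + g j) k l = osum f k l + osum g k l :=
  (osum_unique (g := fun l => osum f k l + osum g k l) (by simp only [osum_self, add_zero])
    (fun l => by simp only [osum_succ]; abel) l).symm

lemma osum_neg (f : ℤ → M) (k l : ℤ) : osum (fun j => -f j) k l = -osum f k l :=
  (osum_unique (g := fun l => -osum f k l) (by simp only [osum_self, neg_zero])
    (fun l => by simp only [osum_succ]; abel) l).symm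

lemma osum_sub (f g : ℤ → M) (k l : ℤ) :
    osum (fun j => f j - g j) k l = osum f k l - osum g k l := by
  simp only [sub_eq_add_neg, osum_add, osum_neg]

lemma osum_shift (f : ℤ → M) (k l a : ℤ) :
    osum f (k + a) (l + a) = osum (fun j => f (j + a)) k l :=
  osum_unique (g := fun l => osum f (k + a) (l + a)) (by simp only [osum_self])
    (fun l => by simp only [add_right_comm l 1 a, osum_succ]) l

lemma osum_reflect (f : ℤ → M) {k l a : ℤ} (ha : a = k + l - 1) :
    osum (fun j => f (a - j)) k l = osum f k l := by
  have h : ∀ l, osum (fun j => f (a - j)) k l = osum f (a + 1 - l) (a + 1 - k) := by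
    refine fun l => (osum_unique (g := fun l => osum f (a + 1 - l) (a + 1 - k))
      (by simp only [osum_self]) (fun l => ?_) l).symm
    have e1 : a + 1 - (l + 1) = a - l := by ring
    have e2 : a + 1 - l = a - l + 1 := by ring
    rw [e1, e2, osum_left f (a - l), add_comm]
  rw [h]
  congr 1 <;> subst ha <;> ring

/-- The reflection j ↦ a - j preserves the interval and reverses the sign of the summand; there is
no 2-torsion. -/
lemma osum_antisymm (h2 : ∀ x : M, x + x = 0 → x = 0) {f : ℤ → ℤ → M}
    (hf : ∀ i j, f i j = -f j i) {k l a : ℤ} (ha : a = k + l - 1) :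
    osum (fun j => f j (a - j)) k l = 0 := by
  apply h2
  nth_rewrite 1 [← osum_reflect _ ha]
  rw [← osum_add]
  simp only [sub_sub_cancel]
  have : (fun j => f (a - j) j + f j (a - j)) = fun _ => (0 : M) := by
    funext j
    rw [hf, neg_add_cancel]
  rw [this]
  exact (osum_unique (f := fun _ => (0 : M)) (g := fun _ => (0 : M)) rfl (fun _ => by simp) l).symm

lemma osum_congr {f g : ℤ → M} (h : ∀ j, f j = g j) (k l : ℤ) : osum f k l = osum g k l := by
  rw [funext h]

end OrientedSum

section OrientedProducts

variable {R : Type} [Ring R]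

lemma mul_osum (a : R) (f : ℤ → R) (k l : ℤ) :
    a * osum f k l = osum (fun j => a * f j) k l := osum_map (AddMonoidHom.mulLeft a) f k l

lemma osum_map_ring {S : Type} [Ring S] (φ : R →+* S) (f : ℤ → R) (k l : ℤ) :
    φ (osum f k l) = osum (fun j => φ (f j)) k l := osum_map (φ : R →+ S) f k l

/-- The oriented convolution `∑_{k ≤ j < l} x_j y_{k+l-1-j}`. -/
def oconv (x y : ℤ → R) (k l : ℤ) : R := osum (fun j => x j * y (k + l - 1 - j)) k l

/-- The separate formulas for positive, zero and negative index difference in the odd flows are the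
cases of one oriented convolution, and this is their antisymmetry. -/
lemma oconv_swap (x y : ℤ → R) (k l : ℤ) : oconv x y k l = -oconv x y l k := by
  rw [oconv, osum_swap, oconv, add_comm]

lemma oconv_self (x y : ℤ → R) (k : ℤ) : oconv x y k k = 0 := osum_self _ _

lemma oconv_reflect (x y : ℤ → R) (k l : ℤ) :
    oconv x y k l = osum (fun j => x (k + l - 1 - j) * y j) k l := by
  rw [oconv, ← osum_reflect _ (rfl : k + l - 1 = k + l - 1)]
  simp only [sub_sub_cancel]

lemma oconv_anticomm {x y : ℤ → R} (h : ∀ i j, x i * y j = -(y j * x i)) (k l : ℤ) :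
    oconv x y k l = -oconv y x k l := by
  rw [oconv_reflect, oconv, ← osum_neg]
  exact osum_congr (fun j => h _ _) k l

lemma oconv_antisymm (h2 : ∀ x : R, x + x = 0 → x = 0) {x : ℤ → R}
    (h : ∀ i j, x i * x j = -(x j * x i)) (k l : ℤ) : oconv x x k l = 0 :=
  osum_antisymm h2 (f := fun i j => x i * x j) h rfl

lemma oconv_add_right (x y z : ℤ → R) (k l : ℤ) :
    oconv x (fun j => y j + z j) k l = oconv x y k l + oconv x z k l := by
  simp only [oconv, mul_add, osum_add]

lemma oconv_add_left (x y z : ℤ → R) (k l : ℤ) :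
    oconv (fun j => x j + y j) z k l = oconv x z k l + oconv y z k l := by
  simp only [oconv, add_mul, osum_add]

lemma oconv_sub_right (x y z : ℤ → R) (k l : ℤ) :
    oconv x (fun j => y j - z j) k l = oconv x y k l - oconv x z k l := by
  simp only [oconv, mul_sub, osum_sub]

lemma oconv_neg_right (x y : ℤ → R) (k l : ℤ) :
    oconv x (fun j => -y j) k l = -oconv x y k l := by
  simp only [oconv, mul_neg, osum_neg]

lemma oconv_mul_left (a : R) (x y : ℤ → R) (k l : ℤ) :
    oconv (fun j => a * x j) y k l = a * oconv x y k l := by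
  simp only [oconv, mul_osum, mul_assoc]

lemma oconv_mul_right {a : R} (ha : ∀ z, a * z = z * a) (x y : ℤ → R) (k l : ℤ) :
    oconv x (fun j => a * y j) k l = a * oconv x y k l := by
  simp only [oconv, mul_osum]
  exact osum_congr (fun j => by rw [← mul_assoc, ← ha, mul_assoc]) k l

/-- A shift of one factor raises the total index by one, so the interval grows by one and one
boundary term has to be removed. -/
lemma oconv_shift_right (x y : ℤ → R) (k l : ℤ) :
    oconv x (fun j => y (j + 1)) k l = oconv x y k (l + 1) - x l * y k := by
  simp only [oconv, osum_succ]
  have e : k + (l + 1) - 1 - l = k := by ring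
  rw [e, add_sub_cancel_right]
  exact osum_congr (fun j => by congr 2; ring) k l

lemma oconv_shift_left (x y : ℤ → R) (k l : ℤ) :
    oconv (fun j => x (j + 1)) y k l = oconv x y k (l + 1) - x k * y l := by
  simp only [oconv]
  rw [osum_left _ k (l + 1), osum_shift (fun j => x j * y (k + (l + 1) - 1 - j))]
  have e : k + (l + 1) - 1 - k = l := by ring
  rw [e, add_sub_cancel_left]
  exact osum_congr (fun j => by congr 2; ring) k l

lemma oconv_map {S : Type} [Ring S] (φ : R →+* S) (x y : ℤ → R) (k l : ℤ) :
    φ (oconv x y k l) = oconv (fun j => φ (x j)) (fun j => φ (y j)) k l := by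
  simp only [oconv, osum_map_ring, map_mul]

end OrientedProducts

/-! ## The recursion relations and the odd flows -/

section OddFlowAlgebra

variable {R : Type} [Ring R] {P Q Qp Pp Pm : R}
  {c cp cm r rp w wp wm : ℤ → R}

/-- The odd flows preserve the second recursion relation. -/
lemma odd_rel2 (hP : ∀ z, P * z = z * P) (hQ : ∀ z, Q * z = z * Q) (hQp : ∀ z, Qp * z = z * Qp)
    (h1 : ∀ j, Qp * cp j = Q * cm j + w j + P * w (j - 1))
    (hcm : ∀ i j, cm i * c j = -(c j * cm i)) (hw : ∀ i j, w i * c j = -(c j * w i)) (k l : ℤ) :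
    oconv c w k (l + 1) + (-(P * w (k - 1)) * c l + P * oconv c w k l) +
      (-(Qp * oconv c cp k (l + 1)) + -(Q * oconv cm c k (l + 1))) = 0 := by
  -- Here c, cp, cm play the role of σ₁ and its shifts by Λ and Λ⁻¹, and w that of (1 - Λ)Qσ₂. The
  -- first recursion relation is convolved with c; the shift of the index of w yields the boundary
  -- term with w (k - 1).
  have e1 : Qp * oconv c cp k (l + 1) = Q * oconv c cm k (l + 1) + oconv c w k (l + 1) +
      P * (oconv c w k l + c l * w (k - 1)) := by
    rw [← oconv_mul_right hQp, funext h1, oconv_add_right, oconv_add_right, oconv_mul_right hQ,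
      oconv_mul_right hP (y := fun j => w (j - 1))]
    have := oconv_shift_right c (fun j => w (j - 1)) k l
    simp only [add_sub_cancel_right] at this
    rw [eq_sub_iff_add_eq] at this
    rw [← this]
  rw [e1, oconv_anticomm hcm, neg_mul, mul_assoc, hw]
  noncomm_ring

/-- The odd flows preserve the first recursion relation. -/
lemma odd_rel1 (h2 : ∀ x : R, x + x = 0 → x = 0) (hP : ∀ z, P * z = z * P)
    (hPp : ∀ z, Pp * z = z * Pp) (hPm : ∀ z, Pm * z = z * Pm)
    (h1 : ∀ j, Qp * cp j = Q * cm j + w j + P * w (j - 1))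
    (hr : ∀ j, c (j + 1) + P * c j = -(r j + rp j)) (hwr : ∀ j, w j = r j - rp j)
    (hwp : ∀ j, wp j = (rp j + rp j) + cp (j + 1) + Pp * cp j)
    (hwm : ∀ j, wm j = -((r j + r j) + cm (j + 1) + Pm * cm j))
    (hcm : ∀ i j, cm i * c j = -(c j * cm i)) (hcp : ∀ i j, cp i * c j = -(c j * cp i))
    (hpp : ∀ i j, cp i * cp j = -(cp j * cp i)) (hmm : ∀ i j, cm i * cm j = -(cm j * cm i))
    (hww : ∀ i j, w i * w j = -(w j * w i)) (k l : ℤ) :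
    (Qp * (c k - cp k) * cp (l + 1) + Qp * oconv cp wp k (l + 1)) -
      (Q * (cm k - c k) * cm (l + 1) + Q * oconv cm wm k (l + 1)) +
      (Q * oconv cm c k (l + 1 + 1) - Qp * oconv c cp k (l + 1 + 1)) +
      (P * w (k - 1) * w l + P * (Q * oconv cm c k (l + 1) - Qp * oconv c cp k (l + 1))) = 0 := by
  -- The convolution of an anticommuting family with itself vanishes, so after a shift only the
  -- boundary term survives.
  have zz : ∀ x : ℤ → R, (∀ i j, x i * x j = -(x j * x i)) → ∀ k l,
      oconv x (fun j => x (j + 1)) k l = x k * x l := by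
    intro x hx k l
    rw [oconv_shift_right, oconv_antisymm h2 hx, zero_sub, hx, neg_neg]
  have e1 : oconv cp wp k (l + 1) = (oconv cp rp k (l + 1) + oconv cp rp k (l + 1)) +
      cp k * cp (l + 1) := by
    rw [funext hwp, oconv_add_right, oconv_add_right, oconv_add_right, zz cp hpp,
      oconv_mul_right hPp, oconv_antisymm h2 hpp, mul_zero, add_zero]
  have e2 : oconv cm wm k (l + 1) = -((oconv cm r k (l + 1) + oconv cm r k (l + 1)) +
      cm k * cm (l + 1)) := by
    rw [funext hwm, oconv_neg_right, oconv_add_right, oconv_add_right, oconv_add_right, zz cm hmm,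
      oconv_mul_right hPm, oconv_antisymm h2 hmm, mul_zero, add_zero]
  -- The second recursion relation convolved with x; it is used for both shifts of c.
  have e3 : ∀ x : ℤ → R, oconv x c k (l + 1 + 1) + P * oconv x c k (l + 1) =
      x (l + 1) * c k - (oconv x r k (l + 1) + oconv x rp k (l + 1)) := by
    intro x
    have := oconv_shift_right x c k (l + 1)
    rw [eq_sub_iff_add_eq] at this
    rw [← this, ← oconv_mul_right hP, add_right_comm, ← oconv_add_right, funext hr,
      oconv_neg_right, oconv_add_right]
    abel
  -- The first relation convolved with w. The term of w with itself drops out, and the term with the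
  -- shifted index leaves w (k - 1) w l.
  have e4 : Qp * (oconv cp r k (l + 1) - oconv cp rp k (l + 1)) -
      Q * (oconv cm r k (l + 1) - oconv cm rp k (l + 1)) = P * (w (k - 1) * w l) := by
    have a : ∀ x : ℤ → R, oconv x r k (l + 1) - oconv x rp k (l + 1) = oconv x w k (l + 1) := by
      intro x
      rw [funext hwr, oconv_sub_right]
    have b : oconv (fun j => w (j - 1)) w k (l + 1) = w (k - 1) * w l := by
      have := oconv_shift_left (fun j => w (j - 1)) w k l
      simp only [add_sub_cancel_right] at this
      rw [oconv_antisymm h2 hww, eq_comm, sub_eq_zero] at this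
      exact this
    rw [a, a, ← oconv_mul_left, funext h1, oconv_add_left, oconv_add_left, oconv_mul_left,
      oconv_mul_left P, b, oconv_antisymm h2 hww]
    abel
  have e5 := congrArg (Q * ·) (e3 cm)
  have e6 := congrArg (Qp * ·) (e3 cp)
  have f1 : ∀ l, oconv c cp k l = -oconv cp c k l := fun l => by
    rw [oconv_anticomm hcp, neg_neg]
  have t1 : P * (Q * oconv cm c k (l + 1)) = Q * (P * oconv cm c k (l + 1)) := by
    rw [← mul_assoc, hP Q, mul_assoc]
  have t2 : P * (Qp * oconv cp c k (l + 1)) = Qp * (P * oconv cp c k (l + 1)) := by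
    rw [← mul_assoc, hP Qp, mul_assoc]
  simp only [e1, e2, f1, mul_neg, sub_neg_eq_add]
  rw [mul_add P (Q * _), t1, t2]
  rw [mul_add] at e5 e6
  have e7 := congrArg₂ (· - ·) (congrArg₂ (· + ·) e5 e6) e4
  simp only [hcm, hcp] at e7
  rw [← sub_eq_zero] at e7
  refine Eq.trans ?_ e7
  noncomm_ring

end OddFlowAlgebra

/-! ## Anticommuting elements -/

/-- Odd elements that anticommute with all odd elements. -/
structure IsOdd (y : SuperPoly U) : Prop where
  par : HasPar (-1) y
  anti : ∀ x, HasPar (-1) x → x * y = -(y * x)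

namespace IsOdd

variable {x y : SuperPoly U}

lemma zero : IsOdd (0 : SuperPoly U) := ⟨HasPar.zero, fun x _ => by rw [mul_zero, zero_mul, neg_zero]⟩

lemma add (hx : IsOdd x) (hy : IsOdd y) : IsOdd (x + y) :=
  ⟨hx.par.add hy.par, fun z hz => by rw [mul_add, hx.anti z hz, hy.anti z hz, add_mul, neg_add]⟩

lemma neg (hx : IsOdd x) : IsOdd (-x) :=
  ⟨hx.par.neg, fun z hz => by rw [mul_neg, hx.anti z hz, neg_mul]⟩

lemma sub (hx : IsOdd x) (hy : IsOdd y) : IsOdd (x - y) := by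
  rw [sub_eq_add_neg]
  exact hx.add hy.neg

lemma incl_mul (f : DiffPoly U) (hx : IsOdd x) : IsOdd (incl U f * x) :=
  ⟨hx.par.incl_mul f, fun z hz => by
    rw [← mul_assoc, ← incl_comm, mul_assoc, hx.anti z hz, mul_neg, mul_assoc]⟩

lemma dx (hx : IsOdd x) : IsOdd (epsMap (superDx U) x) :=
  ⟨hx.par.dx, fun z hz => by
    have h := congrArg (epsMap (superDx U)) (hx.anti z hz)
    rw [map_neg, epsMap_mul superDx_mul, epsMap_mul superDx_mul, hx.anti _ hz.dx, neg_add,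
      add_comm, add_comm (-_)] at h
    exact (add_right_cancel (b := -(x * epsMap (superDx U) z)) (by rw [h, add_comm]))⟩

lemma sig (α : Fin 2) (k : ℤ) : IsOdd (sig U α k) :=
  ⟨HasPar.sig α k, fun z hz => by rw [sig_eq, hz.comm, neg_one_smul]⟩

lemma closed (h : ∀ n : ℕ, ∃ g, IsOdd g ∧ ∃ r, x = g + PowerSeries.X ^ n * r) : IsOdd x where
  par := HasPar.closed fun n => by
    obtain ⟨g, hg, r, hr⟩ := h n
    exact ⟨g, hg.par, r, hr⟩
  anti z hz := by
    rw [← sub_eq_zero, sub_neg_eq_add]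
    refine series_eq_zero fun n => ?_
    obtain ⟨g, hg, r, hr⟩ := h n
    refine ⟨z * r + r * z, ?_⟩
    have hX : z * (PowerSeries.X ^ n * r) = PowerSeries.X ^ n * (z * r) := by
      rw [← mul_assoc, (PowerSeries.commute_X_pow _ n).eq, mul_assoc]
    rw [hr, add_mul, mul_add, hg.anti z hz, hX, mul_add, mul_assoc]
    abel

/-- The subgroup of anticommuting elements. -/
def subgroup (U : Chart) : AddSubgroup (SuperPoly U) where
  carrier := {x | IsOdd x}
  zero_mem' := zero
  add_mem' := add
  neg_mem' := neg

lemma shift (m : ℤ) (hx : IsOdd x) : IsOdd (superShift U m x) := by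
  simp only [superShift, shift_eq]
  exact epsOp_mem (S := subgroup U) (fun _ h => by rw [← incl_X]; exact incl_mul _ h)
    (fun c _ h => by rw [smul_eq_incl_mul]; exact incl_mul _ h) (fun _ h => dx h)
    (fun _ h => closed h) _ hx

end IsOdd

lemma HasPar.parity_eq {x : SuperPoly U} (hx : HasPar 1 x) : AblowitzLadik.parity U x = x := by
  rw [hx.parity, one_smul]

/-! ## The odd flows -/

/-- `Q σ_{2,k}`. -/
def sr (U : Chart) (k : ℤ) : SuperPoly U := sQ U * s2 U k

lemma isOdd_sr (k : ℤ) : IsOdd (sr U k) := (IsOdd.sig 1 k).incl_mul _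

/-- `(1 - Λ) Q σ_{2,k}`. -/
def sw (U : Chart) (k : ℤ) : SuperPoly U := sr U k - superShift U 1 (sr U k)

lemma isOdd_sw (k : ℤ) : IsOdd (sw U k) := (isOdd_sr k).sub ((isOdd_sr k).shift 1)

/-- `ε ∂σ_{1,l}/∂τ_k`. -/
def oddF (U : Chart) (k l : ℤ) : SuperPoly U := oconv (s1 U) (sw U) k l

/-- `ε ∂(Q σ_{2,l})/∂τ_k`. -/
def oddG (U : Chart) (k l : ℤ) : SuperPoly U :=
  -(sQ U * oconv (fun j => superShift U (-1) (s1 U j)) (s1 U) k (l + 1))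

lemma superP0_zero (k : ℤ) : superP0 U k 0 =
    (sQ U * superShift U (-1) (s1 U k) - superShift U 1 (sQ U * s1 U k)) + sw U k := rfl

lemma superP0_one (k : ℤ) : superP0 U k 1 = sQ U * (superShift U (-1) (s1 U k) - s1 U k) := rfl

lemma superP1_zero (k : ℤ) : superP1 U k 0 = sP U * (superShift U 1 (sr U k) - sr U k) := rfl

lemma superP1_one (k : ℤ) : superP1 U k 1 =
    sQ U * (sP U * s1 U k - superShift U (-1) (sP U * s1 U k)) +
      sQ U * (superShift U 1 (sr U k) - superShift U (-1) (sr U k)) := rfl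

lemma isOdd_superP0 (k : ℤ) (α : Fin 2) : IsOdd (superP0 U k α) := by
  fin_cases α
  · exact ((((IsOdd.sig 0 k).shift _).incl_mul _).sub
      (((IsOdd.sig 0 k).incl_mul _).shift _)).add (isOdd_sw k)
  · exact (((IsOdd.sig 0 k).shift _).sub (IsOdd.sig 0 k)).incl_mul _

lemma coeff_zero_mul {R : Type} [Ring R] (f g : PowerSeries R) :
    PowerSeries.coeff 0 (f * g) = PowerSeries.coeff 0 f * PowerSeries.coeff 0 g := by
  simp only [PowerSeries.coeff_zero_eq_constantCoeff, map_mul]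

lemma coeff_zero_sw (k : ℤ) : PowerSeries.coeff 0 (sw U k) = 0 := by
  rw [sw, map_sub, coeff_zero_superShift, sub_self]

lemma coeff_zero_superP0 (k : ℤ) (α : Fin 2) : PowerSeries.coeff 0 (superP0 U k α) = 0 := by
  fin_cases α
  · change PowerSeries.coeff 0 (superP0 U k 0) = 0
    rw [superP0_zero, map_add, coeff_zero_sw, map_sub, coeff_zero_superShift,
      coeff_zero_mul, coeff_zero_superShift, coeff_zero_mul, sub_self,
      add_zero]
  · change PowerSeries.coeff 0 (superP0 U k 1) = 0
    rw [superP0_one, coeff_zero_mul, map_sub, coeff_zero_superShift, sub_self, mul_zero]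

lemma hasPar_osum {e : ℤ} {f : ℤ → SuperPoly U} (h : ∀ j, HasPar e (f j)) (k l : ℤ) :
    HasPar e (osum f k l) := by
  induction l using Int.inductionOn' (b := k) with
  | zero => rw [osum_self]; exact HasPar.zero
  | succ l _ ih => rw [osum_succ]; exact ih.add (h l)
  | pred l _ ih =>
    have := osum_succ f k (l - 1)
    rw [sub_add_cancel] at this
    rw [eq_sub_of_add_eq this.symm]
    exact ih.sub (h _)

lemma hasPar_oconv {x y : ℤ → SuperPoly U} (hx : ∀ j, IsOdd (x j)) (hy : ∀ j, IsOdd (y j))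
    (k l : ℤ) : HasPar 1 (oconv x y k l) :=
  hasPar_osum (fun _ => (hx _).par.mul (hy _).par) k l

lemma hasPar_oddF (k l : ℤ) : HasPar 1 (oddF U k l) := hasPar_oconv (IsOdd.sig 0) isOdd_sw k l

lemma hasPar_oddG (k l : ℤ) : HasPar 1 (oddG U k l) :=
  ((hasPar_oconv (fun j => (IsOdd.sig 0 j).shift _) (IsOdd.sig 0) k _).incl_mul _).neg

lemma coeff_zero_oconv (x y : ℤ → SuperPoly U) (k l : ℤ) :
    PowerSeries.coeff 0 (oconv x y k l) =
      oconv (fun j => PowerSeries.coeff 0 (x j)) (fun j => PowerSeries.coeff 0 (y j)) k l := by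
  simp only [PowerSeries.coeff_zero_eq_constantCoeff]
  exact oconv_map (PowerSeries.constantCoeff (R := Super U)) x y k l

/-- At ε = 0 the factor (1 - Λ)Qσ₂ vanishes. The vanishing of the constant term is what permits the
division by ε in the definition of the odd flow. -/
lemma coeff_zero_oddF (k l : ℤ) : PowerSeries.coeff 0 (oddF U k l) = 0 := by
  rw [oddF, coeff_zero_oconv, oconv]
  simp only [coeff_zero_sw, mul_zero]
  exact (osum_unique (f := fun _ => (0 : Super U)) (g := fun _ => (0 : Super U)) rfl
    (fun _ => by simp) l).symm

/-- At ε = 0 the shift is the identity, and the convolution of the anticommuting family σ₁ with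
itself vanishes. -/
lemma coeff_zero_oddG (k l : ℤ) : PowerSeries.coeff 0 (oddG U k l) = 0 := by
  rw [oddG, map_neg, coeff_zero_mul, coeff_zero_oconv]
  simp only [coeff_zero_superShift]
  rw [oconv_antisymm, mul_zero, neg_zero]
  · intro x hx
    have h2 : (2 : ℝ) • x = 0 := by rw [two_smul, hx]
    exact (smul_eq_zero.1 h2).resolve_left two_ne_zero
  · intro i j
    have := congrArg (PowerSeries.coeff 0) ((IsOdd.sig (U := U) 0 j).anti _ (IsOdd.sig 0 i).par)
    rwa [coeff_zero_mul, map_neg, coeff_zero_mul] at this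

lemma sQ_mul_inv : sQ U * incl U (ofSmooth (fQinv U)) = 1 := by
  rw [sQ, ← map_mul, ofSmooth_Q_mul_inv, map_one]

lemma sP_mul_inv : sP U * incl U (ofSmooth (fPinv U)) = 1 := by
  rw [sP, ← map_mul, ofSmooth_P_mul_inv, map_one]

lemma sQ_comm (z : SuperPoly U) : sQ U * z = z * sQ U := incl_comm _ z

lemma sP_comm (z : SuperPoly U) : sP U * z = z * sP U := incl_comm _ z

lemma HasPar.divEps {e : ℤ} {x : SuperPoly U} (hx : HasPar e x) (h : PowerSeries.coeff 0 x = 0) :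
    HasPar e (divEps x) := HasPar.of_X_mul (by rwa [X_mul_divEps h])

/-- The odd derivations exist. -/
lemma exists_oddDer (U : Chart) (k : ℤ) : ∃ D : SuperPoly U →+ SuperPoly U, IsSDer (parity U) D ∧
    D (sP U) = divEps (superP0 U k 0) ∧ D (sQ U) = divEps (superP0 U k 1) ∧
      (∀ l, D (s1 U l) = divEps (oddF U k l)) ∧ (∀ l, D (sr U l) = divEps (oddG U k l)) ∧
      HasPar (-1) (D (sP U)) ∧ HasPar (-1) (D (sQ U)) ∧ ∀ α l, HasPar 1 (D (sig U α l)) := by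
  have hx : ∀ α, HasPar (-1) (divEps (superP0 U k α)) := fun α =>
    (isOdd_superP0 k α).par.divEps (coeff_zero_superP0 k α)
  have hF : ∀ l, HasPar 1 (divEps (oddF U k l)) := fun l =>
    (hasPar_oddF k l).divEps (coeff_zero_oddF k l)
  have hG : ∀ l, HasPar 1 (divEps (oddG U k l)) := fun l =>
    (hasPar_oddG k l).divEps (coeff_zero_oddG k l)
  -- The flows prescribe the derivative of Qσ₂. By the Leibniz rule this determines the value at σ₂
  -- after division by Q.
  have hy : ∀ α l, HasPar 1 ((![fun l => divEps (oddF U k l), fun l =>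
      incl U (ofSmooth (fQinv U)) * (divEps (oddG U k l) - divEps (superP0 U k 1) * s2 U l)] :
        Fin 2 → ℤ → SuperPoly U) α l) := fun α l => by
    fin_cases α
    · exact hF l
    · exact ((hG l).sub ((hx 1).mul (HasPar.sig 1 l))).incl_mul _
  obtain ⟨D, hD, hP, hQ, hs⟩ := exists_odd (x := fun α => divEps (superP0 U k α)) hx
    hy
  refine ⟨D, hD, hP, hQ, fun l => hs 0 l, fun l => ?_, hP ▸ hx 0, hQ ▸ hx 1,
    fun α l => hs α l ▸ hy α l⟩
  rw [sr, hD.mul, hs, hQ, parity_sQ]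
  change divEps (superP0 U k 1) * s2 U l + sQ U * (incl U (ofSmooth (fQinv U)) *
      (divEps (oddG U k l) - divEps (superP0 U k 1) * s2 U l)) = _
  rw [← mul_assoc (sQ U), sQ_mul_inv, one_mul, add_sub_cancel]

/-- The odd derivations. -/
def oddDer (U : Chart) (k : ℤ) : SuperPoly U →+ SuperPoly U := (exists_oddDer U k).choose

lemma isSDer_oddDer (k : ℤ) : IsSDer (parity U) (oddDer U k) := (exists_oddDer U k).choose_spec.1

lemma X_mul_oddDer_sP (k : ℤ) : PowerSeries.X * oddDer U k (sP U) = superP0 U k 0 := by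
  rw [oddDer, (exists_oddDer U k).choose_spec.2.1, X_mul_divEps (coeff_zero_superP0 k 0)]

lemma X_mul_oddDer_sQ (k : ℤ) : PowerSeries.X * oddDer U k (sQ U) = superP0 U k 1 := by
  rw [oddDer, (exists_oddDer U k).choose_spec.2.2.1, X_mul_divEps (coeff_zero_superP0 k 1)]

lemma X_mul_oddDer_s1 (k l : ℤ) : PowerSeries.X * oddDer U k (s1 U l) = oddF U k l := by
  rw [oddDer, (exists_oddDer U k).choose_spec.2.2.2.1, X_mul_divEps (coeff_zero_oddF k l)]

lemma X_mul_oddDer_sr (k l : ℤ) : PowerSeries.X * oddDer U k (sr U l) = oddG U k l := by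
  rw [oddDer, (exists_oddDer U k).choose_spec.2.2.2.2.1, X_mul_divEps (coeff_zero_oddG k l)]

lemma hasPar_oddDer_sP (k : ℤ) : HasPar (-1) (oddDer U k (sP U)) :=
  (exists_oddDer U k).choose_spec.2.2.2.2.2.1

lemma hasPar_oddDer_sQ (k : ℤ) : HasPar (-1) (oddDer U k (sQ U)) :=
  (exists_oddDer U k).choose_spec.2.2.2.2.2.2.1

lemma hasPar_oddDer_sig (k : ℤ) (α : Fin 2) (l : ℤ) : HasPar 1 (oddDer U k (sig U α l)) :=
  (exists_oddDer U k).choose_spec.2.2.2.2.2.2.2 α l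

/-! ## The recursion relations in `ℬ` -/

/-- `P` in `ℬ`. -/
def bP (U : Chart) : BRing U := toB U (sP U)

/-- `Q` in `ℬ`. -/
def bQ (U : Chart) : BRing U := toB U (sQ U)

/-- `σ_{1,k}` in `ℬ`. -/
def bc (U : Chart) (k : ℤ) : BRing U := toB U (s1 U k)

/-- `Q σ_{2,k}` in `ℬ`. -/
def br (U : Chart) (k : ℤ) : BRing U := toB U (sr U k)

/-- `(1 - Λ) Q σ_{2,k}` in `ℬ`. -/
def bw (U : Chart) (k : ℤ) : BRing U := toB U (sw U k)

lemma bw_eq (k : ℤ) : bw U k = br U k - shiftB U 1 (br U k) := by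
  rw [bw, sw, map_sub]; rfl

lemma shiftB_shiftB (m n : ℤ) (x : BRing U) : shiftB U m (shiftB U n x) = shiftB U (m + n) x := by
  obtain ⟨f, rfl⟩ := toB_surjective x
  rw [shiftB_toB, shiftB_toB, superShift_superShift, shiftB_toB]

lemma shiftB_zero (x : BRing U) : shiftB U 0 x = x := by
  obtain ⟨f, rfl⟩ := toB_surjective x
  rw [shiftB_toB, superShift_zero]

lemma shiftB_one_neg_one (x : BRing U) : shiftB U 1 (shiftB U (-1) x) = x := by
  rw [shiftB_shiftB, add_neg_cancel, shiftB_zero]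

lemma shiftB_neg_one_one (x : BRing U) : shiftB U (-1) (shiftB U 1 x) = x := by
  rw [shiftB_shiftB, neg_add_cancel, shiftB_zero]

lemma bP_comm (x : BRing U) : bP U * x = x * bP U := inclB_comm _ x

lemma bQ_comm (x : BRing U) : bQ U * x = x * bQ U := inclB_comm _ x

lemma shiftB_inclB_comm (m : ℤ) (f : DiffPoly U) (x : BRing U) :
    shiftB U m (toB U (incl U f)) * x = x * shiftB U m (toB U (incl U f)) := by
  rw [shiftB_toB, ← incl_jetShift, inclB_comm]

lemma rel1_eq_sw (k : ℤ) : rel1 U k = superShift U 1 (sQ U) * superShift U 1 (s1 U (k + 1)) -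
    sQ U * superShift U (-1) (s1 U (k + 1)) - sw U (k + 1) - sP U * sw U k := by
  have h : rel1 U k = superShift U 1 (sQ U * s1 U (k + 1)) -
      sQ U * superShift U (-1) (s1 U (k + 1)) +
      (superShift U 1 (sr U (k + 1)) - sr U (k + 1)) - sP U * sw U k := rfl
  have e : sw U (k + 1) = sr U (k + 1) - superShift U 1 (sr U (k + 1)) := rfl
  rw [h, superShift_mul, e, sub_eq_add_neg _ (sr U (k + 1) - _), neg_sub]

lemma rel2_eq_sr (k : ℤ) : rel2 U k =
    s1 U (k + 1) + sP U * s1 U k + (superShift U 1 (sr U k) + sr U k) := rfl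

lemma toB_rel1 (k : ℤ) : toB U (rel1 U k) = 0 := toB_eq_zero.2 ((isRelIdeal_relIdeal U).rel1_mem k)

lemma toB_rel2 (k : ℤ) : toB U (rel2 U k) = 0 := toB_eq_zero.2 ((isRelIdeal_relIdeal U).rel2_mem k)

lemma bc_rel1 (j : ℤ) : shiftB U 1 (bQ U) * shiftB U 1 (bc U j) =
    bQ U * shiftB U (-1) (bc U j) + bw U j + bP U * bw U (j - 1) := by
  have h := toB_rel1 (U := U) (j - 1)
  rw [rel1_eq_sw, sub_add_cancel, map_sub, map_sub, map_sub, map_mul, map_mul, map_mul, sub_sub,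
    sub_sub, sub_eq_zero] at h
  rw [add_assoc]
  exact h

lemma bc_rel2 (j : ℤ) : bc U (j + 1) + bP U * bc U j = -(br U j + shiftB U 1 (br U j)) := by
  have h := toB_rel2 (U := U) j
  rw [rel2_eq_sr, map_add, map_add, map_add, map_mul, add_comm (toB U (superShift U 1 _))] at h
  exact eq_neg_of_add_eq_zero_left h

/-- The term Λ²(Qσ₂) is eliminated by the shifted second relation, so that no shift beyond Λ
remains. The next lemma removes Λ⁻¹(Qσ₂) likewise. These are the forms required by `odd_rel1`. -/
lemma shiftB_bw_one (j : ℤ) : shiftB U 1 (bw U j) = (shiftB U 1 (br U j) + shiftB U 1 (br U j)) +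
    shiftB U 1 (bc U (j + 1)) + shiftB U 1 (bP U) * shiftB U 1 (bc U j) := by
  have h := congrArg (shiftB U 1) (bc_rel2 (U := U) j)
  rw [map_add, map_mul, map_neg, map_add] at h
  rw [add_assoc, h, bw_eq, map_sub]
  abel

lemma shiftB_bw_neg_one (j : ℤ) : shiftB U (-1) (bw U j) = -((br U j + br U j) +
    shiftB U (-1) (bc U (j + 1)) + shiftB U (-1) (bP U) * shiftB U (-1) (bc U j)) := by
  have h := congrArg (shiftB U (-1)) (bc_rel2 (U := U) j)
  rw [map_add, map_mul, map_neg, map_add, shiftB_neg_one_one] at h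
  rw [add_assoc, h, bw_eq, map_sub, shiftB_neg_one_one]
  abel

lemma IsOdd.toB_anti {x y : SuperPoly U} (hx : IsOdd x) (hy : IsOdd y) :
    toB U x * toB U y = -(toB U y * toB U x) := by
  rw [← map_mul, hy.anti x hx.par, map_neg, map_mul]

lemma shiftB_bc_anti (m n i j : ℤ) : shiftB U m (bc U i) * shiftB U n (bc U j) =
    -(shiftB U n (bc U j) * shiftB U m (bc U i)) :=
  ((IsOdd.sig 0 i).shift m).toB_anti ((IsOdd.sig 0 j).shift n)

lemma shiftB_bc_anti_left (m i j : ℤ) : shiftB U m (bc U i) * bc U j =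
    -(bc U j * shiftB U m (bc U i)) :=
  ((IsOdd.sig 0 i).shift m).toB_anti (IsOdd.sig 0 j)

lemma bc_anti (i j : ℤ) : bc U i * bc U j = -(bc U j * bc U i) :=
  (IsOdd.sig 0 i).toB_anti (IsOdd.sig 0 j)

lemma bw_bc_anti (i j : ℤ) : bw U i * bc U j = -(bc U j * bw U i) :=
  (isOdd_sw i).toB_anti (IsOdd.sig 0 j)

lemma bw_anti (i j : ℤ) : bw U i * bw U j = -(bw U j * bw U i) :=
  (isOdd_sw i).toB_anti (isOdd_sw j)

lemma toB_superP0_one (k : ℤ) : toB U (superP0 U k 1) =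
    bQ U * (shiftB U (-1) (bc U k) - bc U k) := by
  rw [superP0_one, map_mul, map_sub]
  rfl

lemma toB_superP0_zero (k : ℤ) : toB U (superP0 U k 0) = -(bP U * bw U (k - 1)) := by
  rw [superP0_zero, map_add, map_sub, superShift_mul, map_mul, map_mul]
  change bQ U * shiftB U (-1) (bc U k) - shiftB U 1 (bQ U) * shiftB U 1 (bc U k) + bw U k = _
  rw [bc_rel1]
  abel

lemma toB_oddF (k l : ℤ) : toB U (oddF U k l) = oconv (bc U) (bw U) k l := oconv_map _ _ _ _ _

lemma toB_oddG (k l : ℤ) : toB U (oddG U k l) =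
    -(bQ U * oconv (fun j => shiftB U (-1) (bc U j)) (bc U) k (l + 1)) := by
  rw [oddG, map_neg, map_mul, oconv_map]
  rfl

lemma shiftB_toB_oddG (k l : ℤ) : shiftB U 1 (toB U (oddG U k l)) =
    -(shiftB U 1 (bQ U) * oconv (bc U) (fun j => shiftB U 1 (bc U j)) k (l + 1)) := by
  rw [toB_oddG, map_neg, map_mul, oconv_map]
  simp only [shiftB_one_neg_one]

/-! ## The odd flows on `ℬ` -/

/-- `ε ∂/∂τ_k` on `SuperPoly U`, with values in `ℬ`. -/
def oddE (U : Chart) (k : ℤ) (f : SuperPoly U) : BRing U := toB U (PowerSeries.X * oddDer U k f)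

lemma oddE_add (k : ℤ) (f g : SuperPoly U) : oddE U k (f + g) = oddE U k f + oddE U k g := by
  rw [oddE, map_add, mul_add, map_add]; rfl

lemma oddE_sub (k : ℤ) (f g : SuperPoly U) : oddE U k (f - g) = oddE U k f - oddE U k g := by
  rw [oddE, map_sub, mul_sub, map_sub]; rfl

lemma oddE_mul (k : ℤ) (f g : SuperPoly U) :
    oddE U k (f * g) = oddE U k f * toB U g + toB U (parity U f) * oddE U k g := by
  rw [oddE, (isSDer_oddDer k).mul, mul_add, map_add, ← mul_assoc, map_mul]
  congr 1
  rw [← epsB_mul_toB, oddE, ← epsB_mul_toB, map_mul, ← mul_assoc, epsB_comm, mul_assoc]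
  rfl

lemma oddE_shift (k m : ℤ) (f : SuperPoly U) :
    oddE U k (superShift U m f) = shiftB U m (oddE U k f) := by
  rw [oddE, (isSDer_oddDer k).shift parity_incl, ← superShift_X_mul]
  rfl

lemma oddE_sP (k : ℤ) : oddE U k (sP U) = -(bP U * bw U (k - 1)) := by
  rw [oddE, X_mul_oddDer_sP, toB_superP0_zero]

lemma oddE_sQ (k : ℤ) : oddE U k (sQ U) = bQ U * (shiftB U (-1) (bc U k) - bc U k) := by
  rw [oddE, X_mul_oddDer_sQ, toB_superP0_one]

lemma oddE_s1 (k l : ℤ) : oddE U k (s1 U l) = oconv (bc U) (bw U) k l := by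
  rw [oddE, X_mul_oddDer_s1, toB_oddF]

lemma oddE_sr (k l : ℤ) : oddE U k (sr U l) =
    -(bQ U * oconv (fun j => shiftB U (-1) (bc U j)) (bc U) k (l + 1)) := by
  rw [oddE, X_mul_oddDer_sr, toB_oddG]

lemma shiftB_oddE_sr (k l : ℤ) : shiftB U 1 (oddE U k (sr U l)) =
    -(shiftB U 1 (bQ U) * oconv (bc U) (fun j => shiftB U 1 (bc U j)) k (l + 1)) := by
  rw [oddE, X_mul_oddDer_sr, shiftB_toB_oddG]

lemma oddE_rel2 (k l : ℤ) : oddE U k (rel2 U l) = 0 := by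
  rw [rel2_eq_sr, oddE_add, oddE_add, oddE_add, oddE_mul, oddE_shift, shiftB_oddE_sr, oddE_sr,
    oddE_s1, oddE_s1, oddE_sP, parity_sP]
  exact odd_rel2 bP_comm bQ_comm (shiftB_inclB_comm 1 _) bc_rel1 (shiftB_bc_anti_left (-1))
    bw_bc_anti k l

lemma oddE_sw (k l : ℤ) : oddE U k (sw U l) =
    shiftB U 1 (bQ U) * oconv (bc U) (fun j => shiftB U 1 (bc U j)) k (l + 1) -
      bQ U * oconv (fun j => shiftB U (-1) (bc U j)) (bc U) k (l + 1) := by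
  rw [sw, oddE_sub, oddE_shift, shiftB_oddE_sr, oddE_sr]
  abel

lemma oddE_rel1 (k l : ℤ) : oddE U k (rel1 U l) = 0 := by
  rw [rel1_eq_sw, oddE_sub, oddE_sub, oddE_sub, oddE_mul, oddE_mul, oddE_mul, oddE_shift,
    oddE_shift, oddE_shift, oddE_sw, oddE_sw, oddE_s1, oddE_sP, oddE_sQ, parity_shift, parity_sP,
    parity_sQ, map_mul, map_sub, shiftB_one_neg_one, oconv_map, oconv_map]
  have h := odd_rel1 (fun x => eq_zero_of_add_self) bP_comm (shiftB_inclB_comm 1 (ofSmooth (fP U)))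
    (shiftB_inclB_comm (-1) (ofSmooth (fP U)))
    bc_rel1 bc_rel2 bw_eq shiftB_bw_one shiftB_bw_neg_one (shiftB_bc_anti_left (-1))
    (shiftB_bc_anti_left 1) (shiftB_bc_anti 1 1) (shiftB_bc_anti (-1) (-1)) bw_anti k l
  refine Eq.trans ?_ h
  change shiftB U 1 (bQ U) * (bc U k - shiftB U 1 (bc U k)) * shiftB U 1 (bc U (l + 1)) +
    shiftB U 1 (bQ U) * _ - (bQ U * (shiftB U (-1) (bc U k) - bc U k) * shiftB U (-1) (bc U (l + 1))
      + bQ U * _) - _ - (-(bP U * bw U (k - 1)) * bw U l + bP U * _) = _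
  noncomm_ring

lemma oddDer_mem_relIdeal (k : ℤ) : ∀ f ∈ relIdeal U, oddDer U k f ∈ relIdeal U := fun f hf => by
  -- The relations are killed only after multiplication by ε; saturation of J removes this factor.
  have h0 : ∀ f, oddE U k f = 0 → oddDer U k f ∈ relIdeal U := fun f hf =>
    (isRelIdeal_relIdeal U).saturated _ (toB_eq_zero.1 hf)
  exact (isSDer_oddDer k).map_relIdeal (fun _ => parity_mem_relIdeal)
    (fun l => h0 _ (oddE_rel1 k l)) (fun l => h0 _ (oddE_rel2 k l)) hf

/-- The odd flow `∂/∂τ_k`. -/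
def oddFlow (U : Chart) (k : ℤ) : BRing U →+ BRing U := descend (oddDer U k) (oddDer_mem_relIdeal k)

lemma isOddFlow_oddFlow (k : ℤ) : IsOddFlow (oddFlow U k) :=
  (isSDer_oddDer k).isOddFlow (oddDer_mem_relIdeal k)

lemma oddFlow_toB (k : ℤ) (f : SuperPoly U) : oddFlow U k (toB U f) = toB U (oddDer U k f) := rfl

lemma epsB_mul_oddFlow (k : ℤ) (f : SuperPoly U) :
    epsB U * oddFlow U k (toB U f) = oddE U k f := by
  rw [oddFlow_toB, epsB_mul_toB]
  rfl

lemma oddFlow_shiftB (k m : ℤ) (x : BRing U) :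
    oddFlow U k (shiftB U m x) = shiftB U m (oddFlow U k x) := by
  obtain ⟨f, rfl⟩ := toB_surjective x
  rw [shiftB_toB, oddFlow_toB, (isSDer_oddDer k).shift parity_incl]
  rfl

lemma parityB_oddFlow (k : ℤ) (x : BRing U) :
    oddFlow U k (parityB U x) = -parityB U (oddFlow U k x) := by
  refine (isOddFlow_oddFlow k).parityB_comm ?_ ?_ (fun α l => ?_) x
  · rw [oddFlow_toB, parityB_toB, (hasPar_oddDer_sP k).parity, neg_one_smul, map_neg]
  · rw [oddFlow_toB, parityB_toB, (hasPar_oddDer_sQ k).parity, neg_one_smul, map_neg]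
  · rw [oddFlow_toB, parityB_toB, (hasPar_oddDer_sig k α l).parity_eq]

/-! ## The odd flows anticommute -/

lemma int_const {M : Type} {f : ℤ → M} (h : ∀ n, f (n + 1) = f n) (n : ℤ) : f n = f 0 := by
  induction n using Int.inductionOn' (b := 0) with
  | zero => rfl
  | succ n _ ih => rw [h, ih]
  | pred n _ ih => rw [← ih, ← h (n - 1), sub_add_cancel]

/-- A symmetric function whose cyclic sums vanish on three consecutive planes vanishes. -/
lemma eq_zero_of_cyclic {M : Type} [AddCommGroup M] (h2 : ∀ x : M, x + x = 0 → x = 0)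
    (h3 : ∀ x : M, x + x + x = 0 → x = 0) {g : ℤ → ℤ → M} (hg : ∀ k l, g k l = g l k) {n : ℤ}
    (h : ∀ k l m s : ℤ, k + l + m + s = n → -1 ≤ s → s ≤ 1 → g k l + g l m + g m k = 0) (k l : ℤ) :
    g k l = 0 := by
  -- Subtract the cyclic sums on two adjacent planes: the increments in m at l and at k are
  -- opposite.
  have h1 : ∀ k l m s : ℤ, k + l + m + s = n → 0 ≤ s → s ≤ 1 →
      g l (m + 1) - g l m = -(g k (m + 1) - g k m) := by
    intro k l m s e hs hs'
    have a := h k l m s e (by omega) hs'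
    have b := h k l (m + 1) (s - 1) (by omega) (by omega) (by omega)
    rw [hg _ k] at a b
    have : g k l + g l (m + 1) + g k (m + 1) - (g k l + g l m + g k m) = 0 := by rw [a, b, sub_zero]
    rw [← sub_eq_zero, ← this]
    abel
  -- Two uses of this with the same third index, at s = 1 and at s = 0, show that the increment in m
  -- does not depend on l.
  have h4 : ∀ l m, g (l + 1) (m + 1) - g (l + 1) m = g l (m + 1) - g l m := by
    intro l m
    have a := h1 (n - l - m - 1) l m 1 (by ring) (by omega) le_rfl
    have b := h1 (n - l - m - 1) (l + 1) m 0 (by ring) le_rfl (by omega)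
    rw [a, b]
  -- The increment is equal to its own negative, hence zero. By symmetry g is constant, and its
  -- cyclic sum is three times the constant.
  have h5 : ∀ l m, g l (m + 1) = g l m := by
    intro l m
    rw [← sub_eq_zero]
    apply h2
    have a := h1 (n - l - m) l m 0 (by ring) le_rfl (by omega)
    have c := fun l => int_const (f := fun l => g l (m + 1) - g l m) (fun l => h4 l m) l
    nth_rewrite 1 [a]
    have := (c l).trans (c (n - l - m)).symm
    rw [this, neg_add_cancel]
  have h6 : ∀ k l, g k l = g 0 0 := by
    intro k l
    rw [int_const (f := g k) (h5 k) l, hg, int_const (f := g 0) (h5 0) k]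
  have a := h n 0 0 0 (by ring) (by omega) (by omega)
  rw [h6 n 0, h6 0 n] at a
  rw [h6, h3 _ a]

lemma shiftB_epsB_mul (m : ℤ) (x : BRing U) :
    shiftB U m (epsB U * x) = epsB U * shiftB U m x := by
  obtain ⟨f, rfl⟩ := toB_surjective x
  rw [epsB_mul_toB, shiftB_toB, superShift_X_mul, ← epsB_mul_toB]
  rfl

lemma eq_zero_of_add_add_self {x : BRing U} (h : x + x + x = 0) : x = 0 := by
  obtain ⟨f, rfl⟩ := toB_surjective x
  rw [← map_add, ← map_add, toB_eq_zero] at h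
  have := relIdeal_smul (1 / 3 : ℝ) h
  rw [toB_eq_zero]
  convert this using 1
  rw [← two_smul ℝ f, smul_add, smul_smul, ← add_smul]
  norm_num

lemma bP_cancel {x : BRing U} (h : bP U * x = 0) : x = 0 := by
  have := congrArg (toB U (incl U (ofSmooth (fPinv U))) * ·) h
  simp only [mul_zero, ← mul_assoc] at this
  rwa [bP, ← map_mul, ← sP_comm, sP_mul_inv, map_one, one_mul] at this

lemma bQ_cancel {x : BRing U} (h : bQ U * x = 0) : x = 0 := by
  have := congrArg (toB U (incl U (ofSmooth (fQinv U))) * ·) h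
  simp only [mul_zero, ← mul_assoc] at this
  rwa [bQ, ← map_mul, ← sQ_comm, sQ_mul_inv, map_one, one_mul] at this

lemma epsB_oddFlow_bP (k : ℤ) : epsB U * oddFlow U k (bP U) = -(bP U * bw U (k - 1)) := by
  rw [bP, epsB_mul_oddFlow, oddE_sP]; rfl

lemma epsB_oddFlow_bQ (k : ℤ) : epsB U * oddFlow U k (bQ U) =
    bQ U * (shiftB U (-1) (bc U k) - bc U k) := by
  rw [bQ, epsB_mul_oddFlow, oddE_sQ]; rfl

lemma epsB_oddFlow_bc (k l : ℤ) : epsB U * oddFlow U k (bc U l) = oconv (bc U) (bw U) k l := by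
  rw [bc, epsB_mul_oddFlow, oddE_s1]

lemma epsB_oddFlow_br (k l : ℤ) : epsB U * oddFlow U k (br U l) =
    -(bQ U * oconv (fun j => shiftB U (-1) (bc U j)) (bc U) k (l + 1)) := by
  rw [br, epsB_mul_oddFlow, oddE_sr]

/-- The functions `x_l` for which `∂x_l/∂τ_k` is antisymmetric in `k`, `l`. -/
def OddAnti (x : ℤ → BRing U) : Prop := ∀ k l, oddFlow U k (x l) = -oddFlow U l (x k)

lemma oddAnti_bc : OddAnti (bc U) := fun k l => epsB_cancel (by
  rw [mul_neg, epsB_oddFlow_bc, epsB_oddFlow_bc, oconv_swap])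

lemma oddAnti_br : OddAnti (fun l => br U (l - 1)) := fun k l => epsB_cancel (by
  rw [mul_neg, epsB_oddFlow_br, epsB_oddFlow_br, oconv_swap, sub_add_cancel, sub_add_cancel,
    mul_neg])

lemma OddAnti.shift {x : ℤ → BRing U} (hx : OddAnti x) (m : ℤ) :
    OddAnti (fun l => shiftB U m (x l)) := fun k l => by
  rw [oddFlow_shiftB, oddFlow_shiftB, hx, map_neg]

lemma OddAnti.add {x y : ℤ → BRing U} (hx : OddAnti x) (hy : OddAnti y) :
    OddAnti (fun l => x l + y l) := fun k l => by
  rw [map_add, map_add, hx, hy, neg_add]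

lemma OddAnti.neg {x : ℤ → BRing U} (hx : OddAnti x) : OddAnti (fun l => -x l) := fun k l => by
  rw [map_neg, map_neg, hx]

lemma parityB_bQ : parityB U (bQ U) = bQ U := parityB_incl _

lemma parityB_bP : parityB U (bP U) = bP U := parityB_incl _

/-- The convolution for Qσ_{2,l} ends at l + 1, so by itself it is antisymmetric only after an index
shift. Its last term and the derivative of the coefficient Q of σ_{1,l} combine to -Qσ_{1,k}σ_{1,l},
which is antisymmetric. -/
lemma oddAnti_sum : OddAnti (fun l => bQ U * bc U l + br U l) := by
  have key : ∀ k l, epsB U * oddFlow U k (bQ U * bc U l + br U l) =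
      -(bQ U * (bc U k * bc U l)) + bQ U * oconv (bc U) (bw U) k l -
        bQ U * osum (fun j => shiftB U (-1) (bc U (k + l - j)) * bc U j) k l := by
    intro k l
    have e : oconv (fun j => shiftB U (-1) (bc U j)) (bc U) k (l + 1) =
        osum (fun j => shiftB U (-1) (bc U (k + l - j)) * bc U j) k l +
          shiftB U (-1) (bc U k) * bc U l := by
      rw [oconv_reflect, osum_succ]
      have e1 : k + (l + 1) - 1 = k + l := by ring
      rw [e1, add_sub_cancel_right]
    rw [map_add, (isOddFlow_oddFlow k).leibniz_parityB, mul_add, mul_add, ← mul_assoc,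
      epsB_oddFlow_bQ, parityB_bQ, ← mul_assoc, epsB_comm, mul_assoc, mul_assoc (bQ U) (epsB U),
      epsB_oddFlow_bc, epsB_oddFlow_br, e]
    noncomm_ring
  refine fun k l => epsB_cancel ?_
  rw [mul_neg, key, key, bc_anti, oconv_swap, osum_swap, add_comm k l]
  noncomm_ring

lemma epsB_mul_epsB_mul (x y : BRing U) : epsB U * (epsB U * (x * y)) = (epsB U * x) * (epsB U * y) := by
  rw [mul_assoc, ← mul_assoc x, ← epsB_comm x, mul_assoc]

lemma oddFlow_genB_anti (k l : ℤ) (i j : Fin 2) : oddFlow U k (genB U i) * oddFlow U l (genB U j) =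
    -(oddFlow U l (genB U j) * oddFlow U k (genB U i)) := by
  have h : ∀ k i, epsB U * oddFlow U k (genB U i) = toB U (superP0 U k i) := by
    intro k i
    fin_cases i
    · exact (epsB_mul_oddFlow k (sP U)).trans (by rw [oddE, X_mul_oddDer_sP]; rfl)
    · exact (epsB_mul_oddFlow k (sQ U)).trans (by rw [oddE, X_mul_oddDer_sQ]; rfl)
  refine epsB_cancel (epsB_cancel ?_)
  rw [mul_neg, mul_neg, epsB_mul_epsB_mul, epsB_mul_epsB_mul, h, h,
    (isOdd_superP0 k i).toB_anti (isOdd_superP0 l j)]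

/-- The anticommutator of the odd flows. -/
def antiFlow (U : Chart) (k l : ℤ) : BRing U →+ BRing U :=
  (oddFlow U k).comp (oddFlow U l) + (oddFlow U l).comp (oddFlow U k)

lemma antiFlow_apply (k l : ℤ) (x : BRing U) :
    antiFlow U k l x = oddFlow U k (oddFlow U l x) + oddFlow U l (oddFlow U k x) := rfl

lemma antiFlow_comm (k l : ℤ) (x : BRing U) : antiFlow U k l x = antiFlow U l k x := add_comm _ _

lemma isEvenFlow_antiFlow (k l : ℤ) : IsEvenFlow (antiFlow U k l) :=
  (isOddFlow_oddFlow k).anticomm (isOddFlow_oddFlow l) (parityB_oddFlow k) (parityB_oddFlow l)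
    (oddFlow_genB_anti k l)

lemma antiFlow_shiftB (k l m : ℤ) (x : BRing U) :
    antiFlow U k l (shiftB U m x) = shiftB U m (antiFlow U k l x) := by
  simp only [antiFlow_apply, oddFlow_shiftB, map_add]

lemma antiFlow_bQ (k l : ℤ) : antiFlow U k l (bQ U) = 0 := by
  have key : ∀ k l, epsB U * (epsB U * oddFlow U k (oddFlow U l (bQ U))) =
      bQ U * ((shiftB U (-1) (bc U k) - bc U k) * (shiftB U (-1) (bc U l) - bc U l) +
        (shiftB U (-1) (oconv (bc U) (bw U) k l) - oconv (bc U) (bw U) k l)) := by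
    intro k l
    rw [← (isOddFlow_oddFlow k).epsB_mul, epsB_oddFlow_bQ, (isOddFlow_oddFlow k).leibniz_parityB,
      mul_add, ← mul_assoc, epsB_oddFlow_bQ, parityB_bQ, ← mul_assoc, epsB_comm, mul_assoc,
      mul_assoc (bQ U) (epsB U), map_sub, oddFlow_shiftB, mul_sub (epsB U), epsB_oddFlow_bc, mul_add]
    have e : epsB U * shiftB U (-1) (oddFlow U k (bc U l)) =
        shiftB U (-1) (oconv (bc U) (bw U) k l) := by
      rw [← shiftB_epsB_mul, epsB_oddFlow_bc]
    rw [e]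
  refine epsB_cancel (epsB_cancel ?_)
  rw [mul_zero, mul_zero, antiFlow_apply, mul_add, mul_add, key, key, oconv_swap, map_neg]
  simp only [sub_mul, mul_sub, shiftB_bc_anti (-1) (-1) k l, shiftB_bc_anti_left (-1), bc_anti k l]
  noncomm_ring

lemma antiFlow_bP (k l : ℤ) : antiFlow U k l (bP U) = 0 := by
  have key : ∀ k l, epsB U * (epsB U * oddFlow U k (oddFlow U l (bP U))) =
      bP U * (bw U (k - 1) * bw U (l - 1)) - bP U * (epsB U * oddFlow U k (bw U (l - 1))) := by
    intro k l
    rw [← (isOddFlow_oddFlow k).epsB_mul, epsB_oddFlow_bP, map_neg,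
      (isOddFlow_oddFlow k).leibniz_parityB, mul_neg,
      mul_add, ← mul_assoc, epsB_oddFlow_bP, parityB_bP, ← mul_assoc, epsB_comm, mul_assoc]
    noncomm_ring
  have hw : ∀ k l, oddFlow U k (bw U (l - 1)) = -oddFlow U l (bw U (k - 1)) := by
    simp only [bw_eq, sub_eq_add_neg _ (shiftB U 1 _)]
    exact oddAnti_br.add (oddAnti_br.shift 1).neg
  refine epsB_cancel (epsB_cancel ?_)
  rw [mul_zero, mul_zero, antiFlow_apply, mul_add, mul_add, key, key, hw, bw_anti]
  noncomm_ring

/-- The cyclic sums of the values of the anticommutators. -/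
def cyc (x : ℤ → BRing U) (k l m : ℤ) : BRing U :=
  antiFlow U k l (x m) + antiFlow U l m (x k) + antiFlow U m k (x l)

/-- In the cyclic sum each double derivative ∂_k∂_l x_m occurs together with ∂_k∂_m x_l, and these
are opposite. -/
lemma OddAnti.cyc_eq_zero {x : ℤ → BRing U} (hx : OddAnti x) (k l m : ℤ) : cyc x k l m = 0 := by
  simp only [cyc, antiFlow_apply]
  rw [hx l m, hx m k, hx k l]
  simp only [map_neg]
  abel

lemma cyc_add (x y : ℤ → BRing U) (k l m : ℤ) :
    cyc (fun j => x j + y j) k l m = cyc x k l m + cyc y k l m := by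
  simp only [cyc, map_add]
  abel

lemma cyc_neg (x : ℤ → BRing U) (k l m : ℤ) : cyc (fun j => -x j) k l m = -cyc x k l m := by
  simp only [cyc, map_neg]
  abel

lemma cyc_shift (x : ℤ → BRing U) (k l m a : ℤ) :
    cyc (fun j => shiftB U a (x j)) k l m = shiftB U a (cyc x k l m) := by
  simp only [cyc, map_add, antiFlow_shiftB]

lemma cyc_mul {a : BRing U} (ha : ∀ k l, antiFlow U k l a = 0) (x : ℤ → BRing U) (k l m : ℤ) :
    cyc (fun j => a * x j) k l m = a * cyc x k l m := by
  simp only [cyc, (isEvenFlow_antiFlow _ _).leibniz, ha, zero_mul, zero_add, mul_add]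

/-- The anticommutators kill Q, so the term Qσ₁ in the sum has vanishing cyclic sum and Qσ₂ inherits
the statement without an index shift. -/
lemma cyc_br (k l m : ℤ) : cyc (br U) k l m = 0 := by
  have h := (oddAnti_sum (U := U)).cyc_eq_zero k l m
  rwa [cyc_add, cyc_mul antiFlow_bQ, oddAnti_bc.cyc_eq_zero, mul_zero, zero_add] at h

/-- The second recursion relation expresses σ_{1,j+1} through elements with vanishing cyclic sums.
Read in the other direction, after multiplication by P, it gives the same for σ_{1,j-1} below. -/
lemma cyc_bc_succ (k l m : ℤ) : cyc (fun j => bc U (j + 1)) k l m = 0 := by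
  have h : (fun j => bc U (j + 1)) =
      fun j => -(bP U * bc U j) + -(br U j + shiftB U 1 (br U j)) := by
    funext j
    rw [← bc_rel2]
    abel
  rw [h, cyc_add, cyc_neg, cyc_neg, cyc_add, cyc_mul antiFlow_bP, cyc_shift, cyc_br,
    oddAnti_bc.cyc_eq_zero, map_zero, mul_zero]
  simp

lemma cyc_bc_pred (k l m : ℤ) : cyc (fun j => bc U (j - 1)) k l m = 0 := by
  have h : (fun j => bP U * bc U (j - 1)) =
      fun j => -bc U j + -(br U (j - 1) + shiftB U 1 (br U (j - 1))) := by
    funext j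
    rw [← bc_rel2, sub_add_cancel]
    abel
  refine bP_cancel ?_
  rw [← cyc_mul antiFlow_bP, h, cyc_add, cyc_neg, cyc_neg, cyc_add,
    cyc_shift (fun j => br U (j - 1)), oddAnti_br.cyc_eq_zero, oddAnti_bc.cyc_eq_zero, map_zero]
  simp

/-- With the total index fixed, the anticommutators on σ₁ form a symmetric function of two indices.
The cyclic identities for σ_{1,j-1}, σ_{1,j} and σ_{1,j+1} are its cyclic sums on the planes s = -1,
0, 1. -/
lemma antiFlow_bc (k l m : ℤ) : antiFlow U k l (bc U m) = 0 := by
  have h := eq_zero_of_cyclic (fun x => eq_zero_of_add_self) (fun x => eq_zero_of_add_add_self)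
    (g := fun k' l' => antiFlow U k' l' (bc U (k + l + m - k' - l')))
    (fun a b => by rw [antiFlow_comm]; congr 2; ring) (n := k + l + m)
    (fun k' l' m' s e hs hs' => ?_) k l
  · rwa [show k + l + m - k - l = m by ring] at h
  · have e1 : k + l + m - k' - l' = m' + s := by omega
    have e2 : k + l + m - l' - m' = k' + s := by omega
    have e3 : k + l + m - m' - k' = l' + s := by omega
    rw [e1, e2, e3]
    obtain rfl | rfl | rfl : s = -1 ∨ s = 0 ∨ s = 1 := by omega
    · exact cyc_bc_pred k' l' m'
    · simp only [add_zero]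
      exact oddAnti_bc.cyc_eq_zero k' l' m'
    · exact cyc_bc_succ k' l' m'

/-- With P and all σ_{1,m} killed, the second relation leaves (1 + Λ) applied to the value, and 1 +
Λ is injective. -/
lemma antiFlow_br (k l m : ℤ) : antiFlow U k l (br U m) = 0 := by
  refine eq_zero_of_shiftB_add ?_
  have h := congrArg (antiFlow U k l) (bc_rel2 (U := U) m)
  rw [map_add, (isEvenFlow_antiFlow _ _).leibniz, antiFlow_bP, antiFlow_bc, antiFlow_bc, zero_mul,
    mul_zero, map_neg, map_add, antiFlow_shiftB, add_zero, add_zero, eq_comm, neg_eq_zero,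
    add_comm] at h
  exact h

lemma br_eq (m : ℤ) : br U m = bQ U * toB U (s2 U m) := map_mul _ _ _

/-- The odd flows anticommute. -/
lemma antiFlow_eq_zero (k l : ℤ) : antiFlow U k l = 0 := by
  refine (isEvenFlow_antiFlow k l).ext isEvenFlow_zero (antiFlow_bP k l) (antiFlow_bQ k l)
    (fun α m => ?_)
  fin_cases α
  · exact antiFlow_bc k l m
  · have h := antiFlow_br (U := U) k l m
    rw [br_eq, (isEvenFlow_antiFlow _ _).leibniz, antiFlow_bQ, zero_mul, zero_add] at h
    exact bQ_cancel h

lemma oddFlow_anticomm (k l : ℤ) (x : BRing U) :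
    oddFlow U k (oddFlow U l x) = -oddFlow U l (oddFlow U k x) := by
  have h := DFunLike.congr_fun (antiFlow_eq_zero (U := U) k l) x
  exact eq_neg_of_add_eq_zero_left h

/-! ## Elements that are linear in the odd variables -/

/-- The projection of the Grassmann algebra to the dual numbers over the generators. -/
abbrev grassTriv : Grass →ₐ[ℝ] TrivSqZeroExt ℝ (OddIdx →₀ ℝ) := ExteriorAlgebra.toTrivSqZeroExt

lemma fst_grassTriv_dx (g : Grass) : (grassTriv (grassDx g)).fst = 0 := by
  induction g using ExteriorAlgebra.induction with
  | algebraMap r => rw [grassDx_algebraMap, map_zero, TrivSqZeroExt.fst_zero]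
  | ι v => rw [grassDx_ι, ExteriorAlgebra.toTrivSqZeroExt_ι, TrivSqZeroExt.fst_inr]
  | mul a b ha hb =>
    rw [grassDx_mul, map_add, map_mul, map_mul, TrivSqZeroExt.fst_add, TrivSqZeroExt.fst_mul,
      TrivSqZeroExt.fst_mul, ha, hb, zero_mul, mul_zero, add_zero]
  | add a b ha hb => rw [map_add, map_add, TrivSqZeroExt.fst_add, ha, hb, add_zero]

lemma snd_grassTriv_dx (g : Grass) :
    (grassTriv (grassDx g)).snd = oddShift (grassTriv g).snd := by
  induction g using ExteriorAlgebra.induction with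
  | algebraMap r =>
    rw [grassDx_algebraMap, map_zero, AlgHom.commutes, TrivSqZeroExt.snd_zero]
    exact (map_zero _).symm
  | ι v => rw [grassDx_ι, ExteriorAlgebra.toTrivSqZeroExt_ι, ExteriorAlgebra.toTrivSqZeroExt_ι,
      TrivSqZeroExt.snd_inr, TrivSqZeroExt.snd_inr]
  | mul a b ha hb =>
    rw [grassDx_mul, map_add, map_mul, map_mul, map_mul, TrivSqZeroExt.snd_add]
    simp only [TrivSqZeroExt.snd_mul, fst_grassTriv_dx, ha, hb, op_smul_eq_smul,
      map_add, map_smul, zero_smul, zero_add, add_zero]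
    rw [add_comm]
  | add a b ha hb =>
    rw [map_add, map_add, map_add, TrivSqZeroExt.snd_add, TrivSqZeroExt.snd_add, map_add, ha, hb]

/-- The linear part of an element of the Grassmann algebra, with `σ_{α,k}^s` replaced by
`∂_x^s ξ_α`. -/
def grassEval (ξ : Fin 2 → Jet U) : Grass →ₗ[ℝ] Jet U :=
  Finsupp.lift (Jet U) ℝ OddIdx (fun v => (jetDx U ^ v.2.2) (ξ v.1)) ∘ₗ
    (TrivSqZeroExt.sndHom ℝ (OddIdx →₀ ℝ)) ∘ₗ grassTriv.toLinearMap

lemma grassEval_apply (ξ : Fin 2 → Jet U) (g : Grass) : grassEval ξ g =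
    Finsupp.lift (Jet U) ℝ OddIdx (fun v => (jetDx U ^ v.2.2) (ξ v.1)) (grassTriv g).snd := rfl

lemma grassEval_ι (ξ : Fin 2 → Jet U) (v : OddIdx) :
    grassEval ξ (ExteriorAlgebra.ι ℝ (Finsupp.single v 1)) = (jetDx U ^ v.2.2) (ξ v.1) := by
  rw [grassEval_apply, ExteriorAlgebra.toTrivSqZeroExt_ι, TrivSqZeroExt.snd_inr]
  simp

lemma grassEval_dx (ξ : Fin 2 → Jet U) (g : Grass) :
    grassEval ξ (grassDx g) = jetDx U (grassEval ξ g) := by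
  rw [grassEval_apply, grassEval_apply, snd_grassTriv_dx]
  induction (grassTriv g).snd using Finsupp.induction_linear with
  | zero => simp
  | add x y hx hy => simp only [map_add, hx, hy]
  | single v r =>
    simp [oddShift, Finsupp.lmapDomain_apply, Finsupp.mapDomain_single, pow_succ']

/-- The linear part of a super differential polynomial, with `σ_{α,k}^s` replaced by
`∂_x^s ξ_α`. -/
def superEval (ξ : Fin 2 → Jet U) : Super U →ₗ[ℝ] Jet U :=
  LinearMap.mul' ℝ (Jet U) ∘ₗ LinearMap.lTensor (Jet U) (grassEval ξ)

lemma superEval_tmul (ξ : Fin 2 → Jet U) (f : Jet U) (g : Grass) :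
    superEval ξ (f ⊗ₜ g) = f * grassEval ξ g := rfl

lemma superEval_mul (ξ : Fin 2 → Jet U) (f : Jet U) (w : Super U) :
    superEval ξ ((f ⊗ₜ[ℝ] (1 : Grass)) * w) = f * superEval ξ w := by
  induction w using TensorProduct.induction_on with
  | zero => simp
  | add x y hx hy => rw [mul_add, map_add, map_add, mul_add, hx, hy]
  | tmul f' g' => rw [Algebra.TensorProduct.tmul_mul_tmul, one_mul, superEval_tmul, superEval_tmul,
      mul_assoc]

lemma superEval_dx (ξ : Fin 2 → Jet U) (w : Super U) :
    superEval ξ (superDx U w) = jetDx U (superEval ξ w) := by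
  induction w using TensorProduct.induction_on with
  | zero => simp
  | add x y hx hy => simp only [map_add, hx, hy]
  | tmul f g => rw [superDx_tmul, map_add, superEval_tmul, superEval_tmul, superEval_tmul,
      grassEval_dx, jetDx_mul]

/-- The linear part of an element of `SuperPoly U`, with `σ_{α,k}` replaced by `ξ_α`. -/
def linEval (ξ : Fin 2 → Jet U) : SuperPoly U →+ DiffPoly U where
  toFun f := PowerSeries.mk fun n => superEval ξ (PowerSeries.coeff n f)
  map_zero' := by ext1 n; simp
  map_add' f g := by ext1 n; simp

lemma coeff_linEval (ξ : Fin 2 → Jet U) (f : SuperPoly U) (n : ℕ) :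
    PowerSeries.coeff n (linEval ξ f) = superEval ξ (PowerSeries.coeff n f) := by
  change PowerSeries.coeff n (PowerSeries.mk fun n => superEval ξ (PowerSeries.coeff n f)) = _
  rw [PowerSeries.coeff_mk]

lemma linEval_incl_mul (ξ : Fin 2 → Jet U) (f : DiffPoly U) (z : SuperPoly U) :
    linEval ξ (incl U f * z) = f * linEval ξ z := by
  ext1 n
  rw [coeff_linEval, PowerSeries.coeff_mul, PowerSeries.coeff_mul, map_sum]
  refine Finset.sum_congr rfl fun p _ => ?_
  rw [coeff_linEval]
  exact superEval_mul ξ _ _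

lemma linEval_X_mul (ξ : Fin 2 → Jet U) (z : SuperPoly U) :
    linEval ξ (PowerSeries.X * z) = PowerSeries.X * linEval ξ z := by
  rw [← incl_X, linEval_incl_mul]

lemma linEval_dx (ξ : Fin 2 → Jet U) (z : SuperPoly U) :
    linEval ξ (epsMap (superDx U) z) = epsMap (jetDx U) (linEval ξ z) := by
  ext1 n
  rw [coeff_linEval, coeff_epsMap, coeff_epsMap, coeff_linEval, superEval_dx]

lemma linEval_smul (ξ : Fin 2 → Jet U) (c : ℝ) (z : SuperPoly U) :
    linEval ξ (c • z) = c • linEval ξ z := by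
  ext1 n
  rw [coeff_linEval, PowerSeries.coeff_smul, PowerSeries.coeff_smul, coeff_linEval]
  exact map_smul _ _ _

lemma linEval_shift (ξ : Fin 2 → Jet U) (m : ℤ) (z : SuperPoly U) :
    linEval ξ (superShift U m z) = jetShift U m (linEval ξ z) := by
  simp only [jetShift, superShift, shift_eq]
  exact epsOp_intertwine (linEval_X_mul ξ) (linEval_dx ξ) _ (linEval_smul ξ) z

lemma linEval_sig (ξ : Fin 2 → Jet U) (α : Fin 2) (k : ℤ) :
    linEval ξ (sig U α k) = PowerSeries.C (ξ α) := by
  ext1 n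
  rw [coeff_linEval, sig, PowerSeries.coeff_C, PowerSeries.coeff_C]
  split_ifs
  · rw [superEval_tmul, grassEval_ι, one_mul]
    rfl
  · rw [map_zero]

/-- Substitution of ξ for the odd variables commutes with multiplication by 𝒜 and with ∂_x.
Derivations along linear super fields thus become ordinary evolutionary derivations, where adjoint
identities are available. -/
lemma linEval_aDer (ξ : Fin 2 → Jet U) (x : Fin 2 → SuperPoly U) (f : DiffPoly U) :
    linEval ξ (aDer x f) = evolve (fun α => linEval ξ (x α)) f := by
  have h := isADer_aDer x
  have h1 : IsADer (RingHom.id _) (epsMap (jetDx U)) ((linEval ξ).comp (aDer x)) :=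
    { mul := fun f g => by
        simp only [AddMonoidHom.comp_apply, h.mul, map_add, linEval_incl_mul, RingHom.id_apply]
      X_mul := fun f => by
        simp only [AddMonoidHom.comp_apply, h.X_mul, linEval_incl_mul, RingHom.id_apply]
      dx := fun f => by simp only [AddMonoidHom.comp_apply, h.dx, linEval_dx]
      smooth := fun f => by
        simp only [AddMonoidHom.comp_apply, h.smooth f, map_add, linEval_incl_mul,
          RingHom.id_apply] }
  have h2 := isADer_evolveHom (fun α => linEval ξ (x α))
  rw [← evolveHom_apply]
  refine h1.ext rfl h2 ?_ ?_ f
  · rw [AddMonoidHom.comp_apply, aDer_P, evolveHom_apply, evolve_P]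
  · rw [AddMonoidHom.comp_apply, aDer_Q, evolveHom_apply, evolve_Q]

/-- The super differential polynomials that are linear in the odd variables with index `l`. -/
def linMap (U : Chart) (l : ℤ) : (Fin 2 × ℕ →₀ Jet U) →+ Super U :=
  Finsupp.liftAddHom fun v => (TensorProduct.mk ℝ (Jet U) Grass).flip
    (ExteriorAlgebra.ι ℝ (Finsupp.single (v.1, l, v.2) 1))

lemma linMap_single (l : ℤ) (v : Fin 2 × ℕ) (f : Jet U) : linMap U l (Finsupp.single v f) =
    f ⊗ₜ ExteriorAlgebra.ι ℝ (Finsupp.single (v.1, l, v.2) 1) := by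
  simp [linMap]

lemma superEval_linMap (ξ : Fin 2 → Jet U) (l : ℤ) (w : Fin 2 × ℕ →₀ Jet U) :
    superEval ξ (linMap U l w) = w.sum fun v f => f * (jetDx U ^ v.2) (ξ v.1) := by
  induction w using Finsupp.induction_linear with
  | zero => simp
  | add x y hx hy =>
    rw [map_add, map_add, hx, hy, Finsupp.sum_add_index'] <;> simp [add_mul]
  | single v r => rw [linMap_single, superEval_tmul, grassEval_ι, Finsupp.sum_single_index]; simp

lemma jetDx_pow_X (β : Fin 2) (N s : ℕ) :
    (jetDx U ^ s) (MvPolynomial.X (β, N)) = MvPolynomial.X (β, N + s) := by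
  induction s with
  | zero => rfl
  | succ s ih => rw [pow_succ', Module.End.mul_apply, ih, jetDx_X]; rfl

/-- Evaluate at ξ_β = ∂_x^{N+1}u^β (and zero in the other component) with N beyond the order of
every coefficient. Then ∂/∂u^{β,N+s+1} isolates the coefficient of σ_β^s. Only partial derivatives
of the evaluation are assumed to vanish, so that an evaluation lying in the kernel of ∂_x is also
covered. -/
lemma linMap_eq_zero (l : ℤ) (w : Fin 2 × ℕ →₀ Jet U)
    (h : ∀ β N i j, jetPartial U i j (superEval (Pi.single β (MvPolynomial.X (β, N)))
      (linMap U l w)) = 0) : w = 0 := by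
  classical
  choose K hK using fun v => exists_jetPartial_eq_zero (w v)
  ext1 v
  obtain ⟨β, s⟩ := v
  let N := w.support.sup K
  have hN : ∀ v j, N ≤ j → jetPartial U β j (w v) = 0 := by
    intro v j hj
    by_cases hv : v ∈ w.support
    · exact hK v j ((Finset.le_sup hv).trans hj) β
    · rw [Finsupp.notMem_support_iff.1 hv, map_zero]
  have h1 := h β N β (N + s + 1)
  rw [superEval_linMap, Finsupp.sum, map_sum] at h1
  have h2 : ∀ v ∈ w.support, jetPartial U β (N + s + 1) (w v * (jetDx U ^ v.2)
      ((Pi.single β (MvPolynomial.X (β, N)) : Fin 2 → Jet U) v.1)) =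
      if v = (β, s) then w (β, s) else 0 := by
    intro v _
    obtain ⟨γ, t⟩ := v
    rw [jetPartial_mul, hN _ _ (by omega), zero_mul, zero_add]
    by_cases hγ : γ = β
    · subst hγ
      simp only [Pi.single_eq_same, jetDx_pow_X, jetPartial_succ_X, Prod.mk.injEq, true_and,
        add_right_inj]
      split_ifs with ht
      · rw [ht, mul_one]
      · rw [mul_zero]
    · simp [hγ, Pi.single_eq_of_ne]
  rw [Finset.sum_congr rfl h2, Finset.sum_ite_eq'] at h1
  split_ifs at h1 with hs
  · exact h1
  · exact Finsupp.notMem_support_iff.1 hs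

lemma tmul_mul_linMap (l : ℤ) (f : Jet U) (w : Fin 2 × ℕ →₀ Jet U) :
    (f ⊗ₜ[ℝ] (1 : Grass)) * linMap U l w ∈ (linMap U l).range := by
  induction w using Finsupp.induction_linear with
  | zero => simp
  | add x y hx hy => rw [map_add, mul_add]; exact add_mem hx hy
  | single v r =>
    rw [linMap_single, Algebra.TensorProduct.tmul_mul_tmul, one_mul, ← linMap_single]
    exact ⟨_, rfl⟩

lemma superDx_linMap (l : ℤ) (w : Fin 2 × ℕ →₀ Jet U) :
    superDx U (linMap U l w) ∈ (linMap U l).range := by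
  induction w using Finsupp.induction_linear with
  | zero => simp
  | add x y hx hy => rw [map_add, map_add]; exact add_mem hx hy
  | single v r =>
    have e : oddShift (Finsupp.single (v.1, l, v.2) 1) = Finsupp.single (v.1, l, v.2 + 1) 1 := by
      simp [oddShift, Finsupp.lmapDomain_apply, Finsupp.mapDomain_single]
    rw [linMap_single, superDx_tmul, grassDx_ι, e, ← linMap_single, ← linMap_single l (v.1, v.2 + 1)]
    exact add_mem ⟨_, rfl⟩ ⟨_, rfl⟩

/-- The elements of `SuperPoly U` that are linear in the odd variables with index `l`. -/
def Lin (U : Chart) (l : ℤ) : AddSubgroup (SuperPoly U) where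
  carrier := {z | ∀ n, PowerSeries.coeff n z ∈ (linMap U l).range}
  zero_mem' n := by rw [map_zero]; exact zero_mem _
  add_mem' hx hy n := by rw [map_add]; exact add_mem (hx n) (hy n)
  neg_mem' hx n := by rw [map_neg]; exact neg_mem (hx n)

namespace Lin

variable {l : ℤ} {z : SuperPoly U}

lemma sig_mem (α : Fin 2) (l : ℤ) : sig U α l ∈ Lin U l := by
  intro n
  rw [sig, PowerSeries.coeff_C]
  split_ifs
  · exact ⟨_, linMap_single l (α, 0) 1⟩
  · exact zero_mem _

lemma incl_mul (f : DiffPoly U) (hz : z ∈ Lin U l) : incl U f * z ∈ Lin U l := by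
  intro n
  rw [PowerSeries.coeff_mul]
  refine sum_mem fun p _ => ?_
  obtain ⟨w, hw⟩ := hz p.2
  rw [← hw]
  exact tmul_mul_linMap l _ w

lemma dx_mem (hz : z ∈ Lin U l) : epsMap (superDx U) z ∈ Lin U l := by
  intro n
  rw [coeff_epsMap]
  obtain ⟨w, hw⟩ := hz n
  rw [← hw]
  exact superDx_linMap l w

lemma X_mul_mem (hz : z ∈ Lin U l) : PowerSeries.X * z ∈ Lin U l := by
  rw [← incl_X]
  exact incl_mul _ hz

lemma divEps_mem (hz : z ∈ Lin U l) : divEps z ∈ Lin U l := by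
  intro n
  rw [divEps, PowerSeries.coeff_mk]
  exact hz _

lemma smul_mem (c : ℝ) (hz : z ∈ Lin U l) : c • z ∈ Lin U l := by
  rw [smul_eq_incl_mul]
  exact incl_mul _ hz

lemma closed (h : ∀ n : ℕ, ∃ g ∈ Lin U l, ∃ r, z = g + PowerSeries.X ^ n * r) : z ∈ Lin U l := by
  intro n
  obtain ⟨g, hg, r, rfl⟩ := h (n + 1)
  have e : PowerSeries.coeff n (PowerSeries.X ^ (n + 1) * r) = 0 := by
    rw [PowerSeries.coeff_X_pow_mul', if_neg (by omega)]
  rw [map_add, e, add_zero]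
  exact hg n

lemma shift_mem (m : ℤ) (hz : z ∈ Lin U l) : superShift U m z ∈ Lin U l := by
  rw [superShift, shift_eq]
  exact epsOp_mem (fun _ h => X_mul_mem h) (fun c _ h => smul_mem c h) (fun _ h => dx_mem h)
    (fun _ h => closed h) _ hz

lemma aDer_mem {x : Fin 2 → SuperPoly U} (hx : ∀ α, x α ∈ Lin U l) (f : DiffPoly U) :
    aDer x f ∈ Lin U l := by
  refine (isADer_aDer x).mem (Lin U l) (fun a _ hm => incl_mul a hm) (fun _ hm => dx_mem hm)
    (fun m hm => closed fun n => ?_) ?_ ?_ f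
  · rw [← incl_X]
    exact hm n
  · rw [aDer_P]; exact hx 0
  · rw [aDer_Q]; exact hx 1

lemma eq_zero_of_jetPartial (hz : z ∈ Lin U l) (h : ∀ ξ : Fin 2 → Jet U, ∀ n i j,
    jetPartial U i j (PowerSeries.coeff n (linEval ξ z)) = 0) : z = 0 := by
  ext1 n
  obtain ⟨w, hw⟩ := hz n
  rw [map_zero, ← hw, linMap_eq_zero l w (fun β N i j => ?_), map_zero]
  rw [hw, ← coeff_linEval]
  exact h _ n i j

lemma eq_zero_of_linEval (hz : z ∈ Lin U l) (h : ∀ ξ : Fin 2 → Jet U, linEval ξ z = 0) : z = 0 :=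
  eq_zero_of_jetPartial hz fun ξ n i j => by rw [h, map_zero, map_zero]

end Lin

/-- Descending induction on s: from ∂_x f = 0 one gets ∂f/∂u^{i,s} = -∂_x(∂f/∂u^{i,s+1}), and high
derivatives vanish. -/
lemma jetPartial_eq_zero_of_dx {f : Jet U} (h : jetDx U f = 0) (i : Fin 2) (s : ℕ) :
    jetPartial U i s f = 0 := by
  obtain ⟨N, hN⟩ := exists_jetPartial_eq_zero f
  have key : ∀ k s, N ≤ s + k → jetPartial U i s f = 0 := by
    intro k
    induction k with
    | zero => exact fun s hs => hN s hs i
    | succ k ih =>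
      intro s hs
      have h1 := jetPartial_succ_dx i s f
      rw [h, map_zero, ih (s + 1) (by omega), map_zero, zero_add] at h1
      exact h1.symm
  exact key N s (by omega)

/-- The shift operator has no nonzero fixed points among the linear elements. -/
lemma Lin.eq_zero_of_shift {l : ℤ} {z : SuperPoly U} (hz : z ∈ Lin U l)
    (h : superShift U 1 z = z) : z = 0 := by
  refine eq_zero_of_jetPartial hz fun ξ n i j => jetPartial_eq_zero_of_dx ?_ i j
  have h1 : jetShift U 1 (linEval ξ z) = linEval ξ z := by rw [← linEval_shift, h]
  rw [← coeff_epsMap, epsMap_eq_zero_of_shift h1, map_zero]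

/-! ## The derivations along the Hamiltonian structures -/

lemma aDer_sub_left (x y : Fin 2 → SuperPoly U) (f : DiffPoly U) :
    aDer x f - aDer y f = aDer (fun α => x α - y α) f := by
  simp only [aDer_apply, map_sub]
  abel

lemma aDer_jetShift (x : Fin 2 → SuperPoly U) (m : ℤ) (f : DiffPoly U) :
    aDer x (jetShift U m f) = superShift U m (aDer x f) := by
  simp only [jetShift, superShift, shift_eq]
  exact epsOp_intertwine (fun f => by rw [(isADer_aDer x).X_mul, incl_X]) (isADer_aDer x).dx _
    (aDer_smul x) f

lemma X_mul_aDer (x : Fin 2 → SuperPoly U) (f : DiffPoly U) :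
    PowerSeries.X * aDer x f = aDer x (PowerSeries.X * f) := by
  rw [(isADer_aDer x).X_mul, incl_X]

lemma aDer_incl (X : Fin 2 → DiffPoly U) (f : DiffPoly U) :
    aDer (fun α => incl U (X α)) f = incl U (evolve X f) := by
  have h : IsADer (incl U) (epsMap (superDx U))
      ((incl U : DiffPoly U →+ SuperPoly U).comp (evolveHom X)) := by
    have e : ∀ f, ((incl U : DiffPoly U →+ SuperPoly U).comp (evolveHom X)) f =
      incl U (evolveHom X f) := fun _ => rfl
    have h := isADer_evolveHom X
    exact ⟨fun f g => by simp only [e, h.mul, map_add, map_mul, RingHom.id_apply],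
      fun f => by simp only [e, h.X_mul, map_mul, RingHom.id_apply],
      fun f => by simp only [e, h.dx, incl_dx],
      fun f => by simp only [e, h.smooth f, map_add, map_mul, RingHom.id_apply]⟩
  rw [← evolveHom_apply]
  refine (isADer_aDer _).ext incl_X h ?_ ?_ f
  · rw [aDer_P, AddMonoidHom.comp_apply, evolveHom_apply, evolve_P]; rfl
  · rw [aDer_Q, AddMonoidHom.comp_apply, evolveHom_apply, evolve_Q]; rfl

/-- The derivation `u ↦ 𝒫₀ σ_l`. -/
def der0 (U : Chart) (l : ℤ) : DiffPoly U →+ SuperPoly U := aDer fun α => divEps (superP0 U l α)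

/-- The derivation `u ↦ 𝒫₁ σ_l`. -/
def der1 (U : Chart) (l : ℤ) : DiffPoly U →+ SuperPoly U := aDer fun α => divEps (superP1 U l α)

lemma coeff_zero_superP1 (k : ℤ) (α : Fin 2) : PowerSeries.coeff 0 (superP1 U k α) = 0 := by
  fin_cases α
  · change PowerSeries.coeff 0 (superP1 U k 0) = 0
    rw [superP1_zero, coeff_zero_mul, map_sub, coeff_zero_superShift, sub_self, mul_zero]
  · change PowerSeries.coeff 0 (superP1 U k 1) = 0
    rw [superP1_one, map_add, coeff_zero_mul, coeff_zero_mul, map_sub, map_sub]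
    simp only [coeff_zero_superShift, sub_self, mul_zero, add_zero]

lemma X_mul_der0 (l : ℤ) (f : DiffPoly U) :
    PowerSeries.X * der0 U l f = aDer (superP0 U l) f := by
  rw [der0, ← aDer_X_mul]
  congr 2
  funext α
  rw [X_mul_divEps (coeff_zero_superP0 l α)]

lemma X_mul_der1 (l : ℤ) (f : DiffPoly U) :
    PowerSeries.X * der1 U l f = aDer (superP1 U l) f := by
  rw [der1, ← aDer_X_mul]
  congr 2
  funext α
  rw [X_mul_divEps (coeff_zero_superP1 l α)]

/-- The first relation is the P component of 𝒫₁σ_k - 𝒫₀σ_{k+1}. The Q component, computed next, sees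
the second relation only through Q(1 - Λ⁻¹). -/
lemma superP1_zero_sub (k : ℤ) : superP1 U k 0 - superP0 U (k + 1) 0 = rel1 U k := by
  rw [superP1_zero, superP0_zero, rel1, sw]
  simp only [mul_sub, sr]
  abel

lemma superP1_one_sub (k : ℤ) : superP1 U k 1 - superP0 U (k + 1) 1 =
    sQ U * (rel2 U k - superShift U (-1) (rel2 U k)) := by
  have e : rel2 U k = s1 U (k + 1) + sP U * s1 U k + (superShift U 1 (sr U k) + sr U k) := rfl
  rw [superP1_one, superP0_one, e]
  simp only [superShift_add, superShift_neg_one_one, mul_sub, mul_add]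
  abel

lemma superP1_sub_mem (k : ℤ) (α : Fin 2) :
    superP1 U k α - superP0 U (k + 1) α ∈ relIdeal U := by
  have h := isRelIdeal_relIdeal U
  fin_cases α
  · change superP1 U k 0 - superP0 U (k + 1) 0 ∈ relIdeal U
    rw [superP1_zero_sub]
    exact h.rel1_mem k
  · change superP1 U k 1 - superP0 U (k + 1) 1 ∈ relIdeal U
    rw [superP1_one_sub]
    exact (relIdeal U).mul_mem_left _ ((relIdeal U).sub_mem (h.rel2_mem k)
      (relIdeal_shift _ (h.rel2_mem k)))

/-- The two derivations agree on P and Q modulo J, hence everywhere; saturation removes the ε by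
which both are divided. -/
lemma der1_sub_mem (k : ℤ) (f : DiffPoly U) : der1 U k f - der0 U (k + 1) f ∈ relIdeal U := by
  have h := isRelIdeal_relIdeal U
  refine h.saturated _ ?_
  rw [mul_sub, X_mul_der1, X_mul_der0, aDer_sub_left]
  refine (isADer_aDer _).mem (relIdeal U).toAddSubgroup
    (fun a _ hm => (relIdeal U).mul_mem_left _ hm) h.dx_mem (fun m hm => ?_) ?_ ?_ f
  · rw [incl_X] at hm
    exact h.closed m hm
  · rw [aDer_P]; exact superP1_sub_mem k 0
  · rw [aDer_Q]; exact superP1_sub_mem k 1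

lemma Lin.superP0_mem (l : ℤ) (α : Fin 2) : superP0 U l α ∈ Lin U l := by
  have h1 : s1 U l ∈ Lin U l := Lin.sig_mem 0 l
  have h2 : sr U l ∈ Lin U l := Lin.incl_mul _ (Lin.sig_mem 1 l)
  fin_cases α
  · exact add_mem (sub_mem (Lin.incl_mul _ (Lin.shift_mem _ h1)) (Lin.shift_mem _
      (Lin.incl_mul _ h1))) (sub_mem h2 (Lin.shift_mem _ h2))
  · exact Lin.incl_mul _ (sub_mem (Lin.shift_mem _ h1) h1)

lemma Lin.superP1_mem (l : ℤ) (α : Fin 2) : superP1 U l α ∈ Lin U l := by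
  have h1 : sP U * s1 U l ∈ Lin U l := Lin.incl_mul _ (Lin.sig_mem 0 l)
  have h2 : sr U l ∈ Lin U l := Lin.incl_mul _ (Lin.sig_mem 1 l)
  fin_cases α
  · exact Lin.incl_mul _ (sub_mem (Lin.shift_mem _ h2) h2)
  · exact add_mem (Lin.incl_mul _ (sub_mem h1 (Lin.shift_mem _ h1)))
      (Lin.incl_mul _ (sub_mem (Lin.shift_mem _ h2) (Lin.shift_mem _ h2)))

lemma Lin.der0_mem (l : ℤ) (f : DiffPoly U) : der0 U l f ∈ Lin U l :=
  Lin.aDer_mem (fun α => Lin.divEps_mem (Lin.superP0_mem l α)) f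

lemma Lin.der1_mem (l : ℤ) (f : DiffPoly U) : der1 U l f ∈ Lin U l :=
  Lin.aDer_mem (fun α => Lin.divEps_mem (Lin.superP1_mem l α)) f

lemma linEval_sr (ξ : Fin 2 → Jet U) (l : ℤ) :
    linEval ξ (sr U l) = ofSmooth (fQ U) * PowerSeries.C (ξ 1) := by
  rw [sr, sQ, linEval_incl_mul, linEval_sig]

lemma linEval_superP0 (ξ : Fin 2 → Jet U) (l : ℤ) (α : Fin 2) :
    linEval ξ (superP0 U l α) = jetP0 (fun β => PowerSeries.C (ξ β)) α := by
  fin_cases α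
  · change linEval ξ (superP0 U l 0) = jetP0 _ 0
    rw [superP0_zero, jetP0_zero, sw]
    simp only [map_add, map_sub, sQ, linEval_incl_mul, linEval_shift, linEval_sig, linEval_sr]
  · change linEval ξ (superP0 U l 1) = jetP0 _ 1
    rw [superP0_one, jetP0_one]
    simp only [map_sub, sQ, linEval_incl_mul, linEval_shift, linEval_sig]

lemma linEval_superP1 (ξ : Fin 2 → Jet U) (l : ℤ) (α : Fin 2) :
    linEval ξ (superP1 U l α) = jetP1 (fun β => PowerSeries.C (ξ β)) α := by
  fin_cases α
  · change linEval ξ (superP1 U l 0) = jetP1 _ 0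
    rw [superP1_zero, jetP1_zero]
    simp only [map_sub, sP, linEval_incl_mul, linEval_shift, linEval_sr]
  · change linEval ξ (superP1 U l 1) = jetP1 _ 1
    rw [superP1_one, jetP1_one]
    simp only [map_add, map_sub, sQ, sP, linEval_incl_mul, linEval_shift, linEval_sig, linEval_sr]

lemma X_mul_linEval_der0 (ξ : Fin 2 → Jet U) (l : ℤ) (f : DiffPoly U) :
    PowerSeries.X * linEval ξ (der0 U l f) = evolve (jetP0 fun β => PowerSeries.C (ξ β)) f := by
  rw [← linEval_X_mul, X_mul_der0, linEval_aDer]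
  simp only [linEval_superP0]

lemma X_mul_linEval_der1 (ξ : Fin 2 → Jet U) (l : ℤ) (f : DiffPoly U) :
    PowerSeries.X * linEval ξ (der1 U l f) = evolve (jetP1 fun β => PowerSeries.C (ξ β)) f := by
  rw [← linEval_X_mul, X_mul_der1, linEval_aDer]
  simp only [linEval_superP1]

/-! ## The even derivations -/

/-- The value of the even derivation at `σ_{1,l}`. -/
def evenC (h : DiffPoly U) (l : ℤ) : SuperPoly U := der0 U l (jetVar h 0)

/-- The value of the even derivation at `Q σ_{2,l}`. -/
def evenR (h : DiffPoly U) (l : ℤ) : SuperPoly U :=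
  der0 U l (ofSmooth (fQ U) * (jetVar h 0 + jetVar h 1)) -
    (incl U (hamField h 1) * s1 U l + sQ U * evenC h l)

lemma hasPar_der0 (l : ℤ) (f : DiffPoly U) : HasPar (-1) (der0 U l f) :=
  HasPar.aDer (fun α => (isOdd_superP0 l α).par.divEps (coeff_zero_superP0 l α)) f

/-- With these values D(σ_{1,l}) and D(Q(σ_{1,l} + σ_{2,l})) are the derivatives along 𝒫₀σ_l of
δh/δP and Q(δh/δP + δh/δQ), the combinations through which the field depends on h. The value at σ₂
itself follows from the Leibniz rule. -/
lemma exists_evenDer (h : DiffPoly U) : ∃ D : SuperPoly U →+ SuperPoly U,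
    IsSDer (RingHom.id _) D ∧ D (sP U) = incl U (hamField h 0) ∧
    D (sQ U) = incl U (hamField h 1) ∧ (∀ l, D (s1 U l) = evenC h l) ∧
    (∀ l, D (sr U l) = evenR h l) ∧ ∀ α l, HasPar (-1) (D (sig U α l)) := by
  have hC : ∀ l, HasPar (-1) (evenC h l) := fun l => hasPar_der0 l _
  have hR : ∀ l, HasPar (-1) (evenR h l) := fun l => (hasPar_der0 l _).sub
    (((HasPar.sig 0 l).incl_mul _).add ((hC l).incl_mul _))
  have hy : ∀ α l, HasPar (-1) ((![fun l => evenC h l, fun l =>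
      incl U (ofSmooth (fQinv U)) * (evenR h l - incl U (hamField h 1) * s2 U l)] :
        Fin 2 → ℤ → SuperPoly U) α l) := fun α l => by
    fin_cases α
    · exact hC l
    · exact ((hR l).sub ((HasPar.sig 1 l).incl_mul _)).incl_mul _
  obtain ⟨D, hD, hP, hQ, hs⟩ := exists_even (x := fun α => incl U (hamField h α))
    (fun α => HasPar.incl _) hy
  refine ⟨D, hD, hP, hQ, fun l => hs 0 l, fun l => ?_, fun α l => hs α l ▸ hy α l⟩
  rw [sr, hD.mul, hs, hQ]
  change incl U (hamField h 1) * s2 U l + sQ U * (incl U (ofSmooth (fQinv U)) *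
      (evenR h l - incl U (hamField h 1) * s2 U l)) = _
  rw [← mul_assoc (sQ U), sQ_mul_inv, one_mul, add_sub_cancel]

/-- The even derivation of the Hamiltonian vector field with density `h`. -/
def evenDer (h : DiffPoly U) : SuperPoly U →+ SuperPoly U := (exists_evenDer h).choose

lemma isSDer_evenDer (h : DiffPoly U) : IsSDer (RingHom.id _) (evenDer h) :=
  (exists_evenDer h).choose_spec.1

lemma evenDer_s1 (h : DiffPoly U) (l : ℤ) : evenDer h (s1 U l) = evenC h l :=
  (exists_evenDer h).choose_spec.2.2.2.1 l

lemma evenDer_sr (h : DiffPoly U) (l : ℤ) : evenDer h (sr U l) = evenR h l :=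
  (exists_evenDer h).choose_spec.2.2.2.2.1 l

lemma hasPar_evenDer_sig (h : DiffPoly U) (α : Fin 2) (l : ℤ) :
    HasPar (-1) (evenDer h (sig U α l)) :=
  (exists_evenDer h).choose_spec.2.2.2.2.2 α l

lemma evenDer_incl (h f : DiffPoly U) : evenDer h (incl U f) = incl U (evolve (hamField h) f) := by
  rw [(isSDer_evenDer h).incl (fun _ => rfl), ← aDer_incl]
  congr 2
  funext α
  fin_cases α
  · exact (exists_evenDer h).choose_spec.2.1
  · exact (exists_evenDer h).choose_spec.2.2.1

lemma evenDer_sP (h : DiffPoly U) : evenDer h (sP U) = incl U (hamField h 0) :=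
  (exists_evenDer h).choose_spec.2.1

lemma evenDer_sQ (h : DiffPoly U) : evenDer h (sQ U) = incl U (hamField h 1) :=
  (exists_evenDer h).choose_spec.2.2.1

lemma evenDer_mul (h : DiffPoly U) (f g : SuperPoly U) :
    evenDer h (f * g) = evenDer h f * g + f * evenDer h g := (isSDer_evenDer h).mul f g

lemma evenDer_shift (h : DiffPoly U) (m : ℤ) (f : SuperPoly U) :
    evenDer h (superShift U m f) = superShift U m (evenDer h f) :=
  (isSDer_evenDer h).shift (fun _ => rfl) m f

lemma evenDer_sum (h : DiffPoly U) (l : ℤ) : evenDer h (sQ U * s1 U l + sr U l) =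
    der0 U l (ofSmooth (fQ U) * (jetVar h 0 + jetVar h 1)) := by
  rw [map_add, evenDer_mul, evenDer_sQ, evenDer_s1, evenDer_sr, evenR, add_sub_cancel]

lemma superP0_zero_eq (l : ℤ) : superP0 U l 0 = superP0 U l 1 +
    ((sQ U * s1 U l + sr U l) - superShift U 1 (sQ U * s1 U l + sr U l)) := by
  rw [superP0_zero, superP0_one, sw, superShift_add, mul_sub]
  abel

lemma jetP0_zero_eq (ξ : Fin 2 → DiffPoly U) : jetP0 ξ 0 = jetP0 ξ 1 +
    (ofSmooth (fQ U) * (ξ 0 + ξ 1) - jetShift U 1 (ofSmooth (fQ U) * (ξ 0 + ξ 1))) := by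
  rw [jetP0_zero, jetP0_one, mul_add, jetShift_add]
  ring

/-- This already gives commutation with the odd flows on P and Q. It holds before passing to ℬ, by
the same decomposition of 𝒫₀ξ into its Q component and a difference as for the field. -/
lemma evenDer_superP0 (h : DiffPoly U) (l : ℤ) (α : Fin 2) :
    evenDer h (superP0 U l α) = PowerSeries.X * der0 U l (hamField h α) := by
  have h1 : evenDer h (superP0 U l 1) = PowerSeries.X * der0 U l (hamField h 1) := by
    -- Both X₁ and 𝒫₀σ have Q components of the form Q times a difference divided by ε, so the
    -- factors may be exchanged.
    have e1 : incl U (hamField h 1) * (superShift U (-1) (s1 U l) - s1 U l) =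
        incl U (jetShift U (-1) (jetVar h 0) - jetVar h 0) * der0 U l (ofSmooth (fQ U)) := by
      refine X_mul_cancel ?_
      rw [← mul_assoc, ← incl_X_mul, X_mul_hamField, ← mul_X_left_comm, X_mul_der0, aDer_Q,
        superP0_one, jetP0_one, map_mul, ← mul_assoc, incl_comm _ (sQ U)]
      rfl
    rw [superP0_one, evenDer_mul, evenDer_sQ, e1, map_sub (evenDer h), evenDer_shift, evenDer_s1,
      der0, X_mul_aDer, X_mul_hamField, jetP0_one, (isADer_aDer _).mul, map_sub (aDer _),
      aDer_jetShift, add_comm]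
    rfl
  fin_cases α
  · change evenDer h (superP0 U l 0) = PowerSeries.X * der0 U l (hamField h 0)
    rw [superP0_zero_eq, map_add, h1, map_sub, evenDer_shift, evenDer_sum, der0, X_mul_aDer,
      X_mul_aDer, X_mul_hamField, X_mul_hamField, jetP0_zero_eq, map_add, map_sub, aDer_jetShift]
  · exact h1

/-! ## The even derivations and the second Hamiltonian structure -/

lemma Lin.evenC_mem (h : DiffPoly U) (l : ℤ) : evenC h l ∈ Lin U l := Lin.der0_mem l _

lemma Lin.evenR_mem (h : DiffPoly U) (l : ℤ) : evenR h l ∈ Lin U l :=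
  sub_mem (Lin.der0_mem l _)
    (add_mem (Lin.incl_mul _ (Lin.sig_mem 0 l)) (Lin.incl_mul _ (Lin.evenC_mem h l)))

lemma Lin.sr_mem (l : ℤ) : sr U l ∈ Lin U l := Lin.incl_mul _ (Lin.sig_mem 1 l)

lemma X_mul_adjLin_hamField (h : DiffPoly U) (ξ : Fin 2 → DiffPoly U) (α : Fin 2) :
    PowerSeries.X * adjLin (hamField h) ξ α = adjLin (jetP0 (jetVar h)) ξ α := by
  rw [← adjLin_X_mul]
  congr 1
  funext β
  exact X_mul_hamField h β

/-- On the covectors ξ the derivation acts as -X_*^†; the next lemma is the same for the second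
component, multiplied by Q. This is the action that enters a Lie derivative of a bivector. -/
lemma linEval_evenC (h : DiffPoly U) (ξ : Fin 2 → Jet U) (l : ℤ) : linEval ξ (evenC h l) =
    -adjLin (hamField h) (fun β => PowerSeries.C (ξ β)) 0 := by
  refine X_mul_cancel ?_
  rw [evenC, X_mul_linEval_der0, mul_neg, X_mul_adjLin_hamField, adjLin_jetP0_zero, neg_neg]

lemma linEval_evenR (h : DiffPoly U) (ξ : Fin 2 → Jet U) (l : ℤ) : linEval ξ (evenR h l) =
    hamField h 1 * PowerSeries.C (ξ 1) -
      ofSmooth (fQ U) * adjLin (hamField h) (fun β => PowerSeries.C (ξ β)) 1 := by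
  refine X_mul_cancel ?_
  have h0 := X_mul_adjLin_hamField h (fun β => PowerSeries.C (ξ β)) 0
  have h1 := X_mul_adjLin_hamField h (fun β => PowerSeries.C (ξ β)) 1
  have h2 := X_mul_hamField h 1
  rw [adjLin_jetP0_zero] at h0
  rw [adjLin_jetP0_one] at h1
  rw [jetP0_one] at h2
  rw [evenR, map_sub, map_add, sQ, linEval_incl_mul, linEval_incl_mul, linEval_sig, linEval_evenC,
    mul_sub, X_mul_linEval_der0, evolve_mul, evolve_add, evolve_Q, jetP0_one]
  linear_combination (ofSmooth (fQ U)) * h0 + ofSmooth (fQ U) * h1 -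
    (PowerSeries.C (ξ 0) + PowerSeries.C (ξ 1)) * h2

lemma evenDer_superP1_zero (h : DiffPoly U) (l : ℤ) : evenDer h (superP1 U l 0) =
    incl U (hamField h 0) * (superShift U 1 (sr U l) - sr U l) +
      sP U * (superShift U 1 (evenR h l) - evenR h l) := by
  rw [superP1_zero, evenDer_mul, evenDer_sP, map_sub (evenDer h), evenDer_shift, evenDer_sr]

lemma evenDer_superP1_one (h : DiffPoly U) (l : ℤ) : evenDer h (superP1 U l 1) =
    incl U (hamField h 1) * (sP U * s1 U l - superShift U (-1) (sP U * s1 U l)) +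
      sQ U * (incl U (hamField h 0) * s1 U l + sP U * evenC h l -
        superShift U (-1) (incl U (hamField h 0) * s1 U l + sP U * evenC h l)) +
    (incl U (hamField h 1) * (superShift U 1 (sr U l) - superShift U (-1) (sr U l)) +
      sQ U * (superShift U 1 (evenR h l) - superShift U (-1) (evenR h l))) := by
  rw [superP1_one, map_add, evenDer_mul, evenDer_mul, evenDer_sQ, map_sub (evenDer h),
    map_sub (evenDer h)]
  simp only [evenDer_shift, evenDer_mul, evenDer_sr, evenDer_s1, evenDer_sP]

/-- Both sides are linear in σ_l, so it suffices to substitute arbitrary ξ. By the previous two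
lemmas the identity then becomes the vanishing of the Lie derivative of 𝒫₁ along X. -/
lemma evenDer_superP1 {h : DiffPoly U} (hp : PreservesP1 (hamField h)) (l : ℤ) (α : Fin 2) :
    evenDer h (superP1 U l α) = PowerSeries.X * der1 U l (hamField h α) := by
  have hC := Lin.evenC_mem h l
  have hR := Lin.evenR_mem h l
  have hs : s1 U l ∈ Lin U l := Lin.sig_mem 0 l
  have hr := Lin.sr_mem (U := U) l
  rw [← sub_eq_zero]
  refine Lin.eq_zero_of_linEval (l := l) (sub_mem ?_ (Lin.X_mul_mem (Lin.der1_mem l _)))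
    fun ξ => ?_
  · fin_cases α
    · change evenDer h (superP1 U l 0) ∈ _
      rw [evenDer_superP1_zero]
      exact add_mem (Lin.incl_mul _ (sub_mem (Lin.shift_mem _ hr) hr))
        (Lin.incl_mul _ (sub_mem (Lin.shift_mem _ hR) hR))
    · change evenDer h (superP1 U l 1) ∈ _
      rw [evenDer_superP1_one]
      have h1 : incl U (hamField h 0) * s1 U l + sP U * evenC h l ∈ Lin U l :=
        add_mem (Lin.incl_mul _ hs) (Lin.incl_mul _ hC)
      have h2 : sP U * s1 U l ∈ Lin U l := Lin.incl_mul _ hs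
      exact add_mem (add_mem (Lin.incl_mul _ (sub_mem h2 (Lin.shift_mem _ h2)))
        (Lin.incl_mul _ (sub_mem h1 (Lin.shift_mem _ h1))))
        (add_mem (Lin.incl_mul _ (sub_mem (Lin.shift_mem _ hr) (Lin.shift_mem _ hr)))
        (Lin.incl_mul _ (sub_mem (Lin.shift_mem _ hR) (Lin.shift_mem _ hR))))
  · have e := hp (fun β => PowerSeries.C (ξ β)) α
    rw [map_sub, linEval_X_mul, X_mul_linEval_der1, sub_eq_zero]
    rw [← sub_eq_iff_eq_add] at e
    rw [← e]
    fin_cases α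
    · change linEval ξ (evenDer h (superP1 U l 0)) = evolve _ (jetP1 _ 0) - jetP1 _ 0 - jetP1 _ 0
      rw [evenDer_superP1_zero]
      simp only [map_add, map_sub, sP, linEval_incl_mul, linEval_shift,
        linEval_sr, linEval_evenR, jetP1_zero, evolve_mul, evolve_sub, evolve_P, evolve_Q,
        evolve_jetShift, jetShift_add, jetShift_sub]
      ring
    · change linEval ξ (evenDer h (superP1 U l 1)) = evolve _ (jetP1 _ 1) - jetP1 _ 1 - jetP1 _ 1
      rw [evenDer_superP1_one]
      simp only [map_add, map_sub, sP, sQ, linEval_incl_mul, linEval_shift, linEval_sig,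
        linEval_sr, linEval_evenR, linEval_evenC, jetP1_one, evolve_mul, evolve_sub, evolve_add,
        evolve_P, evolve_Q, evolve_jetShift, jetShift_add, jetShift_sub, mul_neg, jetShift_neg]
      ring

lemma partialSmooth_inv {f g : Smooth U} (hfg : f * g = 1) {i : Fin 2}
    (hf : partialSmooth U i f = 0) : partialSmooth U i g = 0 := by
  have h := congrArg (partialSmooth U i) hfg
  rw [partialSmooth_mul, hf, zero_mul, zero_add, partialSmooth_one] at h
  calc partialSmooth U i g = (f * g) * partialSmooth U i g := by rw [hfg, one_mul]
    _ = g * (f * partialSmooth U i g) := by ring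
    _ = 0 := by rw [h, mul_zero]

/-- When g depends on u^α alone, both cross terms equal g'(u^α)·X^α·(𝒫₁σ)^α up to order. This allows
division of the components by Q and by P, as needed for log Q and log P. -/
lemma evenDer_smooth_mul_superP1 {h : DiffPoly U} (hp : PreservesP1 (hamField h)) (l : ℤ)
    {g : Smooth U} {α : Fin 2} (hg : ∀ β, β ≠ α → partialSmooth U β g = 0) :
    evenDer h (incl U (ofSmooth g) * superP1 U l α) =
      der1 U l (PowerSeries.X * (ofSmooth g * hamField h α)) := by
  have e1 : evolve (hamField h) (ofSmooth g) = ofSmooth (partialSmooth U α g) * hamField h α := by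
    rw [evolve_ofSmooth]
    fin_cases α
    · rw [hg 1 (by decide), ofSmooth_zero, zero_mul, add_zero]; rfl
    · rw [hg 0 (by decide), ofSmooth_zero, zero_mul, zero_add]; rfl
  have e2 : aDer (superP1 U l) (ofSmooth g) =
      incl U (ofSmooth (partialSmooth U α g)) * superP1 U l α := by
    rw [(isADer_aDer _).smooth g, aDer_P, aDer_Q]
    fin_cases α
    · rw [hg 1 (by decide), ofSmooth_zero, map_zero, zero_mul, add_zero]; rfl
    · rw [hg 0 (by decide), ofSmooth_zero, map_zero, zero_mul, zero_add]; rfl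
  rw [evenDer_mul, evenDer_incl, evenDer_superP1 hp, e1, mul_X_left_comm, der1, ← X_mul_aDer,
    (isADer_aDer _).mul, mul_add, add_comm]
  congr 1
  rw [← mul_X_left_comm]
  have e3 := X_mul_der1 l (ofSmooth g)
  rw [der1] at e3
  rw [e3, e2, ← mul_assoc, ← map_mul, mul_comm (hamField h α)]

lemma evenDer_Qinv_superP1 {h : DiffPoly U} (hp : PreservesP1 (hamField h)) (l : ℤ) :
    evenDer h (incl U (ofSmooth (fQinv U)) * superP1 U l 1) =
      der1 U l (PowerSeries.X * (ofSmooth (fQinv U) * hamField h 1)) :=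
  evenDer_smooth_mul_superP1 hp l fun β hβ => by
    obtain rfl : β = 0 := by omega
    exact partialSmooth_inv fQ_mul_fQinv (by rw [partialSmooth_fQ]; rfl)

lemma evenDer_Pinv_superP1 {h : DiffPoly U} (hp : PreservesP1 (hamField h)) (l : ℤ) :
    evenDer h (incl U (ofSmooth (fPinv U)) * superP1 U l 0) =
      der1 U l (PowerSeries.X * (ofSmooth (fPinv U) * hamField h 0)) :=
  evenDer_smooth_mul_superP1 hp l fun β hβ => by
    obtain rfl : β = 1 := by omega
    exact partialSmooth_inv fP_mul_fPinv (by rw [partialSmooth_fP]; rfl)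

lemma Qinv_mul_sQ (z : SuperPoly U) : incl U (ofSmooth (fQinv U)) * (sQ U * z) = z := by
  rw [← mul_assoc, incl_comm _ (sQ U), sQ_mul_inv, one_mul]

lemma Pinv_mul_sP (z : SuperPoly U) : incl U (ofSmooth (fPinv U)) * (sP U * z) = z := by
  rw [← mul_assoc, incl_comm _ (sP U), sP_mul_inv, one_mul]

lemma Qinv_mul_superP1 (l : ℤ) : incl U (ofSmooth (fQinv U)) * superP1 U l 1 =
    (sP U * s1 U l + (superShift U 1 (sr U l) + sr U l)) -
      superShift U (-1) (sP U * s1 U l + (superShift U 1 (sr U l) + sr U l)) := by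
  rw [superP1_one, mul_add, Qinv_mul_sQ, Qinv_mul_sQ, superShift_add, superShift_add,
    superShift_neg_one_one]
  abel

lemma Pinv_mul_superP1 (l : ℤ) : incl U (ofSmooth (fPinv U)) * superP1 U l 0 =
    superShift U 1 (sr U l) - sr U l := by
  rw [superP1_zero, Pinv_mul_sP]

/-- On elements linear in the σ's the operator 1 - Λ⁻¹ is injective. Equations between differences
can therefore be integrated without a constant. -/
lemma Lin.eq_of_shift {l : ℤ} {x y : SuperPoly U} (hx : x ∈ Lin U l) (hy : y ∈ Lin U l)
    (h : x - superShift U (-1) x = y - superShift U (-1) y) : x = y := by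
  rw [← sub_eq_zero]
  refine Lin.eq_zero_of_shift (sub_mem hx hy) ?_
  have h1 : superShift U (-1) (x - y) = x - y := by
    rw [superShift_sub, ← sub_eq_zero]
    rw [← sub_eq_zero] at h
    rw [← neg_eq_zero, ← h]
    abel
  rw [← congrArg (superShift U 1) h1, superShift_one_neg_one]

section

variable {h : DiffPoly U}

lemma Lin.evenDer_sP_s1_mem (l : ℤ) : evenDer h (sP U * s1 U l) ∈ Lin U l := by
  rw [evenDer_mul, evenDer_sP, evenDer_s1]
  exact add_mem (Lin.incl_mul _ (Lin.sig_mem 0 l)) (Lin.incl_mul _ (Lin.evenC_mem h l))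

lemma Lin.evenDer_sr_mem (l : ℤ) : evenDer h (sr U l) ∈ Lin U l := by
  rw [AblowitzLadik.evenDer_sr]
  exact Lin.evenR_mem h l

/-- The difference of the two components of 𝒫₀σ_l is (1 - Λ) of Q(σ_{1,l} + σ_{2,l}). Apply D, use
`evenDer_superP0`, and cancel the difference operator. -/
lemma evenDer_of_flow_sub {f : DiffPoly U} (hf : PowerSeries.X * (hamField h 1 - hamField h 0) =
    jetShift U 1 f - f) (l : ℤ) : evenDer h (sQ U * s1 U l + sr U l) = der0 U l f := by
  have hm : evenDer h (sQ U * s1 U l + sr U l) ∈ Lin U l := by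
    rw [evenDer_sum]; exact Lin.der0_mem _ _
  have e := congrArg (evenDer h) (superP0_zero_eq (U := U) l)
  rw [map_add, evenDer_superP0, evenDer_superP0, map_sub, evenDer_shift, ← sub_eq_iff_eq_add',
    ← mul_sub, ← map_sub, der0, X_mul_aDer, ← neg_sub (hamField h 1), mul_neg, hf, map_neg,
    map_sub, aDer_jetShift, neg_sub] at e
  refine Lin.eq_of_shift hm (Lin.der0_mem _ _) ?_
  have e' := congrArg (superShift U (-1)) e
  rw [superShift_sub, superShift_sub, superShift_neg_one_one, superShift_neg_one_one] at e'
  rw [← neg_sub, ← e', neg_sub]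
  rfl

/-- In the same way, (𝒫₁σ)₁/Q - (𝒫₁σ)₀/P is (1 - Λ⁻¹) of Pσ_{1,l} + Qσ_{2,l}. With 𝒫₁ in place of 𝒫₀
the derivation is `der1`, which in ℬ accounts for the index l + 1 of the odd flow. -/
lemma evenDer_of_flow_log (hp : PreservesP1 (hamField h)) {g : DiffPoly U}
    (hg : PowerSeries.X * (ofSmooth (fQinv U) * hamField h 1 - ofSmooth (fPinv U) * hamField h 0) =
      g - jetShift U (-1) g) (l : ℤ) : evenDer h (sP U * s1 U l + sr U l) = der1 U l g := by
  refine Lin.eq_of_shift ?_ (Lin.der1_mem l g) ?_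
  · rw [map_add]
    exact add_mem (Lin.evenDer_sP_s1_mem l) (Lin.evenDer_sr_mem l)
  · have e1 : (sP U * s1 U l + sr U l) - superShift U (-1) (sP U * s1 U l + sr U l) =
        incl U (ofSmooth (fQinv U)) * superP1 U l 1 -
          incl U (ofSmooth (fPinv U)) * superP1 U l 0 := by
      rw [Qinv_mul_superP1, Pinv_mul_superP1]
      simp only [superShift_add, superShift_neg_one_one]
      abel
    rw [← evenDer_shift, ← map_sub, e1, map_sub, evenDer_Qinv_superP1 hp, evenDer_Pinv_superP1 hp,
      ← map_sub, ← mul_sub, hg, map_sub]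
    simp only [der1, aDer_jetShift]

/-- The argument applied to (𝒫₁σ)₁/Q alone. It computes D on the second relation without its term
σ_{1,l+1}. -/
lemma evenDer_sum_shift (hp : PreservesP1 (hamField h)) (l : ℤ) :
    evenDer h (sP U * s1 U l + (superShift U 1 (sr U l) + sr U l)) = -der1 U l (jetVar h 0) := by
  refine Lin.eq_of_shift ?_ (neg_mem (Lin.der1_mem l _)) ?_
  · rw [map_add, map_add, evenDer_shift]
    exact add_mem (Lin.evenDer_sP_s1_mem l)
      (add_mem (Lin.shift_mem _ (Lin.evenDer_sr_mem l)) (Lin.evenDer_sr_mem l))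
  · have e : PowerSeries.X * (ofSmooth (fQinv U) * hamField h 1) =
        jetShift U (-1) (jetVar h 0) - jetVar h 0 := by
      rw [mul_left_comm, X_mul_hamField, jetP0_one, ← mul_assoc, mul_comm (ofSmooth (fQinv U)),
        ofSmooth_Q_mul_inv, one_mul]
    rw [← evenDer_shift, ← map_sub, ← Qinv_mul_superP1, evenDer_Qinv_superP1 hp, e, map_sub,
      superShift_neg, der1, aDer_jetShift]
    abel

/-- D maps this relation to minus the difference of `der1` at l and `der0` at l + 1 on δh/δP. For
the first relation it is ε times such a difference on X₀. -/
lemma evenDer_rel2 (hp : PreservesP1 (hamField h)) (l : ℤ) : evenDer h (rel2 U l) ∈ relIdeal U := by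
  rw [rel2_eq_sr, add_assoc, map_add, evenDer_sum_shift hp, evenDer_s1, evenC, ← sub_eq_add_neg,
    ← neg_sub]
  exact (relIdeal U).neg_mem (der1_sub_mem l _)

lemma evenDer_rel1 (hp : PreservesP1 (hamField h)) (l : ℤ) : evenDer h (rel1 U l) ∈ relIdeal U := by
  rw [← superP1_zero_sub, map_sub, evenDer_superP1 hp, evenDer_superP0, ← mul_sub]
  exact (relIdeal U).mul_mem_left _ (der1_sub_mem l _)

lemma evenDer_mem_relIdeal (hp : PreservesP1 (hamField h)) :
    ∀ f ∈ relIdeal U, evenDer h f ∈ relIdeal U := fun _ hf =>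
  (isSDer_evenDer h).map_relIdeal (fun _ h => h) (evenDer_rel1 hp) (evenDer_rel2 hp) hf

end

/-! ## The even flows on `ℬ` -/

/-- The even flow of a Hamiltonian vector field that preserves the second Hamiltonian structure. -/
def evenFlow {h : DiffPoly U} (hp : PreservesP1 (hamField h)) : BRing U →+ BRing U :=
  descend (evenDer h) (evenDer_mem_relIdeal hp)

section

variable {h : DiffPoly U} (hp : PreservesP1 (hamField h))

lemma evenFlow_toB (f : SuperPoly U) : evenFlow hp (toB U f) = toB U (evenDer h f) := rfl

lemma isEvenFlow_evenFlow : IsEvenFlow (evenFlow hp) :=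
  (isSDer_evenDer h).isEvenFlow (evenDer_mem_relIdeal hp)

lemma evenFlow_incl (f : DiffPoly U) : evenFlow hp (toB U (incl U f)) =
    toB U (incl U (evolve (hamField h) f)) := by
  rw [evenFlow_toB, evenDer_incl]

lemma evenFlow_shiftB (m : ℤ) (x : BRing U) :
    evenFlow hp (shiftB U m x) = shiftB U m (evenFlow hp x) := by
  obtain ⟨f, rfl⟩ := toB_surjective x
  rw [shiftB_toB, evenFlow_toB, evenDer_shift]
  rfl

lemma parityB_evenFlow (x : BRing U) :
    evenFlow hp (parityB U x) = parityB U (evenFlow hp x) := by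
  refine (isEvenFlow_evenFlow hp).parityB_comm ?_ ?_ (fun α l => ?_) x
  · rw [sP, evenFlow_incl, parityB_incl]
  · rw [sQ, evenFlow_incl, parityB_incl]
  · rw [evenFlow_toB, parityB_toB, (hasPar_evenDer_sig h α l).parity, neg_one_smul, map_neg]

lemma oddFlow_incl (k : ℤ) (f : DiffPoly U) :
    oddFlow U k (toB U (incl U f)) = toB U (der0 U k f) := by
  refine epsB_cancel ?_
  rw [epsB_mul_toB, X_mul_der0, oddFlow_toB, (isSDer_oddDer k).incl parity_incl, epsB_mul_toB,
    ← aDer_X_mul]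
  congr 3
  funext α
  fin_cases α
  · exact X_mul_oddDer_sP k
  · exact X_mul_oddDer_sQ k

lemma toB_der1 (k : ℤ) (f : DiffPoly U) :
    toB U (der1 U k f) = oddFlow U (k + 1) (toB U (incl U f)) := by
  rw [oddFlow_incl]
  exact toB_eq.2 (der1_sub_mem k f)

lemma evenFlow_bc (l : ℤ) :
    evenFlow hp (bc U l) = oddFlow U l (toB U (incl U (jetVar h 0))) := by
  rw [oddFlow_incl, bc, evenFlow_toB, evenDer_s1, evenC]

lemma evenFlow_sum (l : ℤ) : evenFlow hp (bQ U * bc U l + br U l) =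
    oddFlow U l (toB U (incl U (ofSmooth (fQ U) * (jetVar h 0 + jetVar h 1)))) := by
  rw [oddFlow_incl, bc, bQ, br, ← map_mul, ← map_add, evenFlow_toB, evenDer_sum]

lemma evenFlow_of_flow_sub {f : DiffPoly U} (hf : PowerSeries.X * (hamField h 1 - hamField h 0) =
    jetShift U 1 f - f) (l : ℤ) :
    evenFlow hp (bQ U * bc U l + br U l) = oddFlow U l (toB U (incl U f)) := by
  rw [oddFlow_incl, bc, bQ, br, ← map_mul, ← map_add, evenFlow_toB, evenDer_of_flow_sub hf]

lemma evenFlow_of_flow_log {g : DiffPoly U} (hg : PowerSeries.X *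
    (ofSmooth (fQinv U) * hamField h 1 - ofSmooth (fPinv U) * hamField h 0) =
      g - jetShift U (-1) g) (l : ℤ) :
    evenFlow hp (bP U * bc U l + br U l) = oddFlow U (l + 1) (toB U (incl U g)) := by
  rw [bc, bP, br, ← map_mul, ← map_add, evenFlow_toB, evenDer_of_flow_log hp hg, toB_der1]

end

/-! ## The even flows commute with the odd flows -/

section

variable {h : DiffPoly U} (hp : PreservesP1 (hamField h))

/-- The commutator of an even and an odd flow. -/
def mixedFlow (k : ℤ) : BRing U →+ BRing U :=
  (evenFlow hp).comp (oddFlow U k) - (oddFlow U k).comp (evenFlow hp)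

lemma mixedFlow_apply (k : ℤ) (x : BRing U) :
    mixedFlow hp k x = evenFlow hp (oddFlow U k x) - oddFlow U k (evenFlow hp x) := rfl

lemma evenFlow_genB (i : Fin 2) :
    evenFlow hp (genB U i) = toB U (incl U (hamField h i)) := by
  fin_cases i
  · exact (evenFlow_incl hp _).trans (by rw [evolve_P]; rfl)
  · exact (evenFlow_incl hp _).trans (by rw [evolve_Q]; rfl)

lemma isOddFlow_mixedFlow (k : ℤ) : IsOddFlow (mixedFlow hp k) :=
  (isEvenFlow_evenFlow hp).comm_odd (isOddFlow_oddFlow k) (parityB_evenFlow hp) fun i j => by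
    rw [evenFlow_genB, inclB_comm]

lemma epsB_mul_oddFlow_genB (k : ℤ) (i : Fin 2) :
    epsB U * oddFlow U k (genB U i) = toB U (superP0 U k i) := by
  fin_cases i
  · exact (epsB_mul_oddFlow k (sP U)).trans (by rw [oddE, X_mul_oddDer_sP]; rfl)
  · exact (epsB_mul_oddFlow k (sQ U)).trans (by rw [oddE, X_mul_oddDer_sQ]; rfl)

lemma mixedFlow_genB (k : ℤ) (i : Fin 2) : mixedFlow hp k (genB U i) = 0 := by
  refine epsB_cancel ?_
  rw [mixedFlow_apply, mul_sub, ← (isEvenFlow_evenFlow hp).epsB_mul, epsB_mul_oddFlow_genB,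
    evenFlow_toB, evenDer_superP0, evenFlow_genB, oddFlow_incl, ← epsB_mul_toB, sub_self, mul_zero]

lemma mixedFlow_shiftB (k m : ℤ) (x : BRing U) :
    mixedFlow hp k (shiftB U m x) = shiftB U m (mixedFlow hp k x) := by
  simp only [mixedFlow_apply, oddFlow_shiftB, evenFlow_shiftB, map_sub]

lemma mixedFlow_mul_genB (k : ℤ) (i : Fin 2) (x : BRing U) :
    mixedFlow hp k (genB U i * x) = genB U i * mixedFlow hp k x := by
  rw [(isOddFlow_mixedFlow hp k).leibniz_parityB, mixedFlow_genB, zero_mul, zero_add]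
  congr 1
  fin_cases i
  · exact parityB_bP
  · exact parityB_bQ

/-- If the even flow of x_l is the τ_l-derivative of one f for all l, anticommutativity of the odd
flows carries the antisymmetry of ∂x_l/∂τ_k over to the commutators. -/
lemma mixedFlow_anti {x : ℤ → BRing U} (hx : OddAnti x) {f : DiffPoly U}
    (hf : ∀ l, evenFlow hp (x l) = oddFlow U l (toB U (incl U f))) (k l : ℤ) :
    mixedFlow hp k (x l) = -mixedFlow hp l (x k) := by
  rw [mixedFlow_apply, mixedFlow_apply, hx, hf, hf, oddFlow_anticomm k l, map_neg]
  abel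

lemma mixedFlow_bc_anti (k l : ℤ) : mixedFlow hp k (bc U l) = -mixedFlow hp l (bc U k) :=
  mixedFlow_anti hp oddAnti_bc (evenFlow_bc hp) k l

lemma mixedFlow_br_anti (k l : ℤ) : mixedFlow hp k (br U l) = -mixedFlow hp l (br U k) := by
  have h1 := mixedFlow_anti hp oddAnti_sum (evenFlow_sum hp) k l
  have e : ∀ k l, mixedFlow hp k (bQ U * bc U l) = bQ U * mixedFlow hp k (bc U l) :=
    fun k l => mixedFlow_mul_genB hp k 1 _
  rw [map_add, map_add, e, e, mixedFlow_bc_anti hp k l, mul_neg, neg_add] at h1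
  exact add_left_cancel h1

lemma mixedFlow_bc_succ (k l : ℤ) : mixedFlow hp k (bc U (l + 1)) =
    -(mixedFlow hp k (br U l) + shiftB U 1 (mixedFlow hp k (br U l))) -
      bP U * mixedFlow hp k (bc U l) := by
  have e : mixedFlow hp k (bP U * bc U l) = bP U * mixedFlow hp k (bc U l) :=
    mixedFlow_mul_genB hp k 0 _
  rw [← e, ← mixedFlow_shiftB, ← map_add, ← map_neg, ← bc_rel2, map_add, add_sub_cancel_right]

/-- The second relation and antisymmetry in both σ₁ and Qσ₂ show that raising l has the same effect
as raising k. So the commutator depends on k + l only, and being antisymmetric it is zero. -/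
lemma mixedFlow_bc (k l : ℤ) : mixedFlow hp k (bc U l) = 0 := by
  have h1 : ∀ k l, mixedFlow hp k (bc U (l + 1)) = mixedFlow hp (k + 1) (bc U l) := by
    intro k l
    rw [mixedFlow_bc_anti hp (k + 1) l, mixedFlow_bc_succ, mixedFlow_bc_succ,
      mixedFlow_bc_anti hp k l, mixedFlow_br_anti hp k l, map_neg]
    noncomm_ring
  have h2 := int_const (f := fun j => mixedFlow hp j (bc U (k + l - j))) fun j => by
    rw [← h1]
    congr 2
    ring
  refine eq_zero_of_add_self ?_
  have h3 := (h2 k).trans (h2 l).symm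
  rw [add_sub_cancel_left, add_sub_cancel_right] at h3
  nth_rewrite 1 [h3]
  rw [mixedFlow_bc_anti hp k l, add_neg_cancel]

lemma mixedFlow_br (k l : ℤ) : mixedFlow hp k (br U l) = 0 := by
  refine eq_zero_of_shiftB_add ?_
  have h1 := mixedFlow_bc_succ hp k l
  rw [mixedFlow_bc, mixedFlow_bc, mul_zero, sub_zero, eq_comm, neg_eq_zero, add_comm] at h1
  exact h1

lemma IsOddFlow.sig_eq_zero {D : BRing U →+ BRing U} (hD : IsOddFlow D) (hQ : D (bQ U) = 0)
    (hr : ∀ k, D (br U k) = 0) (k : ℤ) : D (toB U (s2 U k)) = 0 := by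
  have h := hr k
  rw [br_eq, hD.leibniz_parityB, hQ, zero_mul, zero_add, parityB_bQ] at h
  exact bQ_cancel h

lemma IsEvenFlow.sig_eq_zero {D : BRing U →+ BRing U} (hD : IsEvenFlow D) (hQ : D (bQ U) = 0)
    (hr : ∀ k, D (br U k) = 0) (k : ℤ) : D (toB U (s2 U k)) = 0 := by
  have h := hr k
  rw [br_eq, hD.leibniz, hQ, zero_mul, zero_add] at h
  exact bQ_cancel h

/-- The even flows commute with the odd flows. -/
lemma evenFlow_oddFlow_comm (k : ℤ) (x : BRing U) :
    evenFlow hp (oddFlow U k x) = oddFlow U k (evenFlow hp x) := by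
  have hQ : mixedFlow hp k (bQ U) = 0 := mixedFlow_genB hp k 1
  have h1 : mixedFlow hp k = 0 := by
    refine (isOddFlow_mixedFlow hp k).ext isOddFlow_zero (mixedFlow_genB hp k 0) hQ (fun α m => ?_)
    fin_cases α
    · exact mixedFlow_bc hp k m
    · exact (isOddFlow_mixedFlow hp k).sig_eq_zero hQ (mixedFlow_br hp k) m
  have h2 := DFunLike.congr_fun h1 x
  exact sub_eq_zero.1 h2

end

/-! ## The even flows commute -/

/-- Even flows commute if they commute on the gradients of the Hamiltonians. -/
lemma evenFlow_comm {h h' : DiffPoly U} (hp : PreservesP1 (hamField h))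
    (hp' : PreservesP1 (hamField h'))
    (hu : ∀ α, evolve (hamField h) (hamField h' α) = evolve (hamField h') (hamField h α))
    (h0 : evolve (hamField h) (jetVar h' 0) = evolve (hamField h') (jetVar h 0))
    (h1 : evolve (hamField h) (ofSmooth (fQ U) * (jetVar h' 0 + jetVar h' 1)) =
      evolve (hamField h') (ofSmooth (fQ U) * (jetVar h 0 + jetVar h 1))) (x : BRing U) :
    evenFlow hp (evenFlow hp' x) = evenFlow hp' (evenFlow hp x) := by
  have hD : IsEvenFlow ((evenFlow hp).comp (evenFlow hp') - (evenFlow hp').comp (evenFlow hp)) :=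
    (isEvenFlow_evenFlow hp).comm (isEvenFlow_evenFlow hp') fun i j => by
      rw [evenFlow_genB, inclB_comm]
  have e : ∀ x, ((evenFlow hp).comp (evenFlow hp') - (evenFlow hp').comp (evenFlow hp)) x =
      evenFlow hp (evenFlow hp' x) - evenFlow hp' (evenFlow hp x) := fun _ => rfl
  have hg : ∀ i, ((evenFlow hp).comp (evenFlow hp') - (evenFlow hp').comp (evenFlow hp))
      (genB U i) = 0 := fun i => by
    rw [e, evenFlow_genB, evenFlow_genB, evenFlow_incl, evenFlow_incl, hu, sub_self]
  have hQ := hg 1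
  -- On σ_{1,l} the even flow is the τ_l-derivative of δh/δP. As even and odd flows commute, the
  -- commutator is the τ_l-derivative of the commutator on the gradients.
  have hc : ∀ l, ((evenFlow hp).comp (evenFlow hp') - (evenFlow hp').comp (evenFlow hp))
      (bc U l) = 0 := fun l => by
    rw [e, evenFlow_bc, evenFlow_bc, evenFlow_oddFlow_comm, evenFlow_oddFlow_comm, evenFlow_incl,
      evenFlow_incl, h0, sub_self]
  have hr : ∀ l, ((evenFlow hp).comp (evenFlow hp') - (evenFlow hp').comp (evenFlow hp))
      (br U l) = 0 := fun l => by
    have h2 : ((evenFlow hp).comp (evenFlow hp') - (evenFlow hp').comp (evenFlow hp))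
        (bQ U * bc U l + br U l) = 0 := by
      rw [e, evenFlow_sum, evenFlow_sum, evenFlow_oddFlow_comm, evenFlow_oddFlow_comm,
        evenFlow_incl, evenFlow_incl, h1, sub_self]
    rw [map_add, hD.leibniz, hc, mul_zero, add_zero] at h2
    have hQ' : ((evenFlow hp).comp (evenFlow hp') - (evenFlow hp').comp (evenFlow hp))
      (bQ U) = 0 := hQ
    rwa [hQ', zero_mul, zero_add] at h2
  have h2 : (evenFlow hp).comp (evenFlow hp') - (evenFlow hp').comp (evenFlow hp) = 0 := by
    refine hD.ext isEvenFlow_zero (hg 0) hQ (fun α m => ?_)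
    fin_cases α
    · exact hc m
    · exact hD.sig_eq_zero hQ hr m
  exact sub_eq_zero.1 (DFunLike.congr_fun h2 x)

/-! ## Variational derivatives of super differential polynomials -/

lemma superPartial_tmul (i : Fin 2) (s : ℕ) (f : Jet U) (g : Grass) :
    superPartial U i s (f ⊗ₜ g) = jetPartial U i s f ⊗ₜ g := by
  rw [superPartial, LinearMap.rTensor_tmul]

lemma exists_superPartial_eq_zero (i : Fin 2) (w : Super U) :
    ∃ N : ℕ, ∀ s, N ≤ s → superPartial U i s w = 0 := by
  induction w using TensorProduct.induction_on with
  | zero => exact ⟨0, fun s _ => map_zero _⟩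
  | add x y hx hy =>
    obtain ⟨N, hN⟩ := hx
    obtain ⟨N', hN'⟩ := hy
    exact ⟨max N N', fun s hs => by
      rw [map_add, hN s ((le_max_left _ _).trans hs), hN' s ((le_max_right _ _).trans hs),
        add_zero]⟩
  | tmul f g =>
    obtain ⟨N, hN⟩ := exists_jetPartial_eq_zero f
    exact ⟨N, fun s hs => by rw [superPartial_tmul, hN s hs, TensorProduct.zero_tmul]⟩

lemma varDeriv_eq_sum (i : Fin 2) (w : Super U) : ∃ N : ℕ, ∀ K, N ≤ K →
    varDeriv (superDx U) (superPartial U i) w = ∑ s ∈ Finset.range K,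
      (-1 : ℝ) ^ s • (superDx U ^ s) (superPartial U i s w) := by
  obtain ⟨N, hN⟩ := exists_superPartial_eq_zero i w
  refine ⟨N, fun K hK => finsum_eq_sum_of_support_subset _ fun s hs => ?_⟩
  by_contra h
  refine hs ?_
  have h' : ¬ s < K := fun h' => h (by simpa using h')
  change (-1 : ℝ) ^ s • (superDx U ^ s) (superPartial U i s w) = 0
  rw [hN s (by omega), map_zero, smul_zero]

/-- The variational derivative of the coefficients. -/
def varHom (i : Fin 2) : Super U →ₗ[ℝ] Super U where
  toFun := varDeriv (superDx U) (superPartial U i)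
  map_add' x y := by
    obtain ⟨N, hN⟩ := varDeriv_eq_sum i x
    obtain ⟨N', hN'⟩ := varDeriv_eq_sum i y
    obtain ⟨N'', hN''⟩ := varDeriv_eq_sum i (x + y)
    rw [hN (max N (max N' N'')) (by simp), hN' (max N (max N' N'')) (by simp),
      hN'' (max N (max N' N'')) (by simp), ← Finset.sum_add_distrib]
    exact Finset.sum_congr rfl fun s _ => by rw [map_add, map_add, smul_add]
  map_smul' c x := by
    obtain ⟨N, hN⟩ := varDeriv_eq_sum i x
    obtain ⟨N', hN'⟩ := varDeriv_eq_sum i (c • x)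
    rw [hN (max N N') (by simp), hN' (max N N') (by simp), RingHom.id_apply, Finset.smul_sum]
    exact Finset.sum_congr rfl fun s _ => by rw [map_smul, map_smul, smul_comm]

lemma superVar_eq (i : Fin 2) (f : SuperPoly U) : superVar U i f = epsMap (varHom i) f := rfl

lemma varHom_tmul (i : Fin 2) (f : Jet U) (g : Grass) :
    varHom i (f ⊗ₜ[ℝ] g) = adHom i (superDx U) f (inclG U g) := by
  obtain ⟨N, hN⟩ := adHom_eq_sum (M := Super U) f
  obtain ⟨N', hN'⟩ := varDeriv_eq_sum i (f ⊗ₜ[ℝ] g)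
  rw [hN (max N N') (by simp)]
  refine (hN' (max N N') (by simp)).trans (Finset.sum_congr rfl fun s _ => ?_)
  rw [superPartial_tmul, inclG_apply, TensorProduct.smul_tmul', smul_eq_mul, mul_one]

/-- The elements of `SuperPoly U` whose coefficients do not depend on `P`, `Q`. -/
def IsGrass (z : SuperPoly U) : Prop := ∀ n, PowerSeries.coeff n z ∈ (inclG U).range

namespace IsGrass

variable {x y : SuperPoly U}

lemma sig (α : Fin 2) (k : ℤ) : IsGrass (sig U α k) := fun n => by
  rw [AblowitzLadik.sig, PowerSeries.coeff_C]
  split_ifs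
  · exact ⟨_, rfl⟩
  · exact zero_mem _

lemma add (hx : IsGrass x) (hy : IsGrass y) : IsGrass (x + y) := fun n => by
  rw [map_add]; exact add_mem (hx n) (hy n)

lemma sub (hx : IsGrass x) (hy : IsGrass y) : IsGrass (x - y) := fun n => by
  rw [map_sub]
  have h : ∀ a b : Super U, a ∈ (inclG U).range → b ∈ (inclG U).range → a - b ∈ (inclG U).range :=
    fun a b ha hb => by
      obtain ⟨g, rfl⟩ := ha
      obtain ⟨g', rfl⟩ := hb
      exact ⟨g - g', map_sub _ _ _⟩
  exact h _ _ (hx n) (hy n)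

lemma mul (hx : IsGrass x) (hy : IsGrass y) : IsGrass (x * y) := fun n => by
  rw [PowerSeries.coeff_mul]
  exact sum_mem fun p _ => mul_mem (hx _) (hy _)

lemma shift (m : ℤ) (hx : IsGrass x) : IsGrass (superShift U m x) := fun n => by
  have h : ∀ s : ℕ, ∀ w ∈ (inclG U).range, (superDx U ^ s) w ∈ (inclG U).range := by
    intro s w hw
    induction s with
    | zero => exact hw
    | succ s ih =>
      rw [pow_succ', Module.End.mul_apply]
      obtain ⟨g, hg⟩ := ih
      exact ⟨grassDx g, by rw [← hg]; exact (superDx_inclG g).symm⟩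
  rw [superShift, AblowitzLadik.shift, PowerSeries.coeff_mk]
  exact sum_mem fun p _ => Subalgebra.smul_mem _ (h _ _ (hx _)) _

end IsGrass

lemma superVar_add (i : Fin 2) (f g : SuperPoly U) :
    superVar U i (f + g) = superVar U i f + superVar U i g := by
  rw [superVar_eq, map_add]; rfl

lemma superVar_sub (i : Fin 2) (f g : SuperPoly U) :
    superVar U i (f - g) = superVar U i f - superVar U i g := by
  rw [superVar_eq, map_sub]; rfl

lemma superVar_smul (i : Fin 2) (c : ℝ) (f : SuperPoly U) :
    superVar U i (c • f) = c • superVar U i f :=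
  epsMap_smul (varHom i) c f

/-- The factor z contains no P or Q, so only f is varied and z passes into the argument of the
adjoint. -/
lemma superVar_incl_mul (i : Fin 2) (f : DiffPoly U) {z : SuperPoly U} (hz : IsGrass z) :
    superVar U i (incl U f * z) = adSeries i (superDx U) f z := by
  ext1 n
  rw [superVar_eq, coeff_epsMap, PowerSeries.coeff_mul, map_sum, adSeries, coeff_conv]
  refine Finset.sum_congr rfl fun p _ => ?_
  obtain ⟨g, hg⟩ := hz p.2
  have e : PowerSeries.coeff p.1 (incl U f) = PowerSeries.coeff p.1 f ⊗ₜ[ℝ] (1 : Grass) :=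
    PowerSeries.coeff_map _ _ _
  rw [e, ← hg]
  change varHom i ((_ ⊗ₜ[ℝ] (1 : Grass)) * (1 ⊗ₜ[ℝ] g)) = adHom i (superDx U) _ (inclG U g)
  rw [Algebra.TensorProduct.tmul_mul_tmul, mul_one, one_mul, varHom_tmul]

lemma adSeries_super_P (i : Fin 2) (z : SuperPoly U) :
    adSeries i (superDx U) (ofSmooth (fP U)) z = if i = 0 then z else 0 := by
  rw [adSeries_ofSmooth, seriesMap_super, partialSmooth_fP]
  split_ifs <;> simp [ofSmooth_one, ofSmooth_zero]

lemma adSeries_super_Q (i : Fin 2) (z : SuperPoly U) :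
    adSeries i (superDx U) (ofSmooth (fQ U)) z = if i = 1 then z else 0 := by
  rw [adSeries_ofSmooth, seriesMap_super, partialSmooth_fQ]
  split_ifs <;> simp_all [ofSmooth_one, ofSmooth_zero]

lemma adSeries_super_shift (i : Fin 2) (m : ℤ) (f : DiffPoly U) (z : SuperPoly U) :
    adSeries i (superDx U) (jetShift U m f) z = adSeries i (superDx U) f (superShift U (-m) z) :=
  adSeries_shift i isDxModule_superDx m f z

lemma adSeries_super_mul (i : Fin 2) (f g : DiffPoly U) (z : SuperPoly U) :
    adSeries i (superDx U) (f * g) z = adSeries i (superDx U) f (incl U g * z) +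
      adSeries i (superDx U) g (incl U f * z) := adSeries_mul i _ f g z

lemma mul_incl_mul (x y : SuperPoly U) (f : DiffPoly U) :
    x * (incl U f * y) = incl U f * (x * y) := by
  rw [← mul_assoc, ← incl_comm, mul_assoc]

lemma mul_incl_incl_mul (x y : SuperPoly U) (f g : DiffPoly U) :
    x * (incl U f * (incl U g * y)) = incl U (f * g) * (x * y) := by
  rw [← mul_assoc (incl U f), ← map_mul, mul_incl_mul]

lemma densityI0_eq : densityI0 U = (1 / 2 : ℝ) • (incl U (ofSmooth (fQ U)) *
      (s1 U 0 * superShift U (-1) (s1 U 0) + s1 U 0 * s2 U 0 +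
        (s2 U 0 * superShift U (-1) (s1 U 0) - s2 U 0 * s1 U 0)) -
    incl U (jetShift U 1 (ofSmooth (fQ U))) *
      (s1 U 0 * superShift U 1 (s1 U 0) + s1 U 0 * superShift U 1 (s2 U 0))) := by
  rw [densityI0, Fin.sum_univ_two, superP0_zero, superP0_one, sw, sr]
  congr 1
  simp only [superShift_mul, sQ, ← incl_jetShift, mul_add, mul_sub, mul_incl_mul]
  abel

lemma densityI1_eq : densityI1 U = (1 / 2 : ℝ) •
    (incl U (ofSmooth (fP U) * jetShift U 1 (ofSmooth (fQ U))) * (s1 U 0 * superShift U 1 (s2 U 0)) -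
      incl U (ofSmooth (fP U) * ofSmooth (fQ U)) * (s1 U 0 * s2 U 0) +
      (incl U (ofSmooth (fQ U) * ofSmooth (fP U)) * (s2 U 0 * s1 U 0) -
      incl U (ofSmooth (fQ U) * jetShift U (-1) (ofSmooth (fP U))) *
        (s2 U 0 * superShift U (-1) (s1 U 0)) +
      (incl U (ofSmooth (fQ U) * jetShift U 1 (ofSmooth (fQ U))) *
        (s2 U 0 * superShift U 1 (s2 U 0)) -
      incl U (ofSmooth (fQ U) * jetShift U (-1) (ofSmooth (fQ U))) *
        (s2 U 0 * superShift U (-1) (s2 U 0))))) := by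
  rw [densityI1, Fin.sum_univ_two, superP1_zero, superP1_one, sr]
  congr 1
  simp only [superShift_mul, sQ, sP, ← incl_jetShift, mul_add, mul_sub, mul_incl_incl_mul]

lemma half_smul_add_self (z : SuperPoly U) : (1 / 2 : ℝ) • (z + z) = z := by
  rw [← two_smul ℝ z, smul_smul]
  norm_num

lemma isGrass_s1 (k : ℤ) : IsGrass (s1 U k) := IsGrass.sig 0 k

lemma isGrass_s2 (k : ℤ) : IsGrass (s2 U k) := IsGrass.sig 1 k

/-- After a shift is moved off Q, every term occurs twice by anticommutativity, which cancels the
factor 1/2. Nothing depends on P, whence zero for i = 0. -/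
lemma superVar_I0 (i : Fin 2) : superVar U i (densityI0 U) = if i = 1 then
    s1 U 0 * superShift U (-1) (s1 U 0) + s1 U 0 * s2 U 0 + s2 U 0 * superShift U (-1) (s1 U 0)
    else 0 := by
  have h1 := isGrass_s1 (U := U) 0
  have h2 := isGrass_s2 (U := U) 0
  have a1 : superShift U (-1) (s1 U 0) * s1 U 0 = -(s1 U 0 * superShift U (-1) (s1 U 0)) :=
    (IsOdd.sig 0 0).anti _ ((IsOdd.sig 0 0).shift (-1)).par
  have a2 : s2 U 0 * s1 U 0 = -(s1 U 0 * s2 U 0) := (IsOdd.sig 0 0).anti _ (IsOdd.sig 1 0).par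
  have a3 : superShift U (-1) (s1 U 0) * s2 U 0 = -(s2 U 0 * superShift U (-1) (s1 U 0)) :=
    (IsOdd.sig 1 0).anti _ ((IsOdd.sig 0 0).shift (-1)).par
  rw [densityI0_eq, superVar_smul, superVar_sub, superVar_incl_mul, superVar_incl_mul,
    adSeries_super_shift, adSeries_super_Q, adSeries_super_Q]
  · split_ifs
    · rw [← half_smul_add_self (s1 U 0 * superShift U (-1) (s1 U 0) + s1 U 0 * s2 U 0 +
        s2 U 0 * superShift U (-1) (s1 U 0)), superShift_add, superShift_mul, superShift_mul,
        superShift_neg_one_one, superShift_neg_one_one, a1, a2, a3]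
      congr 1
      abel
    · rw [sub_zero, smul_zero]
  · exact (h1.mul (h1.shift _)).add (h1.mul (h2.shift _))
  · exact ((h1.mul (h1.shift _)).add (h1.mul h2)).add ((h2.mul (h1.shift _)).sub (h2.mul h1))

lemma superVar_I1_zero : superVar U 0 (densityI1 U) =
    s1 U 0 * (superShift U 1 (sr U 0) - sr U 0) := by
  have h1 := isGrass_s1 (U := U) 0
  have h2 := isGrass_s2 (U := U) 0
  have a1 : s2 U 0 * s1 U 0 = -(s1 U 0 * s2 U 0) := (IsOdd.sig 0 0).anti _ (IsOdd.sig 1 0).par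
  have a2 : superShift U 1 (s2 U 0) * s1 U 0 = -(s1 U 0 * superShift U 1 (s2 U 0)) :=
    (IsOdd.sig 0 0).anti _ ((IsOdd.sig 1 0).shift 1).par
  rw [densityI1_eq, superVar_smul, superVar_add, superVar_sub, superVar_add, superVar_sub,
    superVar_sub, superVar_incl_mul, superVar_incl_mul, superVar_incl_mul, superVar_incl_mul,
    superVar_incl_mul, superVar_incl_mul]
  · simp only [adSeries_super_mul, adSeries_super_shift, adSeries_super_Q, adSeries_super_P,
      if_true, Fin.isValue, zero_ne_one, if_false, add_zero, zero_add, neg_neg, sub_zero]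
    rw [← half_smul_add_self (s1 U 0 * (superShift U 1 (sr U 0) - sr U 0)), superShift_mul,
      superShift_mul, superShift_one_neg_one, ← incl_jetShift, a1, a2, mul_sub, sr, superShift_mul,
      sQ, ← incl_jetShift, mul_incl_mul, mul_incl_mul, mul_neg, mul_neg]
    congr 1
    abel
  · exact h2.mul (h2.shift _)
  · exact h2.mul (h2.shift _)
  · exact h2.mul (h1.shift _)
  · exact h2.mul h1
  · exact h1.mul h2
  · exact h1.mul (h2.shift _)

lemma superVar_I1_one : superVar U 1 (densityI1 U) =
    -((sP U * s1 U 0 - superShift U (-1) (sP U * s1 U 0) +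
      (superShift U 1 (sr U 0) - superShift U (-1) (sr U 0))) * s2 U 0) := by
  have h1 := isGrass_s1 (U := U) 0
  have h2 := isGrass_s2 (U := U) 0
  have a1 : s2 U 0 * s1 U 0 = -(s1 U 0 * s2 U 0) := (IsOdd.sig 0 0).anti _ (IsOdd.sig 1 0).par
  have a2 : s2 U 0 * superShift U (-1) (s1 U 0) = -(superShift U (-1) (s1 U 0) * s2 U 0) :=
    ((IsOdd.sig 0 0).shift (-1)).anti _ (IsOdd.sig 1 0).par
  have a3 : s2 U 0 * superShift U 1 (s2 U 0) = -(superShift U 1 (s2 U 0) * s2 U 0) :=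
    ((IsOdd.sig 1 0).shift 1).anti _ (IsOdd.sig 1 0).par
  have a4 : s2 U 0 * superShift U (-1) (s2 U 0) = -(superShift U (-1) (s2 U 0) * s2 U 0) :=
    ((IsOdd.sig 1 0).shift (-1)).anti _ (IsOdd.sig 1 0).par
  rw [densityI1_eq, superVar_smul, superVar_add, superVar_sub, superVar_add, superVar_sub,
    superVar_sub, superVar_incl_mul, superVar_incl_mul, superVar_incl_mul, superVar_incl_mul,
    superVar_incl_mul, superVar_incl_mul]
  · simp only [adSeries_super_mul, adSeries_super_shift, adSeries_super_Q, adSeries_super_P,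
      if_true, Fin.isValue, one_ne_zero, if_false, add_zero, zero_add, neg_neg]
    rw [← half_smul_add_self (-((sP U * s1 U 0 - superShift U (-1) (sP U * s1 U 0) +
      (superShift U 1 (sr U 0) - superShift U (-1) (sr U 0))) * s2 U 0))]
    simp only [superShift_mul, superShift_neg_one_one, superShift_one_neg_one, ← incl_jetShift, sr,
      sQ, sP, add_mul, sub_mul, mul_assoc, a1, a2, a3, a4, mul_neg,
      superShift_neg]
    congr 1
    abel
  · exact h2.mul (h2.shift _)
  · exact h2.mul (h2.shift _)
  · exact h2.mul (h1.shift _)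
  · exact h2.mul h1
  · exact h1.mul h2
  · exact h1.mul (h2.shift _)

/-! ## The super extension -/

lemma toB_superP1 (k : ℤ) (α : Fin 2) : toB U (superP1 U (k - 1) α) = toB U (superP0 U k α) := by
  have h := superP1_sub_mem (U := U) (k - 1) α
  rw [sub_add_cancel] at h
  exact toB_eq.2 h

lemma bQ_left_cancel {x y : BRing U} (h : bQ U * x = bQ U * y) : x = y := by
  rw [← sub_eq_zero]
  refine bQ_cancel ?_
  rw [mul_sub, h, sub_self]

lemma bQ_sub_bP_cancel {x : BRing U} (h : (bQ U - bP U) * x = 0) : x = 0 := by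
  have e : toB U (incl U (ofSmooth (fQPinv U))) * (bQ U - bP U) = 1 := by
    rw [bQ, bP, sQ, sP, ← map_sub, ← map_sub, ← map_mul, ← map_mul, mul_comm, ← ofSmooth_sub,
      ← ofSmooth_mul, fQP_mul_fQPinv, ofSmooth_one, map_one, map_one]
  rw [← one_mul x, ← e, mul_assoc, h, mul_zero]

lemma epsB_oddFlow_s2 (k l : ℤ) : epsB U * oddFlow U k (toB U (s2 U l)) =
    -(oconv (fun j => shiftB U (-1) (bc U j)) (bc U) k (l + 1)) -
      (shiftB U (-1) (bc U k) - bc U k) * toB U (s2 U l) := by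
  refine bQ_left_cancel ?_
  have h := epsB_oddFlow_br (U := U) k l
  rw [br_eq, (isOddFlow_oddFlow k).leibniz_parityB, parityB_bQ, mul_add, ← mul_assoc (epsB U),
    epsB_oddFlow_bQ, ← mul_assoc (epsB U), epsB_comm, mul_assoc (bQ U) (epsB U)] at h
  rw [mul_sub, mul_neg, ← h]
  noncomm_ring

lemma oconv_succ {R : Type} [Ring R] (x y : ℤ → R) (k : ℤ) : oconv x y k (k + 1) = x k * y k := by
  rw [oconv, osum_succ, osum_self, zero_add]
  congr 2
  ring

lemma epsB_oddFlow_theta_zero (α : Fin 2) : epsB U * oddFlow U 0 (toB U (sig U α 0)) =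
    toB U (superVar U α (densityI0 U)) := by
  rw [superVar_I0]
  fin_cases α
  · refine (epsB_oddFlow_bc 0 0).trans ?_
    rw [oconv_self]
    exact (map_zero _).symm
  · refine (epsB_oddFlow_s2 0 0).trans ?_
    have a : toB U (s2 U 0) * shiftB U (-1) (bc U 0) = -(shiftB U (-1) (bc U 0) * toB U (s2 U 0)) :=
      (IsOdd.sig 1 0).toB_anti ((IsOdd.sig 0 0).shift (-1))
    change _ = toB U (s1 U 0 * superShift U (-1) (s1 U 0) + s1 U 0 * s2 U 0 +
      s2 U 0 * superShift U (-1) (s1 U 0))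
    rw [map_add, map_add, map_mul, map_mul, map_mul, oconv_succ]
    change _ = bc U 0 * shiftB U (-1) (bc U 0) + bc U 0 * toB U (s2 U 0) +
      toB U (s2 U 0) * shiftB U (-1) (bc U 0)
    rw [a, shiftB_bc_anti_left]
    noncomm_ring

lemma epsB_oddFlow_theta_one (α : Fin 2) : epsB U * oddFlow U 1 (toB U (sig U α 0)) =
    toB U (superVar U α (densityI1 U)) := by
  fin_cases α
  · refine (epsB_oddFlow_bc 1 0).trans ?_
    change _ = toB U (superVar U 0 (densityI1 U))
    have e := oconv_succ (bc U) (bw U) 0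
    rw [zero_add] at e
    rw [oconv_swap, e, superVar_I1_zero, map_mul, ← mul_neg]
    change _ = bc U 0 * _
    rw [bw, ← map_neg, sw, neg_sub]
  · refine (epsB_oddFlow_s2 1 0).trans ?_
    change _ = toB U (superVar U 1 (densityI1 U))
    rw [superVar_I1_one, map_neg, map_mul, zero_add, oconv_self, neg_zero, zero_sub]
    congr 2
    refine bQ_left_cancel ?_
    -- The term Q(Λ⁻¹ - 1)σ_{1,1} is the Q component of 𝒫₀σ₁ = 𝒫₁σ₀, and this removes the odd
    -- variable of index 1 from the formula.
    rw [← toB_superP0_one, ← toB_superP1 1 1, sub_self, superP1_one, bQ, ← map_mul, mul_add]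

/-! ### Uniqueness of the super extension -/

section Uniqueness

variable {h : Idx → DiffPoly U} {Ω : Idx → Idx → DiffPoly U} {Dt Dt' : Idx → (BRing U →+ BRing U)}
  {Dτ Dτ' : ℤ → (BRing U →+ BRing U)}

/-- The listed equations cover every pair of indices, after cancelling ε. The value on σ₂ is
recovered from that on Qσ₂ because Q is invertible. -/
lemma IsSuperExtension.odd_eq (E : IsSuperExtension h Ω Dt Dτ) (E' : IsSuperExtension h Ω Dt' Dτ') :
    Dτ = Dτ' := by
  have hQ : ∀ k, Dτ k (bQ U) = Dτ' k (bQ U) := fun k =>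
    epsB_cancel ((E.tau_Q k).trans (E'.tau_Q k).symm)
  have hpos : ∀ (k : ℤ) (m : ℕ), Dτ k (toB U (s1 U (k + m))) = Dτ' k (toB U (s1 U (k + m))) := by
    intro k m
    rcases Nat.eq_zero_or_pos m with rfl | hm
    · rw [Nat.cast_zero, add_zero, E.tau_s1_zero, E'.tau_s1_zero]
    · exact epsB_cancel ((E.tau_s1_pos k m hm).trans (E'.tau_s1_pos k m hm).symm)
  have hr : ∀ k l, Dτ k (br U l) = Dτ' k (br U l) := by
    intro k l
    rcases le_or_gt k l with hkl | hkl
    · obtain ⟨m, rfl⟩ : ∃ m : ℕ, l = k + m := ⟨(l - k).toNat, by omega⟩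
      exact epsB_cancel ((E.tau_s2_nonneg k m).trans (E'.tau_s2_nonneg k m).symm)
    · obtain ⟨m, rfl⟩ : ∃ m : ℕ, k = l + m := ⟨(k - l).toNat, by omega⟩
      rcases lt_or_ge m 2 with hm | hm
      · obtain rfl : m = 1 := by omega
        exact (E.tau_s2_one l).trans (E'.tau_s2_one l).symm
      · exact epsB_cancel ((E.tau_s2_neg l m hm).trans (E'.tau_s2_neg l m hm).symm)
  funext k
  refine (E.odd k).ext (E'.odd k) (epsB_cancel ((E.tau_P k).trans (E'.tau_P k).symm)) (hQ k)
    (fun α l => ?_)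
  fin_cases α
  · change Dτ k (toB U (s1 U l)) = Dτ' k (toB U (s1 U l))
    rcases le_or_gt k l with hkl | hkl
    · obtain ⟨m, rfl⟩ : ∃ m : ℕ, l = k + m := ⟨(l - k).toNat, by omega⟩
      exact hpos k m
    · obtain ⟨m, rfl⟩ : ∃ m : ℕ, k = l + m := ⟨(k - l).toNat, by omega⟩
      rw [E.tau_s1_neg l m (by omega), E'.tau_s1_neg l m (by omega), hpos]
  · refine bQ_left_cancel ?_
    have e := hr k l
    rw [br_eq, (E.odd k).leibniz_parityB, (E'.odd k).leibniz_parityB, hQ, parityB_bQ] at e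
    exact add_left_cancel e

/-- With the odd flows known, the equations for Qσ₁ + Qσ₂ and Pσ₁ + Qσ₂ are a linear system for the
even flow. Their difference has the invertible coefficient Q - P in front of the value on σ₁. -/
lemma IsSuperExtension.even_eq (E : IsSuperExtension h Ω Dt Dτ)
    (E' : IsSuperExtension h Ω Dt' Dτ') : Dt = Dt' := by
  have hτ := E.odd_eq E'
  funext i
  have hP : Dt i (bP U) = Dt' i (bP U) := epsB_cancel ((E.t_P i).trans (E'.t_P i).symm)
  have hQ : Dt i (bQ U) = Dt' i (bQ U) := epsB_cancel ((E.t_Q i).trans (E'.t_Q i).symm)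
  have ha : ∀ k, Dt i (bQ U * bc U k + br U k) = Dt' i (bQ U * bc U k + br U k) := fun k => by
    have e : bQ U * bc U k + br U k = toB U (sQ U * (s1 U k + s2 U k)) := by
      rw [mul_add, map_add, map_mul]; rfl
    rw [e, E.t_sigma_Q, E'.t_sigma_Q, hτ]
  have hb : ∀ k, Dt i (bP U * bc U k + br U k) = Dt' i (bP U * bc U k + br U k) := fun k => by
    have e : bP U * bc U k + br U k = toB U (sP U * s1 U k + sQ U * s2 U k) := by
      rw [map_add, map_mul]; rfl
    rw [e, E.t_sigma_P, E'.t_sigma_P, hτ]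
  have hc : ∀ k, Dt i (bc U k) = Dt' i (bc U k) := fun k => by
    rw [← sub_eq_zero]
    refine bQ_sub_bP_cancel ?_
    have e1 := ha k
    have e2 := hb k
    rw [map_add, map_add, (E.even i).leibniz, (E'.even i).leibniz, hQ] at e1
    rw [map_add, map_add, (E.even i).leibniz, (E'.even i).leibniz, hP] at e2
    have e3 := sub_eq_zero.2 (congrArg₂ (fun x y => x - y) e1 e2)
    beta_reduce at e3
    rw [← e3]
    noncomm_ring
  refine (E.even i).ext (E'.even i) hP hQ (fun α k => ?_)
  fin_cases α
  · exact hc k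
  · refine bQ_left_cancel ?_
    have e := ha k
    rw [map_add, map_add, (E.even i).leibniz, (E'.even i).leibniz, hQ, hc, br_eq,
      (E.even i).leibniz, (E'.even i).leibniz, hQ] at e
    exact add_left_cancel (add_left_cancel e)

end Uniqueness

/-! ### Existence of the super extension -/

section Existence

variable {h : Idx → DiffPoly U} {Ω : Idx → Idx → DiffPoly U} (H : IsTauStructure h Ω)

lemma IsTauStructure.hamField_preservesP1 (H : IsTauStructure h Ω) (i : Idx) :
    PreservesP1 (hamField (h i.next)) := H.preservesP1 i

/-- The even flows of the extended Ablowitz-Ladik hierarchy on `ℬ`. -/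
def tauFlow (i : Idx) : BRing U →+ BRing U := evenFlow (H.hamField_preservesP1 i)

lemma epsB_mul_inclB (f : DiffPoly U) :
    epsB U * toB U (incl U f) = toB U (incl U (PowerSeries.X * f)) := by
  rw [epsB_mul_toB, incl_X_mul]

lemma isSuperExtension : IsSuperExtension h Ω (tauFlow H) (oddFlow U) where
  even i := isEvenFlow_evenFlow _
  odd k := isOddFlow_oddFlow k
  t_P i := by
    change epsB U * tauFlow H i (genB U 0) = _
    rw [tauFlow, evenFlow_genB, epsB_mul_inclB, ← H.flow_P]
    rfl
  t_Q i := by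
    change epsB U * tauFlow H i (genB U 1) = _
    rw [tauFlow, evenFlow_genB, epsB_mul_inclB, ← H.flow_Q]
    rfl
  tau_P k := by
    refine (epsB_mul_oddFlow_genB k 0).trans ?_
    -- The prescribed form of ∂P/∂τ_k is the P component of 𝒫₁σ_{k-1}; in ℬ it equals that of 𝒫₀σ_k.
    rw [← toB_superP1]
    rfl
  tau_Q k := epsB_mul_oddFlow_genB k 1
  tau_s1_pos k m hm := by
    refine (epsB_oddFlow_bc k (k + m)).trans ?_
    rw [oconv, osum_nat, map_sum]
    refine Finset.sum_congr rfl fun i _ => ?_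
    rw [map_mul, show k + (k + m) - 1 - (k + i) = k + m - 1 - (i : ℤ) by ring]
    rfl
  tau_s1_zero k := epsB_cancel (by rw [mul_zero]; exact (epsB_oddFlow_bc k k).trans (oconv_self _ _ _))
  tau_s1_neg k m hm := oddAnti_bc _ _
  tau_s2_nonneg k m := by
    refine (epsB_oddFlow_br k (k + m)).trans ?_
    rw [map_neg, map_mul, map_sum, oconv_reflect, add_assoc, ← Nat.cast_succ, osum_nat]
    congr 2
    refine Finset.sum_congr rfl fun i _ => ?_
    rw [map_mul, show k + (k + (m.succ : ℕ)) - 1 - (k + i) = k + m - (i : ℤ) by push_cast; ring]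
    rfl
  tau_s2_one k := epsB_cancel (by
    rw [mul_zero]
    refine (epsB_oddFlow_br (k + 1) k).trans ?_
    rw [oconv_self, mul_zero, neg_zero])
  tau_s2_neg k m hm := by
    refine (epsB_oddFlow_br (k + m) k).trans ?_
    obtain ⟨n, rfl⟩ : ∃ n, m = n + 1 := ⟨m - 1, by omega⟩
    rw [oconv_swap, mul_neg, neg_neg, map_mul, map_sum, oconv_reflect,
      show k + ((n + 1 : ℕ) : ℤ) = k + 1 + n by push_cast; ring, osum_nat, Nat.add_sub_cancel]
    congr 1
    -- With k and k + m exchanged, the convolution runs over k + 1, …, k + m - 1, so its counter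
    -- starts at 0 where the prescribed sum starts at 1.
    refine Finset.sum_nbij' (fun i => i + 1) (fun i => i - 1) (by simp) (by simp; omega)
      (by simp) (by simp; omega) fun i _ => ?_
    rw [map_mul, show k + 1 + (k + 1 + n) - 1 - (k + 1 + i) = k + 1 + n - ((i + 1 : ℕ) : ℤ) by
      push_cast; ring, show k + 1 + (i : ℤ) = k + ((i + 1 : ℕ) : ℤ) by push_cast; ring]
    rfl
  t_sigma_Q i k := by
    have e : toB U (sQ U * (s1 U k + s2 U k)) = bQ U * bc U k + br U k := by
      rw [mul_add, map_add, map_mul]; rfl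
    rw [e]
    exact evenFlow_of_flow_sub _ (H.flow_sub i) k
  t_sigma_P i k := by
    have e : toB U (sP U * s1 U k + sQ U * s2 U k) = bP U * bc U k + br U k := by
      rw [map_add, map_mul]; rfl
    rw [e]
    exact evenFlow_of_flow_log _ (H.flow_log i) k

end Existence

end AblowitzLadik

end

theorem mainTheorem9 (U : AblowitzLadik.Chart)
    (h : AblowitzLadik.Idx → AblowitzLadik.DiffPoly U)
    (Ω : AblowitzLadik.Idx → AblowitzLadik.Idx → AblowitzLadik.DiffPoly U)
    (hΩ : AblowitzLadik.IsTauStructure h Ω) :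
    -- the flows of the extended hierarchy, written via `Ω` and `h`
    (∀ i, PowerSeries.X * AblowitzLadik.flow h i 0 = AblowitzLadik.rhsP h Ω i ∧
      PowerSeries.X * AblowitzLadik.flow h i 1 = AblowitzLadik.rhsQ h Ω i) ∧
    -- the flows exist on `ℬ`
    ∃ (Dt : AblowitzLadik.Idx → (AblowitzLadik.BRing U →+ AblowitzLadik.BRing U))
      (Dτ : ℤ → (AblowitzLadik.BRing U →+ AblowitzLadik.BRing U)),
      AblowitzLadik.IsSuperExtension h Ω Dt Dτ ∧
      -- and are uniquely determined by the equations
      (∀ Dt' Dτ', AblowitzLadik.IsSuperExtension h Ω Dt' Dτ' → Dt' = Dt ∧ Dτ' = Dτ) ∧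
      -- the even flows extend those of the extended hierarchy
      (∀ i (f : AblowitzLadik.DiffPoly U),
        Dt i (AblowitzLadik.toB U (AblowitzLadik.incl U f)) =
          AblowitzLadik.toB U (AblowitzLadik.incl U
            (AblowitzLadik.evolve (AblowitzLadik.flow h i) f))) ∧
      -- the odd flows correspond to the local and nonlocal Hamiltonian structures
      (∀ k : ℤ,
        AblowitzLadik.epsB U * Dτ k (AblowitzLadik.smoothB (AblowitzLadik.fP U)) =
          AblowitzLadik.toB U (AblowitzLadik.superP0 U k 0) ∧
        AblowitzLadik.epsB U * Dτ k (AblowitzLadik.smoothB (AblowitzLadik.fQ U)) =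
          AblowitzLadik.toB U (AblowitzLadik.superP0 U k 1) ∧
        AblowitzLadik.epsB U * Dτ k (AblowitzLadik.smoothB (AblowitzLadik.fP U)) =
          AblowitzLadik.toB U (AblowitzLadik.superP1 U (k - 1) 0) ∧
        AblowitzLadik.epsB U * Dτ k (AblowitzLadik.smoothB (AblowitzLadik.fQ U)) =
          AblowitzLadik.toB U (AblowitzLadik.superP1 U (k - 1) 1)) ∧
      (∀ α : Fin 2,
        AblowitzLadik.epsB U * Dτ 0 (AblowitzLadik.toB U (AblowitzLadik.sig U α 0)) =
          AblowitzLadik.toB U (AblowitzLadik.superVar U α (AblowitzLadik.densityI0 U)) ∧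
        AblowitzLadik.epsB U * Dτ 1 (AblowitzLadik.toB U (AblowitzLadik.sig U α 0)) =
          AblowitzLadik.toB U (AblowitzLadik.superVar U α (AblowitzLadik.densityI1 U))) ∧
      -- all flows commute
      (∀ i j x, Dt i (Dt j x) = Dt j (Dt i x)) ∧
      (∀ i k x, Dt i (Dτ k x) = Dτ k (Dt i x)) ∧
      (∀ k l x, Dτ k (Dτ l x) = -Dτ l (Dτ k x)) := by
  have E := AblowitzLadik.isSuperExtension hΩ
  refine ⟨fun i => ⟨hΩ.flow_P i, hΩ.flow_Q i⟩, AblowitzLadik.tauFlow hΩ,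
    AblowitzLadik.oddFlow U, E, fun Dt' Dτ' E' => ⟨E'.even_eq E, E'.odd_eq E⟩,
    fun i f => AblowitzLadik.evenFlow_incl _ f, fun k => ?_,
    fun α => ⟨AblowitzLadik.epsB_oddFlow_theta_zero α, AblowitzLadik.epsB_oddFlow_theta_one α⟩,
    fun i j x => AblowitzLadik.evenFlow_comm _ _ (hΩ.evolve_flow_comm i j)
      (hΩ.evolve_grad_comm i j) (hΩ.evolve_grad_sum_comm i j) x,
    fun i k x => AblowitzLadik.evenFlow_oddFlow_comm _ k x, AblowitzLadik.oddFlow_anticomm⟩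
  rw [AblowitzLadik.toB_superP1, AblowitzLadik.toB_superP1]
  exact ⟨AblowitzLadik.epsB_mul_oddFlow_genB k 0, AblowitzLadik.epsB_mul_oddFlow_genB k 1,
    AblowitzLadik.epsB_mul_oddFlow_genB k 0, AblowitzLadik.epsB_mul_oddFlow_genB k 1⟩
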